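/- **Setting.** Let $\lambda_1,\lambda_3\ge 0$, $J(w):=\lambda_1w_1e_1+\lambda_3w_3e_3$ for $w\in\mathbb R^3$, and consider the Landau–Lifshitz equation $$\partial_t m+m\times(\Delta m-J(m))=0,\qquad m:\mathbb R^N\times[0,T]\to\mathbb S^2. \tag{LL}$$ For an integer $k\ge1$ let $\mathcal E^k(\mathbb R^N)$ be the set of $v\in L^1_{loc}(\mathbb R^N,\mathbb S^2)$ with $v_1,v_3\in L^2$ and $\nabla v\in H^{k-1}$, with the distance given by the norm $$\|v\|_{Z^k}=\big(\|v_1\|_{H^k}^2+\|v_2\|_{L^\infty}^2+\|\nabla v_2\|_{H^{k-1}}^2+\|v_3\|_{H^k}^2\big)^{1/2}.$$ Here $\|f\|_{H^s}^2=\sum_{|\alpha|\le s}\|\partial_x^\alpha f\|_{L^2}^2$ and $|\nabla f|^2=\sum_{i}|\partial_if|^2$ pointwise. **Proposition.** Let $\lambda_1,\lambda_3\ge0$. There exist positive numbers $C_0$, $C_1$ depending only on $\lambda_1,\lambda_3$ and, for each $k\in\mathbb N$, a positive number $C_k'$ depending only on $k,\lambda_1,\lambda_3$, such that the following holds. Let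 $N\ge1$ and $k\in\mathbb N$ with $k>N/2+1$, let $T>0$, and let $m,\tilde m$ be two solutions of (LL) in $C^0([0,T],\mathcal E^{k+1}(\mathbb R^N))$ with $\partial_tm,\partial_t\tilde m\in C^0([0,T],H^{k-1}(\mathbb R^N))$. Set $u:=\tilde m-m$, $v:=(\tilde m+m)/2$ and $u^0:=u(\cdot,0)$. (i) The function $$\mathfrak E^0(t):=\tfrac12\int_{\mathbb R^N}|u(x,t)-u_2^0(x)e_2|^2\,dx$$ is well-defined and of class $C^1$ on $[0,T]$, and for every $t\in[0,T]$ (the norms being those of the functions at time $t$, except for $u_2^0$) $$[\mathfrak E^0]'(t)\le C_0\big(1+\|\nabla\tilde m\|_{L^2}+\|\nabla m\|_{L^2}+\|\tilde m_1\|_{L^2}+\|m_1\|_{L^2}+\|\tilde m_3\|_{L^2}+\|m_3\|_{L^2}\big)\big(\|u-u_2^0e_2\|_{L^2}^2+\|u\|_{L^\infty}^2+\|\nabla u\|_{L^2}^2+\|\nabla u_2^0\|_{L^2}^2\big).$$ (ii) The function $$\mathfrak E^1(t):=\tfrac12\int_{\mathbb R^N}\big(|\nabla u|^2+|u\times\nabla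 v+v\times\nabla u|^2\big)(x,t)\,dx$$ is well-defined and of class $C^1$ on $[0,T]$, and for every $t\in[0,T]$ $$[\mathfrak E^1]'(t)\le C_1\big(1+\|\nabla m\|_{L^\infty}^2+\|\nabla\tilde m\|_{L^\infty}^2\big)\big(\|u\|_{L^\infty}^2+\|\nabla u\|_{L^2}^2\big)\big(1+\|\nabla m\|_{L^\infty}+\|\nabla\tilde m\|_{L^\infty}+\|\nabla m\|_{H^1}+\|\nabla\tilde m\|_{H^1}\big).$$ (iii) For every integer $2\le\ell\le k-1$ the function $$\mathfrak E^\ell(t):=\tfrac12\sum_{|\alpha|=\ell-2}\int_{\mathbb R^N}\Big(|\partial_t\partial_x^\alpha u|^2+|\Delta\partial_x^\alpha u|^2+(\lambda_1+\lambda_3)\big(|\nabla\partial_x^\alpha u_1|^2+|\nabla\partial_x^\alpha u_3|^2\big)+\lambda_1\lambda_3\big(|\partial_x^\alpha u_1|^2+|\partial_x^\alpha u_3|^2\big)\Big)(x,t)\,dx$$ is well-defined and of class $C^1$ on $[0,T]$, and, with $\mathfrak S^\ell:=\sum_{j=0}^\ell\mathfrak E^j$, for every $t\in[0,T]$ $$[\mathfrak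 E^\ell]'(t)\le C_k'\Big(1+\|\nabla m\|_{H^\ell}^2+\|\nabla\tilde m\|_{H^\ell}^2+\|\nabla m\|_{L^\infty}^2+\|\nabla\tilde m\|_{L^\infty}^2+\delta_{\ell=2}\big(\|\tilde m_1\|_{L^2}+\|m_1\|_{L^2}+\|\tilde m_3\|_{L^2}+\|m_3\|_{L^2}\big)\Big)\big(\mathfrak S^\ell(t)+\|u\|_{L^\infty}^2\big),$$ where $\delta_{\ell=2}$ is $1$ if $\ell=2$ and $0$ otherwise. -/

import Mathlib

open MeasureTheory Filter Topology Set
open scoped ContDiff ENNReal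

noncomputable section

namespace LandauLifshitz

/-- The space `ℝ^N`. -/
abbrev X (N : ℕ) := EuclideanSpace ℝ (Fin N)

/-- The target space `ℝ³`; the components 1, 2, 3 of the text are the indices `0`, `1`, `2`. -/
abbrev V := EuclideanSpace ℝ (Fin 3)

/-- The vector product on `ℝ³`. -/
def cross (a b : V) : V := WithLp.toLp 2 (crossProduct a.ofLp b.ofLp)

/-- The anisotropy `J(a) = λ₁ a₁ e₁ + λ₃ a₃ e₃`. -/
def aniso (l₁ l₃ : ℝ) (a : V) : V := !₂[l₁ * a 0, 0, l₃ * a 2]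

/-- The `i`-th component of an `ℝ³`-valued map. -/
def comp {Y : Type*} (i : Fin 3) (f : Y → V) : Y → ℝ := fun x => f x i

section WeakDerivatives

variable {N : ℕ} {F : Type*} [NormedAddCommGroup F] [NormedSpace ℝ F]

/-- The classical first order partial derivative `∂_i φ`. -/
def partialDeriv (i : Fin N) (φ : X N → ℝ) : X N → ℝ :=
  fun x => fderiv ℝ φ x (EuclideanSpace.single i 1)

/-- The classical derivative `∂_1^{α_1} ⋯ ∂_N^{α_N} φ`. -/
def multiDeriv (α : Fin N → ℕ) (φ : X N → ℝ) : X N → ℝ :=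
  (List.finRange N).foldr (fun i g => (partialDeriv i)^[α i] g) φ

/-- The multi-indices of length `r`. -/
def multiIdx (N r : ℕ) : Finset (Fin N → ℕ) := Finset.piAntidiag Finset.univ r

/-- The test functions `C_c^∞(ℝ^N)`. -/
def IsTest (φ : X N → ℝ) : Prop := ContDiff ℝ ∞ φ ∧ HasCompactSupport φ

/-- `g` is the weak derivative `∂^α f`; both functions are in `L¹_loc`. -/
def IsWeakDeriv (α : Fin N → ℕ) (f g : X N → F) : Prop :=
  LocallyIntegrable f volume ∧ LocallyIntegrable g volume ∧
    ∀ φ : X N → ℝ, IsTest φ →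
      ∫ x, multiDeriv α φ x • f x = (-1 : ℝ) ^ (∑ i, α i) • ∫ x, φ x • g x

open Classical in
/-- The weak derivative `∂^α f` when it exists (it is unique up to null sets), and `0` otherwise.
It is only used for functions for which it exists. -/
def weakDeriv (α : Fin N → ℕ) (f : X N → F) : X N → F :=
  if h : ∃ g, IsWeakDeriv α f g then h.choose else 0

/-- `f` has weak first order partial derivatives in `L¹_loc`. -/
def HasWeakGrad (f : X N → F) : Prop := ∀ i : Fin N, ∃ g, IsWeakDeriv (Pi.single i 1) f g

/-- The first order weak partial derivative `∂_i f`. -/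
def wpartial (i : Fin N) (f : X N → F) : X N → F := weakDeriv (Pi.single i 1) f

/-- The weak gradient `∇f = (∂_1 f, …, ∂_N f)`, with the pointwise norm
`|∇f|² = ∑_i |∂_i f|²`. -/
def grad (f : X N → F) : X N → PiLp 2 (fun _ : Fin N => F) :=
  fun x => WithLp.toLp 2 (fun i => wpartial i f x)

/-- The weak Laplacian `Δf = ∑_i ∂_i² f`. -/
def lap (f : X N → F) : X N → F := fun x => ∑ i : Fin N, weakDeriv (Pi.single i 2) f x

/-- The `L²` norm. -/
def l2norm (f : X N → F) : ℝ := (eLpNorm f 2 volume).toReal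

/-- The `L^∞` norm. -/
def linfnorm (f : X N → F) : ℝ := (eLpNorm f ⊤ volume).toReal

/-- The Sobolev space `H^s(ℝ^N)`. -/
def MemH (s : ℕ) (f : X N → F) : Prop :=
  ∀ r ≤ s, ∀ α ∈ multiIdx N r, ∃ g, IsWeakDeriv α f g ∧ MemLp g 2 volume

/-- The norm `‖f‖_{H^s} = (∑_{|α| ≤ s} ‖∂^α f‖_{L²}²)^{1/2}`. -/
def hnorm (s : ℕ) (f : X N → F) : ℝ :=
  √(∑ r ∈ Finset.range (s + 1), ∑ α ∈ multiIdx N r, l2norm (weakDeriv α f) ^ 2)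

end WeakDerivatives

section EnergySpace

variable {N : ℕ}

/-- The vector space `Z^k(ℝ^N)`, for `k ≥ 1`. -/
structure MemZ (k : ℕ) (v : X N → V) : Prop where
  locallyIntegrable : LocallyIntegrable v volume
  hasWeakGrad : HasWeakGrad v
  comp_one : MemLp (comp 0 v) 2 volume
  comp_two : MemLp (comp 1 v) ⊤ volume
  comp_three : MemLp (comp 2 v) 2 volume
  grad_mem : MemH (k - 1) (grad v)

/-- The norm of `Z^k(ℝ^N)`, for `k ≥ 1`. -/
def znorm (k : ℕ) (v : X N → V) : ℝ :=
  √(hnorm k (comp 0 v) ^ 2 + linfnorm (comp 1 v) ^ 2 + hnorm (k - 1) (grad (comp 1 v)) ^ 2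
    + hnorm k (comp 2 v) ^ 2)

/-- The set `𝓔^k(ℝ^N)` of sphere-valued maps in `Z^k(ℝ^N)`, for `k ≥ 1`. -/
def MemE (k : ℕ) (v : X N → V) : Prop := MemZ k v ∧ ∀ᵐ x, ‖v x‖ = 1

/-- `m` is in `C⁰([0,T], 𝓔^k(ℝ^N))`, for the distance given by the `Z^k` norm. -/
def ContInE (k : ℕ) (T : ℝ) (m : ℝ → X N → V) : Prop :=
  ∀ t ∈ Icc 0 T, MemE k (m t) ∧
    Tendsto (fun s => znorm k (m s - m t)) (𝓝[Icc 0 T] t) (𝓝 0)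

/-- `p` is in `C⁰([0,T], H^s(ℝ^N))`. -/
def ContInH (s : ℕ) (T : ℝ) (p : ℝ → X N → V) : Prop :=
  ∀ t ∈ Icc 0 T, MemH s (p t) ∧
    Tendsto (fun r => hnorm s (p r - p t)) (𝓝[Icc 0 T] t) (𝓝 0)

/-- `p` is the time derivative of `m` on `[0,T]` in the sense of distributions in `x`: the pairing
of `m(t)` with each test function on `ℝ^N` has the pairing with `p(t)` as derivative in `t`. -/
def IsTimeDeriv (T : ℝ) (m p : ℝ → X N → V) : Prop :=
  ∀ φ : X N → ℝ, IsTest φ → ∀ t ∈ Icc 0 T,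
    HasDerivWithinAt (fun s => ∫ x, φ x • m s x) (∫ x, φ x • p t x) (Icc 0 T) t

/-- `m : ℝ^N × [0,T] → 𝕊²` is a solution of the Landau–Lifshitz equation
`∂ₜm + m × (Δm - J(m)) = 0` in `C⁰([0,T], 𝓔^{k+1}(ℝ^N))`, with time derivative `dm = ∂ₜm` in
`C⁰([0,T], H^{k-1}(ℝ^N))`. -/
structure IsLLSolution (l₁ l₃ : ℝ) (k : ℕ) (T : ℝ) (m dm : ℝ → X N → V) : Prop where
  cont : ContInE (k + 1) T m
  timeDeriv : IsTimeDeriv T m dm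
  timeDeriv_cont : ContInH (k - 1) T dm
  eqn : ∀ t ∈ Icc 0 T, ∀ᵐ x,
    dm t x + cross (m t x) (lap (m t) x - aniso l₁ l₃ (m t x)) = 0

end EnergySpace

section DifferenceFunctionals

variable {N : ℕ}

/-- The map `u(·,t) - u₂⁰ e₂`, with `u⁰ = u(·,0)`. -/
def shifted (u : ℝ → X N → V) (t : ℝ) : X N → V :=
  fun x => u t x - EuclideanSpace.single 1 (u 0 x 1)

/-- The integrand of `𝔈⁰`. -/
def dens0 (u : ℝ → X N → V) (t : ℝ) : X N → ℝ := fun x => ‖shifted u t x‖ ^ 2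

/-- The integrand of `𝔈¹`, that is `|∇u|² + |u × ∇v + v × ∇u|²`. -/
def dens1 (u v : ℝ → X N → V) (t : ℝ) : X N → ℝ := fun x =>
  ‖grad (u t) x‖ ^ 2
    + ∑ i : Fin N, ‖cross (u t x) (wpartial i (v t) x) + cross (v t x) (wpartial i (u t) x)‖ ^ 2

/-- The integrand of `𝔈^ℓ`, `ℓ ≥ 2`, for the multi-index `α`; here `du` is `∂ₜu`. -/
def densHigh (l₁ l₃ : ℝ) (u du : ℝ → X N → V) (α : Fin N → ℕ) (t : ℝ) : X N → ℝ := fun x =>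
  ‖weakDeriv α (du t) x‖ ^ 2 + ‖lap (weakDeriv α (u t)) x‖ ^ 2
    + (l₁ + l₃) * (‖grad (weakDeriv α (comp 0 (u t))) x‖ ^ 2
        + ‖grad (weakDeriv α (comp 2 (u t))) x‖ ^ 2)
    + l₁ * l₃ * (weakDeriv α (comp 0 (u t)) x ^ 2 + weakDeriv α (comp 2 (u t)) x ^ 2)

/-- The functionals `𝔈^ℓ(t)`, `ℓ ≥ 0`; here `du` is `∂ₜu`. -/
def gE (l₁ l₃ : ℝ) (u v du : ℝ → X N → V) : ℕ → ℝ → ℝ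
  | 0 => fun t => (1 / 2) * ∫ x, dens0 u t x
  | 1 => fun t => (1 / 2) * ∫ x, dens1 u v t x
  | j + 2 => fun t => (1 / 2) * ∑ α ∈ multiIdx N j, ∫ x, densHigh l₁ l₃ u du α t x

/-- The sum `𝔖^ℓ = ∑_{j=0}^ℓ 𝔈^j`. -/
def gS (l₁ l₃ : ℝ) (u v du : ℝ → X N → V) (l : ℕ) (t : ℝ) : ℝ :=
  ∑ j ∈ Finset.range (l + 1), gE l₁ l₃ u v du j t

end DifferenceFunctionals

end LandauLifshitz

end

namespace LandauLifshitz

open Finset (univ sum_congr sum_add_distrib mul_sum sum_nonneg sum_le_sum sum_sub_distrib single_le_sum univ_nonempty sum_comm sum_mul sum_cons cons_induction abs_sum_le_sum_abs sum_neg_distrib)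
open Pi (single)
open Real (norm_eq_abs rpow_add rpow_natCast rpow_one rpow_mul rpow_pos_of_pos mul_rpow sq_sqrt le_sqrt_of_sq_le)
open ENNReal (toReal_nonneg ofReal toReal_mono toReal_le_of_le_ofReal)
open WithLp (toLp)

section

variable {N : ℕ}

lemma IsTest.differentiable {φ : X N → ℝ} (h : IsTest φ) : Differentiable ℝ φ :=
  h.1.differentiable (by simp)

lemma IsTest.continuous {φ : X N → ℝ} (h : IsTest φ) : Continuous φ := h.1.continuous

lemma IsTest.partialDeriv {φ : X N → ℝ} (h : IsTest φ) (i : Fin N) : IsTest (partialDeriv i φ) := by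
  refine ⟨?_, ?_⟩
  · exact (h.1.fderiv_right (m := ∞) (by simp)).clm_apply contDiff_const
  · exact (h.2.fderiv_apply (𝕜 := ℝ) (EuclideanSpace.single i 1))

lemma partialDeriv_comm {φ : X N → ℝ} (h : IsTest φ) (i j : Fin N) :
    partialDeriv i (partialDeriv j φ) = partialDeriv j (partialDeriv i φ) := by
  funext x
  have hd : DifferentiableAt ℝ (fderiv ℝ φ) x :=
    ((h.1.fderiv_right (m := 1) (by norm_cast)).differentiable (by simp)) x
  have key : ∀ a b : X N, fderiv ℝ (fun y => fderiv ℝ φ y a) x b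
      = fderiv ℝ (fderiv ℝ φ) x b a := by
    intro a b
    rw [fderiv_clm_apply hd (differentiableAt_const _)]
    simp
  have hs : IsSymmSndFDerivAt ℝ φ x := by
    apply (h.1.contDiffAt (x := x)).isSymmSndFDerivAt
    simp only [minSmoothness_of_isRCLikeNormedField]
    norm_cast
  change fderiv ℝ (fun y => fderiv ℝ φ y (EuclideanSpace.single j 1)) x _ =
    fderiv ℝ (fun y => fderiv ℝ φ y (EuclideanSpace.single i 1)) x _
  rw [key, key]
  exact hs _ _

lemma IsTest.iterate {φ : X N → ℝ} (h : IsTest φ) (i : Fin N) (n : ℕ) :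
    IsTest ((LandauLifshitz.partialDeriv i)^[n] φ) := by
  induction n with
  | zero => exact h
  | succ n ih => rw [Function.iterate_succ_apply']; exact ih.partialDeriv i

/-- `∏_{i ∈ l} ∂_i^{α_i} φ` along a list of indices. -/
noncomputable def listDeriv (l : List (Fin N)) (α : Fin N → ℕ) (φ : X N → ℝ) : X N → ℝ :=
  l.foldr (fun i g => (partialDeriv i)^[α i] g) φ

lemma IsTest.listDeriv {φ : X N → ℝ} (h : IsTest φ) (l : List (Fin N)) (α : Fin N → ℕ) :
    IsTest (listDeriv l α φ) := by
  induction l with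
  | nil => exact h
  | cons i l ih => exact ih.iterate i _

lemma IsTest.multiDeriv {φ : X N → ℝ} (h : IsTest φ) (α : Fin N → ℕ) :
    IsTest (multiDeriv α φ) := h.listDeriv _ α

lemma iterate_partialDeriv_comm {φ : X N → ℝ} (h : IsTest φ) (i j : Fin N) (n : ℕ) :
    partialDeriv j ((partialDeriv i)^[n] φ) = (partialDeriv i)^[n] (partialDeriv j φ) := by
  induction n with
  | zero => rfl
  | succ n ih =>
    rw [Function.iterate_succ_apply', Function.iterate_succ_apply',
      partialDeriv_comm (h.iterate i n), ih]

lemma partialDeriv_listDeriv {φ : X N → ℝ} (h : IsTest φ) (j : Fin N) (l : List (Fin N))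
    (α : Fin N → ℕ) : partialDeriv j (listDeriv l α φ) = listDeriv l α (partialDeriv j φ) := by
  induction l with
  | nil => rfl
  | cons i l ih =>
    change partialDeriv j ((partialDeriv i)^[α i] (listDeriv l α φ)) =
      (partialDeriv i)^[α i] (listDeriv l α (partialDeriv j φ))
    rw [iterate_partialDeriv_comm (h.listDeriv l α), ih]

lemma iterate_partialDeriv_listDeriv {φ : X N → ℝ} (h : IsTest φ) (j : Fin N) (n : ℕ)
    (l : List (Fin N)) (α : Fin N → ℕ) :
    (partialDeriv j)^[n] (listDeriv l α φ) = listDeriv l α ((partialDeriv j)^[n] φ) := by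
  induction n with
  | zero => rfl
  | succ n ih =>
    rw [Function.iterate_succ_apply', ih, partialDeriv_listDeriv (h.iterate j n),
      Function.iterate_succ_apply']

lemma listDeriv_add {φ : X N → ℝ} (h : IsTest φ) (l : List (Fin N)) (α β : Fin N → ℕ) :
    listDeriv l (α + β) φ = listDeriv l α (listDeriv l β φ) := by
  induction l with
  | nil => rfl
  | cons i l ih =>
    change (partialDeriv i)^[α i + β i] (listDeriv l (α + β) φ) =
      (partialDeriv i)^[α i] (listDeriv l α ((partialDeriv i)^[β i] (listDeriv l β φ)))
    rw [ih, Function.iterate_add_apply, iterate_partialDeriv_listDeriv (h.listDeriv l β)]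

lemma multiDeriv_add {φ : X N → ℝ} (h : IsTest φ) (α β : Fin N → ℕ) :
    multiDeriv (α + β) φ = multiDeriv α (multiDeriv β φ) := listDeriv_add h _ α β

lemma listDeriv_single (l : List (Fin N)) (hl : l.Nodup) (i : Fin N) (φ : X N → ℝ) :
    listDeriv l (single i 1) φ = if i ∈ l then partialDeriv i φ else φ := by
  induction l with
  | nil => rfl
  | cons j l ih =>
    have ih := ih hl.of_cons
    change (partialDeriv j)^[(single i 1 : Fin N → ℕ) j] (listDeriv l (single i 1) φ) = _
    rw [ih]
    by_cases hij : i = j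
    · subst hij
      have : i ∉ l := (List.nodup_cons.1 hl).1
      simp [this]
    · simp [hij]

lemma multiDeriv_single (i : Fin N) (φ : X N → ℝ) :
    multiDeriv (single i 1) φ = partialDeriv i φ := by
  have := listDeriv_single (List.finRange N) (List.nodup_finRange N) i φ
  rwa [if_pos (List.mem_finRange i)] at this

lemma multiDeriv_zero (φ : X N → ℝ) : multiDeriv 0 φ = φ := by
  have : ∀ l : List (Fin N), listDeriv l 0 φ = φ := by
    intro l
    induction l with
    | nil => rfl
    | cons i l ih => change listDeriv l 0 φ = φ; exact ih
  exact this _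

variable {F G : Type*} [NormedAddCommGroup F] [NormedSpace ℝ F] [NormedAddCommGroup G]
  [NormedSpace ℝ G]

lemma IsTest.integrable_smul {φ : X N → ℝ} (h : IsTest φ) {f : X N → F}
    (hf : LocallyIntegrable f) : Integrable (fun x => φ x • f x) :=
  hf.integrable_smul_left_of_hasCompactSupport h.continuous h.2

lemma isWeakDeriv_zero {f : X N → F} (hf : LocallyIntegrable f) : IsWeakDeriv 0 f f :=
  ⟨hf, hf, fun φ _ => by simp [multiDeriv_zero]⟩

lemma IsWeakDeriv.congr {α : Fin N → ℕ} {f f' g g' : X N → F} (h : IsWeakDeriv α f g)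
    (hf : f =ᵐ[volume] f') (hg : g =ᵐ[volume] g') : IsWeakDeriv α f' g' := by
  refine ⟨h.1.congr hf, h.2.1.congr hg, fun φ hφ => ?_⟩
  have e : ∫ x, multiDeriv α φ x • f' x = ∫ x, multiDeriv α φ x • f x :=
    integral_congr_ae (hf.mono fun x hx => by simp only [hx])
  rw [e, h.2.2 φ hφ]
  congr 1
  exact integral_congr_ae (hg.mono fun x hx => by simp only [hx])

lemma IsWeakDeriv.unique [CompleteSpace F] {α : Fin N → ℕ} {f g g' : X N → F}
    (h : IsWeakDeriv α f g) (h' : IsWeakDeriv α f g') : g =ᵐ[volume] g' := by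
  refine ae_eq_of_integral_contDiff_smul_eq h.2.1 h'.2.1 fun φ h1 h2 => ?_
  have := (h.2.2 φ ⟨h1, h2⟩).symm.trans (h'.2.2 φ ⟨h1, h2⟩)
  have hne : ((-1 : ℝ) ^ (∑ i, α i)) ≠ 0 := pow_ne_zero _ (by norm_num)
  exact smul_right_injective F hne this

lemma IsWeakDeriv.spec {α : Fin N → ℕ} {f g : X N → F} (h : IsWeakDeriv α f g) :
    IsWeakDeriv α f (weakDeriv α f) := by
  have hex : ∃ g, IsWeakDeriv α f g := ⟨g, h⟩
  rw [weakDeriv, dif_pos hex]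
  exact hex.choose_spec

lemma IsWeakDeriv.ae_eq [CompleteSpace F] {α : Fin N → ℕ} {f g : X N → F}
    (h : IsWeakDeriv α f g) : weakDeriv α f =ᵐ[volume] g := h.spec.unique h

lemma IsWeakDeriv.add {α : Fin N → ℕ} {f g f' g' : X N → F} (h : IsWeakDeriv α f g)
    (h' : IsWeakDeriv α f' g') : IsWeakDeriv α (f + f') (g + g') := by
  refine ⟨h.1.add h'.1, h.2.1.add h'.2.1, fun φ hφ => ?_⟩
  simp only [Pi.add_apply, smul_add]
  rw [integral_add ((hφ.multiDeriv α).integrable_smul h.1) ((hφ.multiDeriv α).integrable_smul h'.1),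
    integral_add (hφ.integrable_smul h.2.1) (hφ.integrable_smul h'.2.1), h.2.2 φ hφ, h'.2.2 φ hφ,
    smul_add]

lemma IsWeakDeriv.const_smul {α : Fin N → ℕ} {f g : X N → F} (h : IsWeakDeriv α f g) (c : ℝ) :
    IsWeakDeriv α (c • f) (c • g) := by
  refine ⟨h.1.smul c, h.2.1.smul c, fun φ hφ => ?_⟩
  simp only [Pi.smul_apply, smul_comm _ c]
  rw [integral_smul, integral_smul, h.2.2 φ hφ, smul_comm]

lemma IsWeakDeriv.neg {α : Fin N → ℕ} {f g : X N → F} (h : IsWeakDeriv α f g) :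
    IsWeakDeriv α (-f) (-g) := by simpa using h.const_smul (-1)

lemma IsWeakDeriv.sub {α : Fin N → ℕ} {f g f' g' : X N → F} (h : IsWeakDeriv α f g)
    (h' : IsWeakDeriv α f' g') : IsWeakDeriv α (f - f') (g - g') := by
  simpa [sub_eq_add_neg] using h.add h'.neg

lemma isWeakDeriv_zero_fun (α : Fin N → ℕ) : IsWeakDeriv α (0 : X N → F) 0 :=
  ⟨locallyIntegrable_zero, locallyIntegrable_zero, fun φ _ => by simp⟩

lemma IsWeakDeriv.sum {ι : Type*} (s : Finset ι) {α : Fin N → ℕ} {f g : ι → X N → F}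
    (h : ∀ i ∈ s, IsWeakDeriv α (f i) (g i)) : IsWeakDeriv α (∑ i ∈ s, f i) (∑ i ∈ s, g i) := by
  classical
  induction s using Finset.induction_on with
  | empty => simpa using isWeakDeriv_zero_fun α
  | insert a s ha ih =>
    rw [Finset.sum_insert ha, Finset.sum_insert ha]
    exact (h a (Finset.mem_insert_self a s)).add (ih fun i hi => h i (Finset.mem_insert_of_mem hi))

lemma _root_.MeasureTheory.LocallyIntegrable.clm_comp {f : X N → F}
    (hf : LocallyIntegrable f) (L : F →L[ℝ] G) : LocallyIntegrable (fun x => L (f x)) := by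
  intro x
  obtain ⟨s, hs, h⟩ := hf x
  exact ⟨s, hs, L.integrable_comp h⟩

lemma IsWeakDeriv.clm_comp [CompleteSpace F] [CompleteSpace G] {α : Fin N → ℕ} {f g : X N → F}
    (h : IsWeakDeriv α f g) (L : F →L[ℝ] G) :
    IsWeakDeriv α (fun x => L (f x)) (fun x => L (g x)) := by
  refine ⟨h.1.clm_comp L, h.2.1.clm_comp L, fun φ hφ => ?_⟩
  have h1 := L.integral_comp_comm ((hφ.multiDeriv α).integrable_smul h.1)
  have h2 := L.integral_comp_comm (hφ.integrable_smul h.2.1)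
  simp only [map_smul] at h1 h2
  rw [h1, h2, h.2.2 φ hφ, map_smul]

lemma IsWeakDeriv.trans {α β : Fin N → ℕ} {f g h : X N → F} (h1 : IsWeakDeriv α f g)
    (h2 : IsWeakDeriv β g h) : IsWeakDeriv (α + β) f h := by
  refine ⟨h1.1, h2.2.1, fun φ hφ => ?_⟩
  rw [multiDeriv_add hφ, h1.2.2 _ (hφ.multiDeriv β), h2.2.2 φ hφ, smul_smul, ← pow_add]
  simp [sum_add_distrib]

lemma IsWeakDeriv.of_add {α β : Fin N → ℕ} {f g h : X N → F} (h1 : IsWeakDeriv α f g)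
    (h2 : IsWeakDeriv (α + β) f h) : IsWeakDeriv β g h := by
  refine ⟨h1.2.1, h2.2.1, fun φ hφ => ?_⟩
  have e1 := h1.2.2 _ (hφ.multiDeriv β)
  have e2 := h2.2.2 φ hφ
  rw [multiDeriv_add hφ] at e2
  rw [e2] at e1
  simp only [Pi.add_apply, sum_add_distrib, pow_add, mul_smul] at e1
  have hne : ((-1 : ℝ) ^ (∑ i, α i)) ≠ 0 := pow_ne_zero _ (by norm_num)
  exact (smul_right_injective F hne e1).symm

end

section
open ContinuousLinearMap (lsmul)
open scoped Convolution

variable {N : ℕ} {F G W : Type*} [NormedAddCommGroup F] [NormedSpace ℝ F] [NormedAddCommGroup G]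
  [NormedSpace ℝ G] [NormedAddCommGroup W] [NormedSpace ℝ W]

/-- A sequence of bump functions concentrating at the origin. -/
noncomputable def bump (N n : ℕ) : ContDiffBump (0 : X N) where
  rIn := 1 / ((n : ℝ) + 1) / 2
  rOut := 1 / ((n : ℝ) + 1)
  rIn_pos := by positivity
  rIn_lt_rOut := half_lt_self (by positivity)

/-- The mollifier kernels. -/
noncomputable def molKer (N n : ℕ) : X N → ℝ := (bump N n).normed volume

lemma molKer_nonneg (n : ℕ) (x : X N) : 0 ≤ molKer N n x := (bump N n).nonneg_normed x

lemma integral_molKer (n : ℕ) : ∫ x, molKer N n x = 1 := (bump N n).integral_normed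

lemma isTest_molKer (n : ℕ) : IsTest (molKer N n) :=
  ⟨(bump N n).contDiff_normed, (bump N n).hasCompactSupport_normed⟩

lemma integrable_molKer (n : ℕ) : Integrable (molKer N n) := (bump N n).integrable_normed

/-- The mollification `ρ_n ⋆ f`. -/
noncomputable def mol (n : ℕ) (f : X N → F) : X N → F := molKer N n ⋆[lsmul ℝ ℝ, volume] f

lemma mol_apply' (n : ℕ) (f : X N → F) (x : X N) : mol n f x = ∫ t, molKer N n (x - t) • f t := by
  rw [mol, convolution_eq_swap]; rfl

lemma isTest_molKer_sub (n : ℕ) (x : X N) : IsTest (fun t => molKer N n (x - t)) := by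
  refine ⟨(isTest_molKer n).1.comp (contDiff_const.sub contDiff_id), ?_⟩
  exact (isTest_molKer n).2.comp_homeomorph (Homeomorph.subLeft x)

lemma mol_contDiff (n : ℕ) {f : X N → F} (hf : LocallyIntegrable f) : ContDiff ℝ ∞ (mol n f) :=
  (isTest_molKer n).2.contDiff_convolution_left _ (isTest_molKer n).1 hf

lemma mol_congr (n : ℕ) {f g : X N → F} (h : f =ᵐ[volume] g) : mol n f = mol n g := by
  funext x
  rw [mol_apply', mol_apply']
  exact integral_congr_ae (h.mono fun y hy => by simp only [hy])

lemma mol_sub (n : ℕ) {f g : X N → F} (hf : LocallyIntegrable f)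
    (hg : LocallyIntegrable g) : mol n (f - g) = mol n f - mol n g := by
  funext x
  simp only [mol_apply', Pi.sub_apply, smul_sub]
  exact integral_sub ((isTest_molKer_sub n x).integrable_smul hf)
    ((isTest_molKer_sub n x).integrable_smul hg)

lemma mol_fderiv [CompleteSpace F] (n : ℕ) {i : Fin N} {f g : X N → F}
    (h : IsWeakDeriv (single i 1) f g) (x : X N) :
    fderiv ℝ (mol n f) x (EuclideanSpace.single i 1) = mol n g x := by
  have hk := isTest_molKer (N := N) n
  have hd := hk.2.hasFDerivAt_convolution_left (lsmul ℝ ℝ : ℝ →L[ℝ] F →L[ℝ] F)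
    (hk.1.of_le (by norm_cast)) h.1 (μ := volume) x
  have hf : fderiv ℝ (mol n f) x = _ := hd.fderiv
  have hex : ConvolutionExists (fderiv ℝ (molKer N n)) f
      ((lsmul ℝ ℝ : ℝ →L[ℝ] F →L[ℝ] F).precompL (X N)) volume :=
    (hk.2.fderiv (𝕜 := ℝ)).convolutionExists_left _
      (hk.1.continuous_fderiv (by simp)) h.1
  rw [hf, convolution_eq_swap, ContinuousLinearMap.integral_apply (hex x).integrable_swap]
  have e1 : ∀ t, partialDeriv i (fun t => molKer N n (x - t)) t =
      - fderiv ℝ (molKer N n) (x - t) (EuclideanSpace.single i 1) := by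
    intro t
    have hm : HasFDerivAt (molKer N n) (fderiv ℝ (molKer N n) (x - t)) (x - t) :=
      (hk.differentiable _).hasFDerivAt
    have := hm.comp t ((hasFDerivAt_id t).const_sub x)
    have e := this.fderiv
    change fderiv ℝ (molKer N n ∘ fun t => x - t) t _ = _
    change fderiv ℝ (molKer N n ∘ fun t => x - t) t = _ at e
    rw [e]; simp
  have e2 := h.2.2 _ (isTest_molKer_sub n x)
  rw [multiDeriv_single] at e2
  have e3 : ∑ j : Fin N, (single i 1 : Fin N → ℕ) j = 1 := by simp
  simp only [e1, neg_smul, integral_neg, e3, pow_one, one_smul, neg_inj] at e2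
  rw [mol_apply']
  rw [← e2]
  rfl

lemma mol_norm_le [CompleteSpace F] (n : ℕ) {f : X N → F} {C : ℝ}
    (hC : ∀ᵐ x, ‖f x‖ ≤ C) (x : X N) : ‖mol n f x‖ ≤ C := by
  rw [mol_apply']
  have hi : Integrable (fun t => molKer N n (x - t)) := (integrable_molKer n).comp_sub_left x
  have h1 : ∫ t, molKer N n (x - t) = 1 := by
    rw [integral_sub_left_eq_self (molKer N n) volume x, integral_molKer]
  calc ‖∫ t, molKer N n (x - t) • f t‖ ≤ ∫ t, molKer N n (x - t) * C := by
        apply norm_integral_le_of_norm_le (hi.mul_const C)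
        filter_upwards [hC] with t ht
        rw [norm_smul, Real.norm_of_nonneg (molKer_nonneg n _)]
        exact mul_le_mul_of_nonneg_left ht (molKer_nonneg n _)
    _ = C := by rw [integral_mul_const, h1, one_mul]

lemma mol_bounded [CompleteSpace F] (n : ℕ) {f : X N → F} (hf : MemLp f 2) :
    ∃ C : ℝ, ∀ x, ‖mol n f x‖ ≤ C := by
  have h2 : Integrable (fun t => molKer N n t ^ 2) := by
    have := (isTest_molKer (N := N) n).integrable_smul
      (isTest_molKer (N := N) n).continuous.locallyIntegrable (f := molKer N n)
    simpa [pow_two] using this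
  have hf2 : Integrable (fun t => ‖f t‖ ^ 2) := (memLp_two_iff_integrable_sq_norm hf.1).1 hf
  refine ⟨(∫ t, molKer N n t ^ 2) + ∫ t, ‖f t‖ ^ 2, fun x => ?_⟩
  rw [mol_apply']
  have h3 : Integrable (fun t => molKer N n (x - t) ^ 2) := h2.comp_sub_left x
  have h1 : ∫ t, molKer N n (x - t) ^ 2 = ∫ t, molKer N n t ^ 2 :=
    integral_sub_left_eq_self (fun t => molKer N n t ^ 2) volume x
  rw [← h1, ← integral_add h3 hf2]
  apply norm_integral_le_of_norm_le (h3.add hf2)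
  filter_upwards with t
  rw [norm_smul, Real.norm_of_nonneg (molKer_nonneg n _)]
  simp only [Pi.add_apply]
  nlinarith [sq_nonneg (molKer N n (x - t) - ‖f t‖), sq_nonneg (molKer N n (x - t) + ‖f t‖)]

lemma mol_enorm_sq_le (n : ℕ) {f : X N → F} (hf : StronglyMeasurable f) (x : X N) :
    ‖mol n f x‖ₑ ^ (2 : ℝ) ≤ ∫⁻ t, ofReal (molKer N n t) * ‖f (x - t)‖ₑ ^ (2 : ℝ) := by
  have hm : Measurable (fun t => ofReal (molKer N n t)) :=
    (isTest_molKer n).continuous.measurable.ennreal_ofReal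
  set ν : Measure (X N) := volume.withDensity (fun t => ofReal (molKer N n t)) with hν
  have : IsProbabilityMeasure ν := by
    refine ⟨?_⟩
    rw [hν, withDensity_apply _ MeasurableSet.univ, Measure.restrict_univ,
      ← ofReal_integral_eq_lintegral_ofReal (integrable_molKer n)
        (.of_forall (molKer_nonneg n)), integral_molKer, ENNReal.ofReal_one]
  have hfx : StronglyMeasurable (fun t => f (x - t)) :=
    hf.comp_measurable (measurable_const.sub measurable_id)
  have h1 : ‖mol n f x‖ₑ ≤ eLpNorm (fun t => f (x - t)) 1 ν := by
    rw [eLpNorm_one_eq_lintegral_enorm, hν, lintegral_withDensity_eq_lintegral_mul _ hm hfx.enorm]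
    refine (enorm_integral_le_lintegral_enorm _).trans (le_of_eq ?_)
    refine lintegral_congr fun t => ?_
    simp only [ContinuousLinearMap.lsmul_apply, enorm_smul, Pi.mul_apply,
      Real.enorm_of_nonneg (molKer_nonneg n t)]
  have h2 : eLpNorm (fun t => f (x - t)) 1 ν ≤ eLpNorm (fun t => f (x - t)) 2 ν :=
    eLpNorm_le_eLpNorm_of_exponent_le (by norm_num) hfx.aestronglyMeasurable
  have h3 := eLpNorm_nnreal_pow_eq_lintegral (f := fun t => f (x - t)) (μ := ν)
    (p := 2) (by norm_num)
  calc ‖mol n f x‖ₑ ^ (2 : ℝ) ≤ eLpNorm (fun t => f (x - t)) 2 ν ^ (2 : ℝ) :=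
        ENNReal.rpow_le_rpow (h1.trans h2) (by norm_num)
    _ = ∫⁻ t, ‖f (x - t)‖ₑ ^ (2 : ℝ) ∂ν := by simpa using h3
    _ = _ := by
        rw [hν, lintegral_withDensity_eq_lintegral_mul _ hm (hfx.enorm.pow_const _)]
        rfl

lemma eLpNorm_mol_le (n : ℕ) {f : X N → F} (hf : LocallyIntegrable f) :
    eLpNorm (mol n f) 2 ≤ eLpNorm f 2 := by
  have hae := hf.aestronglyMeasurable.ae_eq_mk
  rw [mol_congr n hae, eLpNorm_congr_ae hae]
  set g := hf.aestronglyMeasurable.mk f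
  have hg : StronglyMeasurable g := hf.aestronglyMeasurable.stronglyMeasurable_mk
  have hm : Measurable (fun t => ofReal (molKer N n t)) :=
    (isTest_molKer n).continuous.measurable.ennreal_ofReal
  have e : ∀ h : X N → F, eLpNorm h 2 ^ (2 : ℝ) = ∫⁻ x, ‖h x‖ₑ ^ (2 : ℝ) := fun h => by
    simpa using eLpNorm_nnreal_pow_eq_lintegral (f := h) (μ := volume) (p := 2) (by norm_num)
  have hk1 : ∫⁻ t, ofReal (molKer N n t) = 1 := by
    rw [← ofReal_integral_eq_lintegral_ofReal (integrable_molKer n)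
        (.of_forall (molKer_nonneg n)), integral_molKer, ENNReal.ofReal_one]
  rw [← ENNReal.rpow_le_rpow_iff (z := 2) (by norm_num), e, e]
  calc ∫⁻ x, ‖mol n g x‖ₑ ^ (2 : ℝ)
      ≤ ∫⁻ x, ∫⁻ t, ofReal (molKer N n t) * ‖g (x - t)‖ₑ ^ (2 : ℝ) :=
        lintegral_mono fun x => mol_enorm_sq_le n hg x
    _ = ∫⁻ t, ∫⁻ x, ofReal (molKer N n t) * ‖g (x - t)‖ₑ ^ (2 : ℝ) := by
        apply lintegral_lintegral_swap
        apply Measurable.aemeasurable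
        have : Measurable (fun p : X N × X N => ‖g (p.1 - p.2)‖ₑ) :=
          (hg.comp_measurable (measurable_fst.sub measurable_snd)).enorm
        exact (hm.comp measurable_snd).mul (this.pow_const _)
    _ = ∫⁻ t, ofReal (molKer N n t) * ∫⁻ x, ‖g x‖ₑ ^ (2 : ℝ) := by
        refine lintegral_congr fun t => ?_
        rw [lintegral_const_mul']
        · rw [lintegral_sub_right_eq_self (fun x => ‖g x‖ₑ ^ (2 : ℝ)) t]
        · exact ENNReal.ofReal_ne_top
    _ = ∫⁻ x, ‖g x‖ₑ ^ (2 : ℝ) := by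
        rw [lintegral_mul_const _ hm, hk1, one_mul]

lemma memLp_mol (n : ℕ) {f : X N → F} (hf : MemLp f 2) : MemLp (mol n f) 2 := by
  have hl := hf.locallyIntegrable (by norm_num)
  exact ⟨(mol_contDiff n hl).continuous.aestronglyMeasurable, (eLpNorm_mol_le n hl).trans_lt hf.2⟩

lemma bump_rOut_tendsto : Tendsto (fun n => (bump N n).rOut) atTop (𝓝 0) :=
  tendsto_one_div_add_atTop_nhds_zero_nat

lemma mol_ae_tendsto [CompleteSpace F] {f : X N → F} (hf : LocallyIntegrable f) :
    ∀ᵐ x, Tendsto (fun n => mol n f x) atTop (𝓝 (f x)) := by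
  refine ContDiffBump.ae_convolution_tendsto_right_of_locallyIntegrable (K := 2)
    bump_rOut_tendsto (.of_forall fun n => ?_) hf
  change 1 / ((n : ℝ) + 1) ≤ 2 * (1 / ((n : ℝ) + 1) / 2)
  linarith

lemma mol_tendsto_two_of_continuous [CompleteSpace F] {g : X N → F} (hg : Continuous g)
    (hc : HasCompactSupport g) : Tendsto (fun n => eLpNorm (mol n g - g) 2) atTop (𝓝 0) := by
  set K := Metric.cthickening 1 (tsupport g) with hK
  have hKc : IsCompact K := hc.isCompact.cthickening
  have hsupp : ∀ n, Function.support (mol n g - g) ⊆ K := by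
    intro n x hx
    by_contra hxK
    apply hx
    have h0 : ∀ y ∈ Metric.ball x 1, g y = 0 := by
      intro y hy
      by_contra hne
      apply hxK
      exact Metric.mem_cthickening_of_dist_le x y 1 _ (subset_tsupport g hne)
        (by rw [dist_comm]; exact (Metric.mem_ball.1 hy).le)
    have hx0 : g x = 0 := h0 x (Metric.mem_ball_self one_pos)
    have := (bump N n).normed_convolution_eq_right (μ := volume) (g := g) (x₀ := x) (by
      intro y hy
      rw [hx0]
      apply h0
      apply Metric.ball_subset_ball _ hy
      change 1 / ((n : ℝ) + 1) ≤ 1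
      rw [div_le_one (by positivity)]
      linarith [(Nat.cast_nonneg n : (0 : ℝ) ≤ n)])
    change mol n g x = g x at this
    simp [this]
  have huc := hc.uniformContinuous_of_continuous hg
  have hfin : volume K ^ (1 / (2 : ℝ)) ≠ ⊤ :=
    ENNReal.rpow_ne_top_of_nonneg (by norm_num) hKc.measure_lt_top.ne
  have hε : ∀ ε : ℝ, 0 < ε → ∀ᶠ n in atTop,
      eLpNorm (mol n g - g) 2 ≤ volume K ^ (1 / (2 : ℝ)) * ofReal ε := by
    intro ε hε
    obtain ⟨δ, hδ, hδ'⟩ := Metric.uniformContinuous_iff.1 huc ε hε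
    filter_upwards [(bump_rOut_tendsto (N := N)).eventually (gt_mem_nhds hδ)] with n hn
    rw [← eLpNorm_restrict_eq_of_support_subset (hsupp n)]
    have hb : ∀ᵐ x ∂(volume.restrict K), ‖(mol n g - g) x‖ ≤ ε := by
      filter_upwards with x
      have := (bump N n).dist_normed_convolution_le (μ := volume) (g := g) (x₀ := x) (ε := ε)
        hg.aestronglyMeasurable (fun y hy => (hδ' (lt_trans (Metric.mem_ball.1 hy) hn)).le)
      rw [dist_eq_norm] at this
      exact this
    refine (eLpNorm_le_of_ae_bound hb).trans (le_of_eq ?_)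
    simp
  rw [ENNReal.tendsto_nhds_zero]
  intro η hη
  by_cases hηt : η = ⊤
  · exact .of_forall fun n => hηt ▸ le_top
  set c := (volume K ^ (1 / (2 : ℝ))).toReal with hcdef
  have hη' : 0 < η.toReal := ENNReal.toReal_pos hη.ne' hηt
  have hc0 : 0 ≤ c := toReal_nonneg
  filter_upwards [hε (η.toReal / (c + 1)) (by positivity)] with n hn
  refine hn.trans ?_
  rw [← ENNReal.ofReal_toReal hfin, ← hcdef, ← ENNReal.ofReal_mul hc0]
  refine ENNReal.ofReal_le_of_le_toReal ?_
  rw [mul_div_assoc', div_le_iff₀ (by positivity)]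
  nlinarith

lemma mol_tendsto_two [CompleteSpace F] {f : X N → F} (hf : MemLp f 2) :
    Tendsto (fun n => eLpNorm (mol n f - f) 2) atTop (𝓝 0) := by
  rw [ENNReal.tendsto_nhds_zero]
  intro η hη
  have hη3 : η / 3 ≠ 0 := (ENNReal.div_pos hη.ne' (by norm_num)).ne'
  obtain ⟨g, hgc, hfg, hg, hg2⟩ := hf.exists_hasCompactSupport_eLpNorm_sub_le (by norm_num) hη3
  filter_upwards [ENNReal.tendsto_nhds_zero.1 (mol_tendsto_two_of_continuous hg hgc) (η / 3)
    (pos_iff_ne_zero.2 hη3)] with n hn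
  have hfl := hf.locallyIntegrable (μ := volume) (by norm_num)
  have hgl := hg2.locallyIntegrable (μ := volume) (by norm_num)
  have e : mol n f - f = mol n (f - g) + ((mol n g - g) + (g - f)) := by
    rw [mol_sub n hfl hgl]; abel
  have hsub : MemLp (f - g) 2 := hf.sub hg2
  rw [e]
  have m1 := (memLp_mol n hsub).1
  have m2 := ((memLp_mol n hg2).sub hg2).1
  have m3 := (hg2.sub hf).1
  refine (eLpNorm_add_le m1 (m2.add m3) (by norm_num)).trans ?_
  refine (add_le_add le_rfl (eLpNorm_add_le m2 m3 (by norm_num))).trans ?_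
  have h1 : eLpNorm (mol n (f - g)) 2 ≤ η / 3 := (eLpNorm_mol_le n (hfl.sub hgl)).trans hfg
  have h3 : eLpNorm (g - f) 2 ≤ η / 3 := by
    rw [← neg_sub, eLpNorm_neg]; exact hfg
  calc _ ≤ η / 3 + (η / 3 + η / 3) := by gcongr
    _ = η := by rw [← add_assoc]; exact ENNReal.add_thirds η

end

section

variable {N : ℕ} {F : Type*} [NormedAddCommGroup F] [NormedSpace ℝ F]

lemma IsTest.mul {φ ψ : X N → ℝ} (hφ : IsTest φ) (hψ : IsTest ψ) :
    IsTest (fun x => φ x * ψ x) := ⟨hφ.1.mul hψ.1, hφ.2.mul_right⟩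

lemma partialDeriv_mul {φ ψ : X N → ℝ} (hφ : IsTest φ) (hψ : IsTest ψ) (i : Fin N) (x : X N) :
    partialDeriv i (fun x => φ x * ψ x) x = φ x * partialDeriv i ψ x + ψ x * partialDeriv i φ x := by
  simp only [partialDeriv]
  rw [fderiv_fun_mul (hφ.differentiable x) (hψ.differentiable x)]
  simp

lemma isTest_mul_contDiff {φ ψ : X N → ℝ} (hφ : IsTest φ) (hψ : ContDiff ℝ ∞ ψ) :
    IsTest (fun x => φ x * ψ x) := ⟨hφ.1.mul hψ, hφ.2.mul_right⟩

lemma IsTest.memLp {φ : X N → ℝ} (hφ : IsTest φ) (p : ℝ≥0∞) : MemLp φ p :=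
  hφ.continuous.memLp_of_hasCompactSupport hφ.2

/-- A test function equal to `1` on the ball of radius `n + 1`. -/
noncomputable def cutoff (N n : ℕ) : ContDiffBump (0 : X N) where
  rIn := n + 1
  rOut := n + 2
  rIn_pos := by positivity
  rIn_lt_rOut := by linarith

lemma isTest_cutoff (n : ℕ) : IsTest (cutoff N n : X N → ℝ) :=
  ⟨(cutoff N n).contDiff, (cutoff N n).hasCompactSupport⟩

lemma exists_cutoff_eq_one {K : Set (X N)} (hK : IsCompact K) :
    ∃ n, ∀ x ∈ K, cutoff N n =ᶠ[𝓝 x] 1 := by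
  obtain ⟨R, hR⟩ := hK.isBounded.subset_closedBall 0
  obtain ⟨n, hn⟩ := exists_nat_ge R
  refine ⟨n, fun x hx => (cutoff N n).eventuallyEq_one_of_mem_ball ?_⟩
  exact Metric.closedBall_subset_ball (by change R < (n : ℝ) + 1; linarith) (hR hx)

lemma sum_single_one (i : Fin N) : ∑ j, (single i 1 : Fin N → ℕ) j = 1 := by simp

lemma IsWeakDeriv.integral_eq {i : Fin N} {f f' : X N → F}
    (h : IsWeakDeriv (single i 1) f f') {φ : X N → ℝ} (hφ : IsTest φ) :
    ∫ x, partialDeriv i φ x • f x = - ∫ x, φ x • f' x := by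
  have := h.2.2 φ hφ
  rwa [multiDeriv_single, sum_single_one, pow_one, neg_one_smul] at this

lemma isWeakDeriv_single_iff {i : Fin N} {f f' : X N → F} :
    IsWeakDeriv (single i 1) f f' ↔ LocallyIntegrable f ∧ LocallyIntegrable f' ∧
      ∀ φ : X N → ℝ, IsTest φ → ∫ x, partialDeriv i φ x • f x = - ∫ x, φ x • f' x := by
  refine ⟨fun h => ⟨h.1, h.2.1, fun φ hφ => h.integral_eq hφ⟩, fun h => ⟨h.1, h.2.1, fun φ hφ => ?_⟩⟩
  rw [multiDeriv_single, sum_single_one, pow_one, neg_one_smul]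
  exact h.2.2 φ hφ

lemma IsTest.locallyIntegrable_smul {χ : X N → ℝ} (hχ : IsTest χ) {f : X N → F}
    (hf : LocallyIntegrable f) : LocallyIntegrable (fun x => χ x • f x) :=
  (hχ.integrable_smul hf).locallyIntegrable

lemma IsWeakDeriv.test_smul {i : Fin N} {f f' : X N → F} (h : IsWeakDeriv (single i 1) f f')
    {χ : X N → ℝ} (hχ : IsTest χ) : IsWeakDeriv (single i 1) (fun x => χ x • f x)
      (fun x => partialDeriv i χ x • f x + χ x • f' x) := by
  rw [isWeakDeriv_single_iff]
  refine ⟨hχ.locallyIntegrable_smul h.1, ((hχ.partialDeriv i).locallyIntegrable_smul h.1).add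
    (hχ.locallyIntegrable_smul h.2.1), fun φ hφ => ?_⟩
  have e := h.integral_eq (hφ.mul hχ)
  simp only [partialDeriv_mul hφ hχ, add_smul, mul_smul] at e
  have i1 : Integrable (fun x => φ x • partialDeriv i χ x • f x) :=
    hφ.integrable_smul ((hχ.partialDeriv i).locallyIntegrable_smul h.1)
  have i2 : Integrable (fun x => χ x • partialDeriv i φ x • f x) :=
    hχ.integrable_smul ((hφ.partialDeriv i).locallyIntegrable_smul h.1)
  have i3 : Integrable (fun x => φ x • χ x • f' x) :=
    hφ.integrable_smul (hχ.locallyIntegrable_smul h.2.1)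
  rw [integral_add i1 i2] at e
  simp only [smul_add]
  rw [integral_add i1 i3]
  have e2 : ∫ x, partialDeriv i φ x • χ x • f x = ∫ x, χ x • partialDeriv i φ x • f x :=
    integral_congr_ae (.of_forall fun x => smul_comm _ _ _)
  rw [e2, neg_add, ← e]
  abel

lemma _root_.MeasureTheory.MemLp.integrable_smul_two {𝕜 : Type*} [NormedRing 𝕜] [Module 𝕜 F]
    [IsBoundedSMul 𝕜 F] {g : X N → 𝕜} {f : X N → F} (hg : MemLp g 2)
    (hf : MemLp f 2) : Integrable (fun x => g x • f x) :=
  memLp_one_iff_integrable.1 (hf.smul (p := 2) (q := 2) hg)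

lemma tendsto_integral_smul_mol [CompleteSpace F] {𝕜 : Type*} [NormedRing 𝕜] [Module 𝕜 F]
    [IsBoundedSMul 𝕜 F] {g : X N → 𝕜} {f : X N → F} (hg : MemLp g 2)
    (hf : MemLp f 2) : Tendsto (fun n => ∫ x, g x • mol n f x) atTop (𝓝 (∫ x, g x • f x)) := by
  refine tendsto_integral_of_L1' _ (hg.integrable_smul_two hf).1
    (.of_forall fun n => hg.integrable_smul_two (memLp_mol n hf)) ?_
  refine tendsto_of_tendsto_of_tendsto_of_le_of_le tendsto_const_nhds
    (by simpa using ENNReal.Tendsto.const_mul (mol_tendsto_two hf) (Or.inr hg.2.ne))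
    (fun n => zero_le) fun n => ?_
  have e : ((fun x => g x • mol n f x) - fun x => g x • f x) = g • (mol n f - f) := by
    funext x; simp [smul_sub]
  simp only [e]
  exact eLpNorm_smul_le_mul_eLpNorm ((memLp_mol n hf).sub hf).1 hg.1

/-- Local square integrability, tested by cutoffs. -/
def LocL2 (f : X N → F) : Prop := ∀ φ : X N → ℝ, IsTest φ → MemLp (fun x => φ x • f x) 2

lemma _root_.MeasureTheory.MemLp.locL2 {f : X N → F} (hf : MemLp f 2) : LocL2 f :=
  fun _ hφ => hf.smul (p := ⊤) (hφ.memLp ⊤)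

lemma _root_.MeasureTheory.MemLp.locL2_of_top {f : X N → F} (hf : MemLp f ⊤) : LocL2 f :=
  fun _ hφ => hf.smul (q := ⊤) (p := 2) (hφ.memLp 2)

lemma locallyIntegrable_mul {f g : X N → ℝ} (hf : LocL2 f) (hg : LocL2 g) :
    LocallyIntegrable (fun x => f x * g x) := by
  rw [locallyIntegrable_iff]
  intro K hK
  obtain ⟨n, hn⟩ := exists_cutoff_eq_one hK
  refine ((hf _ (isTest_cutoff n)).integrable_smul_two (hg _ (isTest_cutoff n))).integrableOn.congr_fun
    (fun x hx => ?_) hK.measurableSet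
  simp [(hn x hx).eq_of_nhds]

lemma partialDeriv_eq_zero {φ : X N → ℝ} {i : Fin N} {x : X N} (hx : x ∉ tsupport φ) :
    partialDeriv i φ x = 0 := by
  simp [partialDeriv, (notMem_tsupport_iff_eventuallyEq.1 hx).fderiv_eq]

lemma IsWeakDeriv.mul {i : Fin N} {f f' g g' : X N → ℝ} (hf : IsWeakDeriv (single i 1) f f')
    (hg : IsWeakDeriv (single i 1) g g') (mf : LocL2 f) (mf' : LocL2 f')
    (mg : LocL2 g) (mg' : LocL2 g') :
    IsWeakDeriv (single i 1) (fun x => f x * g x) (fun x => f' x * g x + f x * g' x) := by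
  have l1 := locallyIntegrable_mul mf' mg
  have l2 := locallyIntegrable_mul mf mg'
  rw [isWeakDeriv_single_iff]
  refine ⟨locallyIntegrable_mul mf mg, l1.add l2, fun φ hφ => ?_⟩
  obtain ⟨G, G', hG, mG, mG', hgG⟩ : ∃ G G' : X N → ℝ, IsWeakDeriv (single i 1) G G' ∧
      MemLp G 2 ∧ MemLp G' 2 ∧ ∀ x ∈ tsupport φ, G x = g x ∧ G' x = g' x := by
    obtain ⟨n, hn⟩ := exists_cutoff_eq_one hφ.2.isCompact
    have hχ := isTest_cutoff (N := N) n
    refine ⟨_, _, hg.test_smul hχ, mg _ hχ, (mg _ (hχ.partialDeriv i)).add (mg' _ hχ), fun x hx => ?_⟩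
    simp [(hn x hx).eq_of_nhds, partialDeriv, (hn x hx).fderiv_eq]
  have m1 := mf _ (hφ.partialDeriv i)
  have m2 := mf _ hφ
  have hc := fun k => mol_contDiff k hG.1
  have key : ∀ k, (∫ x, (partialDeriv i φ x • f x) • mol k G x) +
      ∫ x, (φ x • f x) • mol k G' x = - ∫ x, (φ x • f' x) • mol k G x := by
    intro k
    have d : ∀ x, partialDeriv i (fun x => φ x * mol k G x) x =
        φ x * mol k G' x + mol k G x * partialDeriv i φ x := fun x => by
      rw [← mol_fderiv k hG x, partialDeriv,
        fderiv_fun_mul (hφ.differentiable x) ((hc k).differentiable (by simp) x)]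
      rfl
    rw [← integral_add (m1.integrable_smul_two (memLp_mol k mG))
      (m2.integrable_smul_two (memLp_mol k mG'))]
    refine Eq.trans (integral_congr_ae (.of_forall fun x => ?_))
      ((hf.integral_eq (isTest_mul_contDiff hφ (hc k))).trans
      (congrArg _ (integral_congr_ae (.of_forall fun x => ?_)))) <;>
    simp only [d, smul_eq_mul] <;> ring
  have t := tendsto_nhds_unique (((tendsto_integral_smul_mol m1 mG).add
    (tendsto_integral_smul_mol m2 mG')).congr key) (tendsto_integral_smul_mol (mf' _ hφ) mG).neg
  have hs : ∀ {a b : X N → ℝ}, (∀ x ∈ tsupport φ, a x = b x) → (∀ x ∉ tsupport φ, a x = b x) →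
      ∫ x, a x = ∫ x, b x := fun ha hb => congrArg _ (funext fun x => by
    by_cases hx : x ∈ tsupport φ
    exacts [ha x hx, hb x hx])
  simp only [smul_add]
  rw [integral_add (hφ.integrable_smul l1) (hφ.integrable_smul l2), neg_add, ← sub_eq_add_neg,
    eq_sub_iff_add_eq]
  refine Eq.trans (congrArg₂ _ (hs (fun x hx => ?_) fun x hx => ?_)
    (hs (fun x hx => ?_) fun x hx => ?_)) (t.trans (congrArg _ (hs (fun x hx => ?_) fun x hx => ?_)))
  all_goals first
    | simp [hgG x hx, mul_assoc]
    | simp [image_eq_zero_of_notMem_tsupport hx, partialDeriv_eq_zero hx]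

lemma IsWeakDeriv.integral_eq_zero [CompleteSpace F] {i : Fin N} {h h' : X N → F}
    (hw : IsWeakDeriv (single i 1) h h') (hi : Integrable h) (hi' : Integrable h') :
    ∫ x, h' x = 0 := by
  have e : ∀ {k : X N → F}, Integrable k → Integrable (mol 0 k) ∧ ∫ x, mol 0 k x = ∫ x, k x :=
    fun hk => ⟨(integrable_molKer 0).integrable_convolution _ hk, by
      rw [mol, integral_convolution _ (integrable_molKer 0) hk, integral_molKer]; simp⟩
  have hd := (mol_contDiff 0 hw.1).differentiable (by simp)
  have I := integral_bilinear_hasFDerivAt_right_eq_neg_left_of_integrable (μ := volume)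
    (B := ContinuousLinearMap.lsmul ℝ ℝ) (v := EuclideanSpace.single i 1) (f := fun _ : X N => 1)
    (f' := 0) (g := mol 0 h) (by simp) (by simpa [mol_fderiv 0 hw] using (e hi').1)
    (by simpa using (e hi).1) (fun x _ => hasFDerivAt_const _ _) fun x _ => (hd x).hasFDerivAt
  rw [← (e hi').2]
  simpa [mol_fderiv 0 hw] using I

end

section

variable {N : ℕ}

/-- The exponent `2 / s`, with `2 / 0 = ∞`. -/
noncomputable def ex (s : ℝ) : ℝ≥0∞ := 2 / ofReal s

lemma ex_one : ex 1 = 2 := by simp [ex]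

lemma ex_zero : ex 0 = ⊤ := by simp [ex, ENNReal.div_zero]

lemma ex_two : ex 2 = 1 := by
  simp only [ex, ENNReal.ofReal_ofNat]
  exact ENNReal.div_self (by norm_num) (by norm_num)

lemma inv_ex (s : ℝ) : (ex s)⁻¹ = ofReal s / 2 := by
  rw [ex, ENNReal.inv_div (by simp) (by simp)]

lemma ex_ne_zero (s : ℝ) : ex s ≠ 0 := by simp [ex, ENNReal.div_eq_zero_iff]

lemma ex_pos_eq {s : ℝ} (hs : 0 < s) : ex s = ofReal (2 / s) := by
  rw [ex, ENNReal.ofReal_div_of_pos hs, ENNReal.ofReal_ofNat]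

lemma ex_mul_ofReal {s q : ℝ} (hs : 0 ≤ s) (hq : 0 < q) : ex (q * s) * ofReal q = ex s := by
  rcases hs.eq_or_lt with rfl | hs
  · rw [mul_zero, ex_zero, ENNReal.top_mul (by simpa using hq)]
  · rw [ex_pos_eq hs, ex_pos_eq (mul_pos hq hs), ← ENNReal.ofReal_mul (by positivity)]
    congr 1
    field_simp

lemma one_le_ex {s : ℝ} (hs2 : s ≤ 2) : 1 ≤ ex s := by
  rw [← ENNReal.inv_le_one, inv_ex]
  calc ofReal s / 2 ≤ ofReal 2 / 2 := by gcongr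
    _ = 1 := by rw [ENNReal.ofReal_ofNat]; exact ENNReal.div_self (by norm_num) (by norm_num)

/-- `‖f‖_{L^{2/s}} ≤ B`. -/
def Bd (s : ℝ) (f : X N → ℝ) (B : ℝ) : Prop :=
  AEStronglyMeasurable f ∧ eLpNorm f (ex s) ≤ ofReal B

lemma Bd.memLp {s B : ℝ} {f : X N → ℝ} (h : Bd s f B) : MemLp f (ex s) :=
  ⟨h.1, h.2.trans_lt ENNReal.ofReal_lt_top⟩

lemma _root_.MeasureTheory.MemLp.bd {s : ℝ} {f : X N → ℝ} (h : MemLp f (ex s)) :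
    Bd s f (eLpNorm f (ex s)).toReal := ⟨h.1, (ENNReal.ofReal_toReal h.2.ne).ge⟩

lemma Bd.mono {s B B' : ℝ} {f : X N → ℝ} (h : Bd s f B) (hB : B ≤ B') : Bd s f B' :=
  ⟨h.1, h.2.trans (ENNReal.ofReal_le_ofReal hB)⟩

lemma Bd.congr {s B : ℝ} {f g : X N → ℝ} (h : Bd s f B) (hfg : f =ᵐ[volume] g) : Bd s g B :=
  ⟨h.1.congr hfg, (eLpNorm_congr_ae hfg).symm.le.trans h.2⟩

lemma Bd.toReal_le {s B : ℝ} {f : X N → ℝ} (h : Bd s f B) (hB : 0 ≤ B) :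
    (eLpNorm f (ex s)).toReal ≤ B := toReal_le_of_le_ofReal hB h.2

lemma bd_const (c : ℝ) : Bd (N := N) 0 (fun _ => c) |c| := by
  refine ⟨aestronglyMeasurable_const, ?_⟩
  rw [ex_zero, eLpNorm_exponent_top]
  refine (eLpNormEssSup_le_of_ae_bound (C := |c|) (.of_forall fun x => ?_))
  simp

lemma Bd.mul {s t A B : ℝ} {f g : X N → ℝ} (hf : Bd s f A) (hg : Bd t g B) (hs : 0 ≤ s)
    (ht : 0 ≤ t) (hA : 0 ≤ A) : Bd (s + t) (fun x => f x * g x) (A * B) := by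
  refine ⟨hf.1.mul hg.1, ?_⟩
  have : ENNReal.HolderTriple (ex s) (ex t) (ex (s + t)) := by
    constructor
    rw [inv_ex, inv_ex, inv_ex, ENNReal.ofReal_add hs ht, ENNReal.add_div]
  have h := eLpNorm_smul_le_mul_eLpNorm (p := ex s) (q := ex t) (r := ex (s + t)) hg.1 hf.1
  rw [ENNReal.ofReal_mul hA]
  exact h.trans (mul_le_mul' hf.2 hg.2)

lemma Bd.add {s A B : ℝ} {f g : X N → ℝ} (hf : Bd s f A) (hg : Bd s g B) (hs2 : s ≤ 2)
    (hA : 0 ≤ A) (hB : 0 ≤ B) : Bd s (fun x => f x + g x) (A + B) := by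
  refine ⟨hf.1.add hg.1, ?_⟩
  rw [ENNReal.ofReal_add hA hB]
  exact (eLpNorm_add_le hf.1 hg.1 (one_le_ex hs2)).trans (add_le_add hf.2 hg.2)

lemma Bd.const_mul {s A : ℝ} {f : X N → ℝ} (hf : Bd s f A) (hs : 0 ≤ s) (c : ℝ) :
    Bd s (fun x => c * f x) (|c| * A) := by
  have := (bd_const c).mul hf le_rfl hs (abs_nonneg c)
  rwa [zero_add] at this

lemma Bd.rpow {s A q : ℝ} {f : X N → ℝ} (hf : Bd s f A) (hs : 0 ≤ s) (hA : 0 ≤ A) (hq : 0 < q) :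
    Bd (q * s) (fun x => |f x| ^ q) (A ^ q) := by
  refine ⟨(hf.1.norm.aemeasurable.pow_const q).aestronglyMeasurable, ?_⟩
  have := eLpNorm_norm_rpow (μ := volume) (p := ex (q * s)) f hq
  simp only [norm_eq_abs] at this
  rw [this, ex_mul_ofReal hs hq, ← ENNReal.ofReal_rpow_of_nonneg hA hq.le]
  exact ENNReal.rpow_le_rpow hf.2 hq.le

lemma Bd.of_abs {s A : ℝ} {f : X N → ℝ} (hm : AEStronglyMeasurable f)
    (h : Bd s (fun x => |f x|) A) : Bd s f A :=
  ⟨hm, by have := h.2; simpa only [← norm_eq_abs, eLpNorm_norm] using this⟩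

lemma Bd.interp {s t A B θ : ℝ} {f : X N → ℝ} (hf : Bd s f A) (hg : Bd t f B) (hs : 0 ≤ s)
    (ht : 0 ≤ t) (hA : 0 ≤ A) (hB : 0 ≤ B) (h0 : 0 ≤ θ) (h1 : θ ≤ 1) :
    Bd ((1 - θ) * s + θ * t) f (A ^ (1 - θ) * B ^ θ) := by
  rcases h0.eq_or_lt with rfl | h0
  · simpa using hf
  rcases h1.eq_or_lt with rfl | h1
  · simpa using hg
  have h1' : 0 < 1 - θ := by linarith
  have := (hf.rpow hs hA h1').mul (hg.rpow ht hB h0) (by positivity) (by positivity) (by positivity)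
  apply Bd.of_abs hf.1
  convert this using 2 with x
  rw [← Real.rpow_add' (abs_nonneg _) (by norm_num)]
  simp

end

section

variable {N : ℕ}

lemma hasDerivAt_abs_rpow_mul (x : ℝ) {q : ℝ} (hq : 0 < q) :
    HasDerivAt (fun x : ℝ => |x| ^ q * x) ((q + 1) * |x| ^ q) x := by
  rcases eq_or_ne x 0 with rfl | hx
  · rw [hasDerivAt_iff_tendsto_slope]
    simp only [abs_zero, Real.zero_rpow hq.ne', mul_zero]
    have hc : Tendsto (fun y : ℝ => |y| ^ q) (𝓝[≠] 0) (𝓝 0) := by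
      have : Continuous fun y : ℝ => |y| ^ q := continuous_abs.rpow_const fun _ => Or.inr hq.le
      have h := this.tendsto 0
      simp only [abs_zero, Real.zero_rpow hq.ne'] at h
      exact h.mono_left nhdsWithin_le_nhds
    refine hc.congr' ?_
    filter_upwards [self_mem_nhdsWithin] with y hy
    have hy : y ≠ 0 := hy
    simp only [slope, vsub_eq_sub, sub_zero, smul_eq_mul]
    field_simp
    simp
  · have hd := (hasDerivAt_abs hx).rpow_const (p := q) (Or.inl (abs_ne_zero.2 hx))
    refine (hd.mul (hasDerivAt_id x)).congr_deriv ?_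
    simp only [id, mul_one]
    have e : |x| ^ q = |x| ^ (q - 1) * |x| := by
      rw [← Real.rpow_add_one (abs_ne_zero.2 hx)]; simp
    rcases lt_or_gt_of_ne hx with h | h
    · rw [sign_neg h, e, abs_of_neg h]
      simp only [SignType.coe_neg, SignType.coe_one]
      ring
    · rw [sign_pos h, e, abs_of_pos h]
      simp only [SignType.coe_one]
      ring

/-- Smooth functions whose derivatives up to order `n` are bounded, and square integrable from
order one on; `F α` plays the role of `∂^α F 0`. -/
structure SmoothJets (n : ℕ) (F : (Fin N → ℕ) → X N → ℝ) : Prop where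
  smooth : ∀ α, ∑ i, α i ≤ n → ContDiff ℝ ∞ (F α)
  deriv : ∀ α i, ∑ i, α i + 1 ≤ n → ∀ x,
    fderiv ℝ (F α) x (EuclideanSpace.single i 1) = F (α + single i 1) x
  bdd : ∀ α, ∑ i, α i ≤ n → ∃ C, ∀ x, |F α x| ≤ C
  sq : ∀ α, 1 ≤ ∑ i, α i → ∑ i, α i ≤ n → MemLp (F α) 2

lemma bd_zero_of_bounded {f : X N → ℝ} (hf : AEStronglyMeasurable f) {C : ℝ}
    (hC : ∀ᵐ x, |f x| ≤ C) : Bd 0 f C := by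
  refine ⟨hf, ?_⟩
  rw [ex_zero, eLpNorm_exponent_top]
  exact eLpNormEssSup_le_of_ae_bound hC

lemma bd_one_of_memLp {f : X N → ℝ} (hf : MemLp f 2) : Bd 1 f (eLpNorm f 2).toReal := by
  have h : MemLp f (ex 1) := by rw [ex_one]; exact hf
  have := h.bd
  rwa [ex_one] at this

/-- The norm of `L^{2/s}`. -/
noncomputable def nr (s : ℝ) (f : X N → ℝ) : ℝ := (eLpNorm f (ex s)).toReal

lemma nr_nonneg (s : ℝ) (f : X N → ℝ) : 0 ≤ nr s f := toReal_nonneg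

lemma SmoothJets.bd {n : ℕ} {F : (Fin N → ℕ) → X N → ℝ} (h : SmoothJets n F) {α : Fin N → ℕ}
    (hα : ∑ i, α i ≤ n) : Bd ((∑ i, α i : ℕ) / n : ℝ) (F α) (nr ((∑ i, α i : ℕ) / n : ℝ) (F α)) := by
  obtain ⟨C, hC⟩ := h.bdd α hα
  have hm := (h.smooth α hα).continuous.aestronglyMeasurable (μ := volume)
  have b0 : Bd 0 (F α) C := bd_zero_of_bounded hm (.of_forall hC)
  have hC0 : 0 ≤ C := (abs_nonneg _).trans (hC 0)
  apply MemLp.bd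
  rcases eq_zero_or_pos (∑ i, α i) with h0 | h0
  · rw [h0]; simpa using b0.memLp
  · have b1 := bd_one_of_memLp (h.sq α h0 hα)
    have hn : 0 < n := h0.trans_le hα
    have hn' : (0 : ℝ) < n := by exact_mod_cast hn
    have := (b0.interp b1 (θ := (∑ i, α i : ℕ) / n) le_rfl zero_le_one hC0 toReal_nonneg
      (by positivity) (by rw [div_le_one hn']; exact_mod_cast hα)).memLp
    simpa using this

lemma Bd.integral_abs_le {f : X N → ℝ} {A : ℝ} (h : Bd 2 f A) (hA : 0 ≤ A) :
    Integrable f ∧ ∫ x, |f x| ≤ A := by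
  have hi : Integrable f := by
    have := h.memLp
    rw [ex_two] at this
    exact memLp_one_iff_integrable.1 this
  refine ⟨hi, ?_⟩
  have h2 := h.2
  rw [ex_two, eLpNorm_one_eq_lintegral_enorm] at h2
  have := integral_norm_eq_lintegral_enorm hi.1
  simp only [norm_eq_abs] at this
  rw [this]
  exact toReal_le_of_le_ofReal hA h2

lemma nr_rpow {s : ℝ} (hs : 0 < s) {f : X N → ℝ} (h : MemLp f (ex s)) :
    nr s f ^ (2 / s) = ∫ x, |f x| ^ (2 / s) := by
  have hp : 0 < 2 / s := by positivity
  have ht : ex s ≠ ⊤ := by rw [ex_pos_eq hs]; exact ENNReal.ofReal_ne_top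
  have hr : (ex s).toReal = 2 / s := by rw [ex_pos_eq hs, ENNReal.toReal_ofReal hp.le]
  have e := h.eLpNorm_eq_integral_rpow_norm (ex_ne_zero s) ht
  rw [hr] at e
  have h0 : 0 ≤ ∫ x, |f x| ^ (2 / s) := integral_nonneg fun x => by positivity
  simp only [norm_eq_abs] at e
  rw [nr, e, ENNReal.toReal_ofReal (by positivity), ← rpow_mul h0, inv_mul_cancel₀ hp.ne',
    rpow_one]

lemma SmoothJets.step {n : ℕ} {F : (Fin N → ℕ) → X N → ℝ} (h : SmoothJets n F)
    {β : Fin N → ℕ} {i : Fin N} {j : ℕ} (hj : ∑ i, β i = j) (hj2 : j + 2 ≤ n) :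
    nr ((j + 1 : ℕ) / n) (F (β + single i 1)) ^ 2 ≤ (2 * n) * (nr ((j : ℕ) / n) (F β) *
        nr ((j + 2 : ℕ) / n) (F (β + single i 1 + single i 1))) := by
  set s : ℝ := (j + 1 : ℕ) / n with hs
  set g := F β with hg
  set u := F (β + single i 1) with hu
  set k := F (β + single i 1 + single i 1) with hk
  have hn : (0 : ℝ) < n := by exact_mod_cast (by omega : 0 < n)
  have l1 : ∑ a, (β + single i 1 : Fin N → ℕ) a = j + 1 := by simp [sum_add_distrib, hj]
  have l2 : ∑ a, (β + single i 1 + single i 1 : Fin N → ℕ) a = j + 2 := by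
    simp [sum_add_distrib, hj]
  have hs0 : 0 < s := by rw [hs]; positivity
  have hs1 : s < 1 := by
    rw [hs, div_lt_one hn]; exact_mod_cast (by omega : j + 1 < n)
  have bg : Bd ((j : ℕ) / n) g (nr ((j : ℕ) / n) g) := by
    have := h.bd (α := β) (by omega); rwa [hj] at this
  have bu : Bd s u (nr s u) := by
    have := h.bd (α := β + single i 1) (by omega); rwa [l1] at this
  have bk : Bd ((j + 2 : ℕ) / n) k (nr ((j + 2 : ℕ) / n) k) := by
    have := h.bd (α := β + single i 1 + single i 1) (by omega); rwa [l2] at this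
  set p : ℝ := 2 / s with hp
  have hp2 : 2 < p := by rw [hp, lt_div_iff₀ hs0]; linarith
  have hpn : p ≤ 2 * n := by
    rw [hp, hs, div_div_eq_mul_div, div_le_iff₀ (by positivity)]
    push_cast
    have : (0 : ℝ) ≤ j := Nat.cast_nonneg j
    nlinarith
  have hps : p * s = 2 := by rw [hp]; field_simp
  -- the Hölder bound
  have bup := bu.rpow hs0.le (nr_nonneg _ _) (by linarith : 0 < p - 2)
  have b3 := (bg.mul bk (by positivity) (by positivity) (nr_nonneg _ _)).mul bup (by positivity)
    (by nlinarith) (mul_nonneg (nr_nonneg _ _) (nr_nonneg _ _))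
  have hsum : (j : ℕ) / (n : ℝ) + (j + 2 : ℕ) / n + (p - 2) * s = 2 := by
    rw [sub_mul, hps, hs]; push_cast; field_simp; ring
  rw [hsum] at b3
  obtain ⟨i3, e3⟩ := b3.integral_abs_le (mul_nonneg (mul_nonneg (nr_nonneg _ _) (nr_nonneg _ _))
    (Real.rpow_nonneg (nr_nonneg _ _) _))
  -- derivative facts
  have dg : ∀ x, HasFDerivAt g (fderiv ℝ g x) x := fun x =>
    (((h.smooth β (by omega)).differentiable (by simp)) x).hasFDerivAt
  have du : ∀ x, HasFDerivAt u (fderiv ℝ u x) x := fun x =>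
    (((h.smooth _ (by omega)).differentiable (by simp)) x).hasFDerivAt
  have dg1 : ∀ x, fderiv ℝ g x (EuclideanSpace.single i 1) = u x := h.deriv β i (by omega)
  have du1 : ∀ x, fderiv ℝ u x (EuclideanSpace.single i 1) = k x := h.deriv _ i (by omega)
  have hq : 0 < p - 2 := by linarith
  have dU : ∀ x, HasFDerivAt (fun x => |u x| ^ (p - 2) * u x)
      (((p - 2 + 1) * |u x| ^ (p - 2)) • fderiv ℝ u x) x := fun x =>
    (hasDerivAt_abs_rpow_mul (u x) hq).comp_hasFDerivAt x (du x)
  have hint : Integrable (fun x => |u x| ^ p) := by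
    have := bu.rpow hs0.le (nr_nonneg _ _) (by linarith : 0 < p)
    rw [hps] at this
    exact (this.integral_abs_le (by positivity [nr_nonneg s u])).1
  have mu : Continuous u := (h.smooth _ (by omega)).continuous
  have mg : Continuous g := (h.smooth β (by omega)).continuous
  -- integrability of the product
  obtain ⟨Cu, hCu⟩ := h.bdd (β + single i 1) (by omega)
  obtain ⟨Cg, hCg⟩ := h.bdd β (by omega)
  have squ : MemLp u 2 := h.sq _ (by omega) (by omega)
  have hU : Continuous (fun x => |u x| ^ (p - 2) * u x) :=
    ((continuous_abs.comp mu).rpow_const fun _ => Or.inr hq.le).mul mu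
  have hCu0 : 0 ≤ Cu := (abs_nonneg _).trans (hCu 0)
  have hCg0 : 0 ≤ Cg := (abs_nonneg _).trans (hCg 0)
  have hgu : Integrable (fun x => g x * (|u x| ^ (p - 2) * u x)) := by
    rcases eq_zero_or_pos j with hj0 | hj0
    · have hn2 : (2 : ℝ) ≤ n := by exact_mod_cast (by omega : 2 ≤ n)
      have hp4 : 4 ≤ p := by
        rw [hp, hs, hj0, le_div_iff₀ (by positivity)]
        simp only [zero_add, Nat.cast_one]
        rw [mul_one_div, div_le_iff₀ hn]
        linarith
      have hu2 : Integrable (fun x => u x ^ 2) := squ.integrable_sq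
      refine (hu2.const_mul (Cg * Cu ^ (p - 3))).mono' (mg.mul hU).aestronglyMeasurable
        (.of_forall fun x => ?_)
      rw [norm_eq_abs, abs_mul, abs_mul, abs_of_nonneg (Real.rpow_nonneg (abs_nonneg _) _),
        mul_assoc]
      refine mul_le_mul (hCg x) ?_ (by positivity) hCg0
      have e : |u x| ^ (p - 2) * |u x| = |u x| ^ (p - 3) * u x ^ 2 := by
        rw [← sq_abs, ← rpow_natCast |u x| 2, ← Real.rpow_add_one' (abs_nonneg _) (by linarith),
          ← Real.rpow_add' (abs_nonneg _) (by push_cast; linarith)]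
        congr 1; push_cast; ring
      rw [e]
      gcongr
      · linarith
      · exact hCu x
    · have sqg : MemLp g 2 := h.sq β (by omega) (by omega)
      have := (sqg.integrable_mul squ).norm.const_mul (Cu ^ (p - 2))
      refine this.mono' (mg.mul hU).aestronglyMeasurable (.of_forall fun x => ?_)
      simp only [norm_eq_abs, abs_mul, Pi.mul_apply]
      rw [abs_of_nonneg (Real.rpow_nonneg (abs_nonneg (u x)) (p - 2))]
      have : |u x| ^ (p - 2) ≤ Cu ^ (p - 2) := Real.rpow_le_rpow (abs_nonneg _) (hCu x) hq.le
      calc |g x| * (|u x| ^ (p - 2) * |u x|) = |u x| ^ (p - 2) * (|g x| * |u x|) := by ring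
        _ ≤ _ := by gcongr
  have eup : ∀ x, u x * (|u x| ^ (p - 2) * u x) = |u x| ^ p := by
    intro x
    have : |u x| ^ p = |u x| ^ (p - 2) * |u x| ^ (2 : ℝ) := by
      rw [← Real.rpow_add' (abs_nonneg _) (by linarith)]; congr 1; ring
    rw [this, Real.rpow_two, sq_abs]; ring
  have I := integral_bilinear_hasFDerivAt_right_eq_neg_left_of_integrable (μ := volume)
    (B := ContinuousLinearMap.mul ℝ ℝ) (v := EuclideanSpace.single i 1)
    (f := g) (g := fun x => |u x| ^ (p - 2) * u x)
    (by simpa only [dg1, ContinuousLinearMap.mul_apply', eup] using hint)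
    (by
      simp only [_root_.smul_apply, du1, ContinuousLinearMap.mul_apply', smul_eq_mul]
      refine (i3.const_mul (p - 2 + 1)).congr (.of_forall fun x => ?_)
      simp only; ring)
    (by simpa only [ContinuousLinearMap.mul_apply'] using hgu)
    (fun x _ => dg x) (fun x _ => dU x)
  simp only [_root_.smul_apply, du1, dg1, ContinuousLinearMap.mul_apply', smul_eq_mul, eup] at I
  have key : nr s u ^ p ≤ (2 * n) * (nr ((j : ℕ) / n) g * nr ((j + 2 : ℕ) / n) k *
      nr s u ^ (p - 2)) := by
    have hnr := nr_rpow hs0 bu.memLp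
    rw [← hp] at hnr
    rw [hnr]
    have : ∫ x, |u x| ^ p ≤ ∫ x, (p - 1) * |g x * k x * |u x| ^ (p - 2)| := by
      rw [← neg_eq_iff_eq_neg] at I
      rw [← I, ← integral_neg]
      refine integral_mono ?_ (i3.abs.const_mul _) fun x => ?_
      · refine (i3.const_mul (-(p - 2 + 1))).congr (.of_forall fun x => ?_)
        simp only; ring
      · simp only
        have := neg_abs_le (g x * k x * |u x| ^ (p - 2))
        nlinarith
    refine this.trans ?_
    rw [integral_const_mul]
    gcongr
    · linarith
  rcases (nr_nonneg s u).eq_or_lt with h0 | h0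
  · rw [← h0]
    rw [zero_pow two_ne_zero]
    exact mul_nonneg (by positivity) (mul_nonneg (nr_nonneg _ _) (nr_nonneg _ _))
  · have e : nr s u ^ p = nr s u ^ 2 * nr s u ^ (p - 2) := by
      rw [← rpow_natCast, ← rpow_add h0]; congr 1; push_cast; ring
    rw [e, ← mul_assoc] at key
    exact le_of_mul_le_mul_right key (rpow_pos_of_pos h0 _)

end

section

variable {N : ℕ}

/-- The length of a multi-index. -/
def len (α : Fin N → ℕ) : ℕ := ∑ i, α i

@[simp] lemma len_zero : len (0 : Fin N → ℕ) = 0 := by simp [len]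

@[simp] lemma len_add (α β : Fin N → ℕ) : len (α + β) = len α + len β := by
  simp [len, sum_add_distrib]

@[simp] lemma len_single (i : Fin N) (k : ℕ) : len (single i k : Fin N → ℕ) = k := by
  simp [len]

lemma mem_multiIdx {r : ℕ} {α : Fin N → ℕ} : α ∈ multiIdx N r ↔ len α = r := by
  simp [multiIdx, Finset.mem_piAntidiag, len]

lemma exists_eq_add_single {α : Fin N → ℕ} {j : ℕ} (h : len α = j + 1) :
    ∃ β i, α = β + single i 1 ∧ len β = j := by
  have : ∃ i, α i ≠ 0 := by
    by_contra hc
    push Not at hc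
    simp [len, hc] at h
  obtain ⟨i, hi⟩ := this
  have e : α = (α - single i 1) + single i 1 := by
    funext a
    rcases eq_or_ne a i with rfl | ha
    · simp; omega
    · simp [Pi.single_eq_of_ne ha]
  refine ⟨α - single i 1, i, e, ?_⟩
  rw [e, len_add, len_single] at h
  omega

lemma eq_zero_of_len {α : Fin N → ℕ} (h : len α = 0) : α = 0 := by
  funext i
  simp only [len, Finset.sum_eq_zero_iff, Finset.mem_univ, true_imp_iff] at h
  exact h i

lemma SmoothJets.gn {n : ℕ} {F : (Fin N → ℕ) → X N → ℝ} (h : SmoothJets n F) (hn : 0 < n)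
    {B₀ B₁ : ℝ} (hB₀ : 0 < B₀) (hB₁ : 0 < B₁) (h0 : nr 0 (F 0) ≤ B₀)
    (h1 : ∀ α, len α = n → nr 1 (F α) ≤ B₁) (α : Fin N → ℕ) (hα : len α ≤ n) :
    nr (len α / n) (F α) ≤ (2 * n) ^ (n ^ 2) * (B₀ ^ (1 - len α / n : ℝ) * B₁ ^ (len α / n : ℝ)) := by
  classical
  have hn' : (0 : ℝ) < n := by exact_mod_cast hn
  set K : ℝ := 2 * n with hK
  have hK1 : 1 ≤ K := by
    have : (1 : ℝ) ≤ n := by exact_mod_cast hn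
    linarith
  have hK0 : 0 < K := by linarith
  set D : ℕ → ℝ := fun j => B₀ ^ (1 - j / n : ℝ) * B₁ ^ (j / n : ℝ) with hD
  have hD0 : ∀ j, 0 < D j := fun j => by positivity
  have hDm : ∀ j, D (j + 1) ^ 2 = D j * D (j + 2) := by
    intro j
    simp only [hD, mul_pow]
    rw [← rpow_natCast, ← rpow_natCast, ← rpow_mul hB₀.le, ← rpow_mul hB₁.le,
      mul_mul_mul_comm, ← rpow_add hB₀, ← rpow_add hB₁]
    congr 2 <;> push_cast <;> field_simp <;> ring
  set b : (Fin N → ℕ) → ℝ := fun α => K ^ (len α ^ 2) * nr (len α / n) (F α) / D (len α) with hb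
  have hb0 : ∀ α, 0 ≤ b α := fun α =>
    div_nonneg (mul_nonneg (by positivity) (nr_nonneg _ _)) (hD0 _).le
  have hstep : ∀ β i, len β + 2 ≤ n →
      b (β + single i 1) ^ 2 ≤ b β * b (β + single i 1 + single i 1) := by
    intro β i hβ
    have hs := h.step (β := β) (i := i) rfl hβ
    simp only [hb, len_add, len_single]
    change nr ((len β + 1 : ℕ) / n) _ ^ 2 ≤ K * (nr ((len β : ℕ) / n) _ *
      nr ((len β + 2 : ℕ) / n) _) at hs
    set j := len β
    rw [show j + 1 + 1 = j + 2 from rfl]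
    set x := nr ((j + 1 : ℕ) / n) (F (β + single i 1))
    set y := nr ((j : ℕ) / n) (F β)
    set z := nr ((j + 2 : ℕ) / n) (F (β + single i 1 + single i 1))
    have hyz : 0 ≤ y * z := mul_nonneg (nr_nonneg _ _) (nr_nonneg _ _)
    rw [div_pow, hDm, div_mul_div_comm, mul_pow]
    refine div_le_div_of_nonneg_right ?_ (mul_pos (hD0 _) (hD0 _)).le
    have e1 : K ^ j ^ 2 * y * (K ^ (j + 2) ^ 2 * z) = K * (K ^ (j + 1) ^ 2) ^ 2 * (K * (y * z)) := by
      have : K ^ j ^ 2 * K ^ (j + 2) ^ 2 = K * (K ^ (j + 1) ^ 2) ^ 2 * K := by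
        rw [← pow_mul, ← pow_add, ← pow_succ', ← pow_succ]; congr 1; ring
      calc _ = K ^ j ^ 2 * K ^ (j + 2) ^ 2 * (y * z) := by ring
        _ = _ := by rw [this]; ring
    rw [e1]
    have h2 : 0 ≤ (K ^ (j + 1) ^ 2) ^ 2 := by positivity
    calc (K ^ (j + 1) ^ 2) ^ 2 * x ^ 2 ≤ (K ^ (j + 1) ^ 2) ^ 2 * (K * (y * z)) :=
          mul_le_mul_of_nonneg_left hs h2
      _ ≤ K * (K ^ (j + 1) ^ 2) ^ 2 * (K * (y * z)) := by
          have : 0 ≤ (K ^ (j + 1) ^ 2) ^ 2 * (K * (y * z)) := by positivity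
          nlinarith
  have hmain : ∀ α, len α ≤ n → b α ≤ K ^ (n ^ 2) := by
    by_contra hcon
    push Not at hcon
    obtain ⟨α₀, hα₀, hbα₀⟩ := hcon
    set S : Finset (Fin N → ℕ) := (Finset.range (n + 1)).biUnion (multiIdx N) with hS
    have hmem : ∀ α, α ∈ S ↔ len α ≤ n := by
      intro α
      simp [hS, mem_multiIdx]
    obtain ⟨α₁, hα₁, hmax⟩ := S.exists_max_image b ⟨α₀, (hmem _).2 hα₀⟩
    obtain ⟨α, hα, hmin⟩ := (S.filter fun α => b α = b α₁).exists_min_image len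
      ⟨α₁, by simp [hα₁]⟩
    rw [Finset.mem_filter] at hα
    obtain ⟨hαS, hαb⟩ := hα
    have hbig : K ^ (n ^ 2) < b α := hαb ▸ hbα₀.trans_le (hmax _ ((hmem _).2 hα₀))
    have hpos : 0 < b α := lt_trans (by positivity) hbig
    have hle := (hmem α).1 hαS
    rcases eq_zero_or_pos (len α) with hl | hl
    · have := eq_zero_of_len hl
      subst this
      apply hbig.not_ge
      have hD00 : D 0 = B₀ := by simp [hD]
      simp only [hb, len_zero, hD00, Nat.cast_zero, zero_div]
      rw [div_le_iff₀ hB₀]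
      have : (1 : ℝ) ≤ K ^ n ^ 2 := one_le_pow₀ hK1
      simp only [ne_eq, OfNat.ofNat_ne_zero, not_false_eq_true, zero_pow, pow_zero, one_mul]
      nlinarith
    rcases hle.eq_or_lt with hl2 | hl2
    · apply hbig.not_ge
      have hDn : D n = B₁ := by simp [hD, div_self hn'.ne']
      simp only [hb, hl2, hDn, div_self hn'.ne']
      rw [div_le_iff₀ hB₁]
      exact mul_le_mul_of_nonneg_left (h1 α hl2) (by positivity)
    obtain ⟨β, i, rfl, hβ⟩ := exists_eq_add_single (α := α) (j := len α - 1) (by omega)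
    simp only [len_add, len_single] at hl hl2 hmin hβ
    have hs := hstep β i (by omega)
    have hβS : β ∈ S := (hmem _).2 (by omega)
    have hγS : β + single i 1 + single i 1 ∈ S := (hmem _).2 (by simp; omega)
    have hlt : b β < b (β + single i 1) := by
      refine lt_of_le_of_ne (hαb ▸ hmax _ hβS) fun he => ?_
      have := hmin β (Finset.mem_filter.2 ⟨hβS, he.trans hαb⟩)
      omega
    have hγ : b (β + single i 1 + single i 1) ≤ b (β + single i 1) := hαb ▸ hmax _ hγS
    have := mul_le_mul_of_nonneg_left hγ (hb0 β)
    nlinarith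
  have := hmain α hα
  simp only [hb] at this
  rw [div_le_iff₀ (hD0 _)] at this
  refine le_trans ?_ this
  have h1 : (1 : ℝ) ≤ K ^ len α ^ 2 := one_le_pow₀ hK1
  nlinarith [nr_nonneg (len α / n : ℝ) (F α)]

/-- Bounded functions with square integrable weak derivatives of orders `1, …, n`. -/
structure W (n : ℕ) (f : X N → ℝ) : Prop where
  bdd : MemLp f ⊤
  deriv : ∀ α : Fin N → ℕ, 1 ≤ len α → len α ≤ n → ∃ g, IsWeakDeriv α f g ∧ MemLp g 2

lemma _root_.MeasureTheory.MemLp.locInt {F : Type*} [NormedAddCommGroup F] {f : X N → F}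
    {p : ℝ≥0∞} (h : MemLp f p) (hp : 1 ≤ p) : LocallyIntegrable f := h.locallyIntegrable hp

namespace W

variable {n : ℕ} {f : X N → ℝ}

lemma isWeak (h : W n f) {α : Fin N → ℕ} (hα : len α ≤ n) : IsWeakDeriv α f (weakDeriv α f) := by
  rcases eq_zero_or_pos (len α) with h0 | h0
  · rw [eq_zero_of_len h0]
    exact (isWeakDeriv_zero (h.bdd.locInt le_top)).spec
  · obtain ⟨g, hg, -⟩ := h.deriv α h0 hα
    exact hg.spec

lemma weakDeriv_zero_ae (h : W n f) : weakDeriv 0 f =ᵐ[volume] f :=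
  (isWeakDeriv_zero (h.bdd.locInt le_top)).ae_eq

lemma memLp (h : W n f) {α : Fin N → ℕ} (h1 : 1 ≤ len α) (hα : len α ≤ n) :
    MemLp (weakDeriv α f) 2 := by
  obtain ⟨g, hg, hg2⟩ := h.deriv α h1 hα
  exact hg2.ae_eq hg.ae_eq.symm

lemma step (h : W n f) {α : Fin N → ℕ} {i : Fin N} (hα : len α + 1 ≤ n) :
    IsWeakDeriv (single i 1) (weakDeriv α f) (weakDeriv (α + single i 1) f) :=
  (h.isWeak (by omega)).of_add (h.isWeak (by simpa using hα))

lemma mono (h : W n f) {k : ℕ} (hk : k ≤ n) : W k f :=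
  ⟨h.bdd, fun α h1 hα => h.deriv α h1 (hα.trans hk)⟩

lemma smoothJets (h : W n f) (k : ℕ) : SmoothJets n (fun α => mol k (weakDeriv α f)) where
  smooth α hα := mol_contDiff k (h.isWeak hα).2.1
  deriv α i hα x := mol_fderiv k (h.step hα) x
  bdd α hα := by
    rcases eq_zero_or_pos (len α) with h0 | h0
    · refine ⟨(eLpNorm f ⊤).toReal, fun x => (norm_eq_abs _).ge.trans (mol_norm_le k ?_ x)⟩
      rw [eq_zero_of_len h0]
      filter_upwards [h.weakDeriv_zero_ae, ae_le_eLpNormEssSup (f := f) (μ := volume)] with x hx hx2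
      rw [hx, eLpNorm_exponent_top]
      have := h.bdd.2.ne
      rw [eLpNorm_exponent_top] at this
      rw [← toReal_enorm]
      exact toReal_mono this hx2
    · exact mol_bounded k (h.memLp h0 hα)
  sq α h1 hα := memLp_mol k (h.memLp h1 hα)

lemma gn (h : W n f) (hn : 0 < n) {B₀ B₁ : ℝ} (hB₀ : 0 < B₀) (hB₁ : 0 < B₁) (h0 : Bd 0 f B₀)
    (h1 : ∀ α, len α = n → Bd 1 (weakDeriv α f) B₁) {α : Fin N → ℕ} (hα : len α ≤ n) :
    Bd (len α / n) (weakDeriv α f)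
      ((2 * n) ^ (n ^ 2) * (B₀ ^ (1 - len α / n : ℝ) * B₁ ^ (len α / n : ℝ))) := by
  refine ⟨(h.isWeak hα).2.1.aestronglyMeasurable, ?_⟩
  refine (Lp.eLpNorm_lim_le_liminf_eLpNorm (f := fun k => mol k (weakDeriv α f))
    (fun k => (mol_contDiff k (h.isWeak hα).2.1).continuous.aestronglyMeasurable) _
    (mol_ae_tendsto (h.isWeak hα).2.1)).trans ?_
  refine liminf_le_of_le (by isBoundedDefault) fun b hb => ?_
  obtain ⟨k, hk⟩ := hb.exists
  refine hk.trans ?_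
  have hJ := h.smoothJets k
  have := hJ.gn hn hB₀ hB₁ ?_ ?_ α hα
  · have hb := hJ.bd hα
    exact hb.2.trans (ENNReal.ofReal_le_ofReal this)
  · refine Bd.toReal_le (bd_zero_of_bounded (mol_contDiff k
      (h.isWeak (α := 0) (by simp)).2.1).continuous.aestronglyMeasurable
      (.of_forall fun x => (norm_eq_abs _).ge.trans (mol_norm_le k ?_ x))) hB₀.le
    have h02 := h0.2
    rw [ex_zero, eLpNorm_exponent_top] at h02
    filter_upwards [h.weakDeriv_zero_ae, ae_le_eLpNormEssSup (f := f) (μ := volume)] with x hx hx2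
    rw [hx, ← toReal_enorm]
    exact toReal_le_of_le_ofReal hB₀.le (hx2.trans h02)
  · intro β hβ
    have hb1 := (h1 β hβ).2
    have e : eLpNorm (mol k (weakDeriv β f)) (ex 1) ≤ ofReal B₁ := by
      rw [ex_one] at hb1 ⊢
      exact (eLpNorm_mol_le k (h.isWeak hβ.le).2.1).trans hb1
    exact toReal_le_of_le_ofReal hB₁.le e

end W

end

section
open FourierTransform SchwartzMap LineDeriv ComplexConjugate

variable {N : ℕ}

/-- The Fourier transform of a square integrable function. -/
noncomputable abbrev ft {f : X N → ℂ} (hf : MemLp f 2) : X N → ℂ :=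
  (𝓕 hf.toLp : Lp ℂ 2 (volume : Measure (X N)))

lemma integral_schwartz_weakDeriv {i : Fin N} {f f' : X N → ℂ}
    (h : IsWeakDeriv (single i 1) f f') (hf : MemLp f 2) (hf' : MemLp f' 2)
    (ψ : 𝓢(X N, ℂ)) : ∫ x, conj ((∂_{(EuclideanSpace.single i 1 : X N)} ψ : 𝓢(X N, ℂ)) x) * f x =
      - ∫ x, conj (ψ x) * f' x := by
  have m := (ψ.memLp 2 (volume : Measure (X N))).star
  have m' := ((∂_{(EuclideanSpace.single i 1 : X N)} ψ : 𝓢(X N, ℂ)).memLp 2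
    (volume : Measure (X N))).star
  have hd : ∀ x, HasFDerivAt (fun x => conj (ψ x))
      ((Complex.conjCLE : ℂ →L[ℝ] ℂ) ∘L fderiv ℝ ψ x) x := fun x =>
    Complex.conjCLE.hasFDerivAt.comp x (((ψ.smooth 1).differentiable (by simp) x).hasFDerivAt)
  have e : ∀ x, ((Complex.conjCLE : ℂ →L[ℝ] ℂ) ∘L fderiv ℝ ψ x) (EuclideanSpace.single i 1) =
      conj ((∂_{(EuclideanSpace.single i 1 : X N)} ψ : 𝓢(X N, ℂ)) x) := fun x => by
    rw [SchwartzMap.lineDerivOp_apply_eq_fderiv]; rfl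
  refine tendsto_nhds_unique (tendsto_integral_smul_mol m' hf)
    ((tendsto_integral_smul_mol m hf').neg.congr fun n => ?_)
  have I := integral_bilinear_hasFDerivAt_right_eq_neg_left_of_integrable (μ := volume)
    (B := ContinuousLinearMap.mul ℝ ℂ) (v := EuclideanSpace.single i 1) (g := mol n f)
    (by simp only [e]; exact m'.integrable_smul_two (memLp_mol n hf))
    (by simp only [mol_fderiv n h]; exact m.integrable_smul_two (memLp_mol n hf'))
    (m.integrable_smul_two (memLp_mol n hf)) (fun x _ => hd x) fun x _ =>
      ((mol_contDiff n h.1).differentiable (by simp) x).hasFDerivAt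
  simp only [e, mol_fderiv n h] at I
  exact neg_eq_iff_eq_neg.2 I

lemma inner_toLp_eq {f g : X N → ℂ} (hf : MemLp f 2) (hg : MemLp g 2) :
    inner ℂ hf.toLp hg.toLp = ∫ x, conj (f x) * g x := by
  rw [MeasureTheory.L2.inner_def]
  refine integral_congr_ae ?_
  filter_upwards [hf.coeFn_toLp, hg.coeFn_toLp] with x h1 h2
  rw [h1, h2]
  simp [RCLike.inner_apply, mul_comm]

lemma inner_toLp_eq' {f : X N → ℂ} (hf : MemLp f 2) (G : Lp ℂ 2 (volume : Measure (X N))) :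
    inner ℂ hf.toLp G = ∫ x, conj (f x) * G x := by
  have := inner_toLp_eq hf (Lp.memLp G)
  rwa [Lp.toLp_coeFn] at this

lemma fourier_parseval (θ : 𝓢(X N, ℂ)) {q : X N → ℂ} (hq : MemLp q 2) :
    ∫ x, conj ((𝓕 θ : 𝓢(X N, ℂ)) x) * ft hq x = ∫ x, conj (θ x) * q x := by
  have e1 := Lp.inner_fourier_eq (θ.toLp 2 (volume : Measure (X N))) hq.toLp
  rw [SchwartzMap.toLp_fourier_eq] at e1
  rw [← inner_toLp_eq' ((𝓕 θ : 𝓢(X N, ℂ)).memLp 2 volume), ← inner_toLp_eq (θ.memLp 2 volume) hq]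
  exact e1

lemma fourier_lineDeriv_apply (ψ : 𝓢(X N, ℂ)) (i : Fin N) (x : X N) :
    (𝓕 (∂_{(EuclideanSpace.single i 1 : X N)} ψ : 𝓢(X N, ℂ)) : 𝓢(X N, ℂ)) x =
      2 * Real.pi * Complex.I * (x i : ℂ) * (𝓕 ψ : 𝓢(X N, ℂ)) x := by
  rw [SchwartzMap.fourier_lineDerivOp_eq]
  have ht : (fun y : X N => inner ℝ y (EuclideanSpace.single i (1 : ℝ))).HasTemperateGrowth := by
    fun_prop
  rw [_root_.smul_apply, SchwartzMap.smulLeftCLM_apply_apply ht]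
  simp [EuclideanSpace.inner_single_right]
  ring

lemma locallyIntegrable_coord_mul (i : Fin N) {A : X N → ℂ} (hA : LocallyIntegrable A) :
    LocallyIntegrable (fun ξ : X N => (2 * Real.pi * Complex.I * (ξ i : ℂ)) * A ξ) := by
  have hc : Continuous fun ξ : X N => (2 * Real.pi * Complex.I * (ξ i : ℂ)) := by fun_prop
  rw [locallyIntegrable_iff]
  intro K hK
  exact (hA.integrableOn_isCompact hK).continuousOn_mul hc.continuousOn hK

lemma integral_fourier_weakDeriv {i : Fin N} {f f' : X N → ℂ}
    (h : IsWeakDeriv (single i 1) f f') (hf : MemLp f 2) (hf' : MemLp f' 2)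
    (G : 𝓢(X N, ℂ)) : ∫ x, conj (G x) * ft hf' x =
      ∫ x, conj (G x) * ((2 * Real.pi * Complex.I * (x i : ℂ)) * ft hf x) := by
  obtain ⟨ψ, rfl⟩ : ∃ ψ : 𝓢(X N, ℂ), 𝓕 ψ = G := ⟨𝓕⁻ G, fourier_fourierInv_eq G⟩
  have e2 := fourier_parseval (∂_{(EuclideanSpace.single i 1 : X N)} ψ) hf
  rw [integral_schwartz_weakDeriv h hf hf' ψ, ← fourier_parseval ψ hf'] at e2
  simp only [fourier_lineDeriv_apply] at e2
  rw [neg_eq_iff_eq_neg.1 e2.symm, ← integral_neg]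
  refine integral_congr_ae (.of_forall fun x => ?_)
  simp only [map_mul, Complex.conj_ofReal, Complex.conj_I, map_ofNat]
  ring

lemma ae_eq_of_schwartz {A A' : X N → ℂ} (hA : LocallyIntegrable A)
    (hA' : LocallyIntegrable A')
    (key : ∀ G : 𝓢(X N, ℂ), ∫ x, conj (G x) * A' x = ∫ x, conj (G x) * A x) : ∀ᵐ x, A' x = A x := by
  refine ae_eq_of_integral_contDiff_smul_eq hA' hA fun g hg hgc => ?_
  have hgC : HasCompactSupport fun x => (g x : ℂ) :=
    hgc.comp_left (g := fun r : ℝ => (r : ℂ)) Complex.ofReal_zero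
  have hgs : ContDiff ℝ ∞ fun x => (g x : ℂ) := Complex.ofRealCLM.contDiff.comp hg
  have := key (hgC.toSchwartzMap hgs)
  have hGx : ∀ x, (hgC.toSchwartzMap hgs) x = (g x : ℂ) := fun x => rfl
  simp only [hGx, Complex.conj_ofReal, ← Complex.real_smul] at this
  exact this

lemma fourier_weakDeriv {i : Fin N} {f f' : X N → ℂ}
    (h : IsWeakDeriv (single i 1) f f') (hf : MemLp f 2) (hf' : MemLp f' 2) :
    ∀ᵐ ξ : X N, ft hf' ξ = (2 * Real.pi * Complex.I * (ξ i : ℂ)) * ft hf ξ := ae_eq_of_schwartz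
    (locallyIntegrable_coord_mul i ((Lp.memLp (𝓕 hf.toLp)).locInt (by norm_num)))
    ((Lp.memLp (𝓕 hf'.toLp)).locInt (by norm_num))
    (integral_fourier_weakDeriv h hf hf')

end

section
open FourierTransform SchwartzMap ComplexConjugate

variable {N : ℕ}

lemma Bd.sum {ι : Type*} (t : Finset ι) {s : ℝ} {f : ι → X N → ℝ} {A : ι → ℝ}
    (h : ∀ i ∈ t, Bd s (f i) (A i)) (hs : s ≤ 2) (hA : ∀ i ∈ t, 0 ≤ A i) :
    Bd s (fun x => ∑ i ∈ t, f i x) (∑ i ∈ t, A i) := by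
  classical
  induction t using Finset.induction_on with
  | empty => exact ⟨by simpa using aestronglyMeasurable_const, by simp⟩
  | insert a t ha ih =>
    simp only [Finset.sum_insert ha]
    exact (h a (Finset.mem_insert_self a t)).add
      (ih (fun i hi => h i (Finset.mem_insert_of_mem hi))
        fun i hi => hA i (Finset.mem_insert_of_mem hi)) hs (hA a (Finset.mem_insert_self a t))
      (sum_nonneg fun i hi => hA i (Finset.mem_insert_of_mem hi))

lemma norm_ft_weakDeriv {i : Fin N} {f : X N → ℝ} (hf : MemLp (fun x => (f x : ℂ)) 2)
    {s : ℕ} (hD : ∀ j ≤ s, IsWeakDeriv (single i j) f (weakDeriv (single i j) f) ∧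
      MemLp (fun x => Complex.ofReal (weakDeriv (single i j) f x)) 2) :
    ∀ j, (hj : j ≤ s) → ∀ᵐ ξ : X N, ‖ft (hD j hj).2 ξ‖ = (2 * Real.pi * |ξ i|) ^ j * ‖ft hf ξ‖ := by
  intro j
  induction j with
  | zero =>
    intro hj
    have e : (hD 0 hj).2.toLp = hf.toLp := (MemLp.toLp_eq_toLp_iff _ _).2 <| by
      have h := (hD 0 hj).1
      simp only [Pi.single_zero] at h ⊢
      filter_upwards [(isWeakDeriv_zero h.1).ae_eq] with x hx
      rw [hx]
    exact .of_forall fun ξ => by rw [ft, e, pow_zero, one_mul]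
  | succ k ih =>
    intro hj
    have h := (hD (k + 1) hj).1
    rw [Pi.single_add] at h
    have hw := ((hD k (by omega)).1.of_add h).clm_comp Complex.ofRealCLM
    simp only [← Pi.single_add, Complex.ofRealCLM_apply] at hw
    filter_upwards [ih (by omega), fourier_weakDeriv hw (hD k (by omega)).2 (hD (k + 1) hj).2] with ξ h1 h3
    rw [h3]
    rw [norm_mul, h1, pow_succ]
    simp only [norm_mul, Complex.norm_I, Complex.norm_real, Complex.norm_ofNat, norm_eq_abs,
      abs_of_pos Real.pi_pos]
    ring

lemma japanese_le (s : ℕ) (hs : 0 < s) (ξ : X N) : (1 + ‖ξ‖ ^ 2) ^ ((s : ℝ) / 2) ≤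
      ((N : ℝ) + 1) ^ ((s : ℝ) / 2) * (1 + ∑ i, |ξ i| ^ s) := by
  set t : ℝ := 1 + ∑ i, |ξ i| ^ s with ht
  have hsum : ∀ i, |ξ i| ^ s ≤ t := fun i => by
    have := single_le_sum (f := fun i => |ξ i| ^ s) (fun i _ => by positivity)
      (Finset.mem_univ i)
    simp only at this
    linarith
  have ht1 : 1 ≤ t := by
    have : 0 ≤ ∑ i, |ξ i| ^ s := sum_nonneg fun i _ => by positivity
    linarith
  have hs' : (0 : ℝ) < s := by exact_mod_cast hs
  set r : ℝ := t ^ (1 / (s : ℝ)) with hr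
  have hr1 : 1 ≤ r := Real.one_le_rpow ht1 (by positivity)
  have hri : ∀ i, |ξ i| ≤ r := fun i => by
    have := Real.rpow_le_rpow (by positivity) (hsum i) (by positivity : 0 ≤ 1 / (s : ℝ))
    rwa [← rpow_natCast, ← rpow_mul (abs_nonneg _), mul_one_div_cancel hs'.ne',
      rpow_one] at this
  have h1 : 1 + ‖ξ‖ ^ 2 ≤ ((N : ℝ) + 1) * r ^ 2 := by
    rw [EuclideanSpace.norm_sq_eq]
    have : ∑ i, ‖ξ i‖ ^ 2 ≤ ∑ _i : Fin N, r ^ 2 :=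
      sum_le_sum fun i _ => pow_le_pow_left₀ (norm_nonneg _) (hri i) 2
    simp only [Finset.sum_const, Finset.card_univ, Fintype.card_fin, nsmul_eq_mul] at this
    nlinarith [one_le_pow₀ hr1 (n := 2)]
  calc (1 + ‖ξ‖ ^ 2) ^ ((s : ℝ) / 2) ≤ (((N : ℝ) + 1) * r ^ 2) ^ ((s : ℝ) / 2) :=
        Real.rpow_le_rpow (by positivity) h1 (by positivity)
    _ = ((N : ℝ) + 1) ^ ((s : ℝ) / 2) * t := by
        rw [mul_rpow (by positivity) (by positivity), ← rpow_natCast r 2,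
          ← rpow_mul (by positivity), hr, ← rpow_mul (by positivity)]
        congr 1
        have : 1 / (s : ℝ) * (((2 : ℕ) : ℝ) * ((s : ℝ) / 2)) = 1 := by push_cast; field_simp
        rw [this, rpow_one]

lemma memLp_japanese {s : ℕ} (hs : N < 2 * s) :
    MemLp (fun ξ : X N => (1 + ‖ξ‖ ^ 2) ^ (-(s : ℝ) / 2)) 2 := by
  have hm : Continuous fun ξ : X N => (1 + ‖ξ‖ ^ 2) ^ (-(s : ℝ) / 2) :=
    (by fun_prop : Continuous fun ξ : X N => 1 + ‖ξ‖ ^ 2).rpow_const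
      fun ξ => Or.inl (by positivity)
  rw [memLp_two_iff_integrable_sq hm.aestronglyMeasurable]
  have := integrable_rpow_neg_one_add_norm_sq (E := X N) (μ := volume) (r := 2 * s)
    (by simp only [finrank_euclideanSpace, Fintype.card_fin]; exact_mod_cast hs)
  refine this.congr (.of_forall fun ξ => ?_)
  simp only
  rw [← rpow_natCast ((1 + ‖ξ‖ ^ 2) ^ (-(s : ℝ) / 2)) 2, ← rpow_mul (by positivity)]
  congr 1
  push_cast
  ring

lemma norm_fourier_eLpNorm {f : X N → ℂ} (hf : MemLp f 2) : eLpNorm (ft hf) 2 = eLpNorm f 2 := by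
  have h := Lp.norm_fourier_eq hf.toLp
  rw [Lp.norm_toLp, Lp.norm_def] at h
  exact (ENNReal.toReal_eq_toReal_iff' (Lp.memLp (𝓕 hf.toLp)).2.ne hf.2.ne).1 h

lemma fourier_integral_bound {s : ℕ} (hs : N < 2 * s) :
    ∃ C : ℝ, 0 ≤ C ∧ ∀ (f : X N → ℂ) (g : Fin N → X N → ℂ) (hf : MemLp f 2 volume)
      (hg : ∀ i, MemLp (g i) 2 volume), (∀ i, ∀ᵐ ξ : X N, ‖ft (hg i) ξ‖ =
        (2 * Real.pi * |ξ i|) ^ s * ‖ft hf ξ‖) → Integrable (fun ξ => ‖ft hf ξ‖) ∧ ∫ ξ, ‖ft hf ξ‖ ≤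
        C * ((eLpNorm f 2).toReal + ∑ i, (eLpNorm (g i) 2).toReal) := by
  have hs0 : 0 < s := by omega
  set w : X N → ℝ := fun ξ => (1 + ‖ξ‖ ^ 2) ^ (-(s : ℝ) / 2)
  have hw : Bd 1 w _ := bd_one_of_memLp (memLp_japanese hs)
  set C₁ : ℝ := ((N : ℝ) + 1) ^ ((s : ℝ) / 2)
  have hC₁ : 0 ≤ C₁ := by positivity
  refine ⟨C₁ * (eLpNorm w 2).toReal, by positivity, fun f g hf hg h => ?_⟩
  have hbd : ∀ (q : X N → ℂ) (hq : MemLp q 2), Bd 1 (fun ξ => ‖ft hq ξ‖)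
        (eLpNorm q 2).toReal := by
    intro q hq
    have h1 := bd_one_of_memLp (Lp.memLp (𝓕 hq.toLp)).norm
    rwa [eLpNorm_norm, norm_fourier_eLpNorm] at h1
  have hG := (hbd f hf).add (Bd.sum univ (fun i _ => hbd (g i) (hg i)) (by norm_num)
    fun i _ => toReal_nonneg) (by norm_num) toReal_nonneg
    (sum_nonneg fun i _ => toReal_nonneg)
  have hP := (hw.mul hG zero_le_one zero_le_one toReal_nonneg)
  rw [one_add_one_eq_two] at hP
  obtain ⟨hi, hle⟩ := hP.integral_abs_le (mul_nonneg toReal_nonneg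
    (add_nonneg toReal_nonneg (sum_nonneg fun i _ => toReal_nonneg)))
  have hpt : ∀ᵐ ξ : X N, ‖ft hf ξ‖ ≤ C₁ * |w ξ * (‖ft hf ξ‖ + ∑ i, ‖ft (hg i) ξ‖)| := by
    filter_upwards [ae_all_iff.2 h] with ξ hξ
    set a := ‖ft hf ξ‖
    have ha : 0 ≤ a := norm_nonneg _
    have hj := japanese_le s hs0 ξ
    have h1 : (1 + ∑ i, |ξ i| ^ s) * a ≤ a + ∑ i, ‖ft (hg i) ξ‖ := by
      rw [add_mul, one_mul, sum_mul]
      refine add_le_add le_rfl (sum_le_sum fun i _ => ?_)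
      rw [hξ i]
      refine mul_le_mul_of_nonneg_right (pow_le_pow_left₀ (abs_nonneg _) ?_ _) ha
      have := Real.pi_gt_three
      nlinarith [abs_nonneg (ξ i)]
    have hw0 : 0 < w ξ := by positivity
    have hw1 : w ξ * (1 + ‖ξ‖ ^ 2) ^ ((s : ℝ) / 2) = 1 := by
      simp only [w]
      rw [← rpow_add (by positivity)]
      simp [neg_div]
    refine le_trans ?_ (mul_le_mul_of_nonneg_left (le_abs_self _) hC₁)
    calc a = w ξ * ((1 + ‖ξ‖ ^ 2) ^ ((s : ℝ) / 2)) * a := by rw [hw1, one_mul]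
      _ ≤ w ξ * (C₁ * (1 + ∑ i, |ξ i| ^ s)) * a := by gcongr
      _ = C₁ * (w ξ * ((1 + ∑ i, |ξ i| ^ s) * a)) := by ring
      _ ≤ _ := by gcongr
  have hint : Integrable (fun ξ => ‖ft hf ξ‖) := by
    refine (hi.abs.const_mul C₁).mono' (Lp.memLp (𝓕 hf.toLp)).1.norm ?_
    filter_upwards [hpt] with ξ h
    rwa [norm_norm]
  refine ⟨hint, (integral_mono_ae hint (hi.abs.const_mul C₁) hpt).trans ?_⟩
  rw [integral_const_mul, mul_assoc]
  gcongr

lemma sobolev_embedding {s : ℕ} (hs : N < 2 * s) : ∃ C : ℝ, 0 ≤ C ∧ ∀ (f : X N → ℝ), MemLp f 2 →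
      (∀ i j, j ≤ s → ∃ g, IsWeakDeriv (single i j) f g ∧ MemLp g 2) →
      Bd 0 f (C * (nr 1 f + ∑ i, nr 1 (weakDeriv (single i s) f))) := by
  obtain ⟨C, hC, hmain⟩ := fourier_integral_bound hs
  refine ⟨C, hC, fun f hf hder => ?_⟩
  set fC : X N → ℂ := fun x => (f x : ℂ)
  have hfC : MemLp fC 2 := hf.ofReal
  have hD : ∀ i j, j ≤ s → IsWeakDeriv (single i j) f (weakDeriv (single i j) f) ∧
      MemLp (weakDeriv (single i j) f) 2 := by
    intro i j hj
    obtain ⟨g, h1, h2⟩ := hder i j hj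
    exact ⟨h1.spec, h2.ae_eq h1.ae_eq.symm⟩
  have hG : ∀ i j, j ≤ s → MemLp (fun x => Complex.ofReal (weakDeriv (single i j) f x)) 2 :=
    fun i j hj => (hD i j hj).2.ofReal
  obtain ⟨hint, hle⟩ := hmain fC _ hfC (fun i => hG i s le_rfl) fun i =>
    norm_ft_weakDeriv hfC (fun j hj => ⟨(hD i j hj).1, hG i j hj⟩) s le_rfl
  have en : ∀ h : X N → ℝ, eLpNorm (fun x => (h x : ℂ)) 2 = eLpNorm h 2 := by
    intro h
    refine eLpNorm_congr_norm_ae (.of_forall fun x => ?_)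
    simp
  have hfl := hf.locInt (by norm_num)
  have hmol : ∀ n x, |mol n f x| ≤ ∫ ξ, ‖ft hfC ξ‖ := by
    intro n x
    have ht := isTest_molKer_sub n x
    have htC : HasCompactSupport fun t => (molKer N n (x - t) : ℂ) :=
      ht.2.comp_left (g := fun r : ℝ => (r : ℂ)) Complex.ofReal_zero
    have hts : ContDiff ℝ ∞ fun t => (molKer N n (x - t) : ℂ) := Complex.ofRealCLM.contDiff.comp ht.1
    have P := fourier_parseval (htC.toSchwartzMap hts) hfC
    have hval : ∀ t, (htC.toSchwartzMap hts) t = (molKer N n (x - t) : ℂ) := fun t => rfl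
    have e1 : ∫ t, conj ((htC.toSchwartzMap hts) t) * fC t = Complex.ofReal (mol n f x) := by
      rw [mol_apply', ← integral_complex_ofReal]
      refine integral_congr_ae (.of_forall fun t => ?_)
      simp only [hval, Complex.conj_ofReal, fC, smul_eq_mul, Complex.ofReal_mul]
    have hk1 : ∀ ξ, ‖(𝓕 (htC.toSchwartzMap hts) : 𝓢(X N, ℂ)) ξ‖ ≤ 1 := by
      intro ξ
      refine (norm_fourier_apply_le_toLp_one _ ξ).trans (le_of_eq ?_)
      rw [norm_toLp_one]
      simp only [hval, Complex.norm_real, Real.norm_of_nonneg (molKer_nonneg n _)]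
      rw [integral_sub_left_eq_self (molKer N n) volume x, integral_molKer]
    rw [← norm_eq_abs, ← Complex.norm_real, ← e1, ← P]
    refine norm_integral_le_of_norm_le hint (.of_forall fun ξ => ?_)
    rw [norm_mul, RCLike.norm_conj]
    exact mul_le_of_le_one_left (norm_nonneg _) (hk1 ξ)
  have hae : ∀ᵐ x, |f x| ≤ ∫ ξ, ‖ft hfC ξ‖ := by
    filter_upwards [mol_ae_tendsto hfl] with x hx
    exact le_of_tendsto hx.abs (.of_forall fun n => hmol n x)
  refine (bd_zero_of_bounded hf.1 hae).mono (hle.trans (le_of_eq ?_))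
  simp only [fC, en, nr, ex_one]

end

section

variable {N : ℕ}

lemma Bd.locL2 {s B : ℝ} {f : X N → ℝ} (h : Bd s f B) (h0 : 0 ≤ s) (h1 : s ≤ 1) : LocL2 f := by
  intro φ hφ
  have hb : Bd (1 - s) φ _ := MemLp.bd (hφ.memLp (ex (1 - s)))
  have := (hb.mul h (by linarith) h0 toReal_nonneg).memLp
  rwa [sub_add_cancel, ex_one] at this

lemma IsWeakDeriv.mul_weakDeriv {i : Fin N} {f g : X N → ℝ}
    (hf : IsWeakDeriv (single i 1) f (weakDeriv (single i 1) f))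
    (hg : IsWeakDeriv (single i 1) g (weakDeriv (single i 1) g))
    (f0 : LocL2 (weakDeriv 0 f)) (f1 : LocL2 (weakDeriv (single i 1) f))
    (g0 : LocL2 (weakDeriv 0 g)) (g1 : LocL2 (weakDeriv (single i 1) g)) :
    IsWeakDeriv (single i 1) (fun x => f x * g x)
      (fun x => weakDeriv (single i 1) f x * g x + f x * weakDeriv (single i 1) g x) := by
  have L : ∀ {h : X N → ℝ}, LocallyIntegrable h → LocL2 (weakDeriv 0 h) → LocL2 h :=
    fun hl h0 φ hφ => (h0 φ hφ).ae_eq ((isWeakDeriv_zero hl).ae_eq.mono fun x hx => by simp [hx])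
  exact hf.mul hg (L hf.1 f0) f1 (L hg.1 g0) g1

lemma Bd.neg {s B : ℝ} {f : X N → ℝ} (h : Bd s f B) : Bd s (fun x => -f x) B := ⟨h.1.neg, by
    have := h.2
    rw [← eLpNorm_neg] at this
    exact this⟩

lemma Bd.sub {s A B : ℝ} {f g : X N → ℝ} (hf : Bd s f A) (hg : Bd s g B) (hs2 : s ≤ 2)
    (hA : 0 ≤ A) (hB : 0 ≤ B) : Bd s (fun x => f x - g x) (A + B) := by
  simpa only [sub_eq_add_neg] using hf.add hg.neg hs2 hA hB

lemma Bd.of_forall_gt {s B : ℝ} {f : X N → ℝ} (h : ∀ B' > B, Bd s f B') : Bd s f B := by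
  refine ⟨(h (B + 1) (by linarith)).1, ?_⟩
  have ht : Tendsto (fun n : ℕ => ofReal (B + 1 / ((n : ℝ) + 1))) atTop
      (𝓝 (ofReal (B + 0))) := (ENNReal.continuous_ofReal.tendsto _).comp
      (tendsto_const_nhds.add tendsto_one_div_add_atTop_nhds_zero_nat)
  rw [add_zero] at ht
  refine ge_of_tendsto ht (.of_forall fun n => (h _ ?_).2)
  have : (0 : ℝ) < 1 / ((n : ℝ) + 1) := by positivity
  linarith

/-- The weak derivatives `∂^α f` exist and are bounded by `b |α| s` in `L^{2/s}`, for
`s ∈ D |α|`. -/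
def JB (D : ℕ → Set ℝ) (b : ℕ → ℝ → ℝ) (f : X N → ℝ) : Prop := ∀ (α : Fin N → ℕ), ∀ s ∈ D (len α),
    IsWeakDeriv α f (weakDeriv α f) ∧ Bd s (weakDeriv α f) (b (len α) s)

namespace JB

variable {D D₁ D₂ : ℕ → Set ℝ} {b b₁ b₂ : ℕ → ℝ → ℝ} {f g : X N → ℝ}

lemma intro (h : ∀ (α : Fin N → ℕ), ∀ s ∈ D (len α),
    ∃ g, IsWeakDeriv α f g ∧ Bd s g (b (len α) s)) : JB D b f := by
  intro α s hs
  obtain ⟨g, h1, h2⟩ := h α s hs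
  exact ⟨h1.spec, h2.congr h1.ae_eq.symm⟩

lemma mono (h : JB D b f) {D' : ℕ → Set ℝ} {b' : ℕ → ℝ → ℝ}
    (hD : ∀ j, ∀ s ∈ D' j, s ∈ D j ∧ b j s ≤ b' j s) : JB D' b' f := fun α s hs =>
  ⟨(h α s (hD _ s hs).1).1, (h α s (hD _ s hs).1).2.mono (hD _ s hs).2⟩

lemma congr (h : JB D b f) (hfg : f =ᵐ[volume] g) : JB D b g :=
  intro fun α s hs => ⟨_, (h α s hs).1.congr hfg .rfl, (h α s hs).2⟩

lemma add (hf : JB D b₁ f) (hg : JB D b₂ g) (hD : ∀ j, D j ⊆ Icc 0 1)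
    (h1 : ∀ j s, 0 ≤ b₁ j s) (h2 : ∀ j s, 0 ≤ b₂ j s) :
    JB D (fun j s => b₁ j s + b₂ j s) (fun x => f x + g x) :=
  intro fun α s hs => ⟨_, (hf α s hs).1.add (hg α s hs).1,
    (hf α s hs).2.add (hg α s hs).2 (by linarith [(hD _ hs).2]) (h1 _ _) (h2 _ _)⟩

lemma const_mul (hf : JB D b f) (hD : ∀ j, D j ⊆ Icc 0 1) (c : ℝ) :
    JB D (fun j s => |c| * b j s) (fun x => c * f x) :=
  intro fun α s hs => ⟨_, (hf α s hs).1.const_smul c, (hf α s hs).2.const_mul (hD _ hs).1 c⟩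

lemma neg (hf : JB D b f) : JB D b (fun x => -f x) :=
  intro fun α s hs => ⟨_, (hf α s hs).1.neg, (hf α s hs).2.neg⟩

lemma deriv (hf : JB D b f) {γ : Fin N → ℕ} (hγ : IsWeakDeriv γ f (weakDeriv γ f)) :
    JB (fun j => D (len γ + j)) (fun j s => b (len γ + j) s) (weakDeriv γ f) := by
  refine intro fun α s hs => ?_
  rw [← len_add] at hs ⊢
  exact ⟨_, hγ.of_add (hf (γ + α) s hs).1, (hf (γ + α) s hs).2⟩

lemma locL2 (hf : JB D b f) (hD : ∀ j, D j ⊆ Icc 0 1) {α : Fin N → ℕ} {s : ℝ}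
    (hs : s ∈ D (len α)) : LocL2 (weakDeriv α f) := (hf α s hs).2.locL2 (hD _ hs).1 (hD _ hs).2

lemma zero_ae (hf : JB D b f) {s : ℝ} (hs : s ∈ D 0) : weakDeriv 0 f =ᵐ[volume] f := by
  have h := (hf 0 s (by simpa using hs)).1
  exact (isWeakDeriv_zero h.1).ae_eq

lemma mul_aux (n : ℕ) : ∀ {D D₁ D₂ : ℕ → Set ℝ} {b b₁ b₂ : ℕ → ℝ → ℝ} {f g : X N → ℝ}
    (_ : JB D₁ b₁ f) (_ : JB D₂ b₂ g) (_ : ∀ j, D₁ j ⊆ Icc 0 1) (_ : ∀ j, D₂ j ⊆ Icc 0 1)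
    (_ : ∀ j s, 0 ≤ b₁ j s)
    (s : ℝ) (_ : s ∈ D n) (_ : ∀ j₁ j₂, j₁ + j₂ = n →
      ∃ s₁ ∈ D₁ j₁, ∃ s₂ ∈ D₂ j₂, s₁ + s₂ = s ∧ b₁ j₁ s₁ * b₂ j₂ s₂ ≤ b n s)
    (α : Fin N → ℕ) (_ : len α = n), s ≤ 2 → 0 ≤ b n s →
    ∃ h, IsWeakDeriv α (fun x => f x * g x) h ∧ Bd s h (2 ^ n * b n s) := by
  induction n with
  | zero =>
    intro D D₁ D₂ b b₁ b₂ f g hf hg hD1 hD2 hb1 s hs hsp α hα hs2 hb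
    obtain rfl := eq_zero_of_len hα
    obtain ⟨s₁, h1, s₂, h2, rfl, hle⟩ := hsp 0 0 rfl
    have hf0 := hf 0 s₁ (by simpa using h1)
    have hg0 := hg 0 s₂ (by simpa using h2)
    simp only [len_zero] at hf0 hg0
    have e1 := hf.zero_ae h1
    have e2 := hg.zero_ae h2
    have hfb := hf0.2.congr e1
    have hgb := hg0.2.congr e2
    have hloc := locallyIntegrable_mul
      (hfb.locL2 (hD1 0 h1).1 (hD1 0 h1).2) (hgb.locL2 (hD2 0 h2).1 (hD2 0 h2).2)
    refine ⟨_, isWeakDeriv_zero hloc, ?_⟩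
    have := (hfb.mul hgb (hD1 0 h1).1 (hD2 0 h2).1 (hb1 _ _)).mono hle
    simpa using this
  | succ n ih =>
    intro D D₁ D₂ b b₁ b₂ f g hf hg hD1 hD2 hb1 s hs hsp α hα hs2 hb
    obtain ⟨β, i, rfl, hβ⟩ := exists_eq_add_single hα
    obtain ⟨s₁, h10, t₂, h2n, -, -⟩ := hsp 0 (n + 1) (by simp)
    obtain ⟨_, h11, _, -, -, -⟩ := hsp 1 n (by omega)
    obtain ⟨_, -, _, h20, -, -⟩ := hsp (n + 1) 0 rfl
    obtain ⟨_, -, _, h21, -, -⟩ := hsp n 1 rfl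
    have hf1 := (hf (single i 1) _ (by simpa using h11)).1
    have hg1 := (hg (single i 1) _ (by simpa using h21)).1
    have hprod := hf1.mul_weakDeriv hg1 (hf.locL2 hD1 (by simpa using h10))
      (hf.locL2 hD1 (by simpa using h11)) (hg.locL2 hD2 (by simpa using h20))
      (hg.locL2 hD2 (by simpa using h21))
    have hfd := hf.deriv hf1
    have hgd := hg.deriv hg1
    simp only [len_single] at hfd hgd
    obtain ⟨p, hp, hpb⟩ := ih (D := fun j => D (1 + j)) (b := fun j => b (1 + j)) hfd hg
      (fun j => hD1 _) hD2 (fun j s => hb1 _ _) s (by simpa [add_comm] using hs) (by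
        intro j₁ j₂ hj
        rw [add_comm 1 n]
        exact hsp (1 + j₁) j₂ (by omega)) β hβ hs2 (by rwa [add_comm 1 n])
    obtain ⟨q, hq, hqb⟩ := ih (D := fun j => D (1 + j)) (b := fun j => b (1 + j)) hf hgd
      hD1 (fun j => hD2 _) hb1 s (by simpa [add_comm] using hs) (by
        intro j₁ j₂ hj
        rw [add_comm 1 n]
        exact hsp j₁ (1 + j₂) (by omega)) β hβ hs2 (by rwa [add_comm 1 n])
    rw [add_comm 1 n] at hpb hqb
    refine ⟨_, ?_, (hpb.add hqb hs2 (by positivity) (by positivity)).mono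
      (le_of_eq (by rw [pow_succ]; ring))⟩
    rw [add_comm β]
    exact hprod.trans (hp.add hq)

lemma mul (hf : JB D₁ b₁ f) (hg : JB D₂ b₂ g) (hD1 : ∀ j, D₁ j ⊆ Icc 0 1)
    (hD2 : ∀ j, D₂ j ⊆ Icc 0 1) (hb1 : ∀ j s, 0 ≤ b₁ j s) (hb2 : ∀ j s, 0 ≤ b₂ j s)
    (hsp : ∀ n, ∀ s ∈ D n, ∀ j₁ j₂, j₁ + j₂ = n →
      ∃ s₁ ∈ D₁ j₁, ∃ s₂ ∈ D₂ j₂, s₁ + s₂ = s ∧ b₁ j₁ s₁ * b₂ j₂ s₂ ≤ b n s) :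
    JB D (fun n s => 2 ^ n * b n s) (fun x => f x * g x) := by
  refine intro fun α s hs => ?_
  obtain ⟨s₁, h1, s₂, h2, he, hle⟩ := hsp _ s hs 0 (len α) (by simp)
  refine mul_aux (len α) hf hg hD1 hD2 hb1 s hs (hsp _ s hs) α rfl ?_
    ((mul_nonneg (hb1 _ _) (hb2 _ _)).trans hle)
  linarith [(hD1 _ h1).2, (hD2 _ h2).2]

lemma comm_aux (n : ℕ) : ∀ {E E₁ E₂ D₁ D₂ : ℕ → Set ℝ} {c c₁ c₂ b₁ b₂ : ℕ → ℝ → ℝ}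
    {f g : X N → ℝ} (_ : JB E₁ c₁ f) (_ : JB E₂ c₂ g) (_ : JB D₁ b₁ f) (_ : JB D₂ b₂ g)
    (_ : ∀ j, E₁ j ⊆ Icc 0 1) (_ : ∀ j, E₂ j ⊆ Icc 0 1)
    (_ : ∀ j, D₁ j ⊆ Icc 0 1) (_ : ∀ j, D₂ j ⊆ Icc 0 1)
    (_ : ∀ j s, 0 ≤ c₁ j s) (_ : ∀ j s, 0 ≤ c₂ j s) (_ : ∀ j s, 0 ≤ b₁ j s)
    (_ : ∀ n, ∀ s ∈ E n, ∀ j₁ j₂, j₁ + j₂ = n →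
      ∃ s₁ ∈ E₁ j₁, ∃ s₂ ∈ E₂ j₂, s₁ + s₂ = s ∧ c₁ j₁ s₁ * c₂ j₂ s₂ ≤ c n s)
    (s B : ℝ) (_ : (E n).Nonempty) (_ : ∀ j₁ j₂, j₁ + j₂ + 1 = n →
      ∃ s₁ ∈ D₁ j₁, ∃ s₂ ∈ D₂ (j₂ + 1), s₁ + s₂ = s ∧ b₁ j₁ s₁ * b₂ (j₂ + 1) s₂ ≤ B)
    (α : Fin N → ℕ) (_ : len α = n), s ≤ 2 → 0 ≤ B →
    Bd s (fun x => weakDeriv α (fun y => f y * g y) x - g x * weakDeriv α f x) (2 ^ n * B) := by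
  induction n with
  | zero =>
    intro E E₁ E₂ D₁ D₂ c c₁ c₂ b₁ b₂ f g hfE hgE hf hg hE1 hE2 hD1 hD2 hc1 hc2 hb1 hE s B hne hsp α
      hα hs2 hB
    obtain rfl := eq_zero_of_len hα
    obtain ⟨σ, hσ⟩ := hne
    have hfg := hfE.mul hgE hE1 hE2 hc1 hc2 hE
    obtain ⟨s₁, h1, s₂, h2, -, -⟩ := hE 0 σ hσ 0 0 rfl
    have e1 := hfE.zero_ae h1
    have e2 := hfg.zero_ae hσ
    have e0 : (fun x => weakDeriv 0 (fun y => f y * g y) x - g x * weakDeriv 0 f x)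
        =ᵐ[volume] fun _ => (0 : ℝ) := by
      filter_upwards [e1, e2] with x h1 h2
      rw [h1, h2]; ring
    refine Bd.congr ?_ e0.symm
    exact ⟨aestronglyMeasurable_const, by simp⟩
  | succ n ih =>
    intro E E₁ E₂ D₁ D₂ c c₁ c₂ b₁ b₂ f g hfE hgE hf hg hE1 hE2 hD1 hD2 hc1 hc2 hb1 hE s B hne hsp α
      hα hs2 hB
    obtain ⟨β, i, rfl, hβ⟩ := exists_eq_add_single hα
    obtain ⟨σ, hσ⟩ := hne
    obtain ⟨_, h10, _, h2n, -, -⟩ := hE _ σ hσ 0 (n + 1) (by simp)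
    obtain ⟨_, h11, _, h2n', -, -⟩ := hE _ σ hσ 1 n (by omega)
    obtain ⟨_, h1n, _, h20, -, -⟩ := hE _ σ hσ (n + 1) 0 rfl
    obtain ⟨_, -, _, h21, -, -⟩ := hE _ σ hσ n 1 rfl
    have hf1 := (hfE (single i 1) _ (by simpa using h11)).1
    have hg1 := (hgE (single i 1) _ (by simpa using h21)).1
    have hprod := hf1.mul_weakDeriv hg1 (hfE.locL2 hE1 (by simpa using h10))
      (hfE.locL2 hE1 (by simpa using h11)) (hgE.locL2 hE2 (by simpa using h20))
      (hgE.locL2 hE2 (by simpa using h21))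
    have hfd := hf.deriv hf1
    have hgd := hg.deriv hg1
    have hfdE := hfE.deriv hf1
    have hgdE := hgE.deriv hg1
    simp only [len_single] at hfd hgd hfdE hgdE
    have hE' : ∀ n, ∀ s ∈ E (1 + n), ∀ j₁ j₂, j₁ + j₂ = n → ∃ s₁ ∈ E₁ (1 + j₁), ∃ s₂ ∈ E₂ j₂,
        s₁ + s₂ = s ∧ c₁ (1 + j₁) s₁ * c₂ j₂ s₂ ≤ c (1 + n) s :=
      fun m t ht j₁ j₂ hj => hE _ t ht _ _ (by omega)
    have hE'' : ∀ n, ∀ s ∈ E (1 + n), ∀ j₁ j₂, j₁ + j₂ = n → ∃ s₁ ∈ E₁ j₁, ∃ s₂ ∈ E₂ (1 + j₂),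
        s₁ + s₂ = s ∧ c₁ j₁ s₁ * c₂ (1 + j₂) s₂ ≤ c (1 + n) s :=
      fun m t ht j₁ j₂ hj => hE _ t ht _ _ (by omega)
    have hσ' : σ ∈ E (1 + len β) := by rwa [hβ, add_comm]
    have P1 := ih (E := fun j => E (1 + j)) hfdE hgE hfd hg (fun j => hE1 _) hE2 (fun j => hD1 _)
      hD2 (fun j s => hc1 _ _) hc2 (fun j s => hb1 _ _) (c := fun j => c (1 + j))
      hE' s B ⟨σ, by rwa [hβ] at hσ'⟩ (by
        intro j₁ j₂ hj
        exact hsp (1 + j₁) j₂ (by omega)) β hβ hs2 hB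
    have hm1 := (hfdE.mul hgE (fun j => hE1 _) hE2 (fun j s => hc1 _ _) hc2
      (D := fun j => E (1 + j)) (b := fun j => c (1 + j)) hE' β σ hσ').1
    have hm2 := (hfE.mul hgdE hE1 (fun j => hE2 _) hc1 (fun j s => hc2 _ _)
      (D := fun j => E (1 + j)) (b := fun j => c (1 + j)) hE'' β σ hσ').1
    obtain ⟨q, hq, hqb⟩ := mul_aux n (D := fun _ => {s}) (b := fun _ _ => B) hf hgd hD1
      (fun j => hD2 _) hb1 s rfl (by
        intro j₁ j₂ hj
        rw [add_comm 1 j₂]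
        exact hsp j₁ j₂ (by omega)) β hβ hs2 hB
    have hfull := hprod.trans (hm1.add hm2)
    rw [add_comm (single i 1)] at hfull
    have hfd2 := hf1.trans (hfE.deriv hf1 β _ (by simpa [hβ, add_comm] using h1n)).1
    rw [add_comm (single i 1)] at hfd2
    refine ((P1.add (hqb.congr (hq.unique hm2)) hs2 (by positivity) (by positivity)).mono
      (le_of_eq (by rw [pow_succ]; ring))).congr ?_
    filter_upwards [hfull.ae_eq, hfd2.ae_eq] with x h1 h2
    rw [h1, h2]
    simp only [Pi.add_apply]
    ring

end JB

end

section

variable {N : ℕ} {ι : Type*}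

/-- The exponents of a function of weight `d`: a derivative of total weight `c = d + j ≤ K` is
measured in `L^{2/s}` with `c / K ≤ s ≤ 1`, and in `L^∞` when `c = 0`. -/
def DT (K d j : ℕ) : Set ℝ :=
  {s | d + j ≤ K ∧ ((d + j : ℕ) : ℝ) ≤ K * s ∧ s ≤ 1 ∧ (d + j = 0 → s = 0)}

lemma DT_subset (K d j : ℕ) : DT K d j ⊆ Icc 0 1 := by
  rintro s ⟨h1, h2, h3, h4⟩
  refine ⟨?_, h3⟩
  by_contra! hs
  rcases eq_zero_or_pos (d + j) with h0 | h0
  · linarith [h4 h0]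
  · have hK : (0 : ℝ) < K := by exact_mod_cast h0.trans_le h1
    have : (0 : ℝ) < (d + j : ℕ) := by exact_mod_cast h0
    nlinarith

lemma DT_add (K d i j : ℕ) : DT K d (i + j) = DT K (d + i) j := by
  simp only [DT, add_assoc]

lemma one_mem_DT {K d j : ℕ} (h : d + j ≤ K) (h1 : 1 ≤ d + j) : (1 : ℝ) ∈ DT K d j :=
  ⟨h, by rw [mul_one]; exact_mod_cast h, le_rfl, fun h => by omega⟩

lemma DT_split {K d₁ d₂ n : ℕ} {s : ℝ} (hs : s ∈ DT K (d₁ + d₂) n) {j₁ j₂ : ℕ}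
    (hj : j₁ + j₂ = n) : ∃ s₁ ∈ DT K d₁ j₁, ∃ s₂ ∈ DT K d₂ j₂, s₁ + s₂ = s := by
  have hs01 := DT_subset _ _ _ hs
  obtain ⟨h1, h2, h3, h4⟩ := hs
  rcases eq_zero_or_pos (d₁ + d₂ + n) with h0 | h0
  · refine ⟨0, ⟨by omega, ?_, zero_le_one, fun _ => rfl⟩, 0,
      ⟨by omega, ?_, zero_le_one, fun _ => rfl⟩, by rw [h4 h0, add_zero]⟩
    · rw [show d₁ + j₁ = 0 by omega]; simp
    · rw [show d₂ + j₂ = 0 by omega]; simp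
  · set c : ℝ := ((d₁ + d₂ + n : ℕ) : ℝ) with hc
    have hc0 : 0 < c := by rw [hc]; exact_mod_cast h0
    have key : ∀ a : ℕ, a ≤ d₁ + d₂ + n → (a : ℝ) ≤ K * (s * (a / c)) ∧ s * (a / c) ≤ 1 := by
      intro a ha
      have ha' : (a : ℝ) ≤ c := by rw [hc]; exact_mod_cast ha
      have hr : (a : ℝ) / c ≤ 1 := (div_le_one hc0).2 ha'
      have hr0 : 0 ≤ (a : ℝ) / c := by positivity
      refine ⟨?_, by nlinarith [hs01.1]⟩
      calc (a : ℝ) = c * (a / c) := by field_simp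
        _ ≤ (K * s) * (a / c) := mul_le_mul_of_nonneg_right h2 hr0
        _ = _ := by ring
    refine ⟨s * ((d₁ + j₁ : ℕ) / c), ⟨by omega, (key _ (by omega)).1, (key _ (by omega)).2, ?_⟩,
      s * ((d₂ + j₂ : ℕ) / c), ⟨by omega, (key _ (by omega)).1, (key _ (by omega)).2, ?_⟩, ?_⟩
    · intro h; simp [h]
    · intro h; simp [h]
    · have : ((d₁ + j₁ : ℕ) : ℝ) + (d₂ + j₂ : ℕ) = c := by
        rw [hc, ← hj]; push_cast; ring
      rw [← mul_add, ← add_div, this, div_self hc0.ne', mul_one]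

lemma JB.mul_DT {K d₁ d₂ : ℕ} {A C₁ C₂ : ℝ} {f g : X N → ℝ} (hA : 0 < A) (h1 : 0 ≤ C₁)
    (h2 : 0 ≤ C₂)
    (hf : JB (DT K d₁) (fun _ s => C₁ * A ^ s) f) (hg : JB (DT K d₂) (fun _ s => C₂ * A ^ s) g) :
    JB (DT K (d₁ + d₂)) (fun _ s => 2 ^ K * (C₁ * C₂) * A ^ s) (fun x => f x * g x) := by
  refine (hf.mul hg (D := DT K (d₁ + d₂)) (b := fun _ s => (C₁ * C₂) * A ^ s) (DT_subset _ _)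
    (DT_subset _ _)
    (fun _ _ => by positivity) (fun _ _ => by positivity) ?_).mono fun j s hs => ⟨hs, ?_⟩
  · intro n s hs j₁ j₂ hj
    obtain ⟨s₁, h1, s₂, h2, rfl⟩ := DT_split hs hj
    exact ⟨s₁, h1, s₂, h2, rfl, le_of_eq (by rw [rpow_add hA]; ring)⟩
  · rw [mul_assoc (2 ^ K)]
    refine mul_le_mul_of_nonneg_right (pow_le_pow_right₀ (by norm_num) ?_) (by positivity)
    have := hs.1
    omega

/-- Families of functions of weight `d`, of size `B`, with jets bounded in terms of `A`. -/
def UT (K d : ℕ) (A B : ι → ℝ) (f : ι → X N → ℝ) : Prop :=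
  ∃ C : ℝ, 0 ≤ C ∧ ∀ i, JB (DT K d) (fun _ s => C * B i * A i ^ s) (f i)

namespace UT

variable {K d d₁ d₂ : ℕ} {A B B₁ B₂ : ι → ℝ} {f g : ι → X N → ℝ}

lemma congr (hf : UT K d A B f) (h : ∀ i, f i =ᵐ[volume] g i) : UT K d A B g := by
  obtain ⟨C, hC, h1⟩ := hf
  exact ⟨C, hC, fun i => (h1 i).congr (h i)⟩

lemma mul (hA : ∀ i, 0 < A i) (hB₁ : ∀ i, 0 ≤ B₁ i) (hB₂ : ∀ i, 0 ≤ B₂ i) (hf : UT K d₁ A B₁ f)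
    (hg : UT K d₂ A B₂ g) : UT K (d₁ + d₂) A (fun i => B₁ i * B₂ i) (fun i x => f i x * g i x) := by
  obtain ⟨C₁, h1, hf⟩ := hf
  obtain ⟨C₂, h2, hg⟩ := hg
  refine ⟨2 ^ K * (C₁ * C₂), by positivity, fun i => ?_⟩
  refine (JB.mul_DT (hA i) (mul_nonneg h1 (hB₁ i)) (mul_nonneg h2 (hB₂ i)) (hf i) (hg i)).mono
    fun j s hs => ⟨hs, le_of_eq (by ring)⟩

lemma add (hA : ∀ i, 0 < A i) (hB : ∀ i, 0 ≤ B i) (hf : UT K d A B f) (hg : UT K d A B g) :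
    UT K d A B (fun i x => f i x + g i x) := by
  obtain ⟨C₁, h1, hf⟩ := hf
  obtain ⟨C₂, h2, hg⟩ := hg
  refine ⟨C₁ + C₂, by positivity, fun i => ((hf i).add (hg i) (DT_subset _ _) ?_ ?_).mono
    fun j s hs => ⟨hs, le_of_eq (by ring)⟩⟩
  all_goals
    intro _ s
    have := rpow_pos_of_pos (hA i) s
    have := hB i
    positivity

lemma const_mul (hf : UT K d A B f) (c : ℝ) : UT K d A B (fun i x => c * f i x) := by
  obtain ⟨C₁, h1, hf⟩ := hf
  exact ⟨|c| * C₁, by positivity, fun i => ((hf i).const_mul (DT_subset _ _) c).mono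
    fun j s hs => ⟨hs, le_of_eq (by ring)⟩⟩

lemma neg (hf : UT K d A B f) : UT K d A B (fun i x => -f i x) := by
  obtain ⟨C, h1, hf⟩ := hf
  exact ⟨C, h1, fun i => (hf i).neg⟩

lemma sub (hA : ∀ i, 0 < A i) (hB : ∀ i, 0 ≤ B i) (hf : UT K d A B f) (hg : UT K d A B g) :
    UT K d A B (fun i x => f i x - g i x) := by
  simpa only [sub_eq_add_neg] using hf.add hA hB hg.neg

lemma sum {σ : Type*} (hA : ∀ i, 0 < A i) (hB : ∀ i, 0 ≤ B i) (t : Finset σ)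
    {f : σ → ι → X N → ℝ} (hne : t.Nonempty) (h : ∀ a ∈ t, UT K d A B (f a)) :
    UT K d A B (fun i x => ∑ a ∈ t, f a i x) := by
  classical
  induction hne using Finset.Nonempty.cons_induction with
  | singleton a => simpa using h a (by simp)
  | cons a t ha ht ih =>
    simp only [sum_cons]
    exact (h a (by simp)).add hA hB (ih fun b hb => h b (by simp [hb]))

lemma deriv (hf : UT K d A B f) (γ : Fin N → ℕ) :
    UT K (d + len γ) A B (fun i => weakDeriv γ (f i)) := by
  obtain ⟨C, h1, hf⟩ := hf
  refine ⟨C, h1, fun i => ?_⟩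
  rcases Nat.lt_or_ge K (d + len γ) with hK | hK
  · exact JB.intro fun α s hs => absurd hs.1 (by omega)
  rcases eq_zero_or_pos (d + len γ) with h0 | h0
  · have hγ := hf i γ 0 ⟨hK, by rw [h0]; simp, zero_le_one, fun _ => rfl⟩
    simpa only [DT_add] using (hf i).deriv hγ.1
  · have hγ := hf i γ 1 (one_mem_DT hK h0)
    simpa only [DT_add] using (hf i).deriv hγ.1

lemma bd_one (hf : UT K d A B f) {r : ℕ} (h1 : 1 ≤ d + r) (hK : d + r ≤ K) :
    ∃ C : ℝ, 0 ≤ C ∧ ∀ i (α : Fin N → ℕ), len α = r →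
      IsWeakDeriv α (f i) (weakDeriv α (f i)) ∧ Bd 1 (weakDeriv α (f i)) (C * B i * A i) := by
  obtain ⟨C, h0, hf⟩ := hf
  refine ⟨C, h0, fun i α hα => ?_⟩
  have := hf i α 1 (one_mem_DT (by omega) (by omega))
  simpa using this

end UT

/-- The exponents of a function of weight `d` with at least `r` differentiated factors. -/
def DM (l d r j : ℕ) : Set ℝ := {s | d + j ≤ l + r ∧ 0 ≤ s ∧ s ≤ 1 ∧
    ((d + j : ℕ) : ℝ) - ((max r (min (d + j) 1) : ℕ) : ℝ) ≤ l * s ∧ (l + 1) * s ≤ (d + j : ℕ)}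

lemma DM_subset (l d r j : ℕ) : DM l d r j ⊆ Icc 0 1 := fun _ hs => ⟨hs.2.1, hs.2.2.1⟩

lemma DM_add (l d r i j : ℕ) : DM l d r (i + j) = DM l (d + i) r j := by
  simp only [DM, add_assoc]

/-- The single exponent `c / l` of a function of weight `d`, for `c = d + j ≤ l`. -/
def DU (l d j : ℕ) : Set ℝ := {s | d + j ≤ l ∧ 0 ≤ s ∧ s ≤ 1 ∧ l * s = (d + j : ℕ)}

lemma DU_subset (l d j : ℕ) : DU l d j ⊆ Icc 0 1 := fun _ hs => ⟨hs.2.1, hs.2.2.1⟩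

lemma DU_add (l d i j : ℕ) : DU l d (i + j) = DU l (d + i) j := by
  simp only [DU, add_assoc]

lemma div_mem_DU {l d j : ℕ} (hl : 0 < l) (h : d + j ≤ l) : ((d + j : ℕ) : ℝ) / l ∈ DU l d j := by
  have hl' : (0 : ℝ) < l := by exact_mod_cast hl
  have h' : ((d + j : ℕ) : ℝ) ≤ l := by exact_mod_cast h
  exact ⟨h, by positivity, (div_le_one hl').2 h', by field_simp⟩

lemma exists_mem_DM {l d r j : ℕ} (hl : 0 < l) (hr : r ≤ d) (h : d + j ≤ l + r) :
    ((d + j : ℕ) : ℝ) - ((max r (min (d + j) 1) : ℕ) : ℝ) ≤ l * (((d + j : ℕ) : ℝ) / (l + 1)) ∧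
    0 ≤ ((d + j : ℕ) : ℝ) - ((max r (min (d + j) 1) : ℕ) : ℝ) ∧
    ((d + j : ℕ) : ℝ) - ((max r (min (d + j) 1) : ℕ) : ℝ) ≤ l := by
  have h3 : max r (min (d + j) 1) ≤ d + j := by omega
  have h3' : ((max r (min (d + j) 1) : ℕ) : ℝ) ≤ ((d + j : ℕ) : ℝ) := by exact_mod_cast h3
  have h1 : d + j ≤ l + max r (min (d + j) 1) := by omega
  have h1' : ((d + j : ℕ) : ℝ) ≤ l + ((max r (min (d + j) 1) : ℕ) : ℝ) := by exact_mod_cast h1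
  have h2 : d + j ≤ (l + 1) * max r (min (d + j) 1) := by
    rcases eq_zero_or_pos (d + j) with h0 | h0
    · rw [h0]; exact Nat.zero_le _
    · have hp : 1 ≤ max r (min (d + j) 1) := by omega
      nlinarith
  have h2' : ((d + j : ℕ) : ℝ) ≤ (l + 1) * ((max r (min (d + j) 1) : ℕ) : ℝ) := by
    exact_mod_cast h2
  refine ⟨?_, by linarith, by linarith⟩
  rw [mul_div_assoc', le_div_iff₀ (by positivity)]
  nlinarith

lemma DM_split {l d₁ r₁ d₂ r₂ n : ℕ} (hl : 0 < l) (h1 : r₁ ≤ d₁) (h2 : r₂ ≤ d₂) {s : ℝ}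
    (hs : s ∈ DM l (d₁ + d₂) (r₁ + r₂) n) {j₁ j₂ : ℕ} (hj : j₁ + j₂ = n) :
    ∃ s₁ ∈ DM l d₁ r₁ j₁, ∃ s₂ ∈ DM l d₂ r₂ j₂, s₁ + s₂ = s := by
  obtain ⟨hc, hs0, hs1, hlo, hhi⟩ := hs
  obtain ⟨p1, p2, -⟩ := exists_mem_DM hl h1 (show d₁ + j₁ ≤ l + r₁ by omega)
  obtain ⟨q1, q2, -⟩ := exists_mem_DM hl h2 (show d₂ + j₂ ≤ l + r₂ by omega)
  have hl' : (0 : ℝ) < l := by exact_mod_cast hl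
  have hsum : ((d₁ + d₂ + n : ℕ) : ℝ) = ((d₁ + j₁ : ℕ) : ℝ) + ((d₂ + j₂ : ℕ) : ℝ) := by
    rw [← hj]; push_cast; ring
  have hρ : ((max (r₁ + r₂) (min (d₁ + d₂ + n) 1) : ℕ) : ℝ) ≤
      ((max r₁ (min (d₁ + j₁) 1) : ℕ) : ℝ) + ((max r₂ (min (d₂ + j₂) 1) : ℕ) : ℝ) := by
    exact_mod_cast (by omega)
  rw [hsum] at hlo hhi
  set c₁ : ℝ := ((d₁ + j₁ : ℕ) : ℝ)
  set c₂ : ℝ := ((d₂ + j₂ : ℕ) : ℝ)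
  set ρ₁ : ℝ := ((max r₁ (min (d₁ + j₁) 1) : ℕ) : ℝ)
  set ρ₂ : ℝ := ((max r₂ (min (d₂ + j₂) 1) : ℕ) : ℝ)
  set e₁ := c₁ / ((l : ℝ) + 1)
  set e₂ := c₂ / ((l : ℝ) + 1)
  have he₁ : (l + 1) * e₁ = c₁ := by simp only [e₁]; field_simp
  have he₂ : (l + 1) * e₂ = c₂ := by simp only [e₂]; field_simp
  have hse : s ≤ e₁ + e₂ := by nlinarith
  set s₁ := max ((c₁ - ρ₁) / l) (s - e₂)
  have k1 : c₁ - ρ₁ ≤ l * s₁ := by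
    have : (c₁ - ρ₁) / l ≤ s₁ := le_max_left _ _
    rwa [div_le_iff₀ hl', mul_comm] at this
  have k2 : s₁ ≤ e₁ := max_le (by rw [div_le_iff₀ hl', mul_comm]; exact p1) (by linarith)
  have k3 : s - s₁ ≤ e₂ := by
    have : s - e₂ ≤ s₁ := le_max_right _ _
    linarith
  have k4 : c₂ - ρ₂ ≤ l * (s - s₁) := by
    have : s₁ ≤ s - (c₂ - ρ₂) / l := by
      refine max_le ?_ ?_
      · rw [le_sub_iff_add_le, ← add_div, div_le_iff₀ hl']
        linarith
      · have : (c₂ - ρ₂) / l ≤ e₂ := by rw [div_le_iff₀ hl', mul_comm]; exact q1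
        linarith
    have h := (div_le_iff₀ hl').1 (show (c₂ - ρ₂) / l ≤ s - s₁ by linarith)
    linarith
  have k5 : 0 ≤ s₁ := by nlinarith
  have k6 : 0 ≤ s - s₁ := by
    by_contra! hneg
    nlinarith
  exact ⟨s₁, ⟨by omega, k5, by linarith, k1, by nlinarith⟩, s - s₁,
    ⟨by omega, k6, by linarith, k4, by nlinarith⟩, by ring⟩

lemma DUM_split {l d₁ d₂ r n : ℕ} (hl : 0 < l) (hr : 1 ≤ r) (h2 : r ≤ d₂) {s : ℝ}
    (hs : s ∈ DM l (d₁ + d₂) r n) {j₁ j₂ : ℕ} (hj : j₁ + j₂ = n) :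
    ∃ s₁ ∈ DU l d₁ j₁, ∃ s₂ ∈ DM l d₂ r j₂, s₁ + s₂ = s := by
  obtain ⟨hc, hs0, hs1, hlo, hhi⟩ := hs
  have hl' : (0 : ℝ) < l := by exact_mod_cast hl
  have hsum : ((d₁ + d₂ + n : ℕ) : ℝ) = ((d₁ + j₁ : ℕ) : ℝ) + ((d₂ + j₂ : ℕ) : ℝ) := by
    rw [← hj]; push_cast; ring
  have e1 : max r (min (d₁ + d₂ + n) 1) = r := by omega
  have e2 : max r (min (d₂ + j₂) 1) = r := by omega
  have hm := div_mem_DU hl (show d₁ + j₁ ≤ l by omega)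
  have hr2 : (r : ℝ) ≤ ((d₂ + j₂ : ℕ) : ℝ) := by exact_mod_cast (by omega)
  have hc1 : (0 : ℝ) ≤ ((d₁ + j₁ : ℕ) : ℝ) := by positivity
  rw [e1, hsum] at hlo
  rw [hsum] at hhi
  have h1 := hm.2.2.2
  have h0 := hm.2.1
  set s₁ := ((d₁ + j₁ : ℕ) : ℝ) / l
  have hlo' : (r : ℝ) ≤ (d₂ + j₂ : ℕ) := hr2
  refine ⟨s₁, hm, s - s₁, ⟨by omega, ?_, by linarith, by rw [e2]; linarith, by nlinarith⟩, by ring⟩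
  by_contra! hneg
  nlinarith

/-- Families of functions of weight `d` with at least `r` differentiated factors. -/
def UM (l d r : ℕ) (A B : ι → ℝ) (f : ι → X N → ℝ) : Prop :=
  ∃ C : ℝ, 0 ≤ C ∧ ∀ i, JB (DM l d r) (fun j s => C * B i * A i ^ (((d + j : ℕ) : ℝ) - l * s)) (f i)

/-- Families of derivatives of order `d` of functions of size `B`. -/
def UU (l d : ℕ) (B : ι → ℝ) (f : ι → X N → ℝ) : Prop :=
  ∃ C : ℝ, 0 ≤ C ∧ ∀ i, JB (DU l d) (fun _ _ => C * B i) (f i)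

namespace UM

variable {l d d₁ d₂ r r₁ r₂ : ℕ} {A B B₁ B₂ : ι → ℝ} {f g : ι → X N → ℝ}

lemma congr (hf : UM l d r A B f) (h : ∀ i, f i =ᵐ[volume] g i) : UM l d r A B g := by
  obtain ⟨C, hC, h1⟩ := hf
  exact ⟨C, hC, fun i => (h1 i).congr (h i)⟩

lemma mul (hl : 0 < l) (h1 : r₁ ≤ d₁) (h2 : r₂ ≤ d₂) (hA : ∀ i, 0 < A i) (hB₁ : ∀ i, 0 ≤ B₁ i)
    (hB₂ : ∀ i, 0 ≤ B₂ i) (hf : UM l d₁ r₁ A B₁ f) (hg : UM l d₂ r₂ A B₂ g) :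
    UM l (d₁ + d₂) (r₁ + r₂) A (fun i => B₁ i * B₂ i) (fun i x => f i x * g i x) := by
  obtain ⟨C₁, hC1, hf⟩ := hf
  obtain ⟨C₂, hC2, hg⟩ := hg
  refine ⟨2 ^ (l + (r₁ + r₂)) * (C₁ * C₂), by positivity, fun i => ?_⟩
  have hAi := hA i
  have hBi := hB₁ i
  have hBi2 := hB₂ i
  refine ((hf i).mul (hg i) (D := DM l (d₁ + d₂) (r₁ + r₂))
    (b := fun j s => (C₁ * C₂) * (B₁ i * B₂ i) * A i ^ (((d₁ + d₂ + j : ℕ) : ℝ) - l * s))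
    (DM_subset _ _ _) (DM_subset _ _ _) (fun _ _ => by positivity) (fun _ _ => by positivity)
    ?_).mono fun j s hs => ⟨hs, ?_⟩
  · intro n s hs j₁ j₂ hj
    obtain ⟨s₁, h1, s₂, h2, rfl⟩ := DM_split hl h1 h2 hs hj
    refine ⟨s₁, h1, s₂, h2, rfl, le_of_eq ?_⟩
    have e : ((d₁ + d₂ + n : ℕ) : ℝ) - l * (s₁ + s₂) =
        (((d₁ + j₁ : ℕ) : ℝ) - l * s₁) + (((d₂ + j₂ : ℕ) : ℝ) - l * s₂) := by
      rw [← hj]; push_cast; ring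
    rw [e, rpow_add hAi]
    ring
  · rw [mul_assoc (2 ^ _), mul_assoc (2 ^ _)]
    refine mul_le_mul_of_nonneg_right (pow_le_pow_right₀ (by norm_num) ?_) (by positivity)
    have := hs.1
    omega

lemma add (hA : ∀ i, 0 < A i) (hB : ∀ i, 0 ≤ B i) (hf : UM l d r A B f) (hg : UM l d r A B g) :
    UM l d r A B (fun i x => f i x + g i x) := by
  obtain ⟨C₁, h1, hf⟩ := hf
  obtain ⟨C₂, h2, hg⟩ := hg
  refine ⟨C₁ + C₂, by positivity, fun i => ((hf i).add (hg i) (DM_subset _ _ _) ?_ ?_).mono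
    fun j s hs => ⟨hs, le_of_eq (by ring)⟩⟩
  all_goals
    intro _ s
    have := hA i
    have := hB i
    positivity

lemma const_mul (hf : UM l d r A B f) (c : ℝ) : UM l d r A B (fun i x => c * f i x) := by
  obtain ⟨C₁, h1, hf⟩ := hf
  exact ⟨|c| * C₁, by positivity, fun i => ((hf i).const_mul (DM_subset _ _ _) c).mono
    fun j s hs => ⟨hs, le_of_eq (by ring)⟩⟩

lemma neg (hf : UM l d r A B f) : UM l d r A B (fun i x => -f i x) := by
  obtain ⟨C, h1, hf⟩ := hf
  exact ⟨C, h1, fun i => (hf i).neg⟩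

lemma sub (hA : ∀ i, 0 < A i) (hB : ∀ i, 0 ≤ B i) (hf : UM l d r A B f) (hg : UM l d r A B g) :
    UM l d r A B (fun i x => f i x - g i x) := by
  simpa only [sub_eq_add_neg] using hf.add hA hB hg.neg

lemma sum {σ : Type*} (hA : ∀ i, 0 < A i) (hB : ∀ i, 0 ≤ B i) (t : Finset σ)
    {f : σ → ι → X N → ℝ} (hne : t.Nonempty) (h : ∀ a ∈ t, UM l d r A B (f a)) :
    UM l d r A B (fun i x => ∑ a ∈ t, f a i x) := by
  classical
  induction hne using Finset.Nonempty.cons_induction with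
  | singleton a => simpa using h a (by simp)
  | cons a t ha ht ih =>
    simp only [sum_cons]
    exact (h a (by simp)).add hA hB (ih fun b hb => h b (by simp [hb]))

lemma deriv (hl : 0 < l) (hr : r ≤ d) (hf : UM l d r A B f) (γ : Fin N → ℕ) :
    UM l (d + len γ) r A B (fun i => weakDeriv γ (f i)) := by
  obtain ⟨C, h1, hf⟩ := hf
  refine ⟨C, h1, fun i => ?_⟩
  rcases Nat.lt_or_ge (l + r) (d + len γ) with hK | hK
  · exact JB.intro fun α s hs => absurd hs.1 (by omega)
  have hl' : (0 : ℝ) < l := by exact_mod_cast hl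
  obtain ⟨p1, p2, p3⟩ := exists_mem_DM hl hr hK
  have hγ := hf i γ ((((d + len γ : ℕ) : ℝ) - ((max r (min (d + len γ) 1) : ℕ) : ℝ)) / l) ⟨hK,
    div_nonneg p2 hl'.le, (div_le_one hl').2 p3, by rw [mul_div_cancel₀ _ hl'.ne'], ?_⟩
  · have h := (hf i).deriv hγ.1
    simp only [DM_add, ← add_assoc] at h
    exact h
  · rw [mul_div_assoc', div_le_iff₀ hl']
    rw [mul_div_assoc', le_div_iff₀ (by positivity)] at p1
    linarith

lemma bd_one (hf : UM l d r A B f) (hr1 : 1 ≤ r) {j : ℕ} (hc : d + j = l + r) :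
    ∃ C : ℝ, 0 ≤ C ∧ ∀ i (α : Fin N → ℕ), len α = j →
      IsWeakDeriv α (f i) (weakDeriv α (f i)) ∧ Bd 1 (weakDeriv α (f i)) (C * B i * A i ^ r) := by
  obtain ⟨C, h0, hf⟩ := hf
  refine ⟨C, h0, fun i α hα => ?_⟩
  have hm : (1 : ℝ) ∈ DM l d r (len α) := by
    rw [hα]
    refine ⟨hc.le, zero_le_one, le_rfl, ?_, ?_⟩
    · have : max r (min (d + j) 1) = r := by omega
      rw [this, hc]; push_cast; linarith
    · rw [hc, mul_one]; exact_mod_cast (by omega)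
  have h := hf i α 1 hm
  rw [hα] at h
  simp only [hc] at h
  have e : (((l + r : ℕ) : ℝ) - l * 1) = r := by push_cast; ring
  simpa only [e, rpow_natCast] using h

end UM

namespace UU

variable {l d d₁ d₂ r : ℕ} {A B B₁ B₂ : ι → ℝ} {f g : ι → X N → ℝ}

lemma deriv (hl : 0 < l) (hf : UU l d B f) (γ : Fin N → ℕ) :
    UU l (d + len γ) B (fun i => weakDeriv γ (f i)) := by
  obtain ⟨C, h1, hf⟩ := hf
  refine ⟨C, h1, fun i => ?_⟩
  rcases Nat.lt_or_ge l (d + len γ) with hK | hK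
  · exact JB.intro fun α s hs => absurd hs.1 (by omega)
  simpa only [DU_add] using (hf i).deriv (hf i γ _ (div_mem_DU hl hK)).1

lemma mul (hl : 0 < l) (hr : 1 ≤ r) (h2 : r ≤ d₂) (hA : ∀ i, 0 < A i) (hB₁ : ∀ i, 0 ≤ B₁ i)
    (hB₂ : ∀ i, 0 ≤ B₂ i) (hf : UU l d₁ B₁ f) (hg : UM l d₂ r A B₂ g) :
    UM l (d₁ + d₂) r A (fun i => B₁ i * B₂ i) (fun i x => f i x * g i x) := by
  obtain ⟨C₁, hC1, hf⟩ := hf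
  obtain ⟨C₂, hC2, hg⟩ := hg
  refine ⟨2 ^ (l + r) * (C₁ * C₂), by positivity, fun i => ?_⟩
  have hAi := hA i
  have hBi := hB₁ i
  have hBi2 := hB₂ i
  refine ((hf i).mul (hg i) (D := DM l (d₁ + d₂) r)
    (b := fun j s => (C₁ * C₂) * (B₁ i * B₂ i) * A i ^ (((d₁ + d₂ + j : ℕ) : ℝ) - l * s))
    (DU_subset _ _) (DM_subset _ _ _) (fun _ _ => by positivity) (fun _ _ => by positivity)
    ?_).mono fun j s hs => ⟨hs, ?_⟩
  · intro n s hs j₁ j₂ hj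
    obtain ⟨s₁, h1, s₂, h2, rfl⟩ := DUM_split hl hr h2 hs hj
    refine ⟨s₁, h1, s₂, h2, rfl, le_of_eq ?_⟩
    have e : ((d₁ + d₂ + n : ℕ) : ℝ) - l * (s₁ + s₂) = ((d₂ + j₂ : ℕ) : ℝ) - l * s₂ := by
      rw [mul_add, h1.2.2.2, ← hj]; push_cast; ring
    rw [e]
    ring
  · rw [mul_assoc (2 ^ _), mul_assoc (2 ^ _)]
    refine mul_le_mul_of_nonneg_right (pow_le_pow_right₀ (by norm_num) ?_) (by positivity)
    have := hs.1
    omega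

end UU

end

section

variable {N : ℕ} {ι : Type*}

lemma one_mem_DM {l d r j : ℕ} (hr : 1 ≤ r) (hc : d + j = l + r) : (1 : ℝ) ∈ DM l d r j := by
  refine ⟨hc.le, zero_le_one, le_rfl, ?_, ?_⟩
  · have : max r (min (d + j) 1) = r := by omega
    rw [this, hc]; push_cast; linarith
  · rw [hc, mul_one]; exact_mod_cast (by omega)

lemma DM_one_mem {l j : ℕ} {s : ℝ} (hj : j + 1 ≤ l) (hs : s ∈ DM l 1 1 j) :
    s ∈ DM l 0 0 (j + 1) := by
  obtain ⟨h1, h2, h3, h4, h5⟩ := hs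
  have e1 : max 1 (min (1 + j) 1) = 1 := by omega
  have e2 : max 0 (min (0 + (j + 1)) 1) = 1 := by omega
  rw [e1] at h4
  refine ⟨by omega, h2, h3, ?_, ?_⟩
  · rw [e2, show 0 + (j + 1) = 1 + j by omega]; exact h4
  · rw [show 0 + (j + 1) = 1 + j by omega]; exact h5

lemma UM.comm {l d r K j : ℕ} {A A' B B' : ι → ℝ} {f g : ι → X N → ℝ} (hl : 0 < l) (hr1 : 1 ≤ r)
    (hr : r + 1 ≤ d) (hc : d + j = l + r + 1) (hK : d + j ≤ K)
    (hA : ∀ i, 0 < A i) (hB : ∀ i, 0 ≤ B i)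
    (hA' : ∀ i, 0 < A' i) (hB' : ∀ i, 0 ≤ B' i)
    (hf : UM l d r A B f) (hg : UM l 0 0 A (fun _ => 1) g) (hf' : UT K d A' B' f)
    (hg' : UT K 0 A' B' g) : ∃ C : ℝ, 0 ≤ C ∧ ∀ i (α : Fin N → ℕ), len α = j →
      Bd 1 (fun x => weakDeriv α (fun y => f i y * g i y) x - g i x * weakDeriv α (f i) x)
        (C * B i * A i ^ (r + 1)) := by
  obtain ⟨C₁, h1, hf⟩ := hf
  obtain ⟨C₂, h2, hg⟩ := hg
  obtain ⟨c₁, k1, hf'⟩ := hf'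
  obtain ⟨c₂, k2, hg'⟩ := hg'
  refine ⟨2 ^ j * (C₁ * C₂), by positivity, fun i α hα => ?_⟩
  have hAi := hA i
  have hBi := hB i
  have hAi' := hA' i
  have hBi' := hB' i
  have := JB.comm_aux j (E := DT K d) (c := fun _ s => (c₁ * B' i) * (c₂ * B' i) * A' i ^ s)
    (hf' i) (hg' i) (hf i) (hg i) (DT_subset _ _) (DT_subset _ _) (DM_subset _ _ _)
    (DM_subset _ _ _) (fun _ _ => by positivity) (fun _ _ => by positivity)
    (fun _ _ => by positivity)
    (fun n s hs j₁ j₂ hj => by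
      obtain ⟨s₁, h1, s₂, h2, rfl⟩ := DT_split (d₁ := d) (d₂ := 0) hs hj
      exact ⟨s₁, h1, s₂, h2, rfl, le_of_eq (by rw [rpow_add hAi']; ring)⟩)
    1 (C₁ * C₂ * B i * A i ^ (r + 1)) ⟨1, one_mem_DT hK (by omega)⟩ (by
      intro j₁ j₂ hj
      have hm : (1 : ℝ) ∈ DM l (d + 1) (r + 1) (j₁ + j₂) := one_mem_DM (by omega) (by omega)
      obtain ⟨s₁, h1, s₂, h2, hs⟩ := DM_split hl (by omega) le_rfl hm rfl
      refine ⟨s₁, h1, s₂, DM_one_mem (by omega) h2, hs, le_of_eq ?_⟩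
      have e : (((d + j₁ : ℕ) : ℝ) - l * s₁) + (((0 + (j₂ + 1) : ℕ) : ℝ) - l * s₂) =
          ((r + 1 : ℕ) : ℝ) := by
        have : ((d + j₁ : ℕ) : ℝ) + ((0 + (j₂ + 1) : ℕ) : ℝ) = l + ((r + 1 : ℕ) : ℝ) := by
          exact_mod_cast (by omega)
        have h3 : (l : ℝ) * s₁ + l * s₂ = l := by rw [← mul_add, hs, mul_one]
        linarith
      rw [← rpow_natCast, ← e, rpow_add hAi]
      ring) α hα (by norm_num) (by positivity)
  exact this.mono (le_of_eq (by ring))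

lemma UU.comm {l d K j : ℕ} {A A' B B' : ι → ℝ} {f g : ι → X N → ℝ} (hl : 0 < l)
    (hr : 1 ≤ d) (hc : d + j = l + 1) (hK : d + j ≤ K)
    (hA : ∀ i, 0 < A i) (hB : ∀ i, 0 ≤ B i)
    (hA' : ∀ i, 0 < A' i) (hB' : ∀ i, 0 ≤ B' i)
    (hf : UU l d B f) (hg : UM l 0 0 A (fun _ => 1) g) (hf' : UT K d A' B' f)
    (hg' : UT K 0 A' B' g) : ∃ C : ℝ, 0 ≤ C ∧ ∀ i (α : Fin N → ℕ), len α = j →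
      Bd 1 (fun x => weakDeriv α (fun y => f i y * g i y) x - g i x * weakDeriv α (f i) x)
        (C * B i * A i) := by
  obtain ⟨C₁, h1, hf⟩ := hf
  obtain ⟨C₂, h2, hg⟩ := hg
  obtain ⟨c₁, k1, hf'⟩ := hf'
  obtain ⟨c₂, k2, hg'⟩ := hg'
  refine ⟨2 ^ j * (C₁ * C₂), by positivity, fun i α hα => ?_⟩
  have hAi := hA i
  have hBi := hB i
  have hAi' := hA' i
  have hBi' := hB' i
  have := JB.comm_aux j (E := DT K d) (c := fun _ s => (c₁ * B' i) * (c₂ * B' i) * A' i ^ s)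
    (hf' i) (hg' i) (hf i) (hg i) (DT_subset _ _) (DT_subset _ _) (DU_subset _ _)
    (DM_subset _ _ _) (fun _ _ => by positivity) (fun _ _ => by positivity)
    (fun _ _ => by positivity)
    (fun n s hs j₁ j₂ hj => by
      obtain ⟨s₁, h1, s₂, h2, rfl⟩ := DT_split (d₁ := d) (d₂ := 0) hs hj
      exact ⟨s₁, h1, s₂, h2, rfl, le_of_eq (by rw [rpow_add hAi']; ring)⟩)
    1 (C₁ * C₂ * B i * A i) ⟨1, one_mem_DT hK (by omega)⟩ (by
      intro j₁ j₂ hj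
      have hm : (1 : ℝ) ∈ DM l (d + 1) 1 (j₁ + j₂) := one_mem_DM le_rfl (by omega)
      obtain ⟨s₁, h1, s₂, h2, hs⟩ := DUM_split hl le_rfl le_rfl hm rfl
      refine ⟨s₁, h1, s₂, DM_one_mem (by omega) h2, hs, le_of_eq ?_⟩
      have e : (((0 + (j₂ + 1) : ℕ) : ℝ) - l * s₂) = 1 := by
        have h4 : ((d + j₁ : ℕ) : ℝ) + ((0 + (j₂ + 1) : ℕ) : ℝ) = l + 1 := by
          exact_mod_cast (by omega)
        have h3 : (l : ℝ) * s₁ + l * s₂ = l := by rw [← mul_add, hs, mul_one]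
        have := h1.2.2.2
        linarith
      rw [e, rpow_one]
      ring) α hα (by norm_num) (by positivity)
  exact this.mono (le_of_eq (by ring))

lemma gnConst_pos {n : ℕ} (hn : 0 < n) : (1 : ℝ) ≤ (2 * n) ^ (n ^ 2) := by
  have : (1 : ℝ) ≤ n := by exact_mod_cast hn
  exact one_le_pow₀ (by linarith)

lemma Bd.interp_const {s t θ C A p q : ℝ} {f : X N → ℝ} (hC : 0 < C) (hA : 0 < A)
    (hf : Bd s f (C * A ^ p)) (hg : Bd t f (C * A ^ q)) (hs : 0 ≤ s) (ht : 0 ≤ t)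
    (h0 : 0 ≤ θ) (h1 : θ ≤ 1) : Bd ((1 - θ) * s + θ * t) f (C * A ^ ((1 - θ) * p + θ * q)) := by
  refine (hf.interp hg hs ht (by positivity) (by positivity) h0 h1).mono (le_of_eq ?_)
  rw [mul_rpow hC.le (by positivity), mul_rpow hC.le (by positivity),
    ← rpow_mul hA.le, ← rpow_mul hA.le, rpow_add hA, mul_comm p, mul_comm q]
  have : C ^ (1 - θ) * C ^ θ = C := by rw [← rpow_add hC]; simp
  calc _ = (C ^ (1 - θ) * C ^ θ) * (A ^ ((1 - θ) * p) * A ^ (θ * q)) := by ring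
    _ = _ := by rw [this]

lemma UT.base {K : ℕ} {A B : ι → ℝ} {f : ι → X N → ℝ} (hA : ∀ i, 1 ≤ A i) (hB : ∀ i, 0 ≤ B i)
    (hW : ∀ i, W K (f i)) (h0 : ∀ i, Bd 0 (f i) (B i))
    (h1 : ∀ i (α : Fin N → ℕ), 1 ≤ len α → len α ≤ K → Bd 1 (weakDeriv α (f i)) (B i * A i)) :
    UT K 0 A B f := by
  refine ⟨(2 * K) ^ (K ^ 2) + 1, by positivity, fun i α s hs => ?_⟩
  have hA0 : 0 < A i := zero_lt_one.trans_le (hA i)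
  obtain ⟨hc, hlo, hs1, hz⟩ := hs
  simp only [zero_add] at hc hlo hz
  refine ⟨(hW i).isWeak hc, ?_⟩
  rcases eq_zero_or_pos (len α) with hα | hα
  · obtain rfl := eq_zero_of_len hα
    rw [hz hα]
    simp only [Real.rpow_zero, mul_one]
    refine ((h0 i).congr (hW i).weakDeriv_zero_ae.symm).mono ?_
    refine le_mul_of_one_le_left (hB i) ?_
    have : (0 : ℝ) ≤ (2 * K) ^ (K ^ 2) := by positivity
    linarith
  have hK : 0 < K := hα.trans_le hc
  have hK' : (0 : ℝ) < K := by exact_mod_cast hK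
  have hC := gnConst_pos hK
  set C : ℝ := (2 * K) ^ (K ^ 2)
  suffices Bd s (weakDeriv α (f i)) (C * B i * A i ^ s) from
    this.mono (by
      have h2 := rpow_pos_of_pos hA0 s
      exact mul_le_mul_of_nonneg_right (mul_le_mul_of_nonneg_right (by linarith) (hB i)) h2.le)
  refine Bd.of_forall_gt fun B' hB' => ?_
  have hAs := rpow_pos_of_pos hA0 s
  set b := B' / (C * A i ^ s)
  have hb : B i < b := by rw [lt_div_iff₀ (by positivity)]; linarith
  have hb0 : 0 < b := (hB i).trans_lt hb
  have e : B' = C * b * A i ^ s := by simp only [b]; field_simp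
  have hg := (hW i).gn hK hb0 (mul_pos hb0 hA0) ((h0 i).mono hb.le)
    (fun β hβ => (h1 i β (by omega) hβ.le).mono (by gcongr)) hc
  have hc' : (len α : ℝ) ≤ K := by exact_mod_cast hc
  have hg1 : Bd (len α / K) (weakDeriv α (f i)) (C * b * A i ^ ((len α : ℝ) / K)) := by
    refine hg.mono (le_of_eq ?_)
    rw [mul_rpow hb0.le hA0.le, ← mul_assoc (b ^ _), ← rpow_add hb0]
    simp [C, mul_assoc]
  have hg2 : Bd 1 (weakDeriv α (f i)) (C * b * A i ^ (1 : ℝ)) := by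
    refine (h1 i α hα hc).mono ?_
    rw [rpow_one]
    have : B i ≤ C * b := hb.le.trans (le_mul_of_one_le_left hb0.le hC)
    gcongr
  have hs' : (len α : ℝ) / K ≤ s := by rw [div_le_iff₀ hK']; linarith
  rcases hs'.eq_or_lt with he | hlt
  · rw [e, ← he]; exact hg1
  have h1' : (len α : ℝ) / K < 1 := hlt.trans_le hs1
  set s₁ := (len α : ℝ) / K
  have hd : 0 < 1 - s₁ := by linarith
  have := hg1.interp_const (θ := (s - s₁) / (1 - s₁)) (by positivity) hA0 hg2 (by positivity)
    zero_le_one (div_nonneg (by linarith) hd.le) ((div_le_one hd).2 (by linarith))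
  have e2 : (1 - (s - s₁) / (1 - s₁)) * s₁ + (s - s₁) / (1 - s₁) * 1 = s := by
    field_simp; ring
  rw [e2] at this
  rwa [e]

lemma UU.base {l : ℕ} {B : ι → ℝ} {f : ι → X N → ℝ} (hl : 0 < l) (hB : ∀ i, 0 ≤ B i)
    (hW : ∀ i, W l (f i)) (h0 : ∀ i, Bd 0 (f i) (B i))
    (h1 : ∀ i (α : Fin N → ℕ), 1 ≤ len α → len α ≤ l → Bd 1 (weakDeriv α (f i)) (B i)) :
    UU l 0 B f := by
  obtain ⟨C, hC, h⟩ := UT.base (K := l) (A := fun _ => 1) (fun _ => le_rfl) hB hW h0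
    (fun i α ha hb => by simpa using h1 i α ha hb)
  refine ⟨C, hC, fun i => (h i).mono fun j s hs => ⟨⟨hs.1, hs.2.2.2.ge, hs.2.2.1, fun h0 => ?_⟩,
    by simp⟩⟩
  have hl' : (0 : ℝ) < l := by exact_mod_cast hl
  have := hs.2.2.2
  rw [h0, Nat.cast_zero] at this
  exact (mul_eq_zero.1 this).resolve_left hl'.ne'

lemma W.weakDeriv_single {n : ℕ} {f : X N → ℝ} (h : W (n + 1) f) (i : Fin N)
    (hb : MemLp (weakDeriv (single i 1) f) ⊤) : W n (weakDeriv (single i 1) f) where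
  bdd := hb
  deriv α h1 h2 := by
    have hi := h.isWeak (α := single i 1) (by simp)
    have ha : len (single i 1 + α) ≤ n + 1 := by simp only [len_add, len_single]; omega
    exact ⟨_, hi.of_add (h.isWeak ha), h.memLp (by simp only [len_add, len_single]; omega) ha⟩

lemma bd_interval {l : ℕ} (hl : 0 < l) {A : ℝ} {f : X N → ℝ} (hA : 1 ≤ A) (hW : W (l + 1) f)
    (h0 : Bd 0 f 1) (h01 : ∀ j, Bd 0 (weakDeriv (single j 1) f) A)
    (h1 : ∀ α : Fin N → ℕ, 1 ≤ len α → len α ≤ l + 1 → Bd 1 (weakDeriv α f) A)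
    {α : Fin N → ℕ} (hα : 1 ≤ len α) (hα' : len α ≤ l + 1) {s : ℝ}
    (hs1 : (len α : ℝ) - 1 ≤ l * s) (hs2 : (l + 1) * s ≤ len α) : Bd s (weakDeriv α f)
      ((2 * ((l : ℝ) + 1)) ^ ((l + 1) ^ 2) * A ^ ((len α : ℝ) - l * s)) := by
  have hA0 : 0 < A := zero_lt_one.trans_le hA
  have hl' : (0 : ℝ) < l := by exact_mod_cast hl
  have hC := gnConst_pos (Nat.succ_pos l)
  push_cast [Nat.succ_eq_add_one] at hC
  set C : ℝ := (2 * ((l : ℝ) + 1)) ^ ((l + 1) ^ 2)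
  obtain ⟨β, j, rfl, hβ⟩ := exists_eq_add_single (show len α = (len α - 1) + 1 by omega)
  simp only [len_add, len_single, Nat.cast_add, Nat.cast_one, add_sub_cancel_right] at hs1 hs2 hα' ⊢
  have hj := hW.isWeak (α := single j 1) (by simp)
  have hw := hW.isWeak (α := β + single j 1) (by simpa using hα')
  have e : weakDeriv β (weakDeriv (single j 1) f) =ᵐ[volume] weakDeriv (β + single j 1) f := by
    rw [add_comm] at hw ⊢
    exact (hj.of_add hw).ae_eq
  have hWj : W l (weakDeriv (single j 1) f) :=
    hW.weakDeriv_single j (by have := (h01 j).memLp; rwa [ex_zero] at this)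
  have hβl : len β ≤ l := by omega
  have hb1 : Bd (len β / l) (weakDeriv (β + single j 1) f) (C * A ^ (1 : ℝ)) := by
    have hg := (hWj.gn hl hA0 hA0 (h01 j) (fun γ hγ => by
      have hg1 := h1 (single j 1 + γ) (by simp only [len_add, len_single]; omega)
        (by simp only [len_add, len_single]; omega)
      exact hg1.congr (hj.of_add (hW.isWeak (by simp only [len_add, len_single]; omega))).ae_eq.symm)
      hβl).congr e
    refine hg.mono ?_
    rw [← rpow_add hA0]
    simp only [sub_add_cancel, rpow_one]
    refine mul_le_mul_of_nonneg_right ?_ hA0.le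
    calc (2 * (l : ℝ)) ^ (l ^ 2) ≤ (2 * ((l : ℝ) + 1)) ^ (l ^ 2) := by gcongr; linarith
      _ ≤ C := pow_le_pow_right₀ (by linarith) (by nlinarith)
  have hb2 : Bd ((len β + 1) / (l + 1)) (weakDeriv (β + single j 1) f)
      (C * A ^ (((len β : ℝ) + 1) / (l + 1))) := by
    have hg := hW.gn (Nat.succ_pos l) one_pos hA0 h0 (fun γ hγ => h1 γ (by omega) hγ.le)
      (α := β + single j 1) (by simpa using hα')
    simp only [len_add, len_single, Nat.cast_add, Nat.cast_one, Real.one_rpow, one_mul] at hg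
    exact hg
  set s₁ : ℝ := len β / l with hs₁
  set s₂ : ℝ := ((len β : ℝ) + 1) / (l + 1) with hs₂
  have q1 : l * s₁ = len β := by simp only [s₁]; field_simp
  have q2 : (l + 1) * s₂ = len β + 1 := by simp only [s₂]; field_simp
  have k1 : s₁ ≤ s := by rw [hs₁, div_le_iff₀ hl']; linarith
  have k2 : s ≤ s₂ := by rw [hs₂, le_div_iff₀ (by positivity)]; linarith
  rcases (k1.trans k2).eq_or_lt with he | hlt
  · have es : s = s₁ := le_antisymm (k2.trans he.ge) k1
    rw [es]
    convert hb1 using 3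
    linarith
  have hd : 0 < s₂ - s₁ := by linarith
  have := hb1.interp_const (θ := (s - s₁) / (s₂ - s₁)) (by positivity) hA0 hb2 (by positivity)
    (by positivity) (div_nonneg (by linarith) hd.le) ((div_le_one hd).2 (by linarith))
  have e3 : (s - s₁) / (s₂ - s₁) * (s₂ - s₁) = s - s₁ := by field_simp
  set θ := (s - s₁) / (s₂ - s₁)
  have e4 : (1 - θ) * s₁ + θ * s₂ = s := by linarith
  have e5 : (1 - θ) * 1 + θ * s₂ = len β + 1 - l * s := by
    have : s₂ = len β + 1 - l * s₂ := by linarith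
    have h6 : (1 : ℝ) = len β + 1 - l * s₁ := by linarith
    calc (1 - θ) * 1 + θ * s₂ = (1 - θ) * (len β + 1 - l * s₁) + θ * (len β + 1 - l * s₂) := by
          rw [← this, ← h6]
      _ = len β + 1 - l * ((1 - θ) * s₁ + θ * s₂) := by ring
      _ = _ := by rw [e4]
  rwa [e4, e5] at this

lemma UM.base {l : ℕ} (hl : 0 < l) {A : ι → ℝ} {f : ι → X N → ℝ} (hA : ∀ i, 1 ≤ A i)
    (hW : ∀ i, W (l + 1) (f i)) (h0 : ∀ i, Bd 0 (f i) 1)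
    (h01 : ∀ i j, Bd 0 (weakDeriv (single j 1) (f i)) (A i))
    (h1 : ∀ i (α : Fin N → ℕ), 1 ≤ len α → len α ≤ l + 1 → Bd 1 (weakDeriv α (f i)) (A i)) :
    UM l 0 0 A (fun _ => 1) f := by
  refine ⟨(2 * ((l : ℝ) + 1)) ^ ((l + 1) ^ 2), by positivity, fun i α s hs => ?_⟩
  obtain ⟨hc, hs0, hs1, hlo, hhi⟩ := hs
  simp only [zero_add, add_zero, Nat.zero_max] at hc hlo hhi ⊢
  refine ⟨(hW i).isWeak (by omega), ?_⟩
  rcases eq_zero_or_pos (len α) with hα | hα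
  · obtain rfl := eq_zero_of_len hα
    rw [hα, Nat.cast_zero] at hhi ⊢
    have : s = 0 := le_antisymm (by nlinarith [(Nat.cast_nonneg l : (0 : ℝ) ≤ l)]) hs0
    rw [this]
    have hC := gnConst_pos (Nat.succ_pos l)
    push_cast [Nat.succ_eq_add_one] at hC
    refine ((h0 i).congr (hW i).weakDeriv_zero_ae.symm).mono ?_
    simpa using hC
  · rw [min_eq_right hα, Nat.cast_one] at hlo
    rw [mul_one]
    exact bd_interval hl (hA i) (hW i) (h0 i) (h01 i) (h1 i) hα (by omega) hlo hhi

lemma UM.base_deriv {l : ℕ} (hl : 0 < l) {A : ι → ℝ} {f : ι → X N → ℝ} (hA : ∀ i, 1 ≤ A i)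
    (hW : ∀ i, W (l + 1) (f i)) (h0 : ∀ i, Bd 0 (f i) 1)
    (h01 : ∀ i j, Bd 0 (weakDeriv (single j 1) (f i)) (A i))
    (h1 : ∀ i (α : Fin N → ℕ), 1 ≤ len α → len α ≤ l + 1 → Bd 1 (weakDeriv α (f i)) (A i))
    {γ : Fin N → ℕ} (hγ : 1 ≤ len γ) :
    UM l (len γ) 1 A (fun _ => 1) (fun i => weakDeriv γ (f i)) := by
  refine ⟨(2 * ((l : ℝ) + 1)) ^ ((l + 1) ^ 2), by positivity, fun i => JB.intro fun α s hs => ?_⟩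
  obtain ⟨hc, hs0, hs1, hlo, hhi⟩ := hs
  rw [← len_add] at hlo hhi hc ⊢
  have e : max 1 (min (len (γ + α)) 1) = 1 := by omega
  rw [e, Nat.cast_one] at hlo
  refine ⟨_, ((hW i).isWeak (by rw [len_add] at hc; omega)).of_add ((hW i).isWeak hc), ?_⟩
  rw [mul_one]
  exact bd_interval hl (hA i) (hW i) (h0 i) (h01 i) (h1 i) (by rw [len_add]; omega) hc hlo hhi

end

section

variable {N : ℕ}

lemma Bd.integral_mul_le {s t A B : ℝ} {f g : X N → ℝ} (hf : Bd s f A) (hg : Bd t g B)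
    (hs : 0 ≤ s) (ht : 0 ≤ t) (hst : s + t = 2) (hA : 0 ≤ A) (hB : 0 ≤ B) :
    Integrable (fun x => f x * g x) ∧ |∫ x, f x * g x| ≤ A * B := by
  have h := hf.mul hg hs ht hA
  rw [hst] at h
  obtain ⟨h1, h2⟩ := h.integral_abs_le (by positivity)
  exact ⟨h1, (abs_integral_le_integral_abs).trans h2⟩

lemma LocL2.locallyIntegrable {f : X N → ℝ} (hf : LocL2 f) : LocallyIntegrable f := by
  have h1 : LocL2 (fun _ : X N => (1 : ℝ)) := MemLp.locL2_of_top (memLp_top_const 1)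
  simpa using locallyIntegrable_mul h1 hf

lemma bd_nr {s : ℝ} {f : X N → ℝ} (hf : MemLp f (ex s)) : Bd s f (nr s f) := hf.bd

lemma IsTest.bd {φ : X N → ℝ} (hφ : IsTest φ) (s : ℝ) : Bd s φ (nr s φ) := (hφ.memLp _).bd

lemma bd_one_of_cutoff {f : X N → ℝ} {M : ℝ} (hm : AEStronglyMeasurable f)
    (h : ∀ n, Bd 1 (fun x => cutoff N n x * f x) M) : Bd 1 f M := by
  refine ⟨hm, (Lp.eLpNorm_lim_le_liminf_eLpNorm (f := fun n x => cutoff N n x * f x)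
    (fun n => (h n).1) f (.of_forall fun x => ?_)).trans
    (liminf_le_of_le (by isBoundedDefault) fun b hb => ?_)⟩
  · obtain ⟨n₀, hn₀⟩ := exists_nat_ge ‖x‖
    refine tendsto_const_nhds.congr' ?_
    filter_upwards [eventually_ge_atTop n₀] with n hn
    have : cutoff N n x = 1 := by
      refine (cutoff N n).one_of_mem_closedBall ?_
      rw [mem_closedBall_zero_iff]
      change ‖x‖ ≤ (n : ℝ) + 1
      have : (n₀ : ℝ) ≤ n := by exact_mod_cast hn
      linarith
    rw [this, one_mul]
  · obtain ⟨n, hn⟩ := hb.exists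
    exact hn.trans (h n).2

lemma integral_sq_eq_nr {f : X N → ℝ} (hf : MemLp f 2) : ∫ x, f x * f x = nr 1 f ^ 2 := by
  have h : MemLp f (ex 1) := by rwa [ex_one]
  have := nr_rpow one_pos h
  rw [show (2 : ℝ) / 1 = ((2 : ℕ) : ℝ) by norm_num, rpow_natCast] at this
  rw [this]
  refine integral_congr_ae (.of_forall fun x => ?_)
  simp only [rpow_natCast, pow_two, abs_mul_abs_self]

lemma bd_one_of_dual {f : X N → ℝ} (hf : LocL2 f) {M : ℝ} (hM : 0 ≤ M)
    (h : ∀ φ, IsTest φ → |∫ x, φ x * f x| ≤ M * nr 1 φ) : Bd 1 f M := by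
  refine bd_one_of_cutoff hf.locallyIntegrable.aestronglyMeasurable fun n => ?_
  set g : X N → ℝ := fun x => cutoff N n x * f x with hg
  have hg2 : MemLp g 2 := hf _ (isTest_cutoff n)
  have hg1 : MemLp g (ex 1) := by rwa [ex_one]
  have hgl := hg2.locInt (by norm_num)
  have hlim := tendsto_integral_smul_mol hg2 hg2
  have hb : ∀ k, ∫ x, g x * mol k g x ≤ M * nr 1 g := by
    intro k
    have ht := isTest_mul_contDiff (isTest_cutoff n) (mol_contDiff k hgl)
    have h1 := (le_abs_self _).trans (h _ ht)
    have e : ∫ x, (cutoff N n x * mol k g x) * f x = ∫ x, g x * mol k g x :=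
      integral_congr_ae (.of_forall fun x => by simp only [hg]; ring)
    rw [e] at h1
    refine h1.trans (mul_le_mul_of_nonneg_left ?_ hM)
    refine toReal_mono hg1.2.ne ?_
    rw [ex_one]
    refine le_trans (eLpNorm_mono fun x => ?_) (eLpNorm_mol_le k hgl)
    rw [norm_mul, Real.norm_of_nonneg (cutoff N n).nonneg]
    exact mul_le_of_le_one_left (norm_nonneg _) (cutoff N n).le_one
  have h2 : _ ≤ _ := le_of_tendsto hlim (.of_forall hb)
  simp only [smul_eq_mul, integral_sq_eq_nr hg2] at h2
  refine (bd_nr hg1).mono ?_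
  by_contra! hlt
  nlinarith

lemma bd_zero_of_dual {f : X N → ℝ} (hf : LocallyIntegrable f) {M : ℝ}
    (h : ∀ φ, IsTest φ → |∫ x, φ x * f x| ≤ M * nr 2 φ) : Bd 0 f M := by
  refine bd_zero_of_bounded hf.aestronglyMeasurable ?_
  filter_upwards [mol_ae_tendsto hf] with x hx
  refine le_of_tendsto hx.abs (.of_forall fun n => ?_)
  have ht := isTest_molKer_sub n x
  have h1 := h _ ht
  rw [mol_apply']
  simp only [smul_eq_mul]
  refine h1.trans (le_of_eq ?_)
  have h2 := nr_rpow two_pos (ht.memLp (ex 2))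
  rw [div_self two_ne_zero, rpow_one] at h2
  rw [h2]
  simp only [rpow_one, abs_of_nonneg (molKer_nonneg n _)]
  rw [integral_sub_left_eq_self (molKer N n) volume x, integral_molKer, mul_one]

end

section

variable {N : ℕ} {T : ℝ}

/-- `F` is in `C⁰([0,T], L^{2/s})`. -/
def CLp (s T : ℝ) (F : ℝ → X N → ℝ) : Prop := ∀ t ∈ Icc 0 T, MemLp (F t) (ex s) ∧
  ∀ ε > 0, ∀ᶠ r in 𝓝[Icc 0 T] t, Bd s (fun x => F r x - F t x) ε

/-- `F'` is the time derivative of `F`, tested with functions of `x`. -/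
def TD (T : ℝ) (F F' : ℝ → X N → ℝ) : Prop := ∀ φ : X N → ℝ, IsTest φ → ∀ t ∈ Icc 0 T,
  HasDerivWithinAt (fun s => ∫ x, φ x * F s x) (∫ x, φ x * F' t x) (Icc 0 T) t

/-- `F'` is the time derivative of `F` in `L^{2/s}`. -/
def SD (s T : ℝ) (F F' : ℝ → X N → ℝ) : Prop := ∀ t ∈ Icc 0 T, MemLp (F' t) (ex s) ∧
  ∀ ε > 0, ∀ᶠ r in 𝓝[Icc 0 T] t, Bd s (fun x => F r x - F t x - (r - t) * F' t x) (ε * |r - t|)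

lemma eventually_mem_Icc (t : ℝ) : ∀ᶠ r in 𝓝[Icc 0 T] t, r ∈ Icc 0 T := eventually_mem_nhdsWithin

lemma eventually_abs_sub_lt (t : ℝ) {η : ℝ} (hη : 0 < η) : ∀ᶠ r in 𝓝[Icc 0 T] t, |r - t| < η :=
  eventually_nhdsWithin_of_eventually_nhds (_root_.eventually_abs_sub_lt t hη)

namespace CLp

variable {s : ℝ} {F G : ℝ → X N → ℝ}

lemma exists_bound (hF : CLp s T F) (h2 : s ≤ 2) : ∃ M, 0 ≤ M ∧ ∀ t ∈ Icc 0 T, Bd s (F t) M := by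
  have hc : ContinuousOn (fun t => nr s (F t)) (Icc 0 T) := by
    intro t ht
    rw [ContinuousWithinAt, Metric.tendsto_nhds]
    intro ε hε
    filter_upwards [(hF t ht).2 (ε / 2) (by positivity), eventually_mem_Icc t] with r hr hrI
    have e1 : Bd s (F r) (nr s (F t) + ε / 2) := by
      have := (bd_nr (hF t ht).1).add hr h2 (nr_nonneg _ _) (by positivity)
      simpa using this
    have e2 : Bd s (F t) (nr s (F r) + ε / 2) := by
      have := (bd_nr (hF r hrI).1).sub hr h2 (nr_nonneg _ _) (by positivity)
      simpa using this
    have k1 := e1.toReal_le (add_nonneg (nr_nonneg _ _) (by positivity))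
    have k2 := e2.toReal_le (add_nonneg (nr_nonneg _ _) (by positivity))
    change nr s (F r) ≤ _ at k1
    change nr s (F t) ≤ _ at k2
    rw [Real.dist_eq, abs_lt]
    constructor <;> linarith
  obtain ⟨M, hM⟩ := isCompact_Icc.exists_bound_of_continuousOn hc
  refine ⟨|M|, abs_nonneg _, fun t ht => (bd_nr (hF t ht).1).mono ?_⟩
  exact ((le_abs_self _).trans (hM t ht)).trans (le_abs_self _)

lemma congr (hF : CLp s T F) (h : ∀ t ∈ Icc 0 T, F t =ᵐ[volume] G t) : CLp s T G := fun t ht => by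
  refine ⟨(hF t ht).1.ae_eq (h t ht), fun ε hε => ?_⟩
  filter_upwards [(hF t ht).2 ε hε, eventually_mem_Icc t] with r hr hrI
  refine hr.congr ?_
  filter_upwards [h t ht, h r hrI] with x h1 h2
  rw [h1, h2]

lemma add (hF : CLp s T F) (hG : CLp s T G) (h2 : s ≤ 2) :
    CLp s T (fun t x => F t x + G t x) := fun t ht => by
  refine ⟨(hF t ht).1.add (hG t ht).1, fun ε hε => ?_⟩
  filter_upwards [(hF t ht).2 (ε / 2) (by positivity), (hG t ht).2 (ε / 2) (by positivity)]
    with r h3 h4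
  have := h3.add h4 h2 (by positivity) (by positivity)
  rw [add_halves] at this
  refine this.congr (.of_forall fun x => ?_)
  simp only
  ring

lemma neg (hF : CLp s T F) : CLp s T (fun t x => -F t x) := fun t ht => by
  refine ⟨(hF t ht).1.neg, fun ε hε => ?_⟩
  filter_upwards [(hF t ht).2 ε hε] with r h3
  exact h3.neg.congr (.of_forall fun x => by simp only; ring)

lemma sub (hF : CLp s T F) (hG : CLp s T G) (h2 : s ≤ 2) : CLp s T (fun t x => F t x - G t x) := by
  simpa only [sub_eq_add_neg] using hF.add hG.neg h2

lemma mul {s' : ℝ} (hF : CLp s T F) (hG : CLp s' T G) (h0 : 0 ≤ s) (h0' : 0 ≤ s')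
    (h2 : s + s' ≤ 2) : CLp (s + s') T (fun t x => F t x * G t x) := fun t ht => by
  obtain ⟨MF, hMF, hF'⟩ := hF.exists_bound (by linarith)
  obtain ⟨MG, hMG, hG'⟩ := hG.exists_bound (by linarith)
  refine ⟨((hF' t ht).mul (hG' t ht) h0 h0' hMF).memLp, fun ε hε => ?_⟩
  set η := ε / (MF + MG + 1)
  have hη : 0 < η := by positivity
  filter_upwards [(hF t ht).2 η hη, (hG t ht).2 η hη, eventually_mem_Icc t] with r h3 h4 hr
  have h5 := (h3.mul (hG' r hr) h0 h0' hη.le).add ((hF' t ht).mul h4 h0 h0' hMF) h2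
    (by positivity) (by positivity)
  refine (h5.congr (.of_forall fun x => ?_)).mono (?_ : _ ≤ ε)
  · simp only; ring
  · have : η * (MF + MG + 1) = ε := by simp only [η]; field_simp
    nlinarith

lemma continuousOn_integral_mul (hF : CLp 1 T F) (hG : CLp 1 T G) :
    ContinuousOn (fun t => ∫ x, F t x * G t x) (Icc 0 T) := by
  intro t ht
  have h := hF.mul hG zero_le_one zero_le_one (by norm_num)
  rw [one_add_one_eq_two] at h
  have hint : ∀ r ∈ Icc 0 T, Integrable (fun x => F r x * G r x) := fun r hr => by
    have := (h r hr).1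
    rw [ex_two] at this
    exact memLp_one_iff_integrable.1 this
  rw [ContinuousWithinAt, Metric.tendsto_nhds]
  intro ε hε
  filter_upwards [(h t ht).2 (ε / 2) (by positivity), eventually_mem_Icc t] with r hr hrI
  rw [Real.dist_eq, ← integral_sub (hint r hrI) (hint t ht)]
  have := (abs_integral_le_integral_abs).trans (hr.integral_abs_le (by positivity)).2
  linarith

end CLp

namespace TD

variable {s : ℝ} {F F' G G' : ℝ → X N → ℝ}

lemma deriv (h : TD T F F') {α : Fin N → ℕ} (hF : ∀ t ∈ Icc 0 T, IsWeakDeriv α (F t) (G t))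
    (hF' : ∀ t ∈ Icc 0 T, IsWeakDeriv α (F' t) (G' t)) : TD T G G' := by
  intro φ hφ t ht
  have e : ∀ {f g : X N → ℝ}, IsWeakDeriv α f g → ∫ x, φ x * g x =
      (-1 : ℝ) ^ (∑ i, α i) * ∫ x, multiDeriv α φ x * f x := by
    intro f g hfg
    have := hfg.2.2 φ hφ
    simp only [smul_eq_mul] at this
    rw [this, ← mul_assoc, ← mul_pow]
    simp
  rw [e (hF' t ht)]
  refine ((h _ (hφ.multiDeriv α) t ht).const_mul _).congr (fun r hr => ?_) ?_
  · exact e (hF r hr)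
  · exact e (hF t ht)

lemma bound {s' : ℝ} (h : TD T F F') (hF' : CLp s T F') (hs : 0 ≤ s) (hs2 : s ≤ 2)
    (hss : s' + s = 2) (hloc : ∀ t ∈ Icc 0 T, LocallyIntegrable (F t))
    {t ε : ℝ} {S : Set ℝ} (hS : Convex ℝ S) (hSI : S ⊆ Icc 0 T) (ht : t ∈ S) (hε : 0 ≤ ε)
    {f : X N → ℝ} (hf : Bd s f (nr s f))
    (hb : ∀ r ∈ S, Bd s (fun x => F' r x - f x) ε) {r : ℝ} (hr : r ∈ S) {φ : X N → ℝ}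
    (hφ : IsTest φ) :
    |∫ x, φ x * (F r x - F t x - (r - t) * f x)| ≤ ε * |r - t| * nr s' φ := by
  have hs' : 0 ≤ s' := by linarith
  have hφf := (hφ.bd s').integral_mul_le hf hs' hs hss (nr_nonneg _ _) (nr_nonneg _ _)
  have hd : ∀ q ∈ S, HasDerivWithinAt (fun q => (∫ x, φ x * F q x) - q * ∫ x, φ x * f x)
      ((∫ x, φ x * F' q x) - 1 * ∫ x, φ x * f x) S q := fun q hq =>
    ((h φ hφ q (hSI hq)).mono hSI).sub ((hasDerivWithinAt_id q S).mul_const _)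
  have hbd : ∀ q ∈ S, ‖(∫ x, φ x * F' q x) - 1 * ∫ x, φ x * f x‖ ≤ ε * nr s' φ := by
    intro q hq
    have hi := (hφ.bd s').integral_mul_le (bd_nr (hF' q (hSI hq)).1) hs' hs hss (nr_nonneg _ _)
      (nr_nonneg _ _)
    rw [one_mul, ← integral_sub hi.1 hφf.1, norm_eq_abs, mul_comm ε]
    simp only [← mul_sub]
    exact ((hφ.bd s').integral_mul_le (hb q hq) hs' hs hss (nr_nonneg _ _) hε).2
  have := hS.norm_image_sub_le_of_norm_hasDerivWithin_le hd hbd ht hr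
  have i1 := hφ.integrable_smul (hloc r (hSI hr))
  have i2 := hφ.integrable_smul (hloc t (hSI ht))
  simp only [smul_eq_mul] at i1 i2
  have e : ∫ x, φ x * (F r x - F t x - (r - t) * f x) =
      ((∫ x, φ x * F r x) - r * ∫ x, φ x * f x) - ((∫ x, φ x * F t x) - t * ∫ x, φ x * f x) := by
    have e1 : (fun x => φ x * (F r x - F t x - (r - t) * f x)) =
        fun x => (φ x * F r x - φ x * F t x) - (r - t) * (φ x * f x) := by
      funext x; ring
    have i3 : Integrable (fun x => φ x * F r x - φ x * F t x) := i1.sub i2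
    rw [e1, integral_sub i3 (hφf.1.const_mul _), integral_sub i1 i2, integral_const_mul]
    ring
  rw [e]
  rw [norm_eq_abs, norm_eq_abs] at this
  linarith

lemma eventually_bound {s' : ℝ} (h : TD T F F') (hF' : CLp s T F') (hs : 0 ≤ s) (hs2 : s ≤ 2)
    (hss : s' + s = 2) (hloc : ∀ t ∈ Icc 0 T, LocallyIntegrable (F t)) {t ε : ℝ}
    (ht : t ∈ Icc 0 T) (hε : 0 < ε) : ∀ᶠ r in 𝓝[Icc 0 T] t, ∀ φ : X N → ℝ, IsTest φ →
      |∫ x, φ x * (F r x - F t x - (r - t) * F' t x)| ≤ ε * |r - t| * nr s' φ := by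
  have h1 := (hF' t ht).2 ε hε
  rw [eventually_nhdsWithin_iff, Metric.eventually_nhds_iff_ball] at h1
  obtain ⟨δ, hδ, hb⟩ := h1
  filter_upwards [inter_mem_nhdsWithin (Icc 0 T) (Metric.ball_mem_nhds t hδ)] with r hr φ hφ
  exact h.bound (S := Icc 0 T ∩ Metric.ball t δ) hF' hs hs2 hss hloc
    ((convex_Icc 0 T).inter (convex_ball t δ)) inter_subset_left ⟨ht, Metric.mem_ball_self hδ⟩ hε.le
    (bd_nr (hF' t ht).1) (fun q hq => hb q hq.2 hq.1) hr hφ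

lemma locL2_sub {f g h : X N → ℝ} (hf : LocL2 f) (hg : LocL2 g) (hh : LocL2 h) (c : ℝ) :
    LocL2 (fun x => f x - g x - c * h x) := by
  intro φ hφ
  have := ((hf φ hφ).sub (hg φ hφ)).sub ((hh φ hφ).const_mul c)
  refine this.ae_eq (.of_forall fun x => ?_)
  simp only [Pi.sub_apply, smul_eq_mul]
  ring

lemma sd_one (h : TD T F F') (hF' : CLp 1 T F') (hloc : ∀ t ∈ Icc 0 T, LocL2 (F t)) :
    SD 1 T F F' := fun t ht => by
  refine ⟨(hF' t ht).1, fun ε hε => ?_⟩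
  filter_upwards [h.eventually_bound (s' := 1) hF' zero_le_one (by norm_num) (by norm_num)
    (fun t ht => (hloc t ht).locallyIntegrable) ht hε, eventually_mem_Icc t] with r hr hrI
  exact bd_one_of_dual (locL2_sub (hloc r hrI) (hloc t ht)
    ((bd_nr (hF' t ht).1).locL2 zero_le_one le_rfl) _) (by positivity) hr

lemma sd_zero (h : TD T F F') (hF' : CLp 0 T F') (hloc : ∀ t ∈ Icc 0 T, LocL2 (F t)) :
    SD 0 T F F' := fun t ht => by
  refine ⟨(hF' t ht).1, fun ε hε => ?_⟩
  filter_upwards [h.eventually_bound (s' := 2) hF' le_rfl (by norm_num) (by norm_num)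
    (fun t ht => (hloc t ht).locallyIntegrable) ht hε, eventually_mem_Icc t] with r hr hrI
  exact bd_zero_of_dual (locL2_sub (hloc r hrI) (hloc t ht)
    ((bd_nr (hF' t ht).1).locL2 le_rfl zero_le_one) _).locallyIntegrable hr

lemma memLp_sub (h : TD T F F') (hF' : CLp 1 T F') (hloc : ∀ t ∈ Icc 0 T, LocL2 (F t))
    {r t : ℝ} (hr : r ∈ Icc 0 T) (ht : t ∈ Icc 0 T) : MemLp (fun x => F r x - F t x) 2 := by
  obtain ⟨M, hM, hb⟩ := hF'.exists_bound (by norm_num)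
  have h1 := bd_one_of_dual (M := (M + nr 1 (F' t)) * |r - t|) (locL2_sub (hloc r hr) (hloc t ht)
    ((bd_nr (hF' t ht).1).locL2 zero_le_one le_rfl) (r - t))
    (mul_nonneg (add_nonneg hM (nr_nonneg _ _)) (abs_nonneg _)) (fun φ hφ =>
      h.bound (s' := 1) hF' zero_le_one (by norm_num) (by norm_num)
        (fun t ht => (hloc t ht).locallyIntegrable) (convex_Icc 0 T) Subset.rfl ht
        (add_nonneg hM (nr_nonneg _ _)) (bd_nr (hF' t ht).1)
        (fun q hq => (hb q hq).sub (bd_nr (hF' t ht).1) (by norm_num) hM (nr_nonneg _ _)) hr hφ)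
  have h2 := h1.memLp
  have h3 := (hF' t ht).1
  rw [ex_one] at h2 h3
  refine (h2.add (h3.const_mul (r - t))).ae_eq (.of_forall fun x => ?_)
  simp

end TD

namespace SD

variable {s : ℝ} {F F' G G' : ℝ → X N → ℝ}

lemma eventually_le (h : SD s T F F') (hs : 0 ≤ s) (hs2 : s ≤ 2) {t : ℝ} (ht : t ∈ Icc 0 T) :
    ∀ᶠ r in 𝓝[Icc 0 T] t, Bd s (fun x => F r x - F t x) ((1 + nr s (F' t)) * |r - t|) := by
  filter_upwards [(h t ht).2 1 one_pos] with r hr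
  have := hr.add ((bd_nr (h t ht).1).const_mul hs (r - t)) hs2 (by positivity)
    (mul_nonneg (abs_nonneg _) (nr_nonneg _ _))
  refine (this.congr (.of_forall fun x => ?_)).mono (le_of_eq (by ring))
  simp

lemma cLp (h : SD s T F F') (hs : 0 ≤ s) (hs2 : s ≤ 2)
    (hF : ∀ t ∈ Icc 0 T, MemLp (F t) (ex s)) : CLp s T F := fun t ht => by
  refine ⟨hF t ht, fun ε hε => ?_⟩
  have h0 : 0 < 1 + nr s (F' t) := add_pos_of_pos_of_nonneg one_pos (nr_nonneg _ _)
  filter_upwards [h.eventually_le hs hs2 ht, eventually_abs_sub_lt t (div_pos hε h0)] with r h1 h2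
  exact h1.mono ((lt_div_iff₀' h0).1 h2).le

lemma mul (hF : SD 0 T F F') (hG : SD s T G G') (hs : 0 ≤ s) (hs2 : s ≤ 2)
    (h0 : ∀ t ∈ Icc 0 T, MemLp (F t) (ex 0))
    (hGs : ∀ t ∈ Icc 0 T, MemLp (G t) (ex s)) :
    SD s T (fun t x => F t x * G t x) (fun t x => F' t x * G t x + F t x * G' t x) := by
  intro t ht
  have bF := bd_nr (h0 t ht)
  have bF' := bd_nr (hF t ht).1
  have bG := bd_nr (hGs t ht)
  have bG' := bd_nr (hG t ht).1
  have n0 := nr_nonneg 0 (F t)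
  have n1 := nr_nonneg 0 (F' t)
  have n2 := nr_nonneg s (G t)
  have n3 := nr_nonneg s (G' t)
  refine ⟨?_, fun ε hε => ?_⟩
  · have := (bF'.mul bG le_rfl hs n1).add (bF.mul bG' le_rfl hs n0) (by linarith) (by positivity)
      (by positivity)
    rw [zero_add] at this
    exact this.memLp
  set η := ε / (nr s (G t) + nr 0 (F t) + 1 + (1 + nr 0 (F' t)) * (1 + nr s (G' t)))
  have hη : 0 < η := by positivity
  have hη' : η * (nr s (G t) + nr 0 (F t) + 1 + (1 + nr 0 (F' t)) * (1 + nr s (G' t))) = ε := by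
    simp only [η]; field_simp
  filter_upwards [(hF t ht).2 η hη, (hG t ht).2 η hη, hF.eventually_le le_rfl (by norm_num) ht,
    hG.eventually_le hs hs2 ht, eventually_abs_sub_lt t hη] with r h4 h5 h6 h7 h8
  have a0 := abs_nonneg (r - t)
  have p1 := h4.mul bG le_rfl hs (by positivity)
  have p2 := bF.mul h5 le_rfl hs (by positivity)
  have p3 := h6.mul h7 le_rfl hs (by positivity)
  have := (p1.add p2 (by linarith) (by positivity) (by positivity)).add p3 (by linarith)
    (by positivity) (by positivity)
  rw [zero_add] at this
  refine (this.congr (.of_forall fun x => ?_)).mono ?_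
  · simp only; ring
  · rw [← hη']
    have : (1 + nr 0 (F' t)) * |r - t| * ((1 + nr s (G' t)) * |r - t|) ≤
        (1 + nr 0 (F' t)) * (1 + nr s (G' t)) * (η * |r - t|) := by
      calc _ = (1 + nr 0 (F' t)) * (1 + nr s (G' t)) * (|r - t| * |r - t|) := by ring
        _ ≤ _ := by gcongr
    have h9 : 0 ≤ η * |r - t| := by positivity
    nlinarith

lemma add (hF : SD s T F F') (hG : SD s T G G') (hs2 : s ≤ 2) :
    SD s T (fun t x => F t x + G t x) (fun t x => F' t x + G' t x) := fun t ht => by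
  refine ⟨(hF t ht).1.add (hG t ht).1, fun ε hε => ?_⟩
  filter_upwards [(hF t ht).2 (ε / 2) (by positivity), (hG t ht).2 (ε / 2) (by positivity)]
    with r h3 h4
  refine ((h3.add h4 hs2 (by positivity) (by positivity)).congr
    (.of_forall fun x => ?_)).mono (le_of_eq (by ring))
  simp only
  ring

lemma const_mul (hF : SD s T F F') (hs : 0 ≤ s) (c : ℝ) :
    SD s T (fun t x => c * F t x) (fun t x => c * F' t x) := fun t ht => by
  refine ⟨(hF t ht).1.const_mul c, fun ε hε => ?_⟩
  filter_upwards [(hF t ht).2 (ε / (|c| + 1)) (by positivity)] with r h3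
  refine ((h3.const_mul hs c).mono ?_).congr (.of_forall fun x => by simp only; ring)
  rw [div_mul_eq_mul_div, mul_div_assoc', div_le_iff₀ (by positivity)]
  have : 0 ≤ ε * |r - t| := by positivity
  nlinarith [abs_nonneg c]

lemma neg (hF : SD s T F F') : SD s T (fun t x => -F t x) (fun t x => -F' t x) := fun t ht => by
  refine ⟨(hF t ht).1.neg, fun ε hε => ?_⟩
  filter_upwards [(hF t ht).2 ε hε] with r h3
  exact h3.neg.congr (.of_forall fun x => by simp only; ring)

lemma sub (hF : SD s T F F') (hG : SD s T G G') (hs2 : s ≤ 2) :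
    SD s T (fun t x => F t x - G t x) (fun t x => F' t x - G' t x) := by
  simpa only [sub_eq_add_neg] using hF.add hG.neg hs2

lemma congr (hF : SD s T F F') (h : ∀ t ∈ Icc 0 T, F t =ᵐ[volume] G t)
    (h' : ∀ t ∈ Icc 0 T, F' t =ᵐ[volume] G' t) : SD s T G G' := fun t ht => by
  refine ⟨(hF t ht).1.ae_eq (h' t ht), fun ε hε => ?_⟩
  filter_upwards [(hF t ht).2 ε hε, eventually_mem_Icc t] with r hr hrI
  refine hr.congr ?_
  filter_upwards [h t ht, h r hrI, h' t ht] with x h1 h2 h3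
  rw [h1, h2, h3]

lemma hasDerivWithinAt_integral {s' : ℝ} (hF : SD s T F F') (hs : 0 ≤ s) (hs' : 0 ≤ s')
    (hss : s + s' = 2) {g : X N → ℝ} (hg : MemLp g (ex s')) {t : ℝ} (ht : t ∈ Icc 0 T)
    (hi : ∀ r ∈ Icc 0 T, Integrable (fun x => F r x * g x)) :
    HasDerivWithinAt (fun r => ∫ x, F r x * g x) (∫ x, F' t x * g x) (Icc 0 T) t := by
  rw [hasDerivWithinAt_iff_isLittleO, Asymptotics.isLittleO_iff]
  intro c hc
  have n0 := nr_nonneg s' g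
  filter_upwards [(hF t ht).2 (c / (nr s' g + 1)) (by positivity), eventually_mem_Icc t]
    with r hr hrI
  have hm := hr.integral_mul_le (bd_nr hg) hs hs' hss (by positivity) n0
  have hi' := (bd_nr (hF t ht).1).integral_mul_le (bd_nr hg) hs hs' hss (nr_nonneg _ _) n0
  have e : (∫ x, F r x * g x) - (∫ x, F t x * g x) - (r - t) • ∫ x, F' t x * g x =
      ∫ x, (F r x - F t x - (r - t) * F' t x) * g x := by
    have i3 : Integrable (fun x => F r x * g x - F t x * g x) := (hi r hrI).sub (hi t ht)
    rw [smul_eq_mul, ← integral_const_mul, ← integral_sub (hi r hrI) (hi t ht),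
      ← integral_sub i3 (hi'.1.const_mul _)]
    refine integral_congr_ae (.of_forall fun x => ?_)
    simp only
    ring
  rw [e, norm_eq_abs, norm_eq_abs]
  refine hm.2.trans ?_
  have : c / (nr s' g + 1) * nr s' g ≤ c := by
    rw [div_mul_eq_mul_div, div_le_iff₀ (by positivity)]
    nlinarith
  calc _ = (c / (nr s' g + 1) * nr s' g) * |r - t| := by ring
    _ ≤ _ := by gcongr

lemma td (hF : SD s T F F') (hs : 0 ≤ s) (hs2 : s ≤ 2)
    (hloc : ∀ t ∈ Icc 0 T, LocallyIntegrable (F t)) : TD T F F' := by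
  intro φ hφ t ht
  have := hF.hasDerivWithinAt_integral (s' := 2 - s) hs (by linarith) (by ring)
    (hφ.memLp (ex (2 - s))) ht
    (fun r hr => by simpa [mul_comm] using hφ.integrable_smul (hloc r hr))
  simpa only [mul_comm] using this

lemma hasDerivWithinAt_integral_sq (hF : SD 1 T F F') (hF2 : ∀ t ∈ Icc 0 T, MemLp (F t) 2)
    {t : ℝ} (ht : t ∈ Icc 0 T) :
    HasDerivWithinAt (fun r => ∫ x, F r x ^ 2) (2 * ∫ x, F' t x * F t x) (Icc 0 T) t := by
  have hF1 : ∀ t ∈ Icc 0 T, MemLp (F t) (ex 1) := by simpa only [ex_one] using hF2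
  have hi : ∀ r ∈ Icc 0 T, ∀ q ∈ Icc 0 T, Integrable (fun x => F r x * F q x) := fun r hr q hq =>
    ((bd_nr (hF1 r hr)).integral_mul_le (bd_nr (hF1 q hq)) zero_le_one zero_le_one (by norm_num)
      (nr_nonneg _ _) (nr_nonneg _ _)).1
  have h1 := hF.hasDerivWithinAt_integral (s' := 1) zero_le_one zero_le_one (by norm_num)
    (hF1 t ht) ht (fun r hr => hi r hr t ht)
  have hrem : HasDerivWithinAt (fun r => ∫ x, (F r x - F t x) ^ 2) 0 (Icc 0 T) t := by
    rw [hasDerivWithinAt_iff_isLittleO, Asymptotics.isLittleO_iff]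
    intro c hc
    set L := 1 + nr 1 (F' t)
    have hL : 0 < L := by have := nr_nonneg 1 (F' t); positivity
    filter_upwards [hF.eventually_le zero_le_one (by norm_num) ht,
      eventually_abs_sub_lt t (show 0 < c / (L * L) by positivity)] with r hr h3
    have := (hr.integral_mul_le hr zero_le_one zero_le_one (by norm_num) (by positivity)
      (by positivity)).2
    simp only [sub_self, smul_zero, sub_zero, mul_zero, integral_zero, norm_eq_abs,
      pow_two] at this ⊢
    rw [lt_div_iff₀ (by positivity)] at h3
    refine this.trans ?_
    nlinarith [abs_nonneg (r - t)]
  have h2 := (h1.const_mul 2).add hrem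
  rw [add_zero] at h2
  have h4 := h2.sub_const (∫ x, F t x * F t x)
  refine h4.congr_of_mem (fun r hr => ?_) ht
  have h3 : Integrable (fun x => (F r x - F t x) ^ 2) :=
    (((hi r hr r hr).sub ((hi r hr t ht).const_mul 2)).add (hi t ht t ht)).congr
      (.of_forall fun x => by simp only [Pi.add_apply, Pi.sub_apply]; ring)
  simp only [Pi.add_apply]
  rw [← integral_const_mul, ← integral_add ((hi r hr t ht).const_mul 2) h3, ← integral_sub
    (by exact ((hi r hr t ht).const_mul 2).add h3) (hi t ht t ht)]
  exact integral_congr_ae (.of_forall fun x => by simp only; ring)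

end SD

lemma contDiffOn_one_of_hasDerivWithinAt {f f' : ℝ → ℝ} (hT : 0 < T)
    (h : ∀ t ∈ Icc 0 T, HasDerivWithinAt f (f' t) (Icc 0 T) t) (hc : ContinuousOn f' (Icc 0 T)) :
    ContDiffOn ℝ 1 f (Icc 0 T) ∧ ∀ t ∈ Icc 0 T, derivWithin f (Icc 0 T) t = f' t := by
  have hu := uniqueDiffOn_Icc hT
  have he : ∀ t ∈ Icc 0 T, derivWithin f (Icc 0 T) t = f' t := fun t ht =>
    (h t ht).derivWithin (hu t ht)
  exact ⟨(contDiffOn_one_iff_derivWithin hu).2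
    ⟨fun t ht => (h t ht).differentiableWithinAt, hc.congr he⟩, he⟩

end

section

variable {N : ℕ} {T : ℝ}

/-- The weak derivatives of `f`, a function of weight `d`, are bounded by `C`. -/
def JT (K d : ℕ) (C : ℝ) (f : X N → ℝ) : Prop := JB (DT K d) (fun _ _ => C) f

namespace JT

variable {K d d₁ d₂ : ℕ} {C C₁ C₂ : ℝ} {f g : X N → ℝ}

lemma monoC (h : JT K d C f) (hC : C ≤ C₁) : JT K d C₁ f := JB.mono h fun _ _ hs => ⟨hs, hC⟩

lemma add (hf : JT K d C₁ f) (hg : JT K d C₂ g) (h1 : 0 ≤ C₁) (h2 : 0 ≤ C₂) :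
    JT K d (C₁ + C₂) (fun x => f x + g x) :=
  JB.add hf hg (DT_subset _ _) (fun _ _ => h1) fun _ _ => h2

lemma mul (hf : JT K d₁ C₁ f) (hg : JT K d₂ C₂ g) (h1 : 0 ≤ C₁) (h2 : 0 ≤ C₂) :
    JT K (d₁ + d₂) (2 ^ K * (C₁ * C₂)) (fun x => f x * g x) := by
  have := JB.mul_DT (A := 1) one_pos h1 h2 (by simpa [JT] using hf) (by simpa [JT] using hg)
  simpa [JT] using this

lemma const_mul (hf : JT K d C f) (c : ℝ) : JT K d (|c| * C) (fun x => c * f x) :=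
  JB.const_mul hf (DT_subset _ _) c

lemma isWeak (hf : JT K d C f) {γ : Fin N → ℕ} (hK : d + len γ ≤ K) :
    IsWeakDeriv γ f (weakDeriv γ f) := by
  rcases eq_zero_or_pos (d + len γ) with h0 | h0
  · exact (hf γ 0 ⟨hK, by rw [h0]; simp, zero_le_one, fun _ => rfl⟩).1
  · exact (hf γ 1 (one_mem_DT hK h0)).1

lemma deriv (hf : JT K d C f) (γ : Fin N → ℕ) : JT K (d + len γ) C (weakDeriv γ f) := by
  rcases Nat.lt_or_ge K (d + len γ) with hK | hK
  · exact JB.intro fun α s hs => absurd hs.1 (by omega)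
  have := JB.deriv hf (hf.isWeak hK)
  simp only [DT_add] at this
  exact this

lemma mono (hf : JT K d₁ C f) (h1 : 1 ≤ d₁) (h : d₁ ≤ d₂) : JT K d₂ C f := by
  refine JB.mono hf fun j s hs => ⟨⟨?_, ?_, hs.2.2.1, fun h => ?_⟩, le_rfl⟩
  · have := hs.1; omega
  · refine le_trans ?_ hs.2.1
    exact_mod_cast (by omega)
  · omega

lemma bd_one (hf : JT K d C f) {α : Fin N → ℕ} (h1 : 1 ≤ d + len α) (hK : d + len α ≤ K) :
    Bd 1 (weakDeriv α f) C := (hf α 1 (one_mem_DT hK h1)).2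

lemma memLp (hf : JT K d C f) {α : Fin N → ℕ} (h1 : 1 ≤ d + len α) (hK : d + len α ≤ K) :
    MemLp (weakDeriv α f) 2 := by
  have := (hf.bd_one h1 hK).memLp
  rwa [ex_one] at this

lemma zero_ae (hf : JT K d C f) (hK : d ≤ K) : weakDeriv 0 f =ᵐ[volume] f := by
  have := hf.isWeak (γ := 0) (by simpa using hK)
  exact (isWeakDeriv_zero this.1).ae_eq

lemma bd_zero (hf : JT K 0 C f) : Bd 0 f C := by
  have h0 : (0 : ℝ) ∈ DT K 0 (len (0 : Fin N → ℕ)) :=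
    ⟨by simp, by simp, zero_le_one, fun _ => rfl⟩
  exact (hf 0 0 h0).2.congr (hf.zero_ae (Nat.zero_le _))

lemma zero_one {M : ℝ} (hf : JT K 0 C f) (h2 : Bd 1 f M) (hC : 0 ≤ C) (hM : 0 ≤ M) :
    JT K 1 (C + M) f := by
  intro α s hs
  obtain ⟨hc, hlo, hs1, hz⟩ := hs
  have hs0 := (DT_subset K 1 _ ⟨hc, hlo, hs1, hz⟩).1
  rcases eq_zero_or_pos (len α) with h0 | h0
  · obtain rfl := eq_zero_of_len h0
    refine ⟨hf.isWeak (by omega), (?_ : Bd s f _).congr (hf.zero_ae (Nat.zero_le _)).symm⟩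
    have h := hf.bd_zero.interp h2 le_rfl zero_le_one hC hM hs0 hs1
    rw [mul_zero, mul_one, zero_add] at h
    refine h.mono ?_
    have := Real.geom_mean_le_arith_mean2_weighted (w₁ := 1 - s) (w₂ := s) (by linarith) hs0 hC hM
      (by ring)
    nlinarith
  · have h := hf α s ⟨by omega, le_trans (by exact_mod_cast (by omega)) hlo, hs1, fun h => by omega⟩
    exact ⟨h.1, h.2.mono (by linarith)⟩

end JT

/-- Curves of functions of weight `d`, which are continuous together with their derivatives. -/
def CT (K d : ℕ) (T : ℝ) (F : ℝ → X N → ℝ) : Prop := ∀ t ∈ Icc 0 T, (∃ C, 0 ≤ C ∧ JT K d C (F t)) ∧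
    ∀ ε > 0, ∀ᶠ r in 𝓝[Icc 0 T] t, JT K d ε (fun x => F r x - F t x)

namespace CT

variable {K d d₁ d₂ : ℕ} {F G : ℝ → X N → ℝ}

lemma congr (hF : CT K d T F) (h : ∀ t ∈ Icc 0 T, F t =ᵐ[volume] G t) : CT K d T G := by
  intro t ht
  obtain ⟨⟨C, hC, h1⟩, h2⟩ := hF t ht
  refine ⟨⟨C, hC, JB.congr h1 (h t ht)⟩, fun ε hε => ?_⟩
  filter_upwards [h2 ε hε, eventually_mem_Icc t] with r hr hrI
  refine JB.congr hr ?_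
  filter_upwards [h t ht, h r hrI] with x h1 h2
  rw [h1, h2]

lemma mono (hF : CT K d₁ T F) (h1 : 1 ≤ d₁) (h : d₁ ≤ d₂) : CT K d₂ T F := by
  intro t ht
  obtain ⟨⟨C, hC, h3⟩, h2⟩ := hF t ht
  exact ⟨⟨C, hC, h3.mono h1 h⟩, fun ε hε => (h2 ε hε).mono fun r hr => hr.mono h1 h⟩

lemma add (hF : CT K d T F) (hG : CT K d T G) : CT K d T (fun t x => F t x + G t x) := by
  intro t ht
  obtain ⟨⟨C, hC, h1⟩, h2⟩ := hF t ht
  obtain ⟨⟨C', hC', h1'⟩, h2'⟩ := hG t ht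
  refine ⟨⟨C + C', by positivity, h1.add h1' hC hC'⟩, fun ε hε => ?_⟩
  filter_upwards [h2 (ε / 2) (by positivity), h2' (ε / 2) (by positivity)] with r hr hr'
  have := hr.add hr' (by positivity) (by positivity)
  rw [add_halves] at this
  exact JB.congr this (.of_forall fun x => by simp only; ring)

lemma neg (hF : CT K d T F) : CT K d T (fun t x => -F t x) := by
  intro t ht
  obtain ⟨⟨C, hC, h1⟩, h2⟩ := hF t ht
  refine ⟨⟨C, hC, JB.neg h1⟩, fun ε hε => ?_⟩
  filter_upwards [h2 ε hε] with r hr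
  exact JB.congr (JB.neg hr) (.of_forall fun x => by simp only; ring)

lemma sub (hF : CT K d T F) (hG : CT K d T G) : CT K d T (fun t x => F t x - G t x) := by
  simpa only [sub_eq_add_neg] using hF.add hG.neg

lemma const_mul (hF : CT K d T F) (c : ℝ) : CT K d T (fun t x => c * F t x) := by
  intro t ht
  obtain ⟨⟨C, hC, h1⟩, h2⟩ := hF t ht
  refine ⟨⟨|c| * C, by positivity, h1.const_mul c⟩, fun ε hε => ?_⟩
  filter_upwards [h2 (ε / (|c| + 1)) (by positivity)] with r hr
  refine JB.congr ((hr.const_mul c).monoC (?_ : _ ≤ ε))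
    (.of_forall fun x => by simp only; ring)
  rw [mul_div_assoc', div_le_iff₀ (by positivity)]
  nlinarith [abs_nonneg c]

lemma zero : CT K d T (fun _ (_ : X N) => (0 : ℝ)) := by
  have h : ∀ {ε : ℝ}, 0 ≤ ε → JT K d ε (fun _ : X N => (0 : ℝ)) := fun {ε} hε =>
    JB.intro fun α s _ => ⟨_, isWeakDeriv_zero_fun α, aestronglyMeasurable_zero, by simp⟩
  intro t ht
  exact ⟨⟨0, le_rfl, h le_rfl⟩, fun ε hε => .of_forall fun r => by simpa using h hε.le⟩

lemma sum {σ : Type*} (s : Finset σ) {F : σ → ℝ → X N → ℝ}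
    (h : ∀ a ∈ s, CT K d T (F a)) : CT K d T (fun t x => ∑ a ∈ s, F a t x) := by
  classical
  induction s using cons_induction with
  | empty => simpa using zero
  | cons a t ha ih =>
    simp only [sum_cons]
    exact (h a (by simp)).add (ih fun b hb => h b (by simp [hb]))

lemma mul (hF : CT K d₁ T F) (hG : CT K d₂ T G) : CT K (d₁ + d₂) T (fun t x => F t x * G t x) := by
  intro t ht
  obtain ⟨⟨C, hC, h1⟩, h2⟩ := hF t ht
  obtain ⟨⟨C', hC', h1'⟩, h2'⟩ := hG t ht
  refine ⟨⟨_, by positivity, h1.mul h1' hC hC'⟩, fun ε hε => ?_⟩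
  set L : ℝ := 2 ^ K * (C + C' + 1)
  have hL : 0 < L := by positivity
  set η := min 1 (ε / L)
  have hη : 0 < η := lt_min one_pos (by positivity)
  have hη1 : η ≤ 1 := min_le_left _ _
  have hη2 : L * η ≤ ε := by
    have : η ≤ ε / L := min_le_right _ _
    rwa [le_div_iff₀ hL, mul_comm] at this
  filter_upwards [h2 η hη, h2' η hη] with r hr hr'
  have p := ((hr.mul hr' hη.le hη.le).add (hr.mul h1' hη.le hC') (by positivity)
    (by positivity)).add (h1.mul hr' hC hη.le) (by positivity) (by positivity)
  refine JB.congr (p.monoC (?_ : _ ≤ ε)) (.of_forall fun x => by simp only; ring)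
  refine le_trans ?_ hη2
  have : η * η ≤ η := by nlinarith
  have h2K : (0 : ℝ) < 2 ^ K := by positivity
  calc _ = 2 ^ K * (η * η + η * C' + C * η) := by ring
    _ ≤ 2 ^ K * (η + η * C' + C * η) := by gcongr
    _ = L * η := by simp only [L]; ring

lemma isWeak (hF : CT K d T F) {γ : Fin N → ℕ} (hK : d + len γ ≤ K) {t : ℝ} (ht : t ∈ Icc 0 T) :
    IsWeakDeriv γ (F t) (weakDeriv γ (F t)) := by
  obtain ⟨⟨C, hC, h1⟩, -⟩ := hF t ht
  exact h1.isWeak hK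

lemma deriv (hF : CT K d T F) (γ : Fin N → ℕ) :
    CT K (d + len γ) T (fun t => weakDeriv γ (F t)) := by
  rcases Nat.lt_or_ge K (d + len γ) with hK | hK
  · intro t ht
    exact ⟨⟨0, le_rfl, JB.intro fun α s hs => absurd hs.1 (by omega)⟩, fun ε hε =>
      .of_forall fun r => JB.intro fun α s hs => absurd hs.1 (by omega)⟩
  intro t ht
  obtain ⟨⟨C, hC, h1⟩, h2⟩ := hF t ht
  refine ⟨⟨C, hC, h1.deriv γ⟩, fun ε hε => ?_⟩
  filter_upwards [h2 ε hε, eventually_mem_Icc t] with r hr hrI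
  exact JB.congr (hr.deriv γ) ((hF.isWeak hK hrI).sub (hF.isWeak hK ht)).ae_eq

lemma memLp (hF : CT K d T F) {α : Fin N → ℕ} (h1 : 1 ≤ d + len α) (hK : d + len α ≤ K)
    {t : ℝ} (ht : t ∈ Icc 0 T) : MemLp (weakDeriv α (F t)) 2 := by
  obtain ⟨⟨C, hC, h⟩, -⟩ := hF t ht
  exact h.memLp h1 hK

lemma cLp (hF : CT K d T F) {α : Fin N → ℕ} (h1 : 1 ≤ d + len α) (hK : d + len α ≤ K) :
    CLp 1 T (fun t => weakDeriv α (F t)) := by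
  intro t ht
  refine ⟨by rw [ex_one]; exact hF.memLp h1 hK ht, fun ε hε => ?_⟩
  filter_upwards [(hF t ht).2 ε hε, eventually_mem_Icc t] with r hr hrI
  exact (hr.bd_one h1 hK).congr ((hF.isWeak hK hrI).sub (hF.isWeak hK ht)).ae_eq

lemma zero_ae (hF : CT K d T F) (hK : d ≤ K) {t : ℝ} (ht : t ∈ Icc 0 T) :
    weakDeriv 0 (F t) =ᵐ[volume] F t := by
  obtain ⟨⟨C, hC, h⟩, -⟩ := hF t ht
  exact h.zero_ae hK

lemma cLp_zero (hF : CT K d T F) (h1 : 1 ≤ d) (hK : d ≤ K) : CLp 1 T F :=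
  (hF.cLp (α := 0) (by simpa using h1) (by simpa using hK)).congr fun _ ht => hF.zero_ae hK ht

lemma locL2 (hF : CT K d T F) {α : Fin N → ℕ} (hα : d + len α ≤ K) {t : ℝ} (ht : t ∈ Icc 0 T) :
    LocL2 (weakDeriv α (F t)) := by
  obtain ⟨⟨C, hC, h⟩, -⟩ := hF t ht
  rcases eq_zero_or_pos (d + len α) with h0 | h0
  · exact JB.locL2 h (DT_subset _ _) (s := 0) ⟨hα, by rw [h0]; simp, zero_le_one, fun _ => rfl⟩
  · exact JB.locL2 h (DT_subset _ _) (s := 1) (one_mem_DT hα h0)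

lemma isWeakDeriv_mul (hF : CT K d₁ T F) (hG : CT K d₂ T G) (hK : d₁ + d₂ + 1 ≤ K) {t : ℝ}
    (ht : t ∈ Icc 0 T) (i : Fin N) : IsWeakDeriv (single i 1) (fun x => F t x * G t x)
      (fun x => weakDeriv (single i 1) (F t) x * G t x +
        F t x * weakDeriv (single i 1) (G t) x) := by
  exact (hF.isWeak (by simp; omega) ht).mul_weakDeriv (hG.isWeak (by simp; omega) ht)
    (hF.locL2 (by simp; omega) ht) (hF.locL2 (by simp; omega) ht)
    (hG.locL2 (by simp; omega) ht) (hG.locL2 (by simp; omega) ht)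

lemma zero_one (hF : CT K 0 T F) (h2 : CLp 1 T F) : CT K 1 T F := by
  intro t ht
  obtain ⟨⟨C, hC, h⟩, hε⟩ := hF t ht
  refine ⟨⟨_, by have := nr_nonneg 1 (F t); positivity,
    h.zero_one (bd_nr (h2 t ht).1) hC (nr_nonneg _ _)⟩, fun ε hε' => ?_⟩
  filter_upwards [hε (ε / 2) (by positivity), (h2 t ht).2 (ε / 2) (by positivity)] with r h3 h4
  have := h3.zero_one h4 (by positivity) (by positivity)
  rwa [add_halves] at this

lemma base (hW : ∀ t ∈ Icc 0 T, W K (F t)) (h0 : CLp 0 T F)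
    (h1 : ∀ α : Fin N → ℕ, 1 ≤ len α → len α ≤ K → CLp 1 T (fun t => weakDeriv α (F t))) :
    CT K 0 T F := by
  obtain ⟨C, hC, hb⟩ := UT.base (N := N) (K := K)
    (ι := {p : (X N → ℝ) × ℝ // 0 ≤ p.2 ∧ W K p.1 ∧ Bd 0 p.1 p.2 ∧
      ∀ α : Fin N → ℕ, 1 ≤ len α → len α ≤ K → Bd 1 (weakDeriv α p.1) p.2})
    (A := fun _ => 1) (B := fun p => p.1.2) (f := fun p => p.1.1) (fun _ => le_rfl)
    (fun p => p.2.1) (fun p => p.2.2.1) (fun p => p.2.2.2.1)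
    (fun p α h1 h2 => by simpa using p.2.2.2.2 α h1 h2)
  have hb' : ∀ (f : X N → ℝ) (B : ℝ), 0 ≤ B → W K f → Bd 0 f B →
      (∀ α : Fin N → ℕ, 1 ≤ len α → len α ≤ K → Bd 1 (weakDeriv α f) B) → JT K 0 (C * B) f := by
    intro f B p1 p2 p3 p4
    have := hb ⟨(f, B), p1, p2, p3, p4⟩
    simpa [JT] using this
  intro t ht
  have hfin : {α : Fin N → ℕ | len α ≤ K}.Finite := by
    refine Set.Finite.subset (Set.finite_Icc (0 : Fin N → ℕ) fun _ => K) fun α hα => ⟨?_, ?_⟩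
    · intro i; exact Nat.zero_le _
    · intro i
      exact (single_le_sum (f := α) (fun _ _ => Nat.zero_le _) (Finset.mem_univ i)).trans hα
  constructor
  · set B : ℝ := nr 0 (F t) + ∑ α ∈ hfin.toFinset, nr 1 (weakDeriv α (F t))
    have hs : ∀ α ∈ hfin.toFinset, nr 1 (weakDeriv α (F t)) ≤ B := fun α hα => by
      have := single_le_sum (f := fun α => nr 1 (weakDeriv α (F t)))
        (fun _ _ => nr_nonneg _ _) hα
      have h0 := nr_nonneg 0 (F t)
      simp only [B]
      linarith
    have hB0 : nr 0 (F t) ≤ B := by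
      have := sum_nonneg (s := hfin.toFinset) (f := fun α => nr 1 (weakDeriv α (F t)))
        fun _ _ => nr_nonneg _ _
      simp only [B]
      linarith
    have hB := (nr_nonneg _ _).trans hB0
    exact ⟨C * B, by positivity, hb' _ _ hB (hW t ht) ((bd_nr (h0 t ht).1).mono hB0)
      fun α h3 h4 => (bd_nr (h1 α h3 h4 t ht).1).mono (hs α (by simpa using h4))⟩
  · intro ε hε
    set η := ε / (C + 1)
    have hη : 0 < η := by positivity
    have hev : ∀ᶠ r in 𝓝[Icc 0 T] t, ∀ α ∈ hfin.toFinset, 1 ≤ len α →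
        Bd 1 (fun x => weakDeriv α (F r) x - weakDeriv α (F t) x) η := by
      rw [Filter.eventually_all_finset]
      intro α hα
      by_cases h3 : 1 ≤ len α
      · filter_upwards [(h1 α h3 (by simpa using hα) t ht).2 η hη] with r hr _
        exact hr
      · exact .of_forall fun r h => absurd h h3
    filter_upwards [hev, (h0 t ht).2 η hη, eventually_mem_Icc t] with r hr h0r hrI
    have hsub : ∀ α : Fin N → ℕ, len α ≤ K → IsWeakDeriv α (fun x => F r x - F t x)
        (fun x => weakDeriv α (F r) x - weakDeriv α (F t) x) := fun α hα =>
      ((hW r hrI).isWeak hα).sub ((hW t ht).isWeak hα)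
    have hb1 : ∀ α : Fin N → ℕ, 1 ≤ len α → len α ≤ K →
        Bd 1 (weakDeriv α (fun x => F r x - F t x)) η := fun α h3 h4 =>
      (hr α (by simpa using h4) h3).congr (hsub α h4).ae_eq.symm
    refine (hb' _ η hη.le ⟨?_, fun α h3 h4 => ⟨_, hsub α h4, ?_⟩⟩ h0r hb1).monoC ?_
    · have := h0r.memLp
      rwa [ex_zero] at this
    · have := (hr α (by simpa using h4) h3).memLp
      rwa [ex_one] at this
    · simp only [η]
      rw [mul_div_assoc', div_le_iff₀ (by positivity)]
      nlinarith

end CT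

end

section

variable {N : ℕ} {F : Type*} [NormedAddCommGroup F] [NormedSpace ℝ F]

lemma IsWeakDeriv.proj [CompleteSpace F] {ι : Type*} [Fintype ι] {α : Fin N → ℕ}
    {f g : X N → PiLp 2 (fun _ : ι => F)}
    (h : IsWeakDeriv α f g) (i : ι) : IsWeakDeriv α (fun x => f x i) (fun x => g x i) :=
  h.clm_comp (PiLp.proj 2 (fun _ : ι => F) (𝕜 := ℝ) i)

/-- The inclusion of the `i`-th coordinate. -/
noncomputable def inclusionL {ι : Type*} [Fintype ι] [DecidableEq ι] (F : Type*)
    [NormedAddCommGroup F] [NormedSpace ℝ F] (i : ι) : F →L[ℝ] PiLp 2 (fun _ : ι => F) :=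
  (PiLp.continuousLinearEquiv 2 ℝ (fun _ : ι => F)).symm.toContinuousLinearMap.comp
    (ContinuousLinearMap.single ℝ (fun _ : ι => F) i)

lemma inclusionL_apply {ι : Type*} [Fintype ι] [DecidableEq ι] (i j : ι) (a : F) :
    inclusionL F i a j = if j = i then a else 0 := by
  simp [inclusionL]

lemma isWeakDeriv_toLp [CompleteSpace F] {ι : Type*} [Fintype ι] {α : Fin N → ℕ}
    {f g : ι → X N → F} (h : ∀ i, IsWeakDeriv α (f i) (g i)) :
    IsWeakDeriv α (fun x => (toLp 2 fun i => f i x : PiLp 2 (fun _ : ι => F)))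
      (fun x => toLp 2 fun i => g i x) := by
  classical
  have hs := IsWeakDeriv.sum univ fun i _ => (h i).clm_comp (inclusionL F i)
  have e : ∀ f : ι → X N → F, (∑ i, fun x => inclusionL F i (f i x)) =
      fun x => (toLp 2 fun i => f i x : PiLp 2 (fun _ : ι => F)) := by
    intro f
    funext x
    ext j
    simp [Finset.sum_apply, inclusionL_apply]
  rwa [e, e] at hs

lemma l2norm_proj_le {ι G : Type*} [Fintype ι] [NormedAddCommGroup G]
    {f : X N → PiLp 2 (fun _ : ι => G)}
    (hf : MemLp f 2) (i : ι) : l2norm (fun x => f x i) ≤ l2norm f :=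
  toReal_mono hf.2.ne (eLpNorm_mono fun _ => PiLp.norm_apply_le _ i)

lemma MemLp.proj {ι : Type*} [Fintype ι] {f : X N → PiLp 2 (fun _ : ι => F)} {p : ℝ≥0∞}
    (hf : MemLp f p) (i : ι) : MemLp (fun x => f x i) p :=
  (PiLp.proj 2 (fun _ : ι => F) (𝕜 := ℝ) i).comp_memLp' hf

lemma l2norm_le_hnorm {s : ℕ} (f : X N → F) {α : Fin N → ℕ} (hα : len α ≤ s) :
    l2norm (weakDeriv α f) ≤ hnorm s f := by
  refine le_sqrt_of_sq_le ?_
  refine le_trans ?_ (single_le_sum (f := fun r => ∑ α ∈ multiIdx N r,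
    l2norm (weakDeriv α f) ^ 2) (fun r _ => sum_nonneg fun _ _ => sq_nonneg _)
    (Finset.mem_range.2 (Nat.lt_succ_of_le hα)))
  exact single_le_sum (f := fun α => l2norm (weakDeriv α f) ^ 2)
    (fun _ _ => sq_nonneg _) (mem_multiIdx.2 rfl)

lemma nr_one_eq (f : X N → ℝ) : nr 1 f = l2norm f := by rw [nr, ex_one, l2norm]

lemma nr_zero_eq (f : X N → ℝ) : nr 0 f = linfnorm f := by rw [nr, ex_zero, linfnorm]

lemma memH_grad_weak {s : ℕ} {v : X N → V} (hg : HasWeakGrad v) (h : MemH s (grad v))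
    {β : Fin N → ℕ} (hβ : len β ≤ s) (i : Fin N) (a : Fin 3) :
    IsWeakDeriv (single i 1 + β) (comp a v) (fun x => weakDeriv β (grad v) x i a) ∧
      MemLp (weakDeriv β (grad v)) 2 := by
  obtain ⟨g, h1, h2⟩ := h _ hβ β (mem_multiIdx.2 rfl)
  have h3 := (h1.spec.proj i).proj a
  obtain ⟨q, hq⟩ := hg i
  exact ⟨(hq.spec.proj a).trans h3, h2.ae_eq h1.ae_eq.symm⟩

lemma MemE.w {k : ℕ} {v : X N → V} (h : MemE (k + 1) v) (a : Fin 3) : W (k + 1) (comp a v) where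
  bdd := by
    refine ⟨((h.1.locallyIntegrable.clm_comp (PiLp.proj 2 (fun _ : Fin 3 => ℝ) (𝕜 := ℝ) a))
      ).aestronglyMeasurable, ?_⟩
    rw [eLpNorm_exponent_top]
    refine (eLpNormEssSup_le_of_ae_bound (C := 1) ?_).trans_lt ENNReal.ofReal_lt_top
    filter_upwards [h.2] with x hx
    exact (PiLp.norm_apply_le (v x) a).trans hx.le
  deriv α h1 h2 := by
    obtain ⟨β, i, rfl, hβ⟩ := exists_eq_add_single (show len α = (len α - 1) + 1 by omega)
    have := memH_grad_weak h.1.hasWeakGrad h.1.grad_mem (β := β)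
      (by simp only [len_add, len_single] at h2; omega) i a
    rw [add_comm]
    exact ⟨_, this.1, MemLp.proj (MemLp.proj this.2 i) a⟩

lemma W.l2norm_weakDeriv_le {k : ℕ} {f : X N → ℝ} (hf : W (k + 1) f) {β : Fin N → ℕ} {i : Fin N}
    (hβ : len β ≤ k) : l2norm (weakDeriv (single i 1 + β) f) ≤ hnorm k (grad f) := by
  have h1 : ∀ i, IsWeakDeriv β (wpartial i f) (weakDeriv (single i 1 + β) f) := fun i =>
    (hf.isWeak (by simp)).of_add (hf.isWeak (by simp; omega))
  have h2 : MemLp (fun x => (toLp 2 fun i => weakDeriv (single i 1 + β) f x :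
      PiLp 2 (fun _ : Fin N => ℝ))) 2 volume :=
    MemLp.of_eval_piLp fun i => hf.memLp (by simp) (by simp; omega)
  have h3 : weakDeriv β (grad f) =ᵐ[volume] _ := (isWeakDeriv_toLp h1).ae_eq
  calc _ = l2norm (fun x => (toLp 2 fun i => weakDeriv (single i 1 + β) f x :
        PiLp 2 (fun _ : Fin N => ℝ)) i) := rfl
    _ ≤ _ := l2norm_proj_le h2 i
    _ = l2norm (weakDeriv β (grad f)) := by rw [l2norm, l2norm, eLpNorm_congr_ae h3]
    _ ≤ _ := l2norm_le_hnorm _ hβ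

end

section

variable {N : ℕ}

/-- The components of a curve of maps. -/
def cmp (m : ℝ → X N → V) (a : Fin 3) (t : ℝ) : X N → ℝ := comp a (m t)

/-- The constants of the anisotropy. -/
def lam (l1 l3 : ℝ) : Fin 3 → ℝ := ![l1, 0, l3]

lemma cross_apply (a b : V) (i : Fin 3) :
    cross a b i = a (i + 1) * b (i + 2) - a (i + 2) * b (i + 1) := by
  rw [cross, _root_.cross_apply]
  fin_cases i <;> rfl

lemma aniso_apply (l1 l3 : ℝ) (a : V) (i : Fin 3) : aniso l1 l3 a i = lam l1 l3 i * a i := by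
  fin_cases i <;> simp [aniso, lam]

/-- Time-dependent maps into `ℝ³`, in components. -/
abbrev Flow (N : ℕ) := Fin 3 → ℝ → X N → ℝ

/-- A solution of the Landau–Lifshitz equation, in terms of its components. -/
structure Sol (l1 l3 : ℝ) (K : ℕ) (T : ℝ) (m dm : Flow N) : Prop where
  w : ∀ a, ∀ t ∈ Icc 0 T, W K (m a t)
  ct : ∀ a, CT K 0 T (m a)
  sphere : ∀ t ∈ Icc 0 T, ∀ᵐ x, ∑ a, m a t x ^ 2 = 1
  l2 : ∀ a ≠ 1, CLp 1 T (m a)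
  gradInf : ∀ a i, CLp 0 T (fun t => weakDeriv (single i 1) (m a t))
  dmInf : ∀ a, CLp 0 T (dm a)
  td : ∀ a, TD T (m a) (dm a)
  jct : ∀ a, CT K 1 T (fun t x => lam l1 l3 a * m a t x)
  dct : ∀ a, CT K 2 T (dm a)
  eqn : ∀ t ∈ Icc 0 T, ∀ a, ∀ᵐ x, dm a t x =
    -(m (a + 1) t x * ((∑ i, weakDeriv (single i 2) (m (a + 2) t) x) -
        lam l1 l3 (a + 2) * m (a + 2) t x) -
      m (a + 2) t x * ((∑ i, weakDeriv (single i 2) (m (a + 1) t) x) -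
        lam l1 l3 (a + 1) * m (a + 1) t x))

lemma bd_of_l2norm_le {f : X N → ℝ} (hf : MemLp f 2) {ε : ℝ} (h : l2norm f ≤ ε) :
    Bd 1 f ε := (bd_one_of_memLp hf).mono h

lemma bd_of_linfnorm_le {f : X N → ℝ} (hf : MemLp f ⊤) {ε : ℝ} (h : linfnorm f ≤ ε) : Bd 0 f ε := by
  have hf' : MemLp f (ex 0) := by rwa [ex_zero]
  exact (bd_nr hf').mono (by rwa [nr_zero_eq])

lemma hnorm_nonneg {F : Type*} [NormedAddCommGroup F] [NormedSpace ℝ F] (s : ℕ) (f : X N → F) :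
    0 ≤ hnorm s f := Real.sqrt_nonneg _

lemma le_znorm (k : ℕ) (v : X N → V) : hnorm k (comp 0 v) ≤ znorm k v ∧
    linfnorm (comp 1 v) ≤ znorm k v ∧ hnorm (k - 1) (grad (comp 1 v)) ≤ znorm k v ∧
    hnorm k (comp 2 v) ≤ znorm k v := by
  refine ⟨?_, ?_, ?_, ?_⟩ <;> refine le_sqrt_of_sq_le ?_ <;>
    nlinarith [sq_nonneg (hnorm k (comp 0 v)), sq_nonneg (linfnorm (comp 1 v)),
      sq_nonneg (hnorm (k - 1) (grad (comp 1 v))), sq_nonneg (hnorm k (comp 2 v))]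

lemma cLp_zero_of_sobolev {s : ℕ} {T : ℝ} (hs : N < 2 * s) {F : ℝ → X N → ℝ} (h0 : CLp 1 T F)
    (hw : ∀ t ∈ Icc 0 T, ∀ i j, j ≤ s → IsWeakDeriv (single i j) (F t)
      (weakDeriv (single i j) (F t)) ∧ MemLp (weakDeriv (single i j) (F t)) 2)
    (hc : ∀ i, CLp 1 T (fun t => weakDeriv (single i s) (F t))) : CLp 0 T F := by
  obtain ⟨C, hC, hsob⟩ := sobolev_embedding hs
  intro t ht
  have hF : ∀ r ∈ Icc 0 T, MemLp (F r) 2 := fun r hr => by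
    have := (h0 r hr).1
    rwa [ex_one] at this
  refine ⟨(hsob (F t) (hF t ht) fun i j hj => ⟨_, hw t ht i j hj⟩).memLp, fun ε hε => ?_⟩
  set η := ε / (C * (1 + N) + 1)
  have hη : 0 < η := by positivity
  have hev : ∀ᶠ r in 𝓝[Icc 0 T] t, ∀ i ∈ (univ : Finset (Fin N)),
      Bd 1 (fun x => weakDeriv (single i s) (F r) x - weakDeriv (single i s) (F t) x) η := by
    rw [Filter.eventually_all_finset]
    exact fun i _ => (hc i t ht).2 η hη
  filter_upwards [hev, (h0 t ht).2 η hη, eventually_mem_Icc t] with r h1 h2 hrI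
  have hsub : ∀ i j, j ≤ s → IsWeakDeriv (single i j) (fun x => F r x - F t x)
      (fun x => weakDeriv (single i j) (F r) x - weakDeriv (single i j) (F t) x) :=
    fun i j hj => (hw r hrI i j hj).1.sub (hw t ht i j hj).1
  have hb := hsob (fun x => F r x - F t x) ((hF r hrI).sub (hF t ht)) fun i j hj =>
    ⟨_, hsub i j hj, (hw r hrI i j hj).2.sub (hw t ht i j hj).2⟩
  refine hb.mono ?_
  have e1 : nr 1 (fun x => F r x - F t x) ≤ η := h2.toReal_le hη.le
  have e2 : ∀ i ∈ (univ : Finset (Fin N)),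
      nr 1 (weakDeriv (single i s) (fun x => F r x - F t x)) ≤ η := fun i hi =>
    ((h1 i hi).congr (hsub i s le_rfl).ae_eq.symm).toReal_le hη.le
  have e3 := sum_le_sum e2
  simp only [Finset.sum_const, Finset.card_univ, Fintype.card_fin, nsmul_eq_mul] at e3
  have e4 : η * (C * (1 + N) + 1) = ε := by simp only [η]; field_simp
  calc _ ≤ C * (η + N * η) := by gcongr
    _ ≤ ε := by rw [← e4]; nlinarith

lemma eventually_znorm {k : ℕ} {T : ℝ} {m : ℝ → X N → V} (h : ContInE k T m) {t ε : ℝ}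
    (ht : t ∈ Icc 0 T) (hε : 0 < ε) : ∀ᶠ r in 𝓝[Icc 0 T] t, znorm k (m r - m t) < ε :=
  (h t ht).2.eventually (gt_mem_nhds hε)

lemma ContInE.cLp_deriv {k : ℕ} {T : ℝ} {m : ℝ → X N → V} (h : ContInE (k + 1) T m) (a : Fin 3)
    {α : Fin N → ℕ} (h1 : 1 ≤ len α) (h2 : len α ≤ k + 1) :
    CLp 1 T (fun t => weakDeriv α (cmp m a t)) := by
  intro t ht
  have hw := fun r hr => (h r hr).1.w a
  refine ⟨by rw [ex_one]; exact (hw t ht).memLp h1 h2, fun ε hε => ?_⟩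
  filter_upwards [eventually_znorm h ht hε, eventually_mem_Icc t] with r hr hrI
  have hsub : IsWeakDeriv α (comp a (m r - m t))
      (fun x => weakDeriv α (cmp m a r) x - weakDeriv α (cmp m a t) x) :=
    ((hw r hrI).isWeak h2).sub ((hw t ht).isWeak h2)
  have hl : l2norm (weakDeriv α (comp a (m r - m t))) ≤ znorm (k + 1) (m r - m t) := by
    obtain ⟨z0, -, z1, z2⟩ := le_znorm (k + 1) (m r - m t)
    fin_cases a
    · exact (l2norm_le_hnorm _ h2).trans z0
    · refine le_trans ?_ z1
      obtain ⟨β, i, rfl, hβ⟩ := exists_eq_add_single (show len α = (len α - 1) + 1 by omega)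
      rw [add_comm]
      refine W.l2norm_weakDeriv_le ⟨?_, fun γ g1 g2 => ?_⟩
        (by simp only [len_add, len_single] at h2; omega)
      · exact (hw r hrI).bdd.sub (hw t ht).bdd
      · exact ⟨_, ((hw r hrI).isWeak g2).sub ((hw t ht).isWeak g2),
          ((hw r hrI).memLp g1 g2).sub ((hw t ht).memLp g1 g2)⟩
    · exact (l2norm_le_hnorm _ h2).trans z2
  have hm : MemLp (weakDeriv α (comp a (m r - m t))) 2 :=
    (((hw r hrI).memLp h1 h2).sub ((hw t ht).memLp h1 h2)).ae_eq hsub.ae_eq.symm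
  exact (bd_of_l2norm_le hm (hl.trans hr.le)).congr hsub.ae_eq

lemma ContInE.cLp_comp {k : ℕ} {T : ℝ} {m : ℝ → X N → V} (h : ContInE (k + 1) T m) {a : Fin 3}
    (ha : a ≠ 1) : CLp 1 T (cmp m a) := by
  have hm : ∀ r ∈ Icc 0 T, MemLp (cmp m a r) 2 := by
    intro r hr
    fin_cases a
    · exact (h r hr).1.1.comp_one
    · exact absurd rfl ha
    · exact (h r hr).1.1.comp_three
  intro t ht
  refine ⟨by rw [ex_one]; exact hm t ht, fun ε hε => ?_⟩
  filter_upwards [eventually_znorm h ht hε, eventually_mem_Icc t] with r hr hrI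
  have hd : MemLp (comp a (m r - m t)) 2 := (hm r hrI).sub (hm t ht)
  have e0 : weakDeriv 0 (comp a (m r - m t)) =ᵐ[volume] comp a (m r - m t) :=
    (isWeakDeriv_zero (hd.locInt (by norm_num))).ae_eq
  have hl : l2norm (weakDeriv 0 (comp a (m r - m t))) ≤ znorm (k + 1) (m r - m t) := by
    obtain ⟨z0, -, -, z2⟩ := le_znorm (k + 1) (m r - m t)
    fin_cases a
    · exact (l2norm_le_hnorm _ (by simp)).trans z0
    · exact absurd rfl ha
    · exact (l2norm_le_hnorm _ (by simp)).trans z2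
  exact (bd_of_l2norm_le (hd.ae_eq e0.symm) (hl.trans hr.le)).congr e0

lemma ContInE.cLp_zero {k : ℕ} {T : ℝ} {m : ℝ → X N → V} (h : ContInE (k + 1) T m) (hk : 1 ≤ k)
    (hN : N < 2 * k) (a : Fin 3) : CLp 0 T (cmp m a) := by
  by_cases ha : a = 1
  · subst ha
    intro t ht
    have hm : ∀ r ∈ Icc 0 T, MemLp (cmp m 1 r) ⊤ := fun r hr => (h r hr).1.1.comp_two
    refine ⟨by rw [ex_zero]; exact hm t ht, fun ε hε => ?_⟩
    filter_upwards [eventually_znorm h ht hε, eventually_mem_Icc t] with r hr hrI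
    have hd : MemLp (comp 1 (m r - m t)) ⊤ := (hm r hrI).sub (hm t ht)
    exact bd_of_linfnorm_le hd ((le_znorm (k + 1) (m r - m t)).2.1.trans hr.le)
  · refine cLp_zero_of_sobolev hN (h.cLp_comp ha) (fun t ht i j hj => ?_) fun i =>
      h.cLp_deriv a (by simpa using hk) (by simp)
    have hw := (h t ht).1.w a
    refine ⟨hw.isWeak (by simp; omega), ?_⟩
    rcases eq_zero_or_pos j with rfl | hj0
    · have h2 := (h.cLp_comp ha t ht).1
      rw [ex_one] at h2
      rw [Pi.single_zero]
      exact h2.ae_eq hw.weakDeriv_zero_ae.symm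
    · exact hw.memLp (by rw [len_single]; exact hj0) (by simp; omega)

lemma ContInE.ct {k : ℕ} {T : ℝ} {m : ℝ → X N → V} (h : ContInE (k + 1) T m) (hk : 1 ≤ k)
    (hN : N < 2 * k) (a : Fin 3) : CT (k + 1) 0 T (cmp m a) :=
  CT.base (fun t ht => (h t ht).1.w a) (h.cLp_zero hk hN a) fun _ h1 h2 => h.cLp_deriv a h1 h2

lemma CT.cLp_zero_of_sobolev {k d : ℕ} {T : ℝ} {F : ℝ → X N → ℝ} (h : CT (k + 1) d T F)
    (hN : N < 2 * (k - 1)) (h1 : 1 ≤ d) (h2 : d ≤ 2) : CLp 0 T F := by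
  refine LandauLifshitz.cLp_zero_of_sobolev hN (h.cLp_zero h1 (by omega)) (fun t ht i j hj => ?_)
    fun i => h.cLp (by simp; omega) (by simp; omega)
  exact ⟨h.isWeak (by simp; omega) ht, h.memLp (by simp; omega) (by simp; omega) ht⟩

lemma IsLLSolution.lap_comp {l1 l3 : ℝ} {k : ℕ} {T : ℝ} {m dm : ℝ → X N → V} (hk : 1 ≤ k)
    (h : IsLLSolution l1 l3 k T m dm) {t : ℝ} (ht : t ∈ Icc 0 T) (a : Fin 3) :
    ∀ᵐ x, lap (m t) x a = ∑ i, weakDeriv (single i 2) (cmp m a t) x := by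
  have hw := fun b => (h.cont t ht).1.w b
  have : ∀ i : Fin N, ∀ᵐ x, weakDeriv (single i 2) (m t) x a =
      weakDeriv (single i 2) (cmp m a t) x := by
    intro i
    have h1 := isWeakDeriv_toLp fun b => (hw b).isWeak (α := single i 2) (by simp; omega)
    have e : (fun x => (toLp 2 fun b => comp b (m t) x : V)) = m t := by
      funext x; ext b; rfl
    rw [e] at h1
    filter_upwards [h1.ae_eq] with x hx
    rw [hx]
    rfl
  filter_upwards [ae_all_iff.2 this] with x hx
  rw [lap, ← sum_congr rfl fun i _ => hx i]
  exact map_sum (PiLp.proj 2 (fun _ : Fin 3 => ℝ) (𝕜 := ℝ) a) _ _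

lemma IsLLSolution.sol {l1 l3 : ℝ} {k : ℕ} {T : ℝ} {m dm : ℝ → X N → V} (hk : 2 ≤ k)
    (hN : N < 2 * (k - 1)) (h : IsLLSolution l1 l3 k T m dm) :
    Sol l1 l3 (k + 1) T (cmp m) (cmp dm) := by
  have ct := fun a => h.cont.ct (by omega) (by omega) a
  have l2 : ∀ a ≠ 1, CLp 1 T (cmp m a) := fun a ha => h.cont.cLp_comp ha
  have eqn : ∀ t ∈ Icc 0 T, ∀ a, ∀ᵐ x, cmp dm a t x =
    -(cmp m (a + 1) t x * ((∑ i, weakDeriv (single i 2) (cmp m (a + 2) t) x) -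
        lam l1 l3 (a + 2) * cmp m (a + 2) t x) -
      cmp m (a + 2) t x * ((∑ i, weakDeriv (single i 2) (cmp m (a + 1) t) x) -
        lam l1 l3 (a + 1) * cmp m (a + 1) t x)) := by
    intro t ht a
    filter_upwards [h.eqn t ht, h.lap_comp (by omega) ht (a + 1), h.lap_comp (by omega) ht (a + 2)]
      with x h1 h2 h3
    have h4 := congrArg (fun v : V => v a) h1
    simp only [PiLp.add_apply, PiLp.zero_apply, cross_apply, PiLp.sub_apply,
      aniso_apply, h2, h3] at h4
    simp only [cmp, comp] at h4 ⊢
    linarith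
  have Jct : ∀ a, CT (k + 1) 1 T (fun t x => lam l1 l3 a * cmp m a t x) := by
    intro a
    by_cases ha : a = 1
    · subst ha
      have : CT (k + 1) 1 T (fun _ (_ : X N) => (0 : ℝ)) := by
        have h0 := ((ct 0).zero_one (l2 0 (by decide))).const_mul 0
        simpa using h0
      simpa [lam] using this
    · exact ((ct a).zero_one (l2 a ha)).const_mul _
  have hLap : ∀ a, CT (k + 1) 2 T (fun t x => ∑ i, weakDeriv (single i 2) (cmp m a t) x) := by
    intro a
    refine CT.sum univ fun i _ => ?_
    simpa using (ct a).deriv (single i 2)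
  have dct : ∀ a, CT (k + 1) 2 T (cmp dm a) := by
    intro a
    have hq : ∀ b, CT (k + 1) 2 T (fun t x => (∑ i, weakDeriv (single i 2) (cmp m b t) x) -
        lam l1 l3 b * cmp m b t x) := fun b =>
      (hLap b).sub ((Jct b).mono le_rfl (by norm_num))
    have h1 := ((ct (a + 1)).mul (hq (a + 2))).sub ((ct (a + 2)).mul (hq (a + 1)))
    rw [zero_add] at h1
    exact h1.neg.congr fun t ht => by
      filter_upwards [eqn t ht a] with x hx
      rw [hx]
  exact
    { w := fun a t ht => (h.cont t ht).1.w a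
      ct := ct
      sphere := fun t ht => by
        filter_upwards [(h.cont t ht).1.2] with x hx
        have := EuclideanSpace.norm_sq_eq (m t x)
        rw [hx] at this
        simp only [norm_eq_abs, sq_abs, one_pow] at this
        exact this.symm
      l2 := l2
      gradInf := fun a i =>
        CT.cLp_zero_of_sobolev ((ct a).deriv (single i 1)) hN (by simp) (by simp)
      dmInf := fun a => (dct a).cLp_zero_of_sobolev hN (by norm_num) le_rfl
      td := fun a φ hφ t ht => by
        have h1 := h.timeDeriv φ hφ t ht
        have h2 := (PiLp.proj 2 (fun _ : Fin 3 => ℝ) (𝕜 := ℝ) a).hasFDerivAt.comp_hasDerivWithinAt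
          t h1
        have hi : ∀ f : X N → V, LocallyIntegrable f →
            (∫ x, φ x • f x) a = ∫ x, φ x * comp a f x := by
          intro f hf
          exact ((PiLp.proj 2 (fun _ : Fin 3 => ℝ) (𝕜 := ℝ) a).integral_comp_comm
            (hφ.integrable_smul hf)).symm
        have hd : LocallyIntegrable (dm t) := by
          obtain ⟨g, hg, -⟩ := (h.timeDeriv_cont t ht).1 0 (Nat.zero_le _) 0
            (mem_multiIdx.2 (by simp))
          exact hg.1
        have h3 : HasDerivWithinAt (fun s => ∫ x, φ x * cmp m a s x) ((∫ x, φ x • dm t x) a)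
            (Icc 0 T) t := HasDerivWithinAt.congr_of_mem h2
            (fun s hs => (hi _ (h.cont s hs).1.1.locallyIntegrable).symm) ht
        rwa [hi _ hd] at h3
      jct := Jct
      dct := dct
      eqn := eqn }

end

section

lemma sum_fin_three (a : Fin 3) (f : Fin 3 → ℝ) : ∑ b, f b = f a + f (a + 1) + f (a + 2) := by
  fin_cases a
  · simp [Fin.sum_univ_three]
  · rw [Fin.sum_univ_three]; change _ = f 1 + f 2 + f 0; ring
  · rw [Fin.sum_univ_three]; change _ = f 2 + f 0 + f 1; ring

lemma add_one_one (a : Fin 3) : a + 1 + 1 = a + 2 := by fin_cases a <;> rfl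
lemma add_one_two (a : Fin 3) : a + 1 + 2 = a := by fin_cases a <;> rfl
lemma add_two_one (a : Fin 3) : a + 2 + 1 = a := by fin_cases a <;> rfl
lemma add_two_two (a : Fin 3) : a + 2 + 2 = a + 1 := by fin_cases a <;> rfl

end

section

variable {N : ℕ}

lemma isWeakDeriv_const (c : ℝ) (i : Fin N) : IsWeakDeriv (single i 1) (fun _ : X N => c) 0 := by
  rw [isWeakDeriv_single_iff]
  refine ⟨continuous_const.locallyIntegrable, continuous_const.locallyIntegrable, fun φ hφ => ?_⟩
  have h1 : Integrable (partialDeriv i φ) volume :=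
    (hφ.partialDeriv i).continuous.integrable_of_hasCompactSupport (hφ.partialDeriv i).2
  have := integral_mul_fderiv_eq_neg_fderiv_mul_of_integrable (μ := volume) (f := fun _ : X N => c)
    (g := φ) (v := EuclideanSpace.single i 1) (by simp) (h1.const_mul c)
    ((hφ.continuous.integrable_of_hasCompactSupport hφ.2).const_mul c)
    (fun x _ => differentiableAt_const c) fun x _ => hφ.differentiable x
  simpa [partialDeriv, mul_comm c] using this

end

noncomputable section

variable {N K : ℕ} {T l1 l3 : ℝ}

/-- The components of the derivative `∂_i m`. -/
def pd (m : Flow N) (i : Fin N) (a : Fin 3) (t : ℝ) : X N → ℝ := weakDeriv (single i 1) (m a t)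

/-- The components of the Laplacian. -/
def lapc (m : Flow N) (a : Fin 3) (t : ℝ) : X N → ℝ :=
  fun x => ∑ i, weakDeriv (single i 2) (m a t) x

/-- The components of the vector product. -/
def crs (f g : Flow N) (a : Fin 3) (t : ℝ) : X N → ℝ :=
  fun x => f (a + 1) t x * g (a + 2) t x - f (a + 2) t x * g (a + 1) t x

/-- The function `|∇m|²`. -/
def gg (m : Flow N) (t : ℝ) : X N → ℝ := fun x => ∑ i, ∑ a, pd m i a t x * pd m i a t x

/-- The function `⟨m, Jm⟩`. -/
def om (l1 l3 : ℝ) (m : Flow N) (t : ℝ) : X N → ℝ := fun x => ∑ a, lam l1 l3 a * m a t x * m a t x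

/-- The function `⟨Δm, ∂_i m⟩`. -/
def ss (m : Flow N) (i : Fin N) (t : ℝ) : X N → ℝ := fun x => ∑ a, lapc m a t x * pd m i a t x

/-- The function `∂_i |∇m|² + 2 ⟨Δm, ∂_i m⟩`. -/
def qq (m : Flow N) (i : Fin N) (t : ℝ) : X N → ℝ :=
  fun x => weakDeriv (single i 1) (gg m t) x + 2 * ss m i t x

/-- The difference between the time derivative of `m × ∂_i m` and `∂_i Δm`. -/
def yy (l1 l3 : ℝ) (m : Flow N) (i : Fin N) (a : Fin 3) (t : ℝ) : X N → ℝ :=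
  fun x => qq m i t x * m a t x + gg m t x * pd m i a t x - lam l1 l3 a * pd m i a t x +
    om l1 l3 m t x * pd m i a t x

lemma CT.cLp_inf {d : ℕ} {F : ℝ → X N → ℝ} (hF : CT K d T F) (h1 : 1 ≤ d) (hK : d ≤ K) :
    ∀ t ∈ Icc 0 T, MemLp (F t) 2 := fun t ht => by
  have := (hF.cLp_zero h1 hK t ht).1
  rwa [ex_one] at this

lemma CT.add_weakDeriv {d : ℕ} {F : ℝ → X N → ℝ} (hF : CT K d T F) {α β : Fin N → ℕ}
    (hK : d + len (α + β) ≤ K) {t : ℝ} (ht : t ∈ Icc 0 T) :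
    weakDeriv β (weakDeriv α (F t)) =ᵐ[volume] weakDeriv (α + β) (F t) := by
  simp only [len_add] at hK
  exact ((hF.isWeak (by omega) ht).of_add (hF.isWeak (by simp; omega) ht)).ae_eq

namespace Sol

variable {m dm : Flow N}

lemma pd_ct (h : Sol l1 l3 K T m dm) (i : Fin N) (a : Fin 3) : CT K 1 T (pd m i a) := by
  have := (h.ct a).deriv (single i 1)
  rw [len_single, zero_add] at this
  exact this

lemma lapc_ct (h : Sol l1 l3 K T m dm) (a : Fin 3) : CT K 2 T (lapc m a) :=
  CT.sum univ fun i _ => by simpa using (h.ct a).deriv (single i 2)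

lemma gg_ct (h : Sol l1 l3 K T m dm) : CT K 2 T (gg m) :=
  CT.sum univ fun i _ => CT.sum univ fun a _ => (h.pd_ct i a).mul (h.pd_ct i a)

lemma om_ct (h : Sol l1 l3 K T m dm) : CT K 0 T (om l1 l3 m) :=
  CT.sum univ fun a _ => ((h.ct a).const_mul _).mul (h.ct a)

lemma ss_ct (h : Sol l1 l3 K T m dm) (i : Fin N) : CT K 3 T (ss m i) :=
  CT.sum univ fun a _ => (h.lapc_ct a).mul (h.pd_ct i a)

lemma qq_ct (h : Sol l1 l3 K T m dm) (i : Fin N) : CT K 3 T (qq m i) := by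
  have := h.gg_ct.deriv (single i 1)
  rw [len_single] at this
  exact this.add ((h.ss_ct i).const_mul 2)

lemma yy_ct (h : Sol l1 l3 K T m dm) (i : Fin N) (a : Fin 3) : CT K 3 T (yy l1 l3 m i a) := by
  have h1 := (h.qq_ct i).mul (h.ct a)
  have h2 := h.gg_ct.mul (h.pd_ct i a)
  have h3 := ((h.pd_ct i a).const_mul (lam l1 l3 a)).mono le_rfl (show 1 ≤ 3 by norm_num)
  have h4 := (h.om_ct.mul (h.pd_ct i a)).mono (by norm_num) (show 0 + 1 ≤ 3 by norm_num)
  exact ((h1.add h2).sub h3).add h4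

/-- The vector `m × ∂_i m`. -/
abbrev bb (m : Flow N) (i : Fin N) : Flow N := crs m (pd m i)

lemma bb_ct (h : Sol l1 l3 K T m dm) (i : Fin N) (a : Fin 3) : CT K 1 T (bb m i a) :=
  ((h.ct _).mul (h.pd_ct i _)).sub ((h.ct _).mul (h.pd_ct i _))

lemma pd_pd (h : Sol l1 l3 K T m dm) (hK : 2 ≤ K) {t : ℝ} (ht : t ∈ Icc 0 T) (i : Fin N)
    (a : Fin 3) : weakDeriv (single i 1) (pd m i a t) =ᵐ[volume]
      weakDeriv (single i 2) (m a t) := by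
  have e : (single i 2 : Fin N → ℕ) = single i 1 + single i 1 := by
    rw [← Pi.single_add]
  rw [e]
  exact (h.ct a).add_weakDeriv (by simpa using hK) ht

lemma isWeakDeriv_ct (h : Sol l1 l3 K T m dm) (hK : 1 ≤ K) {t : ℝ} (ht : t ∈ Icc 0 T) (i : Fin N)
    (a : Fin 3) : IsWeakDeriv (single i 1) (m a t) (pd m i a t) :=
  (h.ct a).isWeak (by simpa using hK) ht

lemma sphere_deriv (h : Sol l1 l3 K T m dm) (hK : 1 ≤ K) {t : ℝ} (ht : t ∈ Icc 0 T) (i : Fin N) :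
    ∀ᵐ x, ∑ a, m a t x * pd m i a t x = 0 := by
  have h1 : IsWeakDeriv (single i 1) (∑ a, fun x => m a t x * m a t x)
      (∑ a, fun x => pd m i a t x * m a t x + m a t x * pd m i a t x) :=
    IsWeakDeriv.sum univ fun a _ => (h.ct a).isWeakDeriv_mul (h.ct a) (by omega) ht i
  have h3 := (h1.congr (f' := fun _ => 1) (by
    filter_upwards [h.sphere t ht] with x hx
    simp only [Finset.sum_apply, ← hx, sq]) .rfl).unique
      (isWeakDeriv_const (1 : ℝ) i)
  filter_upwards [h3] with x hx
  simp only [Finset.sum_apply, Pi.zero_apply] at hx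
  rw [← mul_right_inj' two_ne_zero, mul_zero, ← hx, mul_sum]
  exact sum_congr rfl fun a _ => by ring

lemma sphere_lap (h : Sol l1 l3 K T m dm) (hK : 2 ≤ K) {t : ℝ} (ht : t ∈ Icc 0 T) :
    ∀ᵐ x, ∑ a, m a t x * lapc m a t x = -gg m t x := by
  have h2 : ∀ i : Fin N, ∀ᵐ x, ∑ a, (pd m i a t x * pd m i a t x +
      m a t x * weakDeriv (single i 2) (m a t) x) = 0 := by
    intro i
    have h1 := IsWeakDeriv.sum univ fun a _ =>
      (h.ct a).isWeakDeriv_mul (h.pd_ct i a) (by omega) ht i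
    have h3 := (h1.congr (f' := 0) (by
      filter_upwards [h.sphere_deriv (by omega) ht i] with x hx
      simpa only [Finset.sum_apply, Pi.zero_apply] using hx) .rfl).unique
        (isWeakDeriv_zero_fun _)
    filter_upwards [h3, ae_all_iff.2 fun a => h.pd_pd hK ht i a] with x hx h4
    simp only [Finset.sum_apply, h4] at hx
    exact hx
  filter_upwards [ae_all_iff.2 h2] with x hx
  have := Finset.sum_eq_zero fun i (_ : i ∈ Finset.univ) => hx i
  simp only [sum_add_distrib] at this
  rw [gg, eq_neg_iff_add_eq_zero, add_comm, ← this]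
  simp only [lapc, mul_sum]
  rw [sum_comm (f := fun a i => m a t x * weakDeriv (single i 2) (m a t) x)]

lemma crs_dm (h : Sol l1 l3 K T m dm) (hK : 2 ≤ K) {t : ℝ} (ht : t ∈ Icc 0 T) (a : Fin 3) :
    ∀ᵐ x, crs m dm a t x = lapc m a t x - lam l1 l3 a * m a t x +
      (gg m t x + om l1 l3 m t x) * m a t x := by
  filter_upwards [h.sphere_lap hK ht, h.sphere t ht, h.eqn t ht (a + 1), h.eqn t ht (a + 2)]
    with x h1 h2 h3 h4
  simp only [add_one_one, add_one_two, add_two_one, add_two_two] at h3 h4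
  rw [sum_fin_three a] at h1 h2
  rw [crs, h3, h4, om, sum_fin_three a]
  simp only [lapc] at h1 ⊢
  linear_combination (-m a t x) * h1 + ((∑ i, weakDeriv (single i 2) (m a t) x) -
    lam l1 l3 a * m a t x) * h2

lemma dm_crs_pd (h : Sol l1 l3 K T m dm) (hK : 1 ≤ K) {t : ℝ} (ht : t ∈ Icc 0 T) (i : Fin N)
    (a : Fin 3) : ∀ᵐ x, crs dm (pd m i) a t x =
      (ss m i t x - ∑ b, lam l1 l3 b * m b t x * pd m i b t x) * m a t x := by
  filter_upwards [h.sphere_deriv hK ht i, h.eqn t ht (a + 1), h.eqn t ht (a + 2)]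
    with x h1 h3 h4
  simp only [add_one_one, add_one_two, add_two_one, add_two_two] at h3 h4
  rw [sum_fin_three a] at h1
  rw [crs, h3, h4, ss, sum_fin_three a, sum_fin_three a]
  simp only [lapc] at h1 ⊢
  linear_combination (-((∑ i, weakDeriv (single i 2) (m a t) x) - lam l1 l3 a * m a t x)) * h1

lemma bb_deriv (h : Sol l1 l3 K T m dm) (hK : 3 ≤ K) {t : ℝ} (ht : t ∈ Icc 0 T) (i : Fin N)
    (a : Fin 3) : ∀ᵐ x, crs dm (pd m i) a t x + crs m (pd dm i) a t x =
      weakDeriv (single i 1) (lapc m a t) x + yy l1 l3 m i a t x := by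
  have e1 := ((h.ct (a + 1)).isWeakDeriv_mul (h.dct (a + 2)) (by omega) ht i).sub
    ((h.ct (a + 2)).isWeakDeriv_mul (h.dct (a + 1)) (by omega) ht i)
  have o : IsWeakDeriv (single i 1) (om l1 l3 m t)
      (fun x => ∑ b, 2 * (lam l1 l3 b * m b t x * pd m i b t x)) := by
    have := IsWeakDeriv.sum univ fun b _ =>
      ((h.ct b).isWeakDeriv_mul (h.ct b) (by omega) ht i).const_smul (lam l1 l3 b)
    refine this.congr (.of_forall fun x => ?_) (.of_forall fun x => ?_)
    · simp [om, mul_assoc]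
    · simp only [Finset.sum_apply, Pi.smul_apply, smul_eq_mul, pd]
      exact sum_congr rfl fun b _ => by ring
  have e2 := (((h.lapc_ct a).isWeak (γ := single i 1) (by simpa using hK) ht).sub
    ((h.isWeakDeriv_ct (by omega) ht i a).const_smul (lam l1 l3 a))).add
    ((h.gg_ct.isWeakDeriv_mul (h.ct a) (by omega) ht i).add
      (h.om_ct.isWeakDeriv_mul (h.ct a) (by omega) ht i))
  have e3 := e1.unique (e2.congr ?_ .rfl)
  · filter_upwards [e3, h.dm_crs_pd (by omega) ht i a, o.ae_eq] with x h1 h2 h3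
    simp only [Pi.sub_apply, Pi.add_apply, Pi.smul_apply, smul_eq_mul, h3, ← mul_sum] at h1
    simp only [crs, yy, qq, pd] at h1 h2 ⊢
    linear_combination h1 + 2 * h2
  · filter_upwards [h.crs_dm (by omega) ht a] with x hx
    simp only [crs, Pi.sub_apply, Pi.add_apply, Pi.smul_apply, smul_eq_mul] at hx ⊢
    rw [hx]; ring

lemma eqn_div (h : Sol l1 l3 K T m dm) (hK : 2 ≤ K) {t : ℝ} (ht : t ∈ Icc 0 T) (a : Fin 3) :
    ∀ᵐ x, dm a t x = -(∑ i, weakDeriv (single i 1) (bb m i a t) x) +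
      crs m (fun b t x => lam l1 l3 b * m b t x) a t x := by
  have e : ∀ i, ∀ᵐ x, weakDeriv (single i 1) (bb m i a t) x =
      m (a + 1) t x * weakDeriv (single i 2) (m (a + 2) t) x -
      m (a + 2) t x * weakDeriv (single i 2) (m (a + 1) t) x := by
    intro i
    have e1 := ((h.ct (a + 1)).isWeakDeriv_mul (h.pd_ct i (a + 2)) (by omega) ht i).sub
      ((h.ct (a + 2)).isWeakDeriv_mul (h.pd_ct i (a + 1)) (by omega) ht i)
    filter_upwards [e1.ae_eq, h.pd_pd hK ht i (a + 1), h.pd_pd hK ht i (a + 2)] with x h1 h2 h3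
    have : weakDeriv (single i 1) (bb m i a t) x = _ := h1
    rw [this, Pi.sub_apply, h2, h3, pd, pd]
    ring
  filter_upwards [ae_all_iff.2 e, h.eqn t ht a] with x h1 h2
  rw [h2, sum_congr rfl fun i _ => h1 i, sum_sub_distrib, ← mul_sum,
    ← mul_sum, crs]
  ring

lemma sd_deriv (h : Sol l1 l3 K T m dm) (a : Fin 3) {α : Fin N → ℕ} (hα : 2 + len α ≤ K) :
    SD 1 T (fun t => weakDeriv α (m a t)) (fun t => weakDeriv α (dm a t)) := by
  refine TD.sd_one ((h.td a).deriv (fun t ht => (h.ct a).isWeak (by omega) ht)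
    fun t ht => (h.dct a).isWeak hα ht) ((h.dct a).cLp (by omega) hα) fun t ht => ?_
  rcases eq_zero_or_pos (len α) with h0 | h0
  · obtain rfl := eq_zero_of_len h0
    exact ((h.w a t ht).bdd.ae_eq (h.w a t ht).weakDeriv_zero_ae.symm).locL2_of_top
  · exact ((h.ct a).memLp (by omega) (by omega) ht).locL2

lemma sd_zero (h : Sol l1 l3 K T m dm) (a : Fin 3) : SD 0 T (m a) (dm a) :=
  (h.td a).sd_zero (h.dmInf a) fun t ht => (h.w a t ht).bdd.locL2_of_top

lemma memLp_top (h : Sol l1 l3 K T m dm) (a : Fin 3) {t : ℝ} (ht : t ∈ Icc 0 T) :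
    MemLp (m a t) (ex 0) := by
  rw [ex_zero]
  exact (h.w a t ht).bdd

lemma sd_bb (h : Sol l1 l3 K T m dm) (hK : 3 ≤ K) (i : Fin N) (a : Fin 3) : SD 1 T (bb m i a)
      (fun t x => weakDeriv (single i 1) (lapc m a t) x + yy l1 l3 m i a t x) := by
  have hp : ∀ b c, SD 1 T (fun t x => m b t x * pd m i c t x)
      (fun t x => dm b t x * pd m i c t x + m b t x * pd dm i c t x) := fun b c =>
    (h.sd_zero b).mul (h.sd_deriv c (α := single i 1) (by simpa using hK)) zero_le_one
      one_le_two (fun t ht => h.memLp_top b ht) fun t ht => by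
        rw [ex_one]; exact (h.pd_ct i c).cLp_inf le_rfl (by omega) t ht
  refine ((hp (a + 1) (a + 2)).sub (hp (a + 2) (a + 1)) one_le_two).congr
    (fun t ht => .rfl) fun t ht => ?_
  filter_upwards [h.bb_deriv hK ht i a] with x hx
  rw [← hx, crs, crs]
  ring

end Sol

end

section

lemma inner_eq_sum (a b : V) : inner ℝ a b = ∑ i, a i * b i := by
  simp [PiLp.inner_apply, mul_comm]

lemma inner_cross_left (a b : V) : inner ℝ (cross a b) a = 0 := by
  rw [inner_eq_sum, sum_fin_three 0]
  simp only [cross_apply, add_one_one, add_one_two, add_two_one, add_two_two]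
  ring

lemma inner_cross_right (a b : V) : inner ℝ (cross a b) b = 0 := by
  rw [inner_eq_sum, sum_fin_three 0]
  simp only [cross_apply, add_one_one, add_one_two, add_two_one, add_two_two]
  ring

lemma norm_sq_eq_sum (a : V) : ‖a‖ ^ 2 = ∑ i, a i ^ 2 := by
  simp [EuclideanSpace.norm_sq_eq]

lemma norm_cross_le (a b : V) : ‖cross a b‖ ≤ ‖a‖ * ‖b‖ := by
  refine abs_le_of_sq_le_sq' ?_ (by positivity) |>.2
  have : ‖cross a b‖ ^ 2 = ‖a‖ ^ 2 * ‖b‖ ^ 2 - inner ℝ a b ^ 2 := by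
    rw [norm_sq_eq_sum, norm_sq_eq_sum, norm_sq_eq_sum, inner_eq_sum, sum_fin_three 0,
      sum_fin_three 0, sum_fin_three 0, sum_fin_three 0]
    simp only [cross_apply, add_one_one, add_one_two, add_two_one, add_two_two]
    ring
  rw [this, mul_pow]
  nlinarith [sq_nonneg (inner ℝ a b)]

lemma abs_inner_cross_le (a b c : V) : |inner ℝ (cross a b) c| ≤ ‖a‖ * ‖b‖ * ‖c‖ :=
  (abs_real_inner_le_norm _ _).trans (by gcongr; exact norm_cross_le a b)

lemma norm_aniso_le {l1 l3 : ℝ} (h1 : 0 ≤ l1) (h3 : 0 ≤ l3) (a : V) :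
    ‖aniso l1 l3 a‖ ≤ (l1 + l3) * ‖a‖ := by
  refine abs_le_of_sq_le_sq' ?_ (by positivity) |>.2
  rw [mul_pow, norm_sq_eq_sum, norm_sq_eq_sum, mul_sum]
  refine sum_le_sum fun i _ => ?_
  rw [aniso_apply, mul_pow]
  gcongr
  · fin_cases i <;> simp [lam, h1, h3]
  · fin_cases i <;> simp [lam, h1, h3]; positivity

/-- The Euclidean norm of a finite family of vectors. -/
noncomputable def pn {σ : Type*} [Fintype σ] (g : σ → V) : ℝ := √(∑ s, ‖g s‖ ^ 2)

variable {σ τ : Type*} [Fintype σ] [Fintype τ]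

lemma pn_nonneg (g : σ → V) : 0 ≤ pn g := Real.sqrt_nonneg _

lemma pn_sq (g : σ → V) : pn g ^ 2 = ∑ s, ‖g s‖ ^ 2 :=
  sq_sqrt (sum_nonneg fun _ _ => sq_nonneg _)

lemma sum_norm_mul_le (f g : σ → V) : ∑ s, ‖f s‖ * ‖g s‖ ≤ pn f * pn g :=
  Real.sum_mul_le_sqrt_mul_sqrt _ _ _

lemma pn_add_le (f g : σ → V) : pn (fun s => f s + g s) ≤ pn f + pn g := by
  have e : ∀ f : σ → V, pn f = ‖(toLp 2 f : PiLp 2 fun _ : σ => V)‖ := fun f => by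
    rw [PiLp.norm_eq_of_L2, pn]
  rw [e, e f, e g]
  exact norm_add_le (toLp 2 f : PiLp 2 fun _ : σ => V) (toLp 2 g)

lemma pn_smul (c : ℝ) (f : σ → V) : pn (fun s => c • f s) = |c| * pn f := by
  simp only [pn, norm_smul, mul_pow, ← mul_sum, norm_eq_abs]
  rw [Real.sqrt_mul (by positivity), Real.sqrt_sq_eq_abs, abs_abs]

lemma norm_le_pn (f : σ → V) (s : σ) : ‖f s‖ ≤ pn f :=
  le_sqrt_of_sq_le (single_le_sum (f := fun s => ‖f s‖ ^ 2)
    (fun _ _ => sq_nonneg _) (Finset.mem_univ s))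

end

section

variable {N : ℕ}

/-- An integrable function whose integral is at most `c`. -/
def IB (f : X N → ℝ) (c : ℝ) : Prop := Integrable f ∧ ∫ x, f x ≤ c

/-- An integrable function whose integral vanishes. -/
def NI (f : X N → ℝ) : Prop := Integrable f ∧ ∫ x, f x = 0

variable {f g : X N → ℝ} {c d : ℝ}

lemma IB.add (hf : IB f c) (hg : IB g d) : IB (fun x => f x + g x) (c + d) :=
  ⟨hf.1.add hg.1, by rw [integral_add hf.1 hg.1]; exact add_le_add hf.2 hg.2⟩

lemma IB.const_mul (hf : IB f c) {r : ℝ} (hr : 0 ≤ r) : IB (fun x => r * f x) (r * c) :=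
  ⟨hf.1.const_mul r, by rw [integral_const_mul]; exact mul_le_mul_of_nonneg_left hf.2 hr⟩

lemma Bd.ib (hf : Bd 1 f c) (hg : Bd 1 g d) (hc : 0 ≤ c) (hd : 0 ≤ d) :
    IB (fun x => f x * g x) (c * d) := by
  have := hf.integral_mul_le hg zero_le_one zero_le_one (by norm_num) hc hd
  exact ⟨this.1, (le_abs_self _).trans this.2⟩

lemma NI.add (hf : NI f) (hg : NI g) : NI (fun x => f x + g x) :=
  ⟨hf.1.add hg.1, by rw [integral_add hf.1 hg.1, hf.2, hg.2, add_zero]⟩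

lemma NI.const_mul (hf : NI f) (r : ℝ) : NI (fun x => r * f x) :=
  ⟨hf.1.const_mul r, by rw [integral_const_mul, hf.2, mul_zero]⟩

lemma NI.sum {σ : Type*} (s : Finset σ) {f : σ → X N → ℝ} (h : ∀ a ∈ s, NI (f a)) :
    NI (fun x => ∑ a ∈ s, f a x) := ⟨integrable_finsetSum s fun a ha => (h a ha).1, by
    rw [integral_finsetSum s fun a ha => (h a ha).1]
    exact Finset.sum_eq_zero fun a ha => (h a ha).2⟩

lemma IB.integral_le {Z B : X N → ℝ} (hB : IB B c) (hf : Integrable f) (hZ : NI Z)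
    (h : ∀ᵐ x, f x + Z x ≤ B x) : ∫ x, f x ≤ c := by
  have := integral_mono_ae (hf.add hZ.1) hB.1 h
  rw [integral_add' hf hZ.1, hZ.2, add_zero] at this
  exact this.trans hB.2

end

section

variable {N K : ℕ} {T : ℝ} {d d₁ d₂ : ℕ} {t : ℝ}

/-- The vector with the given components. -/
noncomputable def ve (f : Flow N) (t : ℝ) (x : X N) : V := toLp 2 fun a => f a t x

lemma inner_ve (f g : Flow N) (t : ℝ) (x : X N) :
    inner ℝ (ve f t x) (ve g t x) = ∑ a, f a t x * g a t x := by
  rw [inner_eq_sum]; rfl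

lemma ve_crs (f g : Flow N) (t : ℝ) (x : X N) : ve (crs f g) t x = cross (ve f t x) (ve g t x) := by
  ext a; rw [cross_apply]; rfl

/-- The difference of two curves. -/
def dff (n m : Flow N) (a : Fin 3) (t : ℝ) : X N → ℝ := fun x => n a t x - m a t x

/-- The mean of two curves. -/
noncomputable def avg (n m : Flow N) (a : Fin 3) (t : ℝ) : X N → ℝ :=
  fun x => 1 / 2 * (n a t x + m a t x)

lemma ve_dff (n m : Flow N) (t : ℝ) (x : X N) : ve (dff n m) t x = ve n t x - ve m t x := rfl

lemma ve_avg (n m : Flow N) (t : ℝ) (x : X N) :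
    ve (avg n m) t x = (1 / 2 : ℝ) • (ve n t x + ve m t x) := rfl

lemma CT.pd {f : Flow N} (hf : ∀ a, CT K d T (f a)) (i : Fin N) (a : Fin 3) :
    CT K (d + 1) T (pd f i a) := by
  have := (hf a).deriv (single i 1)
  rw [len_single] at this
  exact this

lemma CT.crs {f g : Flow N} (hf : ∀ a, CT K d₁ T (f a)) (hg : ∀ a, CT K d₂ T (g a))
    (a : Fin 3) : CT K (d₁ + d₂) T (crs f g a) := ((hf _).mul (hg _)).sub ((hf _).mul (hg _))

lemma CT.dff {f g : Flow N} (hf : ∀ a, CT K d T (f a)) (hg : ∀ a, CT K d T (g a))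
    (a : Fin 3) : CT K d T (dff f g a) := (hf a).sub (hg a)

lemma CT.avg {f g : Flow N} (hf : ∀ a, CT K d T (f a)) (hg : ∀ a, CT K d T (g a))
    (a : Fin 3) : CT K d T (avg f g a) := ((hf a).add (hg a)).const_mul _

lemma CT.const {F : ℝ → X N → ℝ} (hF : CT K d T F) (ht : t ∈ Icc 0 T) :
    CT K d T (fun _ => F t) := fun _ _ =>
  ⟨(hF t ht).1, fun ε hε => ((hF t ht).2 ε hε).self_of_nhdsWithin ht |> fun h =>
    .of_forall fun _ => h⟩

lemma pd_dff {f g : Flow N} (hf : ∀ a, CT K d T (f a)) (hg : ∀ a, CT K d T (g a))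
    (hK : d + 1 ≤ K) (ht : t ∈ Icc 0 T) (i : Fin N) :
    ∀ᵐ x, ve (pd (dff f g) i) t x = ve (pd f i) t x - ve (pd g i) t x := by
  filter_upwards [ae_all_iff.2 fun a => (((hf a).isWeak (γ := single i 1) (by simpa using hK)
    ht).sub ((hg a).isWeak (by simpa using hK) ht)).ae_eq] with x hx
  ext a
  exact hx a

lemma pd_avg {f g : Flow N} (hf : ∀ a, CT K d T (f a)) (hg : ∀ a, CT K d T (g a))
    (hK : d + 1 ≤ K) (ht : t ∈ Icc 0 T) (i : Fin N) :
    ∀ᵐ x, ve (pd (avg f g) i) t x = (1 / 2 : ℝ) • (ve (pd f i) t x + ve (pd g i) t x) := by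
  filter_upwards [ae_all_iff.2 fun a => ((((hf a).isWeak (γ := single i 1) (by simpa using hK)
    ht).add ((hg a).isWeak (by simpa using hK) ht)).const_smul (1 / 2)).ae_eq] with x hx
  ext a
  exact hx a

lemma pd_crs {f g : Flow N} (hf : ∀ a, CT K d₁ T (f a)) (hg : ∀ a, CT K d₂ T (g a))
    (hK : d₁ + d₂ + 1 ≤ K) (ht : t ∈ Icc 0 T) (i : Fin N) : ∀ᵐ x, ve (pd (crs f g) i) t x =
      cross (ve (pd f i) t x) (ve g t x) + cross (ve f t x) (ve (pd g i) t x) := by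
  filter_upwards [ae_all_iff.2 fun a => (((hf (a + 1)).isWeakDeriv_mul (hg (a + 2)) hK ht i).sub
    ((hf (a + 2)).isWeakDeriv_mul (hg (a + 1)) hK ht i)).ae_eq] with x hx
  ext a
  have h1 : pd (crs f g) i a t x = _ := hx a
  have h2 : ve (pd (crs f g) i) t x a = pd (crs f g) i a t x := rfl
  rw [h2, h1, PiLp.add_apply, cross_apply, cross_apply]
  simp only [Pi.sub_apply, ve, pd]
  ring

lemma weakDeriv_inner {f g : Flow N} (hf : ∀ a, CT K d₁ T (f a))
    (hg : ∀ a, CT K d₂ T (g a)) (hK : d₁ + d₂ + 1 ≤ K) (ht : t ∈ Icc 0 T) (i : Fin N) :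
    ∀ᵐ x, weakDeriv (single i 1) (fun x => inner ℝ (ve f t x) (ve g t x)) x =
      inner ℝ (ve (pd f i) t x) (ve g t x) + inner ℝ (ve f t x) (ve (pd g i) t x) := by
  have h1 := (IsWeakDeriv.sum univ fun a _ =>
    (hf a).isWeakDeriv_mul (hg a) hK ht i).congr (f' := fun x => inner ℝ (ve f t x) (ve g t x))
    (.of_forall fun x => by simp only [Finset.sum_apply, inner_ve])
    .rfl
  filter_upwards [h1.ae_eq] with x hx
  rw [hx, inner_ve, inner_ve, Finset.sum_apply, ← sum_add_distrib]
  rfl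

lemma CT.inner {f g : Flow N} (hf : ∀ a, CT K d₁ T (f a))
    (hg : ∀ a, CT K d₂ T (g a)) : CT K (d₁ + d₂) T (fun t x => inner ℝ (ve f t x) (ve g t x)) := by
  simp only [inner_ve]
  exact CT.sum univ fun a _ => (hf a).mul (hg a)

lemma CT.ni {F G : ℝ → X N → ℝ} (hF : CT K d₁ T F)
    (hG : CT K d₂ T G) (h1 : 1 ≤ d₁) (h2 : 1 ≤ d₂) (hK1 : d₁ + 1 ≤ K) (hK2 : d₂ + 1 ≤ K)
    (ht : t ∈ Icc 0 T) (i : Fin N) : NI (fun x => weakDeriv (single i 1) (F t) x * G t x +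
      F t x * weakDeriv (single i 1) (G t) x) := by
  have mF := hF.cLp_inf h1 (by omega) t ht
  have mG := hG.cLp_inf h2 (by omega) t ht
  have mF' := hF.memLp (α := single i 1) (by simp) (by simpa using hK1) ht
  have mG' := hG.memLp (α := single i 1) (by simp) (by simpa using hK2) ht
  have hp := IsWeakDeriv.mul
    (hF.isWeak (γ := single i 1) (by simpa using hK1) ht)
    (hG.isWeak (γ := single i 1) (by simpa using hK2) ht) mF.locL2 mF'.locL2 mG.locL2 mG'.locL2
  have i1 := mF'.integrable_smul_two mG
  have i2 := mF.integrable_smul_two mG'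
  exact ⟨i1.add i2, hp.integral_eq_zero (mF.integrable_smul_two mG) (i1.add i2)⟩

lemma CT.ni_inner {f g : Flow N} (hf : ∀ a, CT K d₁ T (f a))
    (hg : ∀ a, CT K d₂ T (g a)) (h1 : 1 ≤ d₁) (h2 : 1 ≤ d₂) (hK1 : d₁ + 1 ≤ K) (hK2 : d₂ + 1 ≤ K)
    (ht : t ∈ Icc 0 T) (i : Fin N) :
    NI (fun x => Inner.inner ℝ (ve (LandauLifshitz.pd f i) t x) (ve g t x) +
      Inner.inner ℝ (ve f t x) (ve (LandauLifshitz.pd g i) t x)) := by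
  have := NI.sum Finset.univ fun a (_ : a ∈ Finset.univ) => (hf a).ni (hg a) h1 h2 hK1 hK2 ht i
  simp only [inner_ve, ← sum_add_distrib]
  exact this

end

section

variable {N K : ℕ} {T : ℝ} {d : ℕ} {t : ℝ}

lemma hasDerivWithinAt_half_sq {f f' : Flow N} (hf : ∀ a, SD 1 T (f a) (f' a))
    (h2 : ∀ a, ∀ t ∈ Icc 0 T, MemLp (f a t) 2) (ht : t ∈ Icc 0 T) :
    HasDerivWithinAt (fun t => 1 / 2 * ∫ x, ‖ve f t x‖ ^ 2)
      (∫ x, inner ℝ (ve f' t x) (ve f t x)) (Icc 0 T) t := by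
  have m2 : ∀ a, ∀ t ∈ Icc 0 T, MemLp (f' a t) 2 := fun a t ht => by
    have := (hf a t ht).1
    rwa [ex_one] at this
  have h := HasDerivWithinAt.fun_sum fun a (_ : a ∈ Finset.univ) =>
    (hf a).hasDerivWithinAt_integral_sq (h2 a) ht
  have h3 : HasDerivWithinAt (fun t => 1 / 2 * ∫ x, ‖ve f t x‖ ^ 2) _ (Icc 0 T) t :=
    (h.const_mul (1 / 2)).congr_of_mem (fun r hr => by
      simp only [norm_sq_eq_sum]
      exact congrArg _ (integral_finsetSum _ fun a _ => (h2 a r hr).integrable_sq)) ht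
  refine h3.congr_deriv ?_
  have e : ∫ x, ∑ a, f' a t x * f a t x = ∑ a, ∫ x, f' a t x * f a t x :=
    integral_finsetSum _ fun a _ => (m2 a t ht).integrable_smul_two (h2 a t ht)
  simp only [inner_ve, e]
  rw [← mul_sum]
  ring

lemma continuousOn_integral_inner {f g : Flow N} (hf : ∀ a, CLp 1 T (f a))
    (hg : ∀ a, CLp 1 T (g a)) : ContinuousOn (fun t => ∫ x, inner ℝ (ve f t x) (ve g t x)) (Icc 0 T) := by
  have m2 : ∀ {f : Flow N}, (∀ a, CLp 1 T (f a)) → ∀ a, ∀ t ∈ Icc 0 T,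
      MemLp (f a t) 2 := fun hf a t ht => by
    have := (hf a t ht).1
    rwa [ex_one] at this
  refine (continuousOn_finsetSum univ fun a _ =>
    (hf a).continuousOn_integral_mul (hg a)).congr fun t ht => ?_
  simp only [inner_ve]
  exact integral_finsetSum _ fun a _ => (m2 hf a t ht).integrable_smul_two (m2 hg a t ht)

lemma integrable_inner_ve {f g : Flow N} (hf : ∀ a, MemLp (f a t) 2)
    (hg : ∀ a, MemLp (g a t) 2) : Integrable fun x => inner ℝ (ve f t x) (ve g t x) := by
  simp only [inner_ve]
  exact integrable_finsetSum _ fun a _ => (hf a).integrable_smul_two (hg a)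

end

section

variable {N K : ℕ} {T l1 l3 : ℝ} {m dm n dn : Flow N} {t : ℝ}

/-- The function `J m`, in components. -/
def jj (l1 l3 : ℝ) (m : Flow N) (a : Fin 3) (t : ℝ) : X N → ℝ := fun x => lam l1 l3 a * m a t x

lemma ve_jj (l1 l3 : ℝ) (m : Flow N) (t : ℝ) (x : X N) :
    ve (jj l1 l3 m) t x = aniso l1 l3 (ve m t x) := by
  ext a; rw [aniso_apply]; rfl

lemma cross_sub_cross (a b c d : V) : cross a b - cross c d =
    cross (a - c) ((1 / 2 : ℝ) • (b + d)) + cross ((1 / 2 : ℝ) • (a + c)) (b - d) := by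
  ext i
  simp only [cross_apply, PiLp.add_apply, PiLp.sub_apply, PiLp.smul_apply, smul_eq_mul]
  ring

/-- The difference of the second component from its initial value. -/
def sh (m n : Flow N) (a : Fin 3) (t : ℝ) : X N → ℝ :=
  fun x => dff n m a t x - if a = 1 then dff n m a 0 x else 0

namespace Sol

lemma sd_sh (hm : Sol l1 l3 K T m dm) (hn : Sol l1 l3 K T n dn) (hT : 0 < T) (hK : 2 ≤ K)
    (a : Fin 3) : SD 1 T (sh m n a) (dff dn dm a) ∧ CT K 1 T (sh m n a) ∧
      ∀ t ∈ Icc 0 T, MemLp (sh m n a t) 2 := by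
  have h0 : (0 : ℝ) ∈ Icc 0 T := ⟨le_rfl, hT.le⟩
  have td : ∀ {m dm : Flow N}, Sol l1 l3 K T m dm → SD 1 T (m a) (dm a) ∧
      ∀ t ∈ Icc 0 T, MemLp (fun x => m a t x - m a 0 x) 2 := fun {m dm} hm => by
    have h1 := (hm.dct a).cLp_zero (by norm_num) hK
    have h2 : ∀ t ∈ Icc 0 T, LocL2 (m a t) := fun t ht => (hm.w a t ht).bdd.locL2_of_top
    exact ⟨(hm.td a).sd_one h1 h2, fun t ht => (hm.td a).memLp_sub h1 h2 ht h0⟩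
  have c0 := (hn.ct a).sub (hm.ct a)
  by_cases ha : a = 1
  · have e : sh m n a = fun t x => dff n m a t x - dff n m a 0 x := by
      funext t x; simp [sh, ha]
    have sd : SD 1 T (fun t x => dff n m a t x - dff n m a 0 x) (dff dn dm a) := fun t ht => by
      refine ⟨((td hn).1.sub (td hm).1 one_le_two t ht).1, fun ε hε => ?_⟩
      filter_upwards [((td hn).1.sub (td hm).1 one_le_two t ht).2 ε hε] with r hr
      exact hr.congr (.of_forall fun x => by simp only [dff]; ring)
    have m2 : ∀ t ∈ Icc 0 T, MemLp (fun x => dff n m a t x - dff n m a 0 x) 2 :=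
      fun t ht => (((td hn).2 t ht).sub ((td hm).2 t ht)).ae_eq
        (.of_forall fun x => by simp only [dff, Pi.sub_apply]; ring)
    rw [e]
    refine ⟨sd, (c0.sub (c0.const h0)).zero_one (sd.cLp zero_le_one one_le_two fun t ht => ?_), m2⟩
    rw [ex_one]
    exact m2 t ht
  · have e : sh m n a = dff n m a := by
      funext t x; simp [sh, ha]
    rw [e]
    have c2 := (hn.l2 a ha).sub (hm.l2 a ha) one_le_two
    have m2 := fun t ht => (c2 t ht).1
    rw [ex_one] at m2
    exact ⟨(td hn).1.sub (td hm).1 one_le_two, c0.zero_one c2, m2⟩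

lemma dff_eqn (hm : Sol l1 l3 K T m dm) (hn : Sol l1 l3 K T n dn) (hK : 2 ≤ K)
    (ht : t ∈ Icc 0 T) : ∀ᵐ x, ve (dff dn dm) t x = -(∑ i, ve (pd (dff (bb n i) (bb m i)) i) t x) +
      (cross (ve n t x) (aniso l1 l3 (ve n t x)) - cross (ve m t x) (aniso l1 l3 (ve m t x))) := by
  have hb : ∀ i, ∀ᵐ x, ve (pd (dff (bb n i) (bb m i)) i) t x = _ := fun i =>
    pd_dff (hn.bb_ct i) (hm.bb_ct i) hK ht i
  have he : ∀ {m dm : Flow N}, Sol l1 l3 K T m dm → ∀ᵐ x, ve dm t x =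
      -(∑ i, ve (pd (bb m i) i) t x) + cross (ve m t x) (aniso l1 l3 (ve m t x)) :=
    fun {m dm} hm => by
      filter_upwards [ae_all_iff.2 fun a => hm.eqn_div hK ht a] with x hx
      have es : ∀ a, (∑ i, ve (pd (bb m i) i) t x) a = ∑ i, ve (pd (bb m i) i) t x a := fun a =>
        map_sum (PiLp.proj 2 (fun _ : Fin 3 => ℝ) (𝕜 := ℝ) a) _ _
      ext a
      rw [PiLp.add_apply, PiLp.neg_apply, es, ← ve_jj, ← ve_crs]
      exact hx a
  filter_upwards [he hm, he hn, ae_all_iff.2 hb] with x h1 h2 h3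
  rw [ve_dff, h1, h2, sum_congr rfl fun i _ => h3 i, sum_sub_distrib]
  abel

lemma norm_ve (hm : Sol l1 l3 K T m dm) (ht : t ∈ Icc 0 T) : ∀ᵐ x, ‖ve m t x‖ = 1 := by
  filter_upwards [hm.sphere t ht] with x hx
  have : ‖ve m t x‖ ^ 2 = 1 := by rw [norm_sq_eq_sum]; exact hx
  exact (pow_eq_one_iff_of_nonneg (norm_nonneg _) two_ne_zero).1 this

lemma energy_zero_deriv (hm : Sol l1 l3 K T m dm) (hn : Sol l1 l3 K T n dn) (hT : 0 < T)
    (hK : 2 ≤ K) : (∀ t ∈ Icc 0 T, HasDerivWithinAt (fun t => 1 / 2 * ∫ x, ‖ve (sh m n) t x‖ ^ 2)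
      (∫ x, inner ℝ (ve (dff dn dm) t x) (ve (sh m n) t x)) (Icc 0 T) t) ∧
      ContinuousOn (fun t => ∫ x, inner ℝ (ve (dff dn dm) t x) (ve (sh m n) t x)) (Icc 0 T) := by
  have h := fun a => hm.sd_sh hn hT hK a
  exact ⟨fun t ht => hasDerivWithinAt_half_sq (fun a => (h a).1) (fun a => (h a).2.2) ht,
    continuousOn_integral_inner (fun a => ((hn.dct a).sub (hm.dct a)).cLp_zero (by norm_num) hK)
      fun a => (h a).2.1.cLp_zero le_rfl (by omega)⟩

lemma bb_dff (m n : Flow N) (i : Fin N) (t : ℝ) (x : X N) : ve (dff (bb n i) (bb m i)) t x =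
      cross (ve n t x - ve m t x) ((1 / 2 : ℝ) • (ve (pd n i) t x + ve (pd m i) t x)) +
      cross ((1 / 2 : ℝ) • (ve n t x + ve m t x)) (ve (pd n i) t x - ve (pd m i) t x) := by
  rw [ve_dff, bb, bb, ve_crs, ve_crs, cross_sub_cross]

lemma pd_sh (hm : Sol l1 l3 K T m dm) (hn : Sol l1 l3 K T n dn) (hT : 0 < T) (hK : 2 ≤ K)
    (ht : t ∈ Icc 0 T) (i : Fin N) : ∀ᵐ x, ve (pd (sh m n) i) t x =
      ve (pd (dff n m) i) t x - EuclideanSpace.single 1 (pd (dff n m) i 1 0 x) := by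
  have h0 : (0 : ℝ) ∈ Icc 0 T := ⟨le_rfl, hT.le⟩
  have c0 := fun a => (hn.ct a).sub (hm.ct a)
  have h1 := ((c0 1).isWeak (γ := single i 1) (by simp; omega) ht).sub
    ((c0 1).isWeak (γ := single i 1) (by simp; omega) h0)
  filter_upwards [h1.ae_eq] with x hx
  ext a
  by_cases ha : a = 1
  · subst ha
    have e : sh m n 1 t = dff n m 1 t - dff n m 1 0 := by
      funext t; simp [sh]
    have : ve (pd (sh m n) i) t x 1 = weakDeriv (single i 1) (dff n m 1 t - dff n m 1 0) x := by
      rw [← e]; rfl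
    rw [this, PiLp.sub_apply, PiLp.single_apply, if_pos rfl]
    exact hx
  · have e : sh m n a t = dff n m a t := by
      funext t; simp [sh, ha]
    have : ve (pd (sh m n) i) t x a = weakDeriv (single i 1) (dff n m a t) x := by
      rw [← e]; rfl
    rw [this, PiLp.sub_apply, PiLp.single_apply, if_neg ha, sub_zero]
    rfl

end Sol

lemma sum_inner_le {u v : V} {U : ℝ} (hu : ‖u‖ ≤ U) (hv : ‖v‖ ≤ 1) (a b e : Fin N → V) :
    ∑ i, inner ℝ (cross u (b i) + cross v (a i)) (a i - e i) ≤
      U * (pn b * pn a) + U * (pn b * pn e) + pn a * pn e := by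
  have hU := (norm_nonneg u).trans hu
  have h : ∀ i, inner ℝ (cross u (b i) + cross v (a i)) (a i - e i) ≤
      U * (‖b i‖ * ‖a i‖) + U * (‖b i‖ * ‖e i‖) + ‖a i‖ * ‖e i‖ := fun i => by
    rw [inner_sub_right, inner_add_left, inner_add_left, inner_cross_right]
    have h1 := (abs_le.1 (abs_inner_cross_le u (b i) (a i))).2
    have h2 := (abs_le.1 (abs_inner_cross_le u (b i) (e i))).1
    have h3 := (abs_le.1 (abs_inner_cross_le v (a i) (e i))).1
    have h4 : ‖u‖ * (‖b i‖ * ‖a i‖) ≤ U * (‖b i‖ * ‖a i‖) := by gcongr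
    have h5 : ‖u‖ * (‖b i‖ * ‖e i‖) ≤ U * (‖b i‖ * ‖e i‖) := by gcongr
    have h6 : ‖v‖ * (‖a i‖ * ‖e i‖) ≤ 1 * (‖a i‖ * ‖e i‖) := by gcongr
    linarith
  refine (sum_le_sum fun i _ => h i).trans ?_
  rw [sum_add_distrib, sum_add_distrib, ← mul_sum, ← mul_sum]
  gcongr <;> exact sum_norm_mul_le _ _

lemma norm_aniso_le_abs {l1 l3 : ℝ} (h1 : 0 ≤ l1) (h3 : 0 ≤ l3) (a : V) :
    ‖aniso l1 l3 a‖ ≤ (l1 + l3) * (|a 0| + |a 2|) := by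
  refine abs_le_of_sq_le_sq' ?_ (by positivity) |>.2
  have e : ‖aniso l1 l3 a‖ ^ 2 = l1 ^ 2 * |a 0| ^ 2 + l3 ^ 2 * |a 2| ^ 2 := by
    rw [norm_sq_eq_sum, Fin.sum_univ_three]
    simp [aniso, mul_pow]
  rw [e, mul_pow, add_sq, add_sq]
  have := abs_nonneg (a 0)
  have := abs_nonneg (a 2)
  have : 0 ≤ 2 * l1 * l3 * (|a 0| ^ 2 + 2 * |a 0| * |a 2| + |a 2| ^ 2) := by positivity
  have : 0 ≤ (l1 ^ 2 + l3 ^ 2) * (2 * |a 0| * |a 2|) := by positivity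
  nlinarith [mul_nonneg (sq_nonneg l1) (sq_nonneg |a 2|), mul_nonneg (sq_nonneg l3) (sq_nonneg |a 0|)]

lemma Bd.abs {s B : ℝ} {f : X N → ℝ} (h : Bd s f B) : Bd s (fun x => |f x|) B := ⟨h.1.norm, by
    have := h.2
    rw [← eLpNorm_norm] at this
    exact this⟩

lemma cross_aniso_le {u v w : V} {U l1 l3 : ℝ} (h1 : 0 ≤ l1) (h3 : 0 ≤ l3) (hu : ‖u‖ ≤ U)
    (hv : ‖v‖ ≤ 1) (hw : aniso l1 l3 u = aniso l1 l3 w) :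
    inner ℝ (cross u (aniso l1 l3 v) + cross v (aniso l1 l3 u)) w ≤
      (l1 + l3) * (U * ((|v 0| + |v 2|) * ‖w‖)) + (l1 + l3) * (‖w‖ * ‖w‖) := by
  have hU := (norm_nonneg u).trans hu
  rw [inner_add_left, hw]
  refine add_le_add ((abs_le.1 (abs_inner_cross_le _ _ _)).2.trans ?_)
    ((abs_le.1 (abs_inner_cross_le _ _ _)).2.trans ?_)
  · calc _ ≤ U * ((l1 + l3) * (|v 0| + |v 2|)) * ‖w‖ := by
          gcongr; exact norm_aniso_le_abs h1 h3 v
      _ = _ := by ring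
  · calc _ ≤ 1 * ((l1 + l3) * ‖w‖) * ‖w‖ := by
          gcongr; exact norm_aniso_le h1 h3 w
      _ = _ := by ring

lemma Sol.energy_zero_le (hm : Sol l1 l3 K T m dm) (hn : Sol l1 l3 K T n dn) (hl1 : 0 ≤ l1)
    (hl3 : 0 ≤ l3) (hT : 0 < T) (hK : 3 ≤ K) (ht : t ∈ Icc 0 T)
    {U G G' S₁ S₂ S₃ W : ℝ} (hU0 : 0 ≤ U) (hG0 : 0 ≤ G) (hG0' : 0 ≤ G') (h10 : 0 ≤ S₁) (h20 : 0 ≤ S₂)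
    (h30 : 0 ≤ S₃) (hW0 : 0 ≤ W)
    (hU : ∀ᵐ x, ‖ve (dff n m) t x‖ ≤ U) (hW : Bd 1 (fun x => ‖ve (sh m n) t x‖) W)
    (hG : Bd 1 (fun x => pn fun i => ve (pd n i) t x - ve (pd m i) t x) G)
    (hG' : Bd 1 (fun x => pn fun i : Fin N =>
      (EuclideanSpace.single 1 (pd (dff n m) i 1 0 x) : V)) G')
    (h1 : Bd 1 (fun x => pn fun i => ve (pd m i) t x) S₁)
    (h2 : Bd 1 (fun x => pn fun i => ve (pd n i) t x) S₂)
    (h3 : Bd 1 (fun x => (|n 0 t x| + |m 0 t x|) + (|n 2 t x| + |m 2 t x|)) S₃) :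
    ∫ x, inner ℝ (ve (dff dn dm) t x) (ve (sh m n) t x) ≤
      2 * (1 + (l1 + l3)) * (1 + (S₁ + S₂ + S₃)) * (W ^ 2 + U ^ 2 + G ^ 2 + G' ^ 2) := by
  have hs := fun a => hm.sd_sh hn hT (by omega) a
  have hZ := NI.sum Finset.univ fun i (_ : i ∈ Finset.univ) =>
    CT.ni_inner (f := dff (bb n i) (bb m i)) (CT.dff (hn.bb_ct i) (hm.bb_ct i))
      (fun a => (hs a).2.1) le_rfl le_rfl (by omega) (by omega) ht i
  have h12 := h1.add h2 one_le_two h10 h20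
  have hL : 0 ≤ l1 + l3 := by positivity
  have hB := (((((h12.ib hG (by positivity) hG0).const_mul hU0).add
    ((h12.ib hG' (by positivity) hG0').const_mul hU0)).add (hG.ib hG' hG0 hG0')).add
    (((h3.ib hW h30 hW0).const_mul hU0).const_mul hL)).add ((hW.ib hW hW0 hW0).const_mul hL)
  refine (hB.integral_le (integrable_inner_ve
    (fun a => ((hn.dct a).sub (hm.dct a)).cLp_inf (by norm_num) (by omega) t ht)
    fun a => (hs a).2.2 t ht) hZ ?_).trans ?_
  · filter_upwards [hm.dff_eqn hn (by omega) ht, ae_all_iff.2 fun i => hm.pd_sh hn hT (by omega) ht i,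
      hU, hm.norm_ve ht, hn.norm_ve ht, ae_all_iff.2 fun i => pd_dff hn.ct hm.ct (by omega) ht i]
      with x e1 e2 e3 e4 e5 e6
    have hv : ‖(1 / 2 : ℝ) • (ve n t x + ve m t x)‖ ≤ 1 := by
      rw [norm_smul]
      have := norm_add_le (ve n t x) (ve m t x)
      norm_num
      linarith
    have hb : pn (fun i : Fin N => (1 / 2 : ℝ) • (ve (pd n i) t x + ve (pd m i) t x)) ≤
        (pn fun i => ve (pd m i) t x) + pn fun i => ve (pd n i) t x := by
      rw [pn_smul, abs_of_nonneg (by norm_num)]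
      have := pn_add_le (fun i => ve (pd n i) t x) (fun i => ve (pd m i) t x)
      have := pn_nonneg (fun i => ve (pd n i) t x)
      have := pn_nonneg (fun i => ve (pd m i) t x)
      linarith
    have p1 := sum_inner_le e3 hv (fun i => ve (pd n i) t x - ve (pd m i) t x)
      (fun i => (1 / 2 : ℝ) • (ve (pd n i) t x + ve (pd m i) t x))
      (fun i => (EuclideanSpace.single 1 (pd (dff n m) i 1 0 x) : V))
    have p2 := cross_aniso_le hl1 hl3 (w := ve (sh m n) t x) e3 hv (by
      ext a
      rw [aniso_apply, aniso_apply]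
      by_cases ha : a = 1
      · subst ha; simp [lam]
      · simp [ve, sh, ha])
    rw [e1, inner_add_left, inner_neg_left, sum_inner, sum_add_distrib, cross_sub_cross]
    have e7 : aniso l1 l3 (ve n t x) - aniso l1 l3 (ve m t x) = aniso l1 l3 (ve n t x - ve m t x) := by
      ext a; simp only [PiLp.sub_apply, aniso_apply]; ring
    have e8 : (1 / 2 : ℝ) • (aniso l1 l3 (ve n t x) + aniso l1 l3 (ve m t x)) =
        aniso l1 l3 ((1 / 2 : ℝ) • (ve n t x + ve m t x)) := by
      ext a; simp only [PiLp.smul_apply, PiLp.add_apply, aniso_apply, smul_eq_mul]; ring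
    rw [e7, e8]
    simp only [bb_dff, e2, e6] at p1 ⊢
    have p3 : |((1 / 2 : ℝ) • (ve n t x + ve m t x)) 0| + |((1 / 2 : ℝ) • (ve n t x + ve m t x)) 2| ≤
        (|n 0 t x| + |m 0 t x|) + (|n 2 t x| + |m 2 t x|) := by
      have q : ∀ a b : ℝ, |1 / 2 * (a + b)| ≤ |a| + |b| := fun a b => by
        rw [abs_mul, abs_of_nonneg (by norm_num : (0 : ℝ) ≤ 1 / 2)]
        linarith [abs_add_le a b, abs_nonneg a, abs_nonneg b]
      exact add_le_add (q _ _) (q _ _)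
    rw [← ve_dff n m]
    have q1 := pn_nonneg fun i => ve (pd n i) t x - ve (pd m i) t x
    have q2 := pn_nonneg fun i : Fin N => (EuclideanSpace.single 1 (pd (dff n m) i 1 0 x) : V)
    have r1 := mul_le_mul_of_nonneg_left (mul_le_mul_of_nonneg_right hb q1) hU0
    have r2 := mul_le_mul_of_nonneg_left (mul_le_mul_of_nonneg_right hb q2) hU0
    have r3 := mul_le_mul_of_nonneg_left (mul_le_mul_of_nonneg_left
      (mul_le_mul_of_nonneg_right p3 (norm_nonneg (ve (sh m n) t x))) hU0) hL
    linarith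
  · have a1 : U * G ≤ W ^ 2 + U ^ 2 + G ^ 2 + G' ^ 2 := by nlinarith [sq_nonneg (U - G), sq_nonneg W]
    have a2 : U * G' ≤ W ^ 2 + U ^ 2 + G ^ 2 + G' ^ 2 := by
      nlinarith [sq_nonneg (U - G'), sq_nonneg W]
    have a3 : G * G' ≤ W ^ 2 + U ^ 2 + G ^ 2 + G' ^ 2 := by
      nlinarith [sq_nonneg (G - G'), sq_nonneg W]
    have a4 : U * W ≤ W ^ 2 + U ^ 2 + G ^ 2 + G' ^ 2 := by
      nlinarith [sq_nonneg (U - W), sq_nonneg G, sq_nonneg G']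
    have a5 : W * W ≤ W ^ 2 + U ^ 2 + G ^ 2 + G' ^ 2 := by
      nlinarith [sq_nonneg U, sq_nonneg G, sq_nonneg G']
    set Q := W ^ 2 + U ^ 2 + G ^ 2 + G' ^ 2
    have hQ : 0 ≤ Q := by positivity
    have b1 := mul_le_mul_of_nonneg_left a1 (add_nonneg h10 h20)
    have b2 := mul_le_mul_of_nonneg_left a2 (add_nonneg h10 h20)
    have b4 := mul_le_mul_of_nonneg_left a4 (mul_nonneg hL h30)
    have b5 := mul_le_mul_of_nonneg_left a5 hL
    have c1 : 0 ≤ (l1 + l3) * (S₁ + S₂) * Q := by positivity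
    have c2 : 0 ≤ (l1 + l3) * S₃ * Q := by positivity
    have c3 : 0 ≤ (l1 + l3) * Q := by positivity
    have c4 : 0 ≤ S₃ * Q := by positivity
    nlinarith

end

noncomputable section

variable {N : ℕ}

abbrev pn₂ (h : Fin N → Fin N → V) : ℝ := pn fun p : Fin N × Fin N => h p.1 p.2

lemma sum_norm_mul_mul_le (f g : Fin N → V) (h : Fin N → Fin N → V) :
    ∑ i, ∑ j, ‖f i‖ * ‖g j‖ * ‖h i j‖ ≤ pn f * pn g * pn₂ h := by
  have h1 := Real.sum_mul_le_sqrt_mul_sqrt (univ : Finset (Fin N × Fin N))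
    (fun p => ‖f p.1‖ * ‖g p.2‖) fun p => ‖h p.1 p.2‖
  have e : √(∑ p : Fin N × Fin N, (‖f p.1‖ * ‖g p.2‖) ^ 2) = pn f * pn g := by
    rw [pn, pn, ← Real.sqrt_mul (sum_nonneg fun _ _ => sq_nonneg _), Finset.sum_mul_sum,
      Fintype.sum_prod_type]
    simp only [mul_pow]
  rw [e, Fintype.sum_prod_type] at h1
  exact h1

lemma mul_le_of_abs_le {x y X Y : ℝ} (hx : |x| ≤ X) (hy : |y| ≤ Y) : x * y ≤ X * Y :=
  (le_abs_self _).trans (by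
    rw [abs_mul]; exact mul_le_mul hx hy (abs_nonneg _) ((abs_nonneg _).trans hx))

variable {l1 l3 U : ℝ} {u v : V}

lemma energy_one_term (h1 : 0 ≤ l1) (h3 : 0 ≤ l3) (hu : ‖u‖ ≤ U) (hv : ‖v‖ ≤ 1) (a b L : V)
    {q d o g : ℝ} {D Q E : ℝ} (hq : |q| ≤ Q) (hd : |d| ≤ D) (ho : |o| ≤ 2 * (l1 + l3) * U)
    (hg : |g| ≤ E) :
    2 * (inner ℝ L a * inner ℝ (cross u b) v) + q * inner ℝ u (cross u b + cross v a) +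
      (d + o) * inner ℝ b (cross u b + cross v a) + g * inner ℝ a (cross u b + cross v a) -
      inner ℝ (aniso l1 l3 a) (cross u b + cross v a) +
      inner ℝ a (cross a (aniso l1 l3 v) + cross b (aniso l1 l3 u) +
        (cross u (aniso l1 l3 b) + cross v (aniso l1 l3 a))) ≤
      2 * (‖L‖ * U) * (‖a‖ * ‖b‖) + Q * (U * ‖a‖) + (D + 5 * (l1 + l3) * U + E * U) * (‖a‖ * ‖b‖) +
        3 * (l1 + l3) * ‖a‖ ^ 2 := by
  have hU := (norm_nonneg u).trans hu
  have hL : 0 ≤ l1 + l3 := by positivity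
  have cu : ∀ w : V, ‖cross u w‖ ≤ U * ‖w‖ := fun w =>
    (norm_cross_le u w).trans (by gcongr)
  have cv : ∀ w : V, ‖cross v w‖ ≤ ‖w‖ := fun w => (norm_cross_le v w).trans (by
    nlinarith [norm_nonneg w])
  have cj : ∀ w : V, ‖aniso l1 l3 w‖ ≤ (l1 + l3) * ‖w‖ := norm_aniso_le h1 h3
  have i1 : |inner ℝ (cross u b) v| ≤ U * ‖b‖ := (abs_real_inner_le_norm _ _).trans (by
    nlinarith [cu b, norm_nonneg (cross u b), norm_nonneg v])
  have t1 := mul_le_of_abs_le (abs_real_inner_le_norm L a) i1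
  have t2 : q * inner ℝ u (cross u b + cross v a) ≤ Q * (U * ‖a‖) := by
    refine mul_le_of_abs_le hq ?_
    rw [inner_add_right, real_inner_comm, inner_cross_left, zero_add]
    refine (abs_real_inner_le_norm _ _).trans ?_
    exact mul_le_mul hu (cv a) (norm_nonneg _) hU
  have t3 : (d + o) * inner ℝ b (cross u b + cross v a) ≤
      (D + 2 * (l1 + l3) * U) * (‖b‖ * ‖a‖) := by
    refine mul_le_of_abs_le ((abs_add_le _ _).trans (add_le_add hd ho)) ?_
    rw [inner_add_right, real_inner_comm, inner_cross_right, zero_add]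
    refine (abs_real_inner_le_norm _ _).trans ?_
    exact mul_le_mul_of_nonneg_left (cv a) (norm_nonneg _)
  have t4 : g * inner ℝ a (cross u b + cross v a) ≤ E * (‖a‖ * (U * ‖b‖)) := by
    refine mul_le_of_abs_le hg ?_
    rw [inner_add_right, real_inner_comm (cross v a), inner_cross_right, add_zero]
    refine (abs_real_inner_le_norm _ _).trans ?_
    exact mul_le_mul_of_nonneg_left (cu b) (norm_nonneg _)
  have t5 : -inner ℝ (aniso l1 l3 a) (cross u b + cross v a) ≤
      (l1 + l3) * ‖a‖ * (U * ‖b‖ + ‖a‖) := by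
    refine (neg_le_abs _).trans ((abs_real_inner_le_norm _ _).trans ?_)
    exact mul_le_mul (cj a) ((norm_add_le _ _).trans (add_le_add (cu b) (cv a)))
      (norm_nonneg _) (by positivity)
  have t6 : inner ℝ a (cross a (aniso l1 l3 v) + cross b (aniso l1 l3 u) +
      (cross u (aniso l1 l3 b) + cross v (aniso l1 l3 a))) ≤
      ‖a‖ * (‖a‖ * ((l1 + l3) * 1) + ‖b‖ * ((l1 + l3) * U) +
        (U * ((l1 + l3) * ‖b‖) + (l1 + l3) * ‖a‖)) := by
    refine (le_abs_self _).trans ((abs_real_inner_le_norm _ _).trans ?_)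
    refine mul_le_mul_of_nonneg_left ((norm_add_le _ _).trans (add_le_add
      ((norm_add_le _ _).trans (add_le_add ((norm_cross_le _ _).trans ?_)
        ((norm_cross_le _ _).trans ?_)))
      ((norm_add_le _ _).trans (add_le_add ((cu _).trans ?_) ((cv _).trans (cj a))))))
      (norm_nonneg _)
    · exact mul_le_mul_of_nonneg_left ((cj v).trans (by gcongr)) (norm_nonneg _)
    · exact mul_le_mul_of_nonneg_left ((cj u).trans (by gcongr)) (norm_nonneg _)
    · exact mul_le_mul_of_nonneg_left (cj b) hU
  linarith

variable {n m LN LM : V} {Nd Md a b : Fin N → V} {Nh Mh bh : Fin N → Fin N → V} {M : ℝ}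

lemma abs_sum_inner_le (f g : Fin N → V) : |∑ i, inner ℝ (f i) (g i)| ≤ pn f * pn g :=
  (abs_sum_le_sum_abs _ _).trans ((sum_le_sum fun i _ =>
    abs_real_inner_le_norm (f i) (g i)).trans (sum_norm_mul_le f g))

lemma energy_one_identity (hu : u = n - m) (hv : v = (1 / 2 : ℝ) • (n + m)) {a b Nd Md : V}
    (ha : a = Nd - Md) (hb : b = (1 / 2 : ℝ) • (Nd + Md)) (gN gM qN qM : ℝ) :
    inner ℝ ((qN + 2 * inner ℝ LN Nd) • n + gN • Nd - aniso l1 l3 Nd +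
        (inner ℝ n (aniso l1 l3 n) : ℝ) • Nd -
      ((qM + 2 * inner ℝ LM Md) • m + gM • Md - aniso l1 l3 Md +
        (inner ℝ m (aniso l1 l3 m) : ℝ) • Md)) (cross u b + cross v a) +
    inner ℝ a (cross Nd (aniso l1 l3 n) + cross n (aniso l1 l3 Nd) -
      (cross Md (aniso l1 l3 m) + cross m (aniso l1 l3 Md))) -
    (qN - qM) * inner ℝ (cross u b) v - 2 * (inner ℝ (LN - LM) b * inner ℝ (cross u b) v) =
    2 * (inner ℝ ((1 / 2 : ℝ) • (LN + LM)) a * inner ℝ (cross u b) v) +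
      (1 / 2 * (qN + qM + 2 * inner ℝ LN Nd + 2 * inner ℝ LM Md)) *
        inner ℝ u (cross u b + cross v a) +
      ((gN - gM) + 2 * inner ℝ u (aniso l1 l3 v)) * inner ℝ b (cross u b + cross v a) +
      (1 / 2 * (gN + gM + inner ℝ n (aniso l1 l3 n) + inner ℝ m (aniso l1 l3 m))) *
        inner ℝ a (cross u b + cross v a) - inner ℝ (aniso l1 l3 a) (cross u b + cross v a) +
      inner ℝ a (cross a (aniso l1 l3 v) + cross b (aniso l1 l3 u) +
        (cross u (aniso l1 l3 b) + cross v (aniso l1 l3 a))) := by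
  have hA : inner ℝ v (cross u b + cross v a) = inner ℝ (cross u b) v := by
    rw [inner_add_right, real_inner_comm (cross v a) v, inner_cross_left, add_zero,
      real_inner_comm (cross u b) v]
  have hK : cross Nd (aniso l1 l3 n) + cross n (aniso l1 l3 Nd) -
      (cross Md (aniso l1 l3 m) + cross m (aniso l1 l3 Md)) =
      cross a (aniso l1 l3 v) + cross b (aniso l1 l3 u) +
        (cross u (aniso l1 l3 b) + cross v (aniso l1 l3 a)) := by
    subst hu hv ha hb
    ext c
    simp only [PiLp.add_apply, PiLp.sub_apply, cross_apply, aniso_apply, PiLp.smul_apply, smul_eq_mul]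
    ring
  have ho : inner ℝ n (aniso l1 l3 n) - inner ℝ m (aniso l1 l3 m) = 2 * inner ℝ u (aniso l1 l3 v) := by
    subst hu hv
    simp only [inner_eq_sum, Fin.sum_univ_three, PiLp.add_apply, PiLp.sub_apply, aniso_apply,
      PiLp.smul_apply, smul_eq_mul]
    ring
  have hs : inner ℝ LN Nd - inner ℝ LM Md = inner ℝ (LN - LM) b +
      inner ℝ ((1 / 2 : ℝ) • (LN + LM)) a := by
    subst ha hb
    simp only [inner_sub_left, inner_sub_right, inner_add_left, inner_add_right, inner_smul_left,
      inner_smul_right, RCLike.conj_to_real]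
    ring
  have hY : (qN + 2 * inner ℝ LN Nd) • n + gN • Nd - aniso l1 l3 Nd +
        (inner ℝ n (aniso l1 l3 n) : ℝ) • Nd -
      ((qM + 2 * inner ℝ LM Md) • m + gM • Md - aniso l1 l3 Md +
        (inner ℝ m (aniso l1 l3 m) : ℝ) • Md) =
      ((qN - qM) + 2 * (inner ℝ LN Nd - inner ℝ LM Md)) • v +
      (1 / 2 * (qN + qM + 2 * inner ℝ LN Nd + 2 * inner ℝ LM Md)) • u +
      ((gN - gM) + (inner ℝ n (aniso l1 l3 n) - inner ℝ m (aniso l1 l3 m))) • b +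
      (1 / 2 * (gN + gM + inner ℝ n (aniso l1 l3 n) + inner ℝ m (aniso l1 l3 m))) • a -
      aniso l1 l3 a := by
    subst hu hv ha hb
    ext c
    simp only [PiLp.add_apply, PiLp.sub_apply, aniso_apply, PiLp.smul_apply, smul_eq_mul]
    ring
  rw [hY, hK, ho, hs]
  simp only [inner_add_left, inner_sub_left, inner_smul_left, RCLike.conj_to_real, hA]
  rw [← inner_add_left]
  ring

set_option maxHeartbeats 1000000 in
lemma energy_one_pointwise (h1 : 0 ≤ l1) (h3 : 0 ≤ l3) (hn : ‖n‖ = 1) (hm : ‖m‖ = 1)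
    (hu : u = n - m) (hv : v = (1 / 2 : ℝ) • (n + m)) (ha : ∀ i, a i = Nd i - Md i)
    (hb : ∀ i, b i = (1 / 2 : ℝ) • (Nd i + Md i))
    (hbh : ∀ i j, bh i j = (1 / 2 : ℝ) • (Nh i j + Mh i j))
    (hLN : LN = ∑ i, Nh i i) (hLM : LM = ∑ i, Mh i i) {gN gM : ℝ} {qN qM : Fin N → ℝ}
    (hgN : gN = ∑ j, inner ℝ (Nd j) (Nd j)) (hgM : gM = ∑ j, inner ℝ (Md j) (Md j))
    (hqN : ∀ i, qN i = ∑ j, 2 * inner ℝ (Nh j i) (Nd j))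
    (hqM : ∀ i, qM i = ∑ j, 2 * inner ℝ (Mh j i) (Md j))
    (hU : ‖u‖ ≤ U) (hNM : pn Nd ≤ M) (hMM : pn Md ≤ M) :
    ∑ i, (inner ℝ ((qN i + 2 * inner ℝ LN (Nd i)) • n + gN • Nd i - aniso l1 l3 (Nd i) +
        (inner ℝ n (aniso l1 l3 n) : ℝ) • Nd i -
      ((qM i + 2 * inner ℝ LM (Md i)) • m + gM • Md i - aniso l1 l3 (Md i) +
        (inner ℝ m (aniso l1 l3 m) : ℝ) • Md i)) (cross u (b i) + cross v (a i)) +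
    inner ℝ (a i) (cross (Nd i) (aniso l1 l3 n) + cross n (aniso l1 l3 (Nd i)) -
      (cross (Md i) (aniso l1 l3 m) + cross m (aniso l1 l3 (Md i)))) -
    (qN i - qM i) * inner ℝ (cross u (b i)) v -
    2 * (inner ℝ (LN - LM) (b i) * inner ℝ (cross u (b i)) v)) -
    (gN - gM) * ∑ i, (inner ℝ (cross (a i) (b i) + cross u (bh i i)) v +
      inner ℝ (cross u (b i)) (b i)) -
    2 * ∑ i, ∑ j, inner ℝ (a j) ((inner ℝ (cross (a j) (b i) + cross u (bh i j)) v +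
      inner ℝ (cross u (b i)) (b j) : ℝ) • b i + (inner ℝ (cross u (b i)) v : ℝ) • bh i j) ≤
    (14 + 6 * (l1 + l3)) * (1 + M ^ 2) * (pn a * pn a + U * (pn a * (pn Nd + pn Md + ‖LN‖ + ‖LM‖ +
      pn₂ Nh + pn₂ Mh))) := by
  have hU0 := (norm_nonneg u).trans hU
  have hL : 0 ≤ l1 + l3 := by positivity
  have hv1 : ‖v‖ ≤ 1 := by
    rw [hv, norm_smul]
    have := norm_add_le n m
    norm_num
    linarith
  have pN := pn_nonneg Nd
  have pM := pn_nonneg Md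
  have pa := pn_nonneg a
  have pb := pn_nonneg b
  have pNh := (pn_nonneg _ : 0 ≤ pn₂ Nh)
  have pMh := (pn_nonneg _ : 0 ≤ pn₂ Mh)
  have pbh := (pn_nonneg _ : 0 ≤ pn₂ bh)
  have hM0 := pN.trans hNM
  have half : ∀ x : ℝ, |(1 / 2 : ℝ)| * x = 1 / 2 * x := fun x => by
    rw [abs_of_nonneg (by norm_num)]
  have hb1 : pn b ≤ 1 / 2 * (pn Nd + pn Md) := by
    rw [show b = fun i => (1 / 2 : ℝ) • (Nd i + Md i) from funext hb, pn_smul, half]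
    exact mul_le_mul_of_nonneg_left (pn_add_le Nd Md) (by norm_num)
  have hbh1 : pn₂ bh ≤ 1 / 2 * (pn₂ Nh + pn₂ Mh) := by
    simp only [pn₂, hbh]
    rw [pn_smul, half]
    exact mul_le_mul_of_nonneg_left (pn_add_le _ _) (by norm_num)
  have hLv : ‖(1 / 2 : ℝ) • (LN + LM)‖ ≤ 1 / 2 * (‖LN‖ + ‖LM‖) := by
    rw [norm_smul, norm_eq_abs, half]
    exact mul_le_mul_of_nonneg_left (norm_add_le _ _) (by norm_num)
  have hLs : ∑ i, bh i i = (1 / 2 : ℝ) • (LN + LM) := by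
    simp only [hbh, ← Finset.smul_sum, sum_add_distrib, hLN, hLM]
  have hgd : gN - gM = 2 * ∑ j, inner ℝ (a j) (b j) := by
    rw [hgN, hgM, ← sum_sub_distrib, mul_sum]
    refine sum_congr rfl fun j _ => ?_
    rw [ha, hb, inner_smul_right, inner_sub_left, inner_add_right, inner_add_right,
      real_inner_comm (Nd j) (Md j)]
    ring
  have hg1 : |gN - gM| ≤ 2 * (pn a * pn b) := by
    rw [hgd, abs_mul, abs_of_pos two_pos]
    exact mul_le_mul_of_nonneg_left (abs_sum_inner_le a b) two_pos.le
  have hsq : ∀ f : Fin N → V, pn f ≤ M → |∑ j, inner ℝ (f j) (f j)| ≤ M ^ 2 := fun f hf =>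
    (abs_sum_inner_le f f).trans (by rw [sq]; exact mul_le_mul hf hf (pn_nonneg f) hM0)
  have hJ : ∀ w w' : V, ‖w‖ ≤ 1 → |inner ℝ w' (aniso l1 l3 w)| ≤ (l1 + l3) * ‖w'‖ := fun w w' hw =>
    (abs_real_inner_le_norm _ _).trans ((mul_le_mul_of_nonneg_left
      ((norm_aniso_le h1 h3 w).trans (mul_le_of_le_one_right hL hw)) (norm_nonneg w')).trans_eq
        (mul_comm _ _))
  have hg2 : |1 / 2 * (gN + gM + inner ℝ n (aniso l1 l3 n) + inner ℝ m (aniso l1 l3 m))| ≤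
      M ^ 2 + (l1 + l3) := by
    have e1 := abs_le.1 (hsq Nd hNM)
    have e2 := abs_le.1 (hsq Md hMM)
    have e3 := abs_le.1 (hJ n n hn.le)
    have e4 := abs_le.1 (hJ m m hm.le)
    rw [← hgN] at e1
    rw [← hgM] at e2
    rw [hn] at e3
    rw [hm] at e4
    rw [abs_le]
    constructor <;> linarith [e1.1, e1.2, e2.1, e2.2, e3.1, e3.2, e4.1, e4.2]
  have ho : |2 * inner ℝ u (aniso l1 l3 v)| ≤ 2 * (l1 + l3) * U := by
    rw [abs_mul, abs_of_pos two_pos, mul_assoc]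
    exact mul_le_mul_of_nonneg_left ((hJ v u hv1).trans (by gcongr)) two_pos.le
  have hq : ∀ i, |1 / 2 * (qN i + qM i + 2 * inner ℝ LN (Nd i) + 2 * inner ℝ LM (Md i))| ≤
      (∑ j, ‖Nh j i‖ * ‖Nd j‖) + (∑ j, ‖Mh j i‖ * ‖Md j‖) + ‖LN‖ * ‖Nd i‖ + ‖LM‖ * ‖Md i‖ := by
    intro i
    have e0 : ∀ (f : Fin N → V) (g : Fin N → V), |∑ j, 2 * inner ℝ (f j) (g j)| ≤
        2 * ∑ j, ‖f j‖ * ‖g j‖ := fun f g => by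
      rw [← mul_sum, abs_mul, abs_of_pos two_pos]
      exact mul_le_mul_of_nonneg_left ((abs_sum_le_sum_abs _ _).trans
        (sum_le_sum fun j _ => abs_real_inner_le_norm _ _)) two_pos.le
    have e1 := abs_le.1 (e0 (fun j => Nh j i) Nd)
    have e2 := abs_le.1 (e0 (fun j => Mh j i) Md)
    have e3 := abs_le.1 (abs_real_inner_le_norm LN (Nd i))
    have e4 := abs_le.1 (abs_real_inner_le_norm LM (Md i))
    rw [hqN, hqM, abs_le]
    constructor <;> linarith [e1.1, e1.2, e2.1, e2.2, e3.1, e3.2, e4.1, e4.2]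
  have S1 := sum_le_sum fun i (_ : i ∈ (univ : Finset (Fin N))) =>
    (energy_one_identity (LN := LN) (LM := LM) (l1 := l1) (l3 := l3) hu hv (ha i) (hb i) gN gM
      (qN i) (qM i)).le.trans
    (energy_one_term h1 h3 hU hv1 (a i) (b i) ((1 / 2 : ℝ) • (LN + LM)) (hq i) hg1 ho hg2)
  have cu : ∀ w : V, ‖cross u w‖ ≤ U * ‖w‖ := fun w =>
    (norm_cross_le u w).trans (by gcongr)
  have iv : ∀ w : V, |inner ℝ w v| ≤ ‖w‖ := fun w => (abs_real_inner_le_norm _ _).trans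
    (mul_le_of_le_one_right (norm_nonneg w) hv1)
  have S2 : -((gN - gM) * ∑ i, (inner ℝ (cross (a i) (b i) + cross u (bh i i)) v +
      inner ℝ (cross u (b i)) (b i))) ≤ 2 * (pn a * pn b) *
        (pn a * pn b + U * (1 / 2 * (‖LN‖ + ‖LM‖))) := by
    rw [← neg_mul]
    refine mul_le_of_abs_le (by rwa [abs_neg]) ?_
    have e : ∑ i, (inner ℝ (cross (a i) (b i) + cross u (bh i i)) v +
        inner ℝ (cross u (b i)) (b i)) = ∑ i, inner ℝ (cross (a i) (b i)) v +
        inner ℝ (cross u ((1 / 2 : ℝ) • (LN + LM))) v := by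
      have : cross u ((1 / 2 : ℝ) • (LN + LM)) = ∑ i, cross u (bh i i) := by
        rw [← hLs]
        exact map_sum (AddMonoidHom.mk' (cross u) fun x y => by
          ext c; simp only [cross_apply, PiLp.add_apply]; ring) _ _
      rw [this, sum_inner, ← sum_add_distrib]
      exact sum_congr rfl fun i _ => by rw [inner_cross_right, inner_add_left, add_zero]
    rw [e]
    refine (abs_add_le _ _).trans (add_le_add ((abs_sum_le_sum_abs _ _).trans
      ((sum_le_sum fun i _ => (iv _).trans (norm_cross_le _ _)).trans
        (sum_norm_mul_le a b))) ((iv _).trans ((cu _).trans (by gcongr))))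
  have S3 : -∑ i, ∑ j, inner ℝ (a j) ((inner ℝ (cross (a j) (b i) + cross u (bh i j)) v +
      inner ℝ (cross u (b i)) (b j) : ℝ) • b i + (inner ℝ (cross u (b i)) v : ℝ) • bh i j) ≤
      (pn a * pn b) * (pn a * pn b) + 2 * U * (pn b * pn a * pn₂ bh) +
        U * (pn b * pn b) * (pn a * pn b) := by
    have e : ∀ i j, -inner ℝ (a j) ((inner ℝ (cross (a j) (b i) + cross u (bh i j)) v +
        inner ℝ (cross u (b i)) (b j) : ℝ) • b i + (inner ℝ (cross u (b i)) v : ℝ) • bh i j) ≤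
        ‖a j‖ ^ 2 * ‖b i‖ ^ 2 + 2 * U * (‖b i‖ * ‖a j‖ * ‖bh i j‖) +
          U * (‖b i‖ ^ 2 * (‖a j‖ * ‖b j‖)) := by
      intro i j
      rw [inner_add_right, inner_smul_right, inner_smul_right, neg_add]
      have k1 : |inner ℝ (cross (a j) (b i) + cross u (bh i j)) v + inner ℝ (cross u (b i)) (b j)| ≤
          ‖a j‖ * ‖b i‖ + U * ‖bh i j‖ + U * ‖b i‖ * ‖b j‖ := by
        refine (abs_add_le _ _).trans (add_le_add ((iv _).trans ((norm_add_le _ _).trans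
          (add_le_add (norm_cross_le _ _) (cu _)))) ((abs_real_inner_le_norm _ _).trans ?_))
        exact mul_le_mul_of_nonneg_right (cu _) (norm_nonneg _)
      have k2 := mul_le_of_abs_le (y := -inner ℝ (a j) (b i)) k1
        ((abs_neg _).trans_le (abs_real_inner_le_norm _ _))
      have k3 := mul_le_of_abs_le (y := -inner ℝ (a j) (bh i j)) ((iv _).trans (cu (b i)))
        ((abs_neg _).trans_le (abs_real_inner_le_norm _ _))
      linarith
    rw [← sum_neg_distrib]
    simp only [← sum_neg_distrib]
    refine (sum_le_sum fun i _ => sum_le_sum fun j _ => e i j).trans ?_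
    simp only [sum_add_distrib, ← mul_sum, ← sum_mul, ← pn_sq]
    have q1 := mul_le_mul_of_nonneg_left (sum_norm_mul_mul_le b a bh) (show 0 ≤ 2 * U by positivity)
    have q2 := mul_le_mul_of_nonneg_left (sum_norm_mul_le a b)
      (show 0 ≤ U * (pn b * pn b) by positivity)
    linarith
  have S4 : ∑ i, ((∑ j, ‖Nh j i‖ * ‖Nd j‖) + (∑ j, ‖Mh j i‖ * ‖Md j‖) + ‖LN‖ * ‖Nd i‖ +
      ‖LM‖ * ‖Md i‖) * (U * ‖a i‖) ≤ U * (M * pn a * (pn₂ Nh + pn₂ Mh + ‖LN‖ + ‖LM‖)) := by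
    have e1 : ∀ (f : Fin N → V) (h : Fin N → Fin N → V), pn f ≤ M →
        ∑ i, (∑ j, ‖h j i‖ * ‖f j‖) * ‖a i‖ ≤ M * pn a * pn₂ h := fun f h hf => by
        refine le_trans (le_of_eq ?_) ((sum_norm_mul_mul_le f a h).trans (by
          have := (pn_nonneg _ : 0 ≤ pn₂ h); gcongr))
        simp only [sum_mul]
        rw [sum_comm]
        exact sum_congr rfl fun _ _ => sum_congr rfl fun _ _ => by ring
    have e2 : ∀ (f : Fin N → V) (w : V), pn f ≤ M → ∑ i, ‖w‖ * ‖f i‖ * ‖a i‖ ≤ M * pn a * ‖w‖ :=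
      fun f w hf => by
        simp only [mul_assoc, ← mul_sum]
        have := (sum_norm_mul_le f a).trans (mul_le_mul_of_nonneg_right hf pa)
        exact (mul_le_mul_of_nonneg_left this (norm_nonneg w)).trans_eq (by ring)
    have e3 := mul_le_mul_of_nonneg_left (add_le_add (add_le_add (add_le_add (e1 Nd Nh hNM)
      (e1 Md Mh hMM)) (e2 Nd LN hNM)) (e2 Md LM hMM)) hU0
    refine le_trans (le_of_eq ?_) (e3.trans (le_of_eq (by ring)))
    rw [← sum_add_distrib, ← sum_add_distrib, ← sum_add_distrib, mul_sum]
    exact sum_congr rfl fun _ _ => by ring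
  rw [sum_add_distrib, sum_add_distrib, sum_add_distrib, ← mul_sum,
    ← mul_sum, ← mul_sum, ← pn_sq] at S1
  have hab := sum_norm_mul_le a b
  set α := pn a
  set β := pn b
  set h := pn Nd + pn Md + ‖LN‖ + ‖LM‖ + pn₂ Nh + pn₂ Mh with hh
  set δ := pn₂ bh
  have nLN := norm_nonneg LN
  have nLM := norm_nonneg LM
  have hβM : β ≤ M := by linarith
  have hβh : β ≤ h := by linarith
  have hδh : δ ≤ h := by linarith
  have hh0 : 0 ≤ h := by positivity
  have hΛh : 1 / 2 * (‖LN‖ + ‖LM‖) ≤ h := by linarith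
  have W1 : ∀ c, 0 ≤ c → c * (∑ i, ‖a i‖ * ‖b i‖) ≤ c * (α * β) := fun c hc =>
    mul_le_mul_of_nonneg_left hab hc
  have w1 := W1 (2 * (‖(1 / 2 : ℝ) • (LN + LM)‖ * U)) (by positivity)
  have w2 := W1 (2 * (α * β) + 5 * (l1 + l3) * U + (M ^ 2 + (l1 + l3)) * U) (by positivity)
  have g1 : ‖(1 / 2 : ℝ) • (LN + LM)‖ * U * (α * β) ≤ h * U * (α * M) := by
    have := hLv.trans hΛh
    gcongr
  have g2 : U * (α * β) ≤ U * (α * h) := by gcongr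
  have g3 : α * β * (α * β) ≤ α * M * (α * M) := by gcongr
  have g4 : α * β * (U * (1 / 2 * (‖LN‖ + ‖LM‖))) ≤ α * M * (U * h) := by gcongr
  have g5 : U * (β * α * δ) ≤ U * (M * α * h) := by gcongr
  have g6 : U * (β * β) * (α * β) ≤ U * (M * M) * (α * h) := by gcongr
  have g7 : U * (M * α * (pn₂ Nh + pn₂ Mh + ‖LN‖ + ‖LM‖)) ≤ U * (M * α * h) := by
    gcongr
    linarith
  have g8 := mul_le_mul_of_nonneg_left g2 (show 0 ≤ 6 * (l1 + l3) + M ^ 2 by positivity)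
  have F1 : 0 ≤ U * (α * h) := by positivity
  have F2 : M * (U * (α * h)) ≤ (1 + M ^ 2) / 2 * (U * (α * h)) := by
    have : M ≤ (1 + M ^ 2) / 2 := by nlinarith only [sq_nonneg (M - 1)]
    gcongr
  have F3 : 0 ≤ (l1 + l3) * M ^ 2 * (U * (α * h)) := by positivity
  have F4 : 0 ≤ (l1 + l3) * M ^ 2 * (α * α) := by positivity
  have F5 : 0 ≤ (l1 + l3) * (α * α) := by positivity
  have F6 : 0 ≤ M ^ 2 * (α * α) := by positivity
  have F7 : 0 ≤ M ^ 2 * (U * (α * h)) := by positivity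
  have F8 : 0 ≤ α * α := by positivity
  linarith only [S1, S2, S3, S4, w1, w2, g1, g2, g3, g4, g5, g6, g7, g8, F1, F2, F3, F4, F5, F6, F7,
    F8]

end

noncomputable section

variable {N K : ℕ} {T l1 l3 : ℝ} {m dm n dn : Flow N} {t : ℝ}

lemma sum_inner_cancel (X a Lg Y A aa Kd b AA : Fin N → V) (bP : Fin N → Fin N → V) (du L K : V)
    (q P PP : Fin N → ℝ) (g : ℝ) (hL : ∑ i, aa i = L) (hdu : du = -(∑ i, AA i) + K) :
    ∑ i, (inner ℝ (X i) (a i) + inner ℝ (Lg i + Y i) (A i)) +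
      (((((∑ i, -1 * (inner ℝ (X i) (a i) + inner ℝ du (aa i))) +
        ∑ i, -1 * (inner ℝ (Lg i) (A i) + inner ℝ L (AA i))) +
        ∑ i, (inner ℝ (aa i) K + inner ℝ (a i) (Kd i))) + ∑ i, -1 * (q i * P i + g * PP i)) +
        ∑ i, ∑ j, -2 * (inner ℝ (aa j) (P i • b i) + inner ℝ (a j) (bP i j))) =
    ∑ i, (inner ℝ (Y i) (A i) + inner ℝ (a i) (Kd i) - q i * P i - 2 * (inner ℝ L (b i) * P i)) -
      g * ∑ i, PP i - 2 * ∑ i, ∑ j, inner ℝ (a j) (bP i j) := by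
  have e1 : ∑ i, inner ℝ du (aa i) = inner ℝ du L := by rw [← hL, inner_sum]
  have e2 : ∑ i, inner ℝ L (AA i) = inner ℝ L (K - du) := by rw [hdu, ← inner_sum]; congr 1; abel
  have e3 : ∑ i, inner ℝ (aa i) K = inner ℝ L K := by rw [← hL, sum_inner]
  have e4 : ∑ i, ∑ j, inner ℝ (aa j) (P i • b i) = ∑ i, inner ℝ L (b i) * P i :=
    sum_congr rfl fun i _ => by rw [← sum_inner, hL, inner_smul_right, mul_comm]
  simp only [sum_add_distrib, sum_sub_distrib, ← mul_sum, e1, e2, e3, e4,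
    inner_add_left, inner_sub_right]
  rw [real_inner_comm L du]
  ring

lemma pd_smul {d₁ d₂ : ℕ} {F : ℝ → X N → ℝ} {g : Flow N} (hF : CT K d₁ T F)
    (hg : ∀ a, CT K d₂ T (g a)) (hK : d₁ + d₂ + 1 ≤ K) (ht : t ∈ Icc 0 T) (i : Fin N) :
    ∀ᵐ x, ve (pd (fun a t x => F t x * g a t x) i) t x =
      weakDeriv (single i 1) (F t) x • ve g t x + F t x • ve (pd g i) t x := by
  filter_upwards [ae_all_iff.2 fun a => (hF.isWeakDeriv_mul (hg a) hK ht i).ae_eq] with x hx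
  ext a
  exact hx a

namespace Sol

lemma ve_lapc (h : Sol l1 l3 K T m dm) (hK : 2 ≤ K) (ht : t ∈ Icc 0 T) :
    ∀ᵐ x, ve (lapc m) t x = ∑ i, ve (pd (pd m i) i) t x := by
  filter_upwards [ae_all_iff.2 fun i => ae_all_iff.2 fun a => h.pd_pd hK ht i a] with x hx
  have es : ∀ a, (∑ i, ve (pd (pd m i) i) t x) a = ∑ i, ve (pd (pd m i) i) t x a := fun a =>
    map_sum (PiLp.proj 2 (fun _ : Fin 3 => ℝ) (𝕜 := ℝ) a) _ _
  ext a
  rw [es]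
  change ∑ i : Fin N, _ = ∑ i, pd (pd m i) i a t x
  exact sum_congr rfl fun i _ => (hx i a).symm

lemma gg_deriv (h : Sol l1 l3 K T m dm) (hK : 3 ≤ K) (ht : t ∈ Icc 0 T) (i : Fin N) :
    ∀ᵐ x, weakDeriv (single i 1) (gg m t) x =
      ∑ j, 2 * inner ℝ (ve (pd (pd m j) i) t x) (ve (pd m j) t x) := by
  have h1 := IsWeakDeriv.sum univ fun j _ => IsWeakDeriv.sum univ fun a _ =>
    (h.pd_ct j a).isWeakDeriv_mul (h.pd_ct j a) (by omega) ht i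
  have h2 := h1.congr (f' := gg m t) (.of_forall fun x => by
    simp only [Finset.sum_apply, gg]) .rfl
  filter_upwards [h2.ae_eq] with x hx
  rw [hx]
  simp only [Finset.sum_apply, inner_ve, mul_sum]
  refine sum_congr rfl fun j _ => sum_congr rfl fun a _ => ?_
  simp only [pd]
  ring

lemma gg_eq (m : Flow N) (t : ℝ) (x : X N) :
    gg m t x = ∑ j, inner ℝ (ve (pd m j) t x) (ve (pd m j) t x) := by
  simp only [inner_ve, gg]

lemma ve_yy (m : Flow N) (i : Fin N) (t : ℝ) (x : X N) : ve (yy l1 l3 m i) t x =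
    (weakDeriv (single i 1) (gg m t) x + 2 * inner ℝ (ve (lapc m) t x) (ve (pd m i) t x)) •
      ve m t x + gg m t x • ve (pd m i) t x - aniso l1 l3 (ve (pd m i) t x) +
      (inner ℝ (ve m t x) (aniso l1 l3 (ve m t x)) : ℝ) • ve (pd m i) t x := by
  have e : om l1 l3 m t x = inner ℝ (ve m t x) (aniso l1 l3 (ve m t x)) := by
    rw [← ve_jj, inner_ve, om]
    exact sum_congr rfl fun a _ => by simp only [jj]; ring
  ext a
  simp only [PiLp.add_apply, PiLp.sub_apply, PiLp.smul_apply, smul_eq_mul, aniso_apply, inner_ve, ← e]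
  rfl

lemma jj_ct (h : Sol l1 l3 K T m dm) (a : Fin 3) : CT K 1 T (jj l1 l3 m a) := h.jct a

lemma pd_jj (h : Sol l1 l3 K T m dm) (hK : 1 ≤ K) (ht : t ∈ Icc 0 T) (i : Fin N) :
    ∀ᵐ x, ve (pd (jj l1 l3 m) i) t x = aniso l1 l3 (ve (pd m i) t x) := by
  filter_upwards [ae_all_iff.2 fun a =>
    ((h.isWeakDeriv_ct hK ht i a).const_smul (lam l1 l3 a)).ae_eq] with x hx
  ext a
  rw [aniso_apply]
  exact hx a

/-- The time derivative of the functional at the `H¹` level. -/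
def dOne (l1 l3 : ℝ) (m dm n dn : Flow N) (t : ℝ) : ℝ :=
  ∑ i, ((∫ x, inner ℝ (ve (dff (pd dn i) (pd dm i)) t x) (ve (dff (pd n i) (pd m i)) t x)) +
    ∫ x, inner ℝ (ve (dff (fun a t x => pd (lapc n) i a t x + yy l1 l3 n i a t x)
      (fun a t x => pd (lapc m) i a t x + yy l1 l3 m i a t x)) t x)
      (ve (dff (bb n i) (bb m i)) t x))

lemma memLp_inf {d : ℕ} {f : Flow N} (hf : ∀ a, CT K d T (f a)) (h1 : 1 ≤ d)
    (hK : d ≤ K) : ∀ a, ∀ t ∈ Icc 0 T, MemLp (f a t) 2 := fun a t ht =>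
  (hf a).cLp_inf h1 hK t ht

lemma energy_one_deriv (hm : Sol l1 l3 K T m dm) (hn : Sol l1 l3 K T n dn) (hK : 3 ≤ K) :
    (∀ t ∈ Icc 0 T, HasDerivWithinAt (fun t => ∑ i, (1 / 2 * (∫ x, ‖ve (dff (pd n i) (pd m i)) t x‖ ^ 2)
      + 1 / 2 * ∫ x, ‖ve (dff (bb n i) (bb m i)) t x‖ ^ 2)) (dOne l1 l3 m dm n dn t) (Icc 0 T) t) ∧
      ContinuousOn (dOne l1 l3 m dm n dn) (Icc 0 T) := by
  have c1 := fun i => CT.dff (hn.pd_ct i) (hm.pd_ct i)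
  have c2 := fun i => CT.dff (hn.bb_ct i) (hm.bb_ct i)
  have c3 := fun i => CT.dff (CT.pd hn.dct i) (CT.pd hm.dct i)
  have c4 := fun i => CT.dff (fun a => (CT.pd hn.lapc_ct i a).add (hn.yy_ct i a))
    fun a => (CT.pd hm.lapc_ct i a).add (hm.yy_ct i a)
  constructor
  · refine fun t ht => HasDerivWithinAt.fun_sum fun i _ => (hasDerivWithinAt_half_sq (fun a => ?_)
      (memLp_inf (c1 i) le_rfl (by omega)) ht).add (hasDerivWithinAt_half_sq (fun a => ?_)
      (memLp_inf (c2 i) le_rfl (by omega)) ht)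
    · exact (hn.sd_deriv a (α := single i 1) (by simpa using hK)).sub
        (hm.sd_deriv a (α := single i 1) (by simpa using hK)) one_le_two
    · exact (hn.sd_bb hK i a).sub (hm.sd_bb hK i a) one_le_two
  · exact continuousOn_finsetSum _ fun i _ => (continuousOn_integral_inner
      (fun a => (c3 i a).cLp_zero (by norm_num) hK) fun a => (c1 i a).cLp_zero le_rfl (by omega)).add
      (continuousOn_integral_inner
      (fun a => (c4 i a).cLp_zero (by norm_num) hK) fun a => (c2 i a).cLp_zero le_rfl (by omega))

set_option maxHeartbeats 1000000 in
lemma energy_one_le (hm : Sol l1 l3 K T m dm) (hn : Sol l1 l3 K T n dn) (hl1 : 0 ≤ l1)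
    (hl3 : 0 ≤ l3) (hK : 3 ≤ K) (ht : t ∈ Icc 0 T) {U G H M : ℝ} (hU0 : 0 ≤ U) (hG0 : 0 ≤ G)
    (hH0 : 0 ≤ H) (hU : ∀ᵐ x, ‖ve (dff n m) t x‖ ≤ U)
    (hG : Bd 1 (fun x => pn fun i => ve (pd n i) t x - ve (pd m i) t x) G)
    (hM1 : ∀ᵐ x, (pn fun i => ve (pd n i) t x) ≤ M)
    (hM2 : ∀ᵐ x, (pn fun i => ve (pd m i) t x) ≤ M)
    (hH : Bd 1 (fun x => (pn fun i => ve (pd n i) t x) + (pn fun i => ve (pd m i) t x) +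
      ‖ve (lapc n) t x‖ + ‖ve (lapc m) t x‖ +
      (pn fun p : Fin N × Fin N => ve (pd (pd n p.1) p.2) t x) +
      (pn fun p : Fin N × Fin N => ve (pd (pd m p.1) p.2) t x)) H) : dOne l1 l3 m dm n dn t ≤
      (14 + 6 * (l1 + l3)) * (1 + M ^ 2) * (G * G + U * (G * H)) := by
  have c0 := CT.dff hn.ct hm.ct
  have cv := CT.avg hn.ct hm.ct
  have c1 := fun i => CT.dff (hn.pd_ct i) (hm.pd_ct i)
  have cb := fun i => CT.avg (hn.pd_ct i) (hm.pd_ct i)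
  have c2 := fun i => CT.dff (hn.bb_ct i) (hm.bb_ct i)
  have c3 := fun i => CT.dff (CT.pd hn.dct i) (CT.pd hm.dct i)
  have c4 := fun i => CT.dff (fun a => (CT.pd hn.lapc_ct i a).add (hn.yy_ct i a))
    fun a => (CT.pd hm.lapc_ct i a).add (hm.yy_ct i a)
  have cd := CT.dff hn.dct hm.dct
  have cl := CT.dff hn.lapc_ct hm.lapc_ct
  have cKn := CT.crs hn.ct hn.jj_ct
  have cKm := CT.crs hm.ct hm.jj_ct
  have cK := CT.dff cKn cKm
  have cg := hn.gg_ct.sub hm.gg_ct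
  have cub := fun i => CT.crs c0 (cb i)
  have cP := fun i => CT.inner (cub i) cv
  have cbP := fun i a => (cP i).mul (cb i a)
  have hZ := ((((NI.sum Finset.univ fun i (_ : i ∈ Finset.univ) => (CT.ni_inner cd (c1 i)
      (by norm_num) le_rfl (by omega) (by omega) ht i).const_mul (-1)).add
    (NI.sum Finset.univ fun i (_ : i ∈ Finset.univ) => (CT.ni_inner cl (c2 i)
      (by norm_num) le_rfl (by omega) (by omega) ht i).const_mul (-1))).add
    (NI.sum Finset.univ fun i (_ : i ∈ Finset.univ) => CT.ni_inner (c1 i) cK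
      le_rfl (by norm_num) (by omega) (by omega) ht i)).add
    (NI.sum Finset.univ fun i (_ : i ∈ Finset.univ) => (CT.ni cg (cP i)
      (by norm_num) (by norm_num) (by omega) (by omega) ht i).const_mul (-1))).add
    (NI.sum Finset.univ fun i (_ : i ∈ Finset.univ) => NI.sum Finset.univ fun j
      (_ : j ∈ Finset.univ) => (CT.ni_inner (c1 j) (cbP i)
      le_rfl (by norm_num) (by omega) (by omega) ht j).const_mul (-2))
  have i1 := fun i => integrable_inner_ve
    (fun a => memLp_inf (c3 i) (by norm_num) hK a t ht)
    (fun a => memLp_inf (c1 i) le_rfl (by omega) a t ht)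
  have i2 := fun i => integrable_inner_ve
    (fun a => memLp_inf (c4 i) (by norm_num) hK a t ht)
    (fun a => memLp_inf (c2 i) le_rfl (by omega) a t ht)
  have hB := ((hG.ib hG hG0 hG0).add ((hG.ib hH hG0 hH0).const_mul hU0)).const_mul
    (r := (14 + 6 * (l1 + l3)) * (1 + M ^ 2)) (by positivity)
  have ed : dOne l1 l3 m dm n dn t = ∫ x, ∑ i, (inner ℝ (ve (dff (pd dn i) (pd dm i)) t x)
      (ve (dff (pd n i) (pd m i)) t x) +
    inner ℝ (ve (dff (fun a t x => pd (lapc n) i a t x + yy l1 l3 n i a t x)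
      (fun a t x => pd (lapc m) i a t x + yy l1 l3 m i a t x)) t x)
      (ve (dff (bb n i) (bb m i)) t x)) := by
    refine Eq.trans ?_ (integral_finsetSum _ fun i _ => (i1 i).add (i2 i)).symm
    exact sum_congr rfl fun i _ => (integral_add (i1 i) (i2 i)).symm
  rw [ed]
  refine hB.integral_le (integrable_finsetSum _ fun i _ => (i1 i).add (i2 i)) hZ ?_
  have e1 := ae_all_iff.2 fun i => pd_dff hn.dct hm.dct (by omega) ht i
  have e2 := ae_all_iff.2 fun i => pd_dff (hn.pd_ct i) (hm.pd_ct i) (by omega) ht i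
  have e3 := ae_all_iff.2 fun i => pd_dff hn.lapc_ct hm.lapc_ct (by omega) ht i
  have e4 := ae_all_iff.2 fun i => pd_dff cKn cKm (by omega) ht i
  have e5 := ae_all_iff.2 fun i => pd_crs hn.ct hn.jj_ct (by omega) ht i
  have e6 := ae_all_iff.2 fun i => pd_crs hm.ct hm.jj_ct (by omega) ht i
  have e7 : ∀ᵐ x, ∀ i, weakDeriv (single i 1) (fun x => gg n t x - gg m t x) x =
      weakDeriv (single i 1) (gg n t) x - weakDeriv (single i 1) (gg m t) x :=
    ae_all_iff.2 fun i => ((hn.gg_ct.isWeak (γ := single i 1) (by simpa using hK) ht).sub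
      (hm.gg_ct.isWeak (γ := single i 1) (by simpa using hK) ht)).ae_eq
  have e8 := ae_all_iff.2 fun i => ae_all_iff.2 fun j =>
    weakDeriv_inner (cub i) cv (by omega) ht j
  have e9 := ae_all_iff.2 fun i => ae_all_iff.2 fun j => pd_crs c0 (cb i) (by omega) ht j
  have e10 := ae_all_iff.2 fun j => pd_dff hn.ct hm.ct (by omega) ht j
  have e11 := ae_all_iff.2 fun j => pd_avg hn.ct hm.ct (by omega) ht j
  have e12 := ae_all_iff.2 fun i => ae_all_iff.2 fun j =>
    pd_avg (hn.pd_ct i) (hm.pd_ct i) (by omega) ht j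
  have e13 := ae_all_iff.2 fun i => ae_all_iff.2 fun j => pd_smul (cP i) (cb i) (by omega) ht j
  have e14 := ae_all_iff.2 fun i => hn.gg_deriv hK ht i
  have e15 := ae_all_iff.2 fun i => hm.gg_deriv hK ht i
  have e16 := ae_all_iff.2 fun i => hn.pd_jj (by omega) ht i
  have e17 := ae_all_iff.2 fun i => hm.pd_jj (by omega) ht i
  filter_upwards [e1, e2, e3, e4, e5, e6, e7, e8, e9, e10, e11, e12, e13, e14, e15, e16, e17,
    hn.ve_lapc (by omega) ht, hm.ve_lapc (by omega) ht, hm.dff_eqn hn (by omega) ht, hU, hM1, hM2,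
    hn.norm_ve ht, hm.norm_ve ht] with x e1 e2 e3 e4 e5 e6 e7 e8 e9 e10 e11 e12 e13 e14 e15 e16 e17
    e18 e19 e20 e21 e22 e23 e24 e25
  have key := energy_one_pointwise (l1 := l1) (l3 := l3) hl1 hl3 e24 e25 rfl rfl (fun i => rfl)
    (fun i => rfl) (fun i j => rfl) e18 e19 (gg_eq n t x) (gg_eq m t x) e14 e15 e21 e22 e23
  have hc := sum_inner_cancel (fun i => ve (dff (pd dn i) (pd dm i)) t x)
    (fun i => ve (dff (pd n i) (pd m i)) t x) (fun i => ve (pd (lapc n) i) t x - ve (pd (lapc m) i) t x)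
    (fun i => ve (yy l1 l3 n i) t x - ve (yy l1 l3 m i) t x)
    (fun i => ve (dff (bb n i) (bb m i)) t x)
    (fun i => ve (pd (dff (pd n i) (pd m i)) i) t x)
    (fun i => ve (pd (dff (crs n (jj l1 l3 n)) (crs m (jj l1 l3 m))) i) t x)
    (fun i => ve (avg (pd n i) (pd m i)) t x)
    (fun i => ve (pd (dff (bb n i) (bb m i)) i) t x)
    (fun i j => ve (pd (fun a t x => inner ℝ (ve (crs (dff n m) (avg (pd n i) (pd m i))) t x)
      (ve (avg n m) t x) * avg (pd n i) (pd m i) a t x) j) t x)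
    (ve (dff dn dm) t x) (ve (dff (lapc n) (lapc m)) t x)
    (ve (dff (crs n (jj l1 l3 n)) (crs m (jj l1 l3 m))) t x)
    (fun i => weakDeriv (single i 1) (fun x => gg n t x - gg m t x) x)
    (fun i => inner ℝ (ve (crs (dff n m) (avg (pd n i) (pd m i))) t x) (ve (avg n m) t x))
    (fun i => weakDeriv (single i 1) (fun x =>
      inner ℝ (ve (crs (dff n m) (avg (pd n i) (pd m i))) t x) (ve (avg n m) t x)) x)
    (gg n t x - gg m t x)
    (by simp only [e2, ve_dff, e18, e19, sum_sub_distrib])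
    (by rw [e20, ve_dff, ve_crs, ve_crs, ve_jj, ve_jj])
  refine le_trans (le_of_eq ?_) (hc.le.trans (le_trans (le_of_eq ?_) key))
  · simp only [e1, e3]
    congr 1
    refine sum_congr rfl fun i _ => ?_
    congr 2
    ext a
    simp only [PiLp.add_apply, PiLp.sub_apply]
    change (_ + _) - (_ + _) = _ - _ + (_ - _)
    simp only [ve]
    ring
  · simp only [e4, e7, e8, e13, bb_dff]
    simp only [e9, e5, e6, e10, e11, e12, e16, e17]
    simp only [ve_yy, ve_crs, ve_dff, ve_avg, ve_jj]

end Sol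

end

section

variable {N K : ℕ} {T : ℝ}

lemma SD.wd {F F' : ℝ → X N → ℝ} {d d' : ℕ} (h : SD 1 T F F') (hF : CT K d T F)
    (hF' : CT K d' T F') {α : Fin N → ℕ} (h1 : 1 ≤ d') (hK : d + len α ≤ K) (hK' : d' + len α ≤ K) :
    SD 1 T (fun t => weakDeriv α (F t)) (fun t => weakDeriv α (F' t)) :=
  ((h.td zero_le_one one_le_two fun _ ht => (hF.isWeak hK ht).1).deriv
    (fun _ ht => hF.isWeak hK ht) fun _ ht => hF'.isWeak hK' ht).sd_one
      (hF'.cLp (by omega) hK') fun _ ht => hF.locL2 hK ht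

lemma SD.sum {σ : Type*} (s : Finset σ) {F F' : σ → ℝ → X N → ℝ}
    (h : ∀ a ∈ s, SD 1 T (F a) (F' a)) :
    SD 1 T (fun t x => ∑ a ∈ s, F a t x) (fun t x => ∑ a ∈ s, F' a t x) := by
  classical
  induction s using cons_induction with
  | empty =>
    intro t _
    exact ⟨by simp, fun ε hε => .of_forall fun r => ⟨by simp [aestronglyMeasurable_const], by
      simp⟩⟩
  | cons a t ha ih =>
    simp only [sum_cons]
    exact (h a (by simp)).add (ih fun b hb => h b (by simp [hb])) one_le_two

end

noncomputable section

variable {N K : ℕ} {T l1 l3 : ℝ} {m dm n dn : Flow N} {t : ℝ}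

/-- The time derivative of `m × Jm`. -/
def jt (l1 l3 : ℝ) (m dm : Flow N) (a : Fin 3) (t : ℝ) : X N → ℝ :=
  fun x => crs dm (jj l1 l3 m) a t x + crs m (jj l1 l3 dm) a t x

/-- The time derivative of `m × ∂_j m`. -/
def zz (l1 l3 : ℝ) (m : Flow N) (j : Fin N) (a : Fin 3) (t : ℝ) : X N → ℝ :=
  fun x => pd (lapc m) j a t x + yy l1 l3 m j a t x

/-- The second time derivative of `m`. -/
def mtt (l1 l3 : ℝ) (m dm : Flow N) (a : Fin 3) (t : ℝ) : X N → ℝ :=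
  fun x => -(∑ j, pd (zz l1 l3 m j) j a t x) + jt l1 l3 m dm a t x

namespace Sol

lemma jt_ct (h : Sol l1 l3 K T m dm) (a : Fin 3) : CT K 3 T (jt l1 l3 m dm a) :=
  (CT.crs h.dct h.jj_ct a).add ((CT.crs h.ct (fun a => (h.dct a).const_mul (lam l1 l3 a)) a).mono
    (by norm_num) (by norm_num))

lemma zz_ct (h : Sol l1 l3 K T m dm) (j : Fin N) (a : Fin 3) : CT K 3 T (zz l1 l3 m j a) :=
  (CT.pd h.lapc_ct j a).add (h.yy_ct j a)

lemma mtt_ct (h : Sol l1 l3 K T m dm) (a : Fin 3) : CT K 4 T (mtt l1 l3 m dm a) :=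
  (CT.sum univ fun j _ => CT.pd (h.zz_ct j) j a).neg.add
    ((h.jt_ct a).mono (by norm_num) (by norm_num))

lemma sd_self (h : Sol l1 l3 K T m dm) (hK : 2 ≤ K) (a : Fin 3) : SD 1 T (m a) (dm a) :=
  (h.td a).sd_one ((h.dct a).cLp_zero (by norm_num) hK) fun t ht => (h.w a t ht).bdd.locL2_of_top

lemma sd_dm (h : Sol l1 l3 K T m dm) (hK : 4 ≤ K) (a : Fin 3) :
    SD 1 T (dm a) (mtt l1 l3 m dm a) := by
  have hp : ∀ b c, SD 1 T (fun t x => m b t x * jj l1 l3 m c t x)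
      (fun t x => dm b t x * jj l1 l3 m c t x + m b t x * jj l1 l3 dm c t x) := fun b c =>
    (h.sd_zero b).mul ((h.sd_self (by omega) c).const_mul zero_le_one _) zero_le_one
      one_le_two (fun t ht => h.memLp_top b ht) fun t ht => by
        rw [ex_one]; exact (h.jj_ct c).cLp_inf le_rfl (by omega) t ht
  refine (((SD.sum univ fun j _ => (h.sd_bb (by omega) j a).wd (h.bb_ct j a) (h.zz_ct j a)
    (α := single j 1) (by norm_num) (by simp; omega) (by simpa using hK)).neg).add
    ((hp (a + 1) (a + 2)).sub (hp (a + 2) (a + 1)) one_le_two) one_le_two).congr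
    (fun t ht => ?_) fun t ht => .of_forall fun x => ?_
  · filter_upwards [h.eqn_div (by omega) ht a] with x hx
    rw [hx]; rfl
  · simp only [mtt, jt, crs]
    change -(∑ j, pd (zz l1 l3 m j) j a t x) + _ = _
    ring

lemma sd_lapc (h : Sol l1 l3 K T m dm) (hK : 4 ≤ K) (a : Fin 3) : SD 1 T (lapc m a) (lapc dm a) :=
  SD.sum univ fun _ _ => h.sd_deriv a (by simpa using hK)

lemma ldm_ct (h : Sol l1 l3 K T m dm) (a : Fin 3) : CT K 4 T (lapc dm a) :=
  CT.sum univ fun i _ => by simpa using (h.dct a).deriv (single i 2)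

end Sol

/-- The coefficient of `|∇u_a|²`. -/
def c1 (l1 l3 : ℝ) (a : Fin 3) : ℝ := if a = 1 then 0 else l1 + l3

/-- The coefficient of `|u_a|²`. -/
def c2 (l1 l3 : ℝ) (a : Fin 3) : ℝ := if a = 1 then 0 else l1 * l3

/-- The derivative `∂^α` of the difference of two curves. -/
def wd (α : Fin N → ℕ) (n m : Flow N) (a : Fin 3) (t : ℝ) : X N → ℝ := weakDeriv α (dff n m a t)

/-- The functional at the `H^l` level, for one multi-index. -/
def eHigh (l1 l3 : ℝ) (m dm n dn : Flow N) (α : Fin N → ℕ) (t : ℝ) : ℝ :=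
  ∑ a, (1 / 2 * (∫ x, wd α dn dm a t x ^ 2) + 1 / 2 * (∫ x, wd α (lapc n) (lapc m) a t x ^ 2) +
    c1 l1 l3 a * ∑ i, 1 / 2 * (∫ x, pd (wd α n m) i a t x ^ 2) +
    c2 l1 l3 a * (1 / 2 * ∫ x, wd α n m a t x ^ 2))

/-- Its time derivative. -/
def dHigh (l1 l3 : ℝ) (m dm n dn : Flow N) (α : Fin N → ℕ) (t : ℝ) : ℝ :=
  ∑ a, ((∫ x, wd α (mtt l1 l3 n dn) (mtt l1 l3 m dm) a t x * wd α dn dm a t x) +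
    (∫ x, wd α (lapc dn) (lapc dm) a t x * wd α (lapc n) (lapc m) a t x) +
    c1 l1 l3 a * ∑ i, (∫ x, pd (wd α dn dm) i a t x * pd (wd α n m) i a t x) +
    c2 l1 l3 a * ∫ x, wd α dn dm a t x * wd α n m a t x)

lemma wd_ct {d : ℕ} {f g : Flow N} (hf : ∀ a, CT K d T (f a))
    (hg : ∀ a, CT K d T (g a)) (α : Fin N → ℕ) (a : Fin 3) : CT K (d + len α) T (wd α f g a) :=
  (CT.dff hf hg a).deriv α

lemma Sol.wd_memLp (hm : Sol l1 l3 K T m dm) (hn : Sol l1 l3 K T n dn) {α : Fin N → ℕ}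
    (hα : len α + 1 ≤ K) {a : Fin 3} (ha : a ≠ 1) : CLp 1 T (wd α n m a) := by
  rcases eq_zero_or_pos (len α) with h0 | h0
  · obtain rfl := eq_zero_of_len h0
    exact ((hn.l2 a ha).sub (hm.l2 a ha) one_le_two).congr fun t ht =>
      ((CT.dff hn.ct hm.ct a).zero_ae (Nat.zero_le _) ht).symm
  · exact (CT.dff hn.ct hm.ct a).cLp (by omega) (by omega)

lemma _root_.HasDerivWithinAt.half_sq {F F' : ℝ → X N → ℝ} (h : SD 1 T F F') (h2 : CLp 1 T F)
    (ht : t ∈ Icc 0 T) : HasDerivWithinAt (fun t => 1 / 2 * ∫ x, F t x ^ 2) (∫ x, F' t x * F t x)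
      (Icc 0 T) t := by
  refine ((h.hasDerivWithinAt_integral_sq (fun t ht => ?_) ht).const_mul (1 / 2)).congr_deriv (by ring)
  have := (h2 t ht).1
  rwa [ex_one] at this

lemma Sol.high_deriv (hm : Sol l1 l3 K T m dm) (hn : Sol l1 l3 K T n dn) {α : Fin N → ℕ}
    (hα : len α + 4 ≤ K) :
    (∀ t ∈ Icc 0 T, HasDerivWithinAt (eHigh l1 l3 m dm n dn α) (dHigh l1 l3 m dm n dn α t)
      (Icc 0 T) t) ∧ ContinuousOn (dHigh l1 l3 m dm n dn α) (Icc 0 T) := by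
  have cu := CT.dff hn.ct hm.ct
  have cd := CT.dff hn.dct hm.dct
  have cU := wd_ct hn.ct hm.ct α
  have cW := wd_ct hn.dct hm.dct α
  have cL := wd_ct hn.lapc_ct hm.lapc_ct α
  have cW' := wd_ct hn.mtt_ct hm.mtt_ct α
  have cL' := wd_ct hn.ldm_ct hm.ldm_ct α
  have sU := fun a => ((hn.sd_self (by omega) a).sub (hm.sd_self (by omega) a) one_le_two).wd (cu a)
    (cd a) (α := α) (by norm_num) (by omega) (by omega)
  have sW := fun a => ((hn.sd_dm (by omega) a).sub (hm.sd_dm (by omega) a) one_le_two).wd (cd a)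
    (CT.dff hn.mtt_ct hm.mtt_ct a) (α := α) (by norm_num) (by omega) (by omega)
  have sL := fun a => ((hn.sd_lapc (by omega) a).sub (hm.sd_lapc (by omega) a) one_le_two).wd
    (CT.dff hn.lapc_ct hm.lapc_ct a) (CT.dff hn.ldm_ct hm.ldm_ct a) (α := α) (by norm_num)
    (by omega) (by omega)
  have kW := fun a => (cW a).cLp_zero (by omega) (by omega)
  have kL := fun a => (cL a).cLp_zero (by omega) (by omega)
  have kP := fun i a => (CT.pd cU i a).cLp_zero (by omega) (by omega)
  constructor
  · refine fun t ht => HasDerivWithinAt.fun_sum fun a _ => (((HasDerivWithinAt.half_sq (sW a) (kW a)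
      ht).add (HasDerivWithinAt.half_sq (sL a) (kL a) ht)).add
      ((HasDerivWithinAt.fun_sum fun i _ => HasDerivWithinAt.half_sq ((sU a).wd (cU a) (cW a)
        (α := single i 1) (by omega) (by simp; omega) (by simp; omega)) (kP i a) ht).const_mul
        _)).add ?_
    by_cases ha : a = 1
    · simpa [c2, ha] using hasDerivWithinAt_const t (Icc 0 T) (0 : ℝ)
    · exact (HasDerivWithinAt.half_sq (sU a) (hm.wd_memLp hn (by omega) ha) ht).const_mul _
  · refine continuousOn_finsetSum _ fun a _ => ((((cW' a).cLp_zero (by omega) (by omega)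
      ).continuousOn_integral_mul (kW a)).add (((cL' a).cLp_zero (by omega) (by omega)
      ).continuousOn_integral_mul (kL a))).add ((continuousOn_finsetSum _ fun i _ =>
        (((CT.pd cW i a).cLp_zero (by omega) (by omega)).continuousOn_integral_mul (kP i a))
        ).const_smul (c1 l1 l3 a)) |>.add ?_
    by_cases ha : a = 1
    · simpa [c2, ha] using continuousOn_const
    · exact ((kW a).continuousOn_integral_mul (hm.wd_memLp hn (by omega) ha)).const_smul (c2 l1 l3 a)

end

section

variable {N : ℕ} {ι : Type*}

namespace UU

variable {l d : ℕ} {B : ι → ℝ} {f g : ι → X N → ℝ}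

lemma congr (hf : UU l d B f) (h : ∀ i, f i =ᵐ[volume] g i) : UU l d B g := by
  obtain ⟨C, hC, h1⟩ := hf
  exact ⟨C, hC, fun i => (h1 i).congr (h i)⟩

lemma sum {σ : Type*} (hB : ∀ i, 0 ≤ B i) (t : Finset σ) {f : σ → ι → X N → ℝ}
    (hne : t.Nonempty) (h : ∀ a ∈ t, UU l d B (f a)) : UU l d B (fun i x => ∑ a ∈ t, f a i x) := by
  classical
  induction hne using Finset.Nonempty.cons_induction with
  | singleton a => simpa using h a (by simp)
  | cons a t ha ht ih =>
    simp only [sum_cons]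
    obtain ⟨C₁, h1, hf⟩ := h a (by simp)
    obtain ⟨C₂, h2, hg⟩ := ih fun b hb => h b (by simp [hb])
    exact ⟨C₁ + C₂, by positivity, fun i => ((hf i).add (hg i) (DU_subset _ _)
      (fun _ _ => mul_nonneg h1 (hB i)) fun _ _ => mul_nonneg h2 (hB i)).mono
        fun j s hs => ⟨hs, le_of_eq (by ring)⟩⟩

end UU

lemma UT.zero_one {K : ℕ} {A B : ι → ℝ} {f : ι → X N → ℝ} (hA : ∀ i, 0 < A i) (hB : ∀ i, 0 ≤ B i)
    (hf : UT K 0 A B f) (h2 : ∀ i, Bd 1 (f i) (B i * A i)) : UT K 1 A B f := by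
  obtain ⟨C, hC, hf⟩ := hf
  refine ⟨C + 1, by positivity, fun i α s hs => ?_⟩
  obtain ⟨hc, hlo, hs1, hz⟩ := hs
  have hs0 := (DT_subset K 1 _ ⟨hc, hlo, hs1, hz⟩).1
  have hAi := hA i
  have hBi := hB i
  rcases eq_zero_or_pos (len α) with h0 | h0
  · obtain rfl := eq_zero_of_len h0
    have hd : (0 : ℝ) ∈ DT K 0 (len (0 : Fin N → ℕ)) := ⟨by simp, by simp, zero_le_one, fun _ => rfl⟩
    have e := (hf i).zero_ae (by simpa using hd)
    refine ⟨(hf i 0 0 hd).1, (?_ : Bd s (f i) _).congr e.symm⟩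
    have hb0 := (hf i 0 0 hd).2.congr e
    simp only [Real.rpow_zero, mul_one] at hb0
    have h := (hb0.mono (show _ ≤ (C + 1) * B i by linarith)).interp ((h2 i).mono
      (show _ ≤ (C + 1) * B i * A i by nlinarith [mul_nonneg hC (mul_nonneg hBi hAi.le)])) le_rfl
      zero_le_one (by positivity) (by positivity) hs0 hs1
    rw [mul_zero, mul_one, zero_add, mul_rpow (by positivity) hAi.le, ← mul_assoc,
      ← Real.rpow_add_of_nonneg (by positivity) (by linarith) hs0, sub_add_cancel,
      rpow_one] at h
    exact h
  · have h := hf i α s ⟨by omega, le_trans (by exact_mod_cast (by omega)) hlo, hs1, fun h => by omega⟩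
    refine ⟨h.1, h.2.mono ?_⟩
    have := rpow_pos_of_pos hAi s
    exact mul_le_mul_of_nonneg_right (mul_le_mul_of_nonneg_right (by linarith) hBi) this.le

lemma exists_ut {K d : ℕ} {f g : ι → X N → ℝ} (hf : ∀ i, ∃ C, 0 ≤ C ∧ JT K d C (f i))
    (hg : ∀ i, ∃ C, 0 ≤ C ∧ JT K 0 C (g i)) : ∃ B : ι → ℝ, (∀ i, 0 ≤ B i) ∧
      UT K d (fun _ => 1) B f ∧ UT K 0 (fun _ => 1) B g := by
  choose c hc hf using hf
  choose e he hg using hg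
  exact ⟨fun i => max (c i) (e i), fun i => (hc i).trans (le_max_left _ _), ⟨1, zero_le_one, fun i =>
    JB.mono (hf i) fun _ _ hs => ⟨hs, by simp⟩⟩, ⟨1, zero_le_one, fun i =>
      JB.mono (hg i) fun _ _ hs => ⟨hs, by simp⟩⟩⟩

/-- Two families of size `1` of functions of weight `d`, whose difference is of size `B`. -/
def PP (K d : ℕ) (A B : ι → ℝ) (f g : ι → X N → ℝ) : Prop :=
  UT K d A (fun _ => 1) f ∧ UT K d A (fun _ => 1) g ∧ UT K d A B (fun i x => g i x - f i x)

namespace PP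

variable {K d d₁ d₂ : ℕ} {A B : ι → ℝ} {f g f' g' : ι → X N → ℝ}

lemma mul (hA : ∀ i, 0 < A i) (hB : ∀ i, 0 ≤ B i) (h : PP K d₁ A B f g) (h' : PP K d₂ A B f' g') :
    PP K (d₁ + d₂) A B (fun i x => f i x * f' i x) (fun i x => g i x * g' i x) := by
  refine ⟨by simpa using h.1.mul hA (by simp) (by simp) h'.1,
    by simpa using h.2.1.mul hA (by simp) (by simp) h'.2.1, ?_⟩
  have h1 := h.2.2.mul hA hB (by simp) h'.2.1
  have h2 := h.1.mul hA (by simp) hB h'.2.2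
  simp only [mul_one, one_mul] at h1 h2
  exact (h1.add hA hB h2).congr fun i => .of_forall fun x => by ring

lemma const_mul (h : PP K d A B f g) (c : ℝ) :
    PP K d A B (fun i x => c * f i x) (fun i x => c * g i x) :=
  ⟨h.1.const_mul c, h.2.1.const_mul c, (h.2.2.const_mul c).congr fun i =>
    .of_forall fun x => by ring⟩

lemma add (hA : ∀ i, 0 < A i) (hB : ∀ i, 0 ≤ B i) (h : PP K d A B f g) (h' : PP K d A B f' g') :
    PP K d A B (fun i x => f i x + f' i x) (fun i x => g i x + g' i x) :=
  ⟨h.1.add hA (by simp) h'.1, h.2.1.add hA (by simp) h'.2.1, (h.2.2.add hA hB h'.2.2).congr fun i =>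
    .of_forall fun x => by ring⟩

lemma sub (hA : ∀ i, 0 < A i) (hB : ∀ i, 0 ≤ B i) (h : PP K d A B f g) (h' : PP K d A B f' g') :
    PP K d A B (fun i x => f i x - f' i x) (fun i x => g i x - g' i x) := by
  refine ⟨h.1.sub hA (by simp) h'.1, h.2.1.sub hA (by simp) h'.2.1,
    (h.2.2.sub hA hB h'.2.2).congr fun i => .of_forall fun x => by ring⟩

lemma sum {σ : Type*} (hA : ∀ i, 0 < A i) (hB : ∀ i, 0 ≤ B i) (t : Finset σ)
    {f g : σ → ι → X N → ℝ} (hne : t.Nonempty) (h : ∀ a ∈ t, PP K d A B (f a) (g a)) :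
    PP K d A B (fun i x => ∑ a ∈ t, f a i x) (fun i x => ∑ a ∈ t, g a i x) :=
  ⟨UT.sum hA (by simp) t hne fun a ha => (h a ha).1, UT.sum hA (by simp) t hne fun a ha => (h a ha).2.1,
    (UT.sum hA hB t hne fun a ha => (h a ha).2.2).congr fun i => .of_forall fun x => by
      simp only [sum_sub_distrib]⟩

end PP

/-- Families of functions bounded in `L²` by a multiple of `c`. -/
def LB (c : ι → ℝ) (f : ι → X N → ℝ) : Prop := ∃ C : ℝ, 0 ≤ C ∧ ∀ i, Bd 1 (f i) (C * c i)

namespace LB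

variable {c c' : ι → ℝ} {f g : ι → X N → ℝ}

lemma congr (hf : LB c f) (h : ∀ i, f i =ᵐ[volume] g i) : LB c g := by
  obtain ⟨C, hC, h1⟩ := hf
  exact ⟨C, hC, fun i => (h1 i).congr (h i)⟩

lemma mono (hf : LB c f) (h : ∀ i, c i ≤ c' i) : LB c' f := by
  obtain ⟨C, hC, h1⟩ := hf
  exact ⟨C, hC, fun i => (h1 i).mono (mul_le_mul_of_nonneg_left (h i) hC)⟩

lemma add (hc : ∀ i, 0 ≤ c i) (hf : LB c f) (hg : LB c g) : LB c (fun i x => f i x + g i x) := by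
  obtain ⟨C₁, h1, hf⟩ := hf
  obtain ⟨C₂, h2, hg⟩ := hg
  exact ⟨C₁ + C₂, by positivity, fun i => ((hf i).add (hg i) one_le_two (mul_nonneg h1 (hc i))
    (mul_nonneg h2 (hc i))).mono (le_of_eq (by ring))⟩

lemma neg (hf : LB c f) : LB c (fun i x => -f i x) := by
  obtain ⟨C, hC, h1⟩ := hf
  exact ⟨C, hC, fun i => (h1 i).neg⟩

lemma mul_right (hc : ∀ i, 0 ≤ c i) (hf : LB c f) (h : ∀ i, Bd 0 (g i) (c' i)) :
    LB (fun i => c i * c' i) (fun i x => f i x * g i x) := by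
  obtain ⟨C, hC, h1⟩ := hf
  refine ⟨C, hC, fun i => ?_⟩
  have := (h1 i).mul (h i) zero_le_one le_rfl (mul_nonneg hC (hc i))
  rw [add_zero] at this
  exact this.mono (le_of_eq (by ring))

lemma sum {σ : Type*} (hc : ∀ i, 0 ≤ c i) (t : Finset σ) {f : σ → ι → X N → ℝ}
    (h : ∀ a ∈ t, LB c (f a)) : LB c (fun i x => ∑ a ∈ t, f a i x) := by
  classical
  induction t using cons_induction with
  | empty => exact ⟨0, le_rfl, fun i => ⟨by simp [aestronglyMeasurable_const], by simp⟩⟩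
  | cons a t ha ih =>
    simp only [sum_cons]
    exact (h a (by simp)).add hc (ih fun b hb => h b (by simp [hb]))

end LB

end

noncomputable section

variable {N K l : ℕ} {l1 l3 : ℝ}

lemma W.sub {n : ℕ} {f g : X N → ℝ} (hf : W n f) (hg : W n g) : W n (fun x => f x - g x) :=
  ⟨hf.bdd.sub hg.bdd, fun _ h1 h2 => ⟨_, (hf.isWeak h2).sub (hg.isWeak h2),
    (hf.memLp h1 h2).sub (hg.memLp h1 h2)⟩⟩

lemma Sol.bd_zero {T t : ℝ} {m dm : Flow N} (h : Sol l1 l3 K T m dm)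
    (ht : t ∈ Icc 0 T) (a : Fin 3) : Bd 0 (m a t) 1 := by
  refine bd_zero_of_bounded (h.w a t ht).bdd.1 ?_
  filter_upwards [h.sphere t ht] with x hx
  rw [← sq_le_one_iff_abs_le_one, ← hx]
  exact single_le_sum (f := fun a => m a t x ^ 2) (fun _ _ => sq_nonneg _) (Finset.mem_univ a)

/-- The bounds for a single solution. -/
structure Ctl (l : ℕ) (t A A' : ℝ) (m : Flow N) : Prop where
  b0 : ∀ a i, Bd 0 (pd m i a t) A
  b1 : ∀ a (α : Fin N → ℕ), 1 ≤ len α → len α ≤ l + 1 → Bd 1 (weakDeriv α (m a t)) A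
  b2 : l = 2 → ∀ a ≠ 1, Bd 1 (m a t) A'

/-- Two solutions at a given time, with bounds for the solutions and for their difference. -/
structure Dat (N K l : ℕ) (l1 l3 : ℝ) where
  (T t A A' U : ℝ)
  α : Fin N → ℕ
  (m dm n dn : Flow N)
  hm : Sol l1 l3 K T m dm
  hn : Sol l1 l3 K T n dn
  ht : t ∈ Icc 0 T
  hα : len α + 2 = l
  hA : 1 ≤ A
  hA' : A ≤ A'
  hU : 0 ≤ U
  cm : Ctl l t A A' m
  cn : Ctl l t A A' n
  u0 : ∀ a, Bd 0 (dff n m a t) U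
  u1 : ∀ a (α : Fin N → ℕ), 1 ≤ len α → len α ≤ l → Bd 1 (weakDeriv α (dff n m a t)) U
  u2 : ∀ a ≠ 1, Bd 1 (dff n m a t) U
  du : ∀ a, Bd 1 (wd α dn dm a t) U

namespace Dat

lemma A_pos (D : Dat N K l l1 l3) : 0 < D.A := zero_lt_one.trans_le D.hA

variable {p : Dat N K l l1 l3 → Flow N}

lemma sol (hp : p = Dat.m ∨ p = Dat.n) (D : Dat N K l l1 l3) : ∃ dp, Sol l1 l3 K D.T (p D) dp := by
  rcases hp with rfl | rfl
  exacts [⟨_, D.hm⟩, ⟨_, D.hn⟩]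

lemma ctl (hp : p = Dat.m ∨ p = Dat.n) (D : Dat N K l l1 l3) : Ctl l D.t D.A D.A' (p D) := by
  rcases hp with rfl | rfl
  exacts [D.cm, D.cn]

lemma um (hl : 0 < l) (hK : l + 2 ≤ K) (hp : p = Dat.m ∨ p = Dat.n) (a : Fin 3) :
    UM l 0 0 Dat.A (fun _ => 1) (fun D => p D a D.t) :=
  UM.base hl Dat.hA (fun D => ((sol hp D).choose_spec.w a D.t D.ht).mono (by omega))
    (fun D => (sol hp D).choose_spec.bd_zero D.ht a) (fun D j => (ctl hp D).b0 a j)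
    fun D => (ctl hp D).b1 a

lemma um_wd (hl : 0 < l) (hK : l + 2 ≤ K) (hp : p = Dat.m ∨ p = Dat.n) (a : Fin 3)
    {γ : Fin N → ℕ} (hγ : 1 ≤ len γ) :
    UM l (len γ) 1 Dat.A (fun _ => 1) (fun D => weakDeriv γ (p D a D.t)) :=
  UM.base_deriv hl Dat.hA (fun D => ((sol hp D).choose_spec.w a D.t D.ht).mono (by omega))
    (fun D => (sol hp D).choose_spec.bd_zero D.ht a) (fun D j => (ctl hp D).b0 a j)
    (fun D => (ctl hp D).b1 a) hγ

lemma um_pd (hl : 0 < l) (hK : l + 2 ≤ K) (hp : p = Dat.m ∨ p = Dat.n) (i : Fin N) (a : Fin 3) :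
    UM l 1 1 Dat.A (fun _ => 1) (fun D => pd (p D) i a D.t) := by
  have := um_wd hl hK hp a (γ := single i 1) (by simp)
  rwa [len_single] at this

lemma uu (hl : 0 < l) (hK : l + 2 ≤ K) (a : Fin 3) :
    UU l 0 Dat.U (fun D : Dat N K l l1 l3 => dff D.n D.m a D.t) :=
  UU.base hl Dat.hU (fun D => ((D.hn.w a D.t D.ht).sub (D.hm.w a D.t D.ht)).mono (by omega))
    (fun D => D.u0 a) fun D => D.u1 a

lemma wd_sub (D : Dat N K l l1 l3) (a : Fin 3) {γ : Fin N → ℕ} (hγ : len γ ≤ K) :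
    weakDeriv γ (dff D.n D.m a D.t) =ᵐ[volume]
      fun x => weakDeriv γ (D.n a D.t) x - weakDeriv γ (D.m a D.t) x :=
  (((D.hn.ct a).isWeak (by omega) D.ht).sub ((D.hm.ct a).isWeak (by omega) D.ht)).ae_eq

lemma uu_wd (hl : 0 < l) (hK : l + 2 ≤ K) (a : Fin 3) {γ : Fin N → ℕ} (hγ : len γ ≤ K) :
    UU l (len γ) Dat.U (fun (D : Dat N K l l1 l3) x =>
      weakDeriv γ (D.n a D.t) x - weakDeriv γ (D.m a D.t) x) := by
  have := (uu (l1 := l1) (l3 := l3) hl hK a).deriv hl γ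
  rw [zero_add] at this
  exact this.congr fun D => D.wd_sub a hγ

lemma uu_pd (hl : 0 < l) (hK : l + 2 ≤ K) (i : Fin N) (a : Fin 3) :
    UU l 1 Dat.U (fun (D : Dat N K l l1 l3) => dff (pd D.n i) (pd D.m i) a D.t) := by
  have := uu_wd (l1 := l1) (l3 := l3) hl hK a (γ := single i 1) (by simp; omega)
  rwa [len_single] at this

lemma uu_mul {d₁ d₂ r : ℕ} (hl : 0 < l) (hr : 1 ≤ r) (h2 : r ≤ d₂)
    {f g : Dat N K l l1 l3 → X N → ℝ} (hf : UU l d₁ Dat.U f)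
    (hg : UM l d₂ r Dat.A (fun _ => 1) g) :
    UM l (d₁ + d₂) r Dat.A Dat.U (fun i x => f i x * g i x) := by
  simpa using hf.mul hl hr h2 A_pos Dat.hU (by simp) hg

lemma um_mul {d₁ d₂ r₁ r₂ : ℕ} (hl : 0 < l) (h1 : r₁ ≤ d₁) (h2 : r₂ ≤ d₂) {B : _ → ℝ}
    {f g : Dat N K l l1 l3 → X N → ℝ} (hB : ∀ i, 0 ≤ B i) (hf : UM l d₁ r₁ Dat.A B f)
    (hg : UM l d₂ r₂ Dat.A (fun _ => 1) g) :
    UM l (d₁ + d₂) (r₁ + r₂) Dat.A B (fun i x => f i x * g i x) := by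
  simpa using hf.mul hl h1 h2 A_pos hB (by simp) hg

lemma pp {A : Dat N K l l1 l3 → ℝ} (hA : ∀ D, D.A ≤ A D) (hK : l + 2 ≤ K) (a : Fin 3) :
    PP l 0 A Dat.U (fun D => D.m a D.t) (fun D => D.n a D.t) := by
  have hA1 : ∀ D, 1 ≤ A D := fun D => D.hA.trans (hA D)
  refine ⟨UT.base hA1 (by simp) (fun D => (D.hm.w a D.t D.ht).mono (by omega))
    (fun D => D.hm.bd_zero D.ht a) fun D α h1 h2 => (D.cm.b1 a α h1 (by omega)).mono (by simpa using hA D),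
    UT.base hA1 (by simp) (fun D => (D.hn.w a D.t D.ht).mono (by omega))
    (fun D => D.hn.bd_zero D.ht a) fun D α h1 h2 => (D.cn.b1 a α h1 (by omega)).mono (by simpa using hA D),
    UT.base hA1 Dat.hU (fun D => ((D.hn.w a D.t D.ht).sub (D.hm.w a D.t D.ht)).mono (by omega))
    (fun D => D.u0 a) fun D α h1 h2 => (D.u1 a α h1 h2).mono (le_mul_of_one_le_right D.hU (hA1 D))⟩

lemma pp_wd (hK : l + 2 ≤ K) (a : Fin 3) {γ : Fin N → ℕ} (hγ : len γ ≤ K) :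
    PP l (len γ) Dat.A Dat.U (fun D : Dat N K l l1 l3 => weakDeriv γ (D.m a D.t))
      (fun D => weakDeriv γ (D.n a D.t)) := by
  obtain ⟨h1, h2, h3⟩ := pp (l1 := l1) (l3 := l3) (fun D => le_rfl) hK a
  have := And.intro (h1.deriv γ) (And.intro (h2.deriv γ) (h3.deriv γ))
  rw [zero_add] at this
  exact ⟨this.1, this.2.1, this.2.2.congr fun D => D.wd_sub a hγ⟩

lemma pp_pd (hK : l + 2 ≤ K) (i : Fin N) (a : Fin 3) :
    PP l 1 Dat.A Dat.U (fun D : Dat N K l l1 l3 => pd D.m i a D.t) (fun D => pd D.n i a D.t) := by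
  have := pp_wd (l1 := l1) (l3 := l3) hK a (γ := single i 1) (by simp; omega)
  rwa [len_single] at this

lemma pp_crs {A : Dat N K l l1 l3 → ℝ} (hA : ∀ D, D.A ≤ A D) {d₁ d₂ : ℕ} {f g f' g' : _ → Flow N}
    (h : ∀ a, PP l d₁ A Dat.U (fun D => f D a D.t) (fun D => g D a D.t))
    (h' : ∀ a, PP l d₂ A Dat.U (fun D => f' D a D.t) (fun D => g' D a D.t)) (a : Fin 3) :
    PP l (d₁ + d₂) A Dat.U (fun D => crs (f D) (f' D) a D.t) (fun D => crs (g D) (g' D) a D.t) := by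
  have hA1 : ∀ D, 0 < A D := fun D => D.A_pos.trans_le (hA D)
  exact ((h _).mul hA1 Dat.hU (h' _)).sub hA1 Dat.hU ((h _).mul hA1 Dat.hU (h' _))

variable [Nonempty (Fin N)]

lemma um_lapc (hl : 0 < l) (hK : l + 2 ≤ K) (hp : p = Dat.m ∨ p = Dat.n) (a : Fin 3) :
    UM l 2 1 Dat.A (fun _ => 1) (fun D => lapc (p D) a D.t) :=
  UM.sum A_pos (by simp) univ univ_nonempty fun i _ => by
    have := um_wd hl hK hp a (γ := single i 2) (by simp)
    rwa [len_single] at this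

lemma uu_lapc (hl : 0 < l) (hK : l + 2 ≤ K) (a : Fin 3) :
    UU l 2 Dat.U (fun (D : Dat N K l l1 l3) => dff (lapc D.n) (lapc D.m) a D.t) := by
  refine (UU.sum Dat.hU univ univ_nonempty fun i _ => ?_).congr fun D =>
    .of_forall fun x => sum_sub_distrib _ _
  have := uu_wd (l1 := l1) (l3 := l3) hl hK a (γ := single i 2) (by simp; omega)
  rwa [len_single] at this

lemma um_gg (hl : 0 < l) (hK : l + 2 ≤ K) (hp : p = Dat.m ∨ p = Dat.n) :
    UM l 2 2 Dat.A (fun _ => 1) (fun D => gg (p D) D.t) :=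
  UM.sum A_pos (by simp) univ univ_nonempty fun i _ =>
    UM.sum A_pos (by simp) univ univ_nonempty fun a _ =>
      um_mul hl le_rfl le_rfl (by simp) (um_pd hl hK hp i a) (um_pd hl hK hp i a)

lemma um_qq (hl : 0 < l) (hK : l + 2 ≤ K) (hp : p = Dat.m ∨ p = Dat.n) (j : Fin N) :
    UM l 3 2 Dat.A (fun _ => 1) (fun D => qq (p D) j D.t) := by
  have h1 := (um_gg hl hK hp).deriv hl le_rfl (single j 1)
  rw [len_single] at h1
  exact h1.add A_pos (by simp) ((UM.sum A_pos (by simp) univ univ_nonempty fun a _ =>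
    um_mul hl (by norm_num) le_rfl (by simp) (um_lapc hl hK hp a) (um_pd hl hK hp j a)).const_mul 2)

/-- The difference of the functions `|∇m|²`. -/
def dg (D : Dat N K l l1 l3) : X N → ℝ := fun x => gg D.n D.t x - gg D.m D.t x

/-- The difference of the functions `∂_j |∇m|² + 2 ⟨Δm, ∂_j m⟩`. -/
def dq (j : Fin N) (D : Dat N K l l1 l3) : X N → ℝ := fun x => qq D.n j D.t x - qq D.m j D.t x

lemma um_dg (hl : 0 < l) (hK : l + 2 ≤ K) :
    UM l 2 1 Dat.A Dat.U (dg : Dat N K l l1 l3 → X N → ℝ) := by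
  refine (UM.sum A_pos Dat.hU univ univ_nonempty fun i _ =>
    UM.sum A_pos Dat.hU univ univ_nonempty fun a _ =>
      uu_mul hl le_rfl le_rfl (uu_pd hl hK i a) ((um_pd hl hK (.inr rfl) i a).add A_pos (by simp)
        (um_pd hl hK (.inl rfl) i a))).congr fun D => .of_forall fun x => ?_
  simp only [dg, gg, dff, ← sum_sub_distrib]
  exact sum_congr rfl fun i _ => sum_congr rfl fun a _ => by ring

lemma um_dq (hl : 0 < l) (hK : l + 2 ≤ K) (j : Fin N) :
    UM l 3 1 Dat.A Dat.U (dq j : Dat N K l l1 l3 → X N → ℝ) := by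
  have h1 := (um_dg (l1 := l1) (l3 := l3) hl hK).deriv hl (by norm_num) (single j 1)
  rw [len_single] at h1
  have h3 := fun a => uu_mul hl le_rfl le_rfl (uu_lapc (l1 := l1) (l3 := l3) hl hK a)
    (um_pd hl hK (.inr rfl) j a)
  have h2 := UM.sum A_pos Dat.hU univ univ_nonempty fun a _ =>
    (h3 a).add A_pos Dat.hU (uu_mul (d₁ := 1) (d₂ := 2) hl le_rfl (by norm_num)
        (uu_pd hl hK j a) (um_lapc hl hK (.inl rfl) a))
  refine (h1.add A_pos Dat.hU (h2.const_mul 2)).congr fun D => ?_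
  have e := ((D.hn.gg_ct.isWeak (γ := single j 1) (by simp; omega) D.ht).sub
    (D.hm.gg_ct.isWeak (by simp; omega) D.ht)).ae_eq
  filter_upwards [e] with x hx
  have hx : weakDeriv (single j 1) D.dg x = _ := hx
  simp only [Pi.sub_apply] at hx
  simp only [dq, qq, hx, ss, dff]
  have : ∀ a, (lapc D.n a D.t x - lapc D.m a D.t x) * pd D.n j a D.t x + (pd D.n j a D.t x -
      pd D.m j a D.t x) * lapc D.m a D.t x = lapc D.n a D.t x * pd D.n j a D.t x -
        lapc D.m a D.t x * pd D.m j a D.t x := fun a => by ring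
  simp only [this, sum_sub_distrib]
  ring

lemma um_rr (hl : 0 < l) (hK : l + 2 ≤ K) (j : Fin N) (a : Fin 3) :
    UM l 3 2 Dat.A Dat.U (fun (D : Dat N K l l1 l3) x => dff D.n D.m a D.t x * qq D.n j D.t x +
      D.dg x * pd D.n j a D.t x + dff (pd D.n j) (pd D.m j) a D.t x * gg D.m D.t x) :=
  ((uu_mul hl (by norm_num) (by norm_num) (uu hl hK a) (um_qq hl hK (.inr rfl) j)).add A_pos Dat.hU
    (um_mul hl (by norm_num) le_rfl Dat.hU (um_dg hl hK) (um_pd hl hK (.inr rfl) j a))).add A_pos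
      Dat.hU (uu_mul hl (by norm_num) le_rfl (uu_pd hl hK j a) (um_gg hl hK (.inl rfl)))

end Dat

end

section

variable {N K d : ℕ} {T t l1 l3 : ℝ}

lemma weakDeriv_eq {F : Type*} [NormedAddCommGroup F] [NormedSpace ℝ F] {α : Fin N → ℕ}
    {f g : X N → F} (h : f =ᵐ[volume] g) : weakDeriv α f = weakDeriv α g := by
  have : IsWeakDeriv α f = IsWeakDeriv α g := funext fun k => propext
    ⟨fun hk => hk.congr h .rfl, fun hk => hk.congr h.symm .rfl⟩
  rw [weakDeriv, weakDeriv, this]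

lemma weakDeriv_congr {α : Fin N → ℕ} {f g : X N → ℝ} (h : f =ᵐ[volume] g) :
    weakDeriv α f =ᵐ[volume] weakDeriv α g := EventuallyEq.of_eq (weakDeriv_eq h)

lemma CT.swap {F : ℝ → X N → ℝ} (hF : CT K d T F) {α β : Fin N → ℕ}
    (hK : d + len α + len β ≤ K) (ht : t ∈ Icc 0 T) :
    weakDeriv β (weakDeriv α (F t)) =ᵐ[volume] weakDeriv α (weakDeriv β (F t)) :=
  (hF.add_weakDeriv (by rw [len_add]; omega) ht).trans (by
    rw [add_comm α β]
    exact (hF.add_weakDeriv (by rw [len_add]; omega) ht).symm)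

lemma wd_lapc {f g : Flow N} (hf : ∀ a, CT K d T (f a)) (hg : ∀ a, CT K d T (g a))
    {α : Fin N → ℕ} (hK : d + len α + 2 ≤ K) (ht : t ∈ Icc 0 T) (a : Fin 3) :
    ∀ᵐ x, wd α (lapc f) (lapc g) a t x = ∑ j, pd (pd (wd α f g) j) j a t x := by
  have hu := CT.dff hf hg a
  have e : ∀ j : Fin N, (single j 2 : Fin N → ℕ) = single j 1 + single j 1 := fun j => by
    rw [← Pi.single_add]
  have h1 : ∀ j, pd (pd (wd α f g) j) j a t =ᵐ[volume]
      weakDeriv α (weakDeriv (single j 2) (dff f g a t)) := fun j => by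
    refine ((hu.deriv α).add_weakDeriv (by simp; omega) ht).trans ?_
    rw [← e]
    exact hu.swap (by simp; omega) ht
  have h2 : dff (lapc f) (lapc g) a t =ᵐ[volume] ∑ j, weakDeriv (single j 2) (dff f g a t) := by
    filter_upwards [ae_all_iff.2 fun j => (((hf a).isWeak (γ := single j 2) (by simp; omega)
      ht).sub ((hg a).isWeak (by simp; omega) ht)).ae_eq] with x hx
    have hx : ∀ j, weakDeriv (single j 2) (dff f g a t) x = _ := hx
    simp only [Finset.sum_apply, hx, Pi.sub_apply, sum_sub_distrib, dff, lapc]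
  have h3 := (IsWeakDeriv.sum univ fun j _ => (hu.deriv (single j 2)).isWeak (γ := α)
    (by simp; omega) ht).ae_eq
  filter_upwards [(weakDeriv_congr h2).trans h3, ae_all_iff.2 h1] with x hx h4
  simp only [h4]
  rw [wd, hx, Finset.sum_apply]

lemma Sol.wd_mtt {m dm n dn : Flow N} (hm : Sol l1 l3 K T m dm)
    (hn : Sol l1 l3 K T n dn) {α : Fin N → ℕ} (hK : len α + 4 ≤ K) (ht : t ∈ Icc 0 T) (a : Fin 3) :
    ∀ᵐ x, wd α (mtt l1 l3 n dn) (mtt l1 l3 m dm) a t x =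
      -(∑ j, (pd (pd (wd α (lapc n) (lapc m)) j) j a t x +
        wd (α + single j 1) (yy l1 l3 n j) (yy l1 l3 m j) a t x)) +
      wd α (jt l1 l3 n dn) (jt l1 l3 m dm) a t x := by
  have hz := fun j => CT.dff (hn.zz_ct j) (hm.zz_ct j) a
  have hL := CT.dff hn.lapc_ct hm.lapc_ct a
  have hy := fun j => CT.dff (hn.yy_ct j) (hm.yy_ct j) a
  have hj := CT.dff hn.jt_ct hm.jt_ct a
  have h1 : dff (mtt l1 l3 n dn) (mtt l1 l3 m dm) a t =ᵐ[volume]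
      -(∑ j, weakDeriv (single j 1) (dff (zz l1 l3 n j) (zz l1 l3 m j) a t)) +
        dff (jt l1 l3 n dn) (jt l1 l3 m dm) a t := by
    filter_upwards [ae_all_iff.2 fun j => ((((hn.zz_ct j a).isWeak (γ := single j 1)
      (by simp; omega) ht).sub ((hm.zz_ct j a).isWeak (by simp; omega) ht)).ae_eq)] with x hx
    have hx : ∀ j, weakDeriv (single j 1) (dff (zz l1 l3 n j) (zz l1 l3 m j) a t) x = _ := hx
    simp only [Pi.add_apply, Pi.neg_apply, Finset.sum_apply, hx, Pi.sub_apply,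
      sum_sub_distrib]
    simp only [dff, mtt, pd]
    ring
  have h2 := (IsWeakDeriv.sum univ fun j _ => ((hz j).deriv (single j 1)).isWeak (γ := α)
    (by simp; omega) ht).neg.add (hj.isWeak (γ := α) (by omega) ht)
  have h3 : ∀ j, weakDeriv α (weakDeriv (single j 1) (dff (zz l1 l3 n j) (zz l1 l3 m j) a t))
      =ᵐ[volume] pd (pd (wd α (lapc n) (lapc m)) j) j a t +
        wd (α + single j 1) (yy l1 l3 n j) (yy l1 l3 m j) a t := by
    intro j
    have e1 : dff (zz l1 l3 n j) (zz l1 l3 m j) a t =ᵐ[volume]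
        weakDeriv (single j 1) (dff (lapc n) (lapc m) a t) +
          dff (yy l1 l3 n j) (yy l1 l3 m j) a t := by
      filter_upwards [(((hn.lapc_ct a).isWeak (γ := single j 1) (by simp; omega) ht).sub
        ((hm.lapc_ct a).isWeak (by simp; omega) ht)).ae_eq] with x hx
      have hx : weakDeriv (single j 1) (dff (lapc n) (lapc m) a t) x = _ := hx
      rw [Pi.add_apply, hx]
      simp only [dff, zz, Pi.sub_apply, pd]
      ring
    have e2 := (((hL.deriv (single j 1)).isWeak (γ := α + single j 1)
      (by simp; omega) ht).add ((hy j).isWeak (by simp; omega) ht)).ae_eq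
    have e3 : weakDeriv (α + single j 1) (weakDeriv (single j 1) (dff (lapc n) (lapc m) a t))
        =ᵐ[volume] pd (pd (wd α (lapc n) (lapc m)) j) j a t :=
      ((hL.deriv (single j 1)).add_weakDeriv (by simp; omega) ht).symm.trans
        (weakDeriv_congr (hL.swap (by simp; omega) ht).symm)
    filter_upwards [(hz j).swap (α := single j 1) (β := α) (by simp; omega) ht,
      (hz j).add_weakDeriv (α := α) (β := single j 1) (by simp; omega) ht, weakDeriv_congr e1, e2, e3]
      with x k1 k2 k3 k4 k5
    rw [k1, k2, k3, k4, Pi.add_apply, k5]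
    rfl
  filter_upwards [weakDeriv_congr h1, h2.ae_eq, ae_all_iff.2 h3] with x k1 k2 k3
  rw [wd, k1, k2]
  simp only [Pi.add_apply, Pi.neg_apply, Finset.sum_apply, k3]
  rfl

end

section

variable {N K l : ℕ} {l1 l3 : ℝ}

lemma UU.bd_one {ι : Type*} {d j : ℕ} {B : ι → ℝ} {f : ι → X N → ℝ} (hf : UU l d B f)
    (hc : d + j = l) {γ : ι → Fin N → ℕ} (hγ : ∀ i, len (γ i) = j) :
    LB B (fun i => weakDeriv (γ i) (f i)) := by
  obtain ⟨C, h0, hf⟩ := hf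
  exact ⟨C, h0, fun i => (hf i (γ i) 1 ⟨by rw [hγ, hc], zero_le_one, le_rfl, by rw [hγ, hc, mul_one]⟩).2⟩

namespace Dat

lemma lb_um {d r j : ℕ} {f : Dat N K l l1 l3 → X N → ℝ} (hf : UM l d r Dat.A Dat.U f) (hr : 1 ≤ r)
    (hc : d + j = l + r) {γ : Dat N K l l1 l3 → Fin N → ℕ} (hγ : ∀ D, len (γ D) = j) :
    (∀ D, IsWeakDeriv (γ D) (f D) (weakDeriv (γ D) (f D))) ∧
      LB (fun D => D.U * D.A ^ r) (fun D => weakDeriv (γ D) (f D)) := by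
  obtain ⟨C, hC, h⟩ := hf.bd_one hr hc
  exact ⟨fun D => (h D _ (hγ D)).1, C, hC, fun D => (h D _ (hγ D)).2.mono (le_of_eq (by ring))⟩

lemma lb_ut {d j : ℕ} {A : Dat N K l l1 l3 → ℝ} {f : Dat N K l l1 l3 → X N → ℝ}
    (hf : UT l d A Dat.U f) (h1 : 1 ≤ d + j) (hK : d + j ≤ l) {γ : Dat N K l l1 l3 → Fin N → ℕ}
    (hγ : ∀ D, len (γ D) = j) : (∀ D, IsWeakDeriv (γ D) (f D) (weakDeriv (γ D) (f D))) ∧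
      LB (fun D => D.U * A D) (fun D => weakDeriv (γ D) (f D)) := by
  obtain ⟨C, hC, h⟩ := hf.bd_one h1 hK
  exact ⟨fun D => (h D _ (hγ D)).1, C, hC, fun D => (h D _ (hγ D)).2.mono (le_of_eq (by ring))⟩

lemma len_α (D : Dat N K l l1 l3) : len D.α = l - 2 := by have := D.hα; omega

lemma len_β (hl : 2 ≤ l) (j : Fin N) (D : Dat N K l l1 l3) : len (D.α + single j 1) = l - 1 := by
  rw [len_add, len_single, D.len_α]; omega

lemma jt_m (D : Dat N K l l1 l3) (a : Fin 3) : ∃ C, 0 ≤ C ∧ JT K 0 C (D.m a D.t) :=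
  (D.hm.ct a D.t D.ht).1

lemma pp_jj (hl : 2 ≤ l) (hK : l + 2 ≤ K) : ∃ e, 1 ≤ e + (l - 2) ∧ e ≤ 1 ∧ ∀ a, PP l e Dat.A' Dat.U
    (fun D : Dat N K l l1 l3 => jj l1 l3 D.m a D.t) (fun D => jj l1 l3 D.n a D.t) := by
  have h0 := pp (l1 := l1) (l3 := l3) (N := N) Dat.hA' hK
  have hA : ∀ D : Dat N K l l1 l3, 0 < D.A' := fun D => D.A_pos.trans_le D.hA'
  rcases hl.eq_or_lt with rfl | hl
  · refine ⟨1, by norm_num, le_rfl, fun a => ?_⟩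
    have h1 : ∀ a ≠ 1, PP 2 1 Dat.A' Dat.U (fun D : Dat N K 2 l1 l3 => D.m a D.t)
        (fun D => D.n a D.t) := fun a ha =>
      ⟨(h0 a).1.zero_one hA (by simp) fun D => (D.cm.b2 rfl a ha).mono (by simp),
        (h0 a).2.1.zero_one hA (by simp) fun D => (D.cn.b2 rfl a ha).mono (by simp),
        (h0 a).2.2.zero_one hA Dat.hU fun D => (D.u2 a ha).mono
          (le_mul_of_one_le_right D.hU (D.hA.trans D.hA'))⟩
    by_cases ha : a = 1
    · have e : ∀ p : Flow N, ∀ t, jj l1 l3 p a t = fun x => 0 * p 0 t x := fun p t => by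
        ext x; simp [jj, lam, ha]
      simp only [e]
      exact (h1 0 (by decide)).const_mul 0
    · exact (h1 a ha).const_mul _
  · exact ⟨0, by omega, by norm_num, fun a => (h0 a).const_mul _⟩

variable [Nonempty (Fin N)]

lemma lb_comm_lapc (hl : 2 ≤ l) (hK : l + 2 ≤ K) (j : Fin N) (b c : Fin 3) :
    LB (fun D : Dat N K l l1 l3 => D.U * D.A) (fun D x =>
      weakDeriv (D.α + single j 1) (fun y => dff (lapc D.n) (lapc D.m) b D.t y * D.m c D.t y) x -
      D.m c D.t x * weakDeriv (D.α + single j 1) (dff (lapc D.n) (lapc D.m) b D.t) x) := by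
  obtain ⟨B, hB, h1, h2⟩ := exists_ut
    (fun D : Dat N K l l1 l3 => (CT.dff D.hn.lapc_ct D.hm.lapc_ct b D.t D.ht).1) fun D => D.jt_m c
  obtain ⟨C, hC, h⟩ := UU.comm (j := l - 1) (by omega) (by norm_num) (by omega) (by omega) A_pos
    Dat.hU (by simp) hB (uu_lapc (by omega) hK b) (um (by omega) hK (.inl rfl) c) h1 h2
  exact ⟨C, hC, fun D => (h D _ (D.len_β hl j)).mono (le_of_eq (by ring))⟩

lemma lb_comm_dq (hl : 2 ≤ l) (hK : l + 2 ≤ K) (j : Fin N) (a : Fin 3) :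
    LB (fun D : Dat N K l l1 l3 => D.U * D.A ^ 2) (fun D x =>
      weakDeriv (D.α + single j 1) (fun y => D.dq j y * D.m a D.t y) x -
      D.m a D.t x * weakDeriv (D.α + single j 1) (D.dq j) x) := by
  obtain ⟨B, hB, h1, h2⟩ := exists_ut (f := fun D : Dat N K l l1 l3 => D.dq j)
    (fun D => (((D.hn.qq_ct j).sub (D.hm.qq_ct j)) D.t D.ht).1) fun D => D.jt_m a
  obtain ⟨C, hC, h⟩ := UM.comm (j := l - 1) (by omega) le_rfl (by norm_num) (by omega) (by omega) A_pos
    Dat.hU (by simp) hB (um_dq (by omega) hK j) (um (by omega) hK (.inl rfl) a) h1 h2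
  exact ⟨C, hC, fun D => (h D _ (D.len_β hl j)).mono (le_of_eq (by ring))⟩

lemma lb_yy (hl : 2 ≤ l) (hK : l + 2 ≤ K) (j : Fin N) (a : Fin 3) :
    LB (fun D : Dat N K l l1 l3 => D.U * D.A ^ 2) (fun D x =>
      wd (D.α + single j 1) (yy l1 l3 D.n j) (yy l1 l3 D.m j) a D.t x -
      D.m a D.t x * weakDeriv (D.α + single j 1) (D.dq j) x) := by
  have hc : ∀ D : Dat N K l l1 l3, 0 ≤ D.U * D.A ^ 2 := fun D => mul_nonneg D.hU (sq_nonneg _)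
  obtain ⟨r1, r2⟩ := lb_um (um_rr (l1 := l1) (l3 := l3) (by omega) hK j a) (by norm_num)
    (show 3 + (l - 1) = l + 2 by omega) (len_β hl j)
  have q := pp_pd (l1 := l1) (l3 := l3) hK j a
  have q' := PP.sum A_pos Dat.hU univ univ_nonempty fun b _ =>
    ((pp (N := N) (l1 := l1) (l3 := l3) (fun D => le_rfl) hK b).const_mul (lam l1 l3 b)).mul A_pos
      Dat.hU (pp (l1 := l1) (l3 := l3) (fun D => le_rfl) hK b)
  obtain ⟨s1, s2⟩ := lb_ut ((q.const_mul (-lam l1 l3 a)).add A_pos Dat.hU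
    (q'.mul A_pos Dat.hU q)).2.2 (j := l - 1) (by omega) (by omega) (len_β hl j)
  have s3 : LB (fun D : Dat N K l l1 l3 => D.U * D.A ^ 2) _ := s2.mono fun D => by
    have := D.hA
    exact mul_le_mul_of_nonneg_left (by nlinarith) D.hU
  refine (((lb_comm_dq (l1 := l1) (l3 := l3) hl hK j a).add hc r2).add hc s3).congr fun D => ?_
  have w := ((((((D.hn.qq_ct j).sub (D.hm.qq_ct j)).mul (D.hm.ct a)).isWeak
    (γ := D.α + single j 1) (by rw [len_β hl]; omega) D.ht).add (r1 D)).add (s1 D)).congr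
    (f' := dff (yy l1 l3 D.n j) (yy l1 l3 D.m j) a D.t) (.of_forall fun x => by
      simp only [Pi.add_apply, dff, yy, om, dg]; ring) .rfl
  filter_upwards [w.ae_eq] with x hx
  rw [wd, hx]
  simp only [Pi.add_apply, dq]
  ring

lemma lb_dq (hl : 2 ≤ l) (hK : l + 2 ≤ K) (j : Fin N) :
    LB (fun D : Dat N K l l1 l3 => D.U * D.A) (fun D => weakDeriv D.α (D.dq j)) := by
  simpa using (lb_um (um_dq (l1 := l1) (l3 := l3) (by omega) hK j) le_rfl
    (show 3 + (l - 2) = l + 1 by omega) len_α).2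

lemma pp_lapc (hK : l + 2 ≤ K) (a : Fin 3) : PP l 2 Dat.A Dat.U
    (fun D : Dat N K l l1 l3 => lapc D.m a D.t) (fun D => lapc D.n a D.t) :=
  PP.sum A_pos Dat.hU univ univ_nonempty fun i _ => by
    have := pp_wd (l1 := l1) (l3 := l3) hK a (γ := single i 2) (by simp; omega)
    rwa [len_single] at this

lemma lb_jt (hl : 2 ≤ l) (hK : l + 2 ≤ K) (a : Fin 3) :
    LB (fun D : Dat N K l l1 l3 => D.U * D.A') (fun D =>
      wd D.α (jt l1 l3 D.n D.dn) (jt l1 l3 D.m D.dm) a D.t) := by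
  obtain ⟨e, he1, he2, pj⟩ := pp_jj (N := N) (l1 := l1) (l3 := l3) hl hK
  have hA : ∀ D : Dat N K l l1 l3, 0 < D.A' := fun D => D.A_pos.trans_le D.hA'
  have p0 := pp (l1 := l1) (l3 := l3) (N := N) (fun D => le_rfl) hK
  have p0' := pp (l1 := l1) (l3 := l3) (N := N) Dat.hA' hK
  have hj : ∀ {A : Dat N K l l1 l3 → ℝ} {d : ℕ} {f g : Dat N K l l1 l3 → Flow N},
      (∀ a, PP l d A Dat.U (fun D => f D a D.t) (fun D => g D a D.t)) → ∀ a, PP l d A Dat.U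
        (fun D => jj l1 l3 (f D) a D.t) (fun D => jj l1 l3 (g D) a D.t) :=
    fun h a => (h a).const_mul _
  have pX := pp_crs (fun D => le_rfl) p0 (pp_lapc hK)
  have t1a := pp_crs (fun D => le_rfl) pX (hj p0) a
  have t1b := pp_crs (fun D => le_rfl) p0 (hj pX) a
  have pY0 := pp_crs Dat.hA' p0' (hj p0')
  have pY1 := pp_crs Dat.hA' p0' pj
  have t2a := pp_crs Dat.hA' pY0 pj a
  have t2b := pp_crs Dat.hA' p0' (hj pY1) a
  simp only [zero_add, add_zero] at t1a t1b t2a t2b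
  obtain ⟨r1, r2⟩ := lb_ut (t1a.add A_pos Dat.hU t1b).2.2 (j := l - 2) (by omega) (by omega) len_α
  obtain ⟨s1, s2⟩ := lb_ut (t2a.add hA Dat.hU t2b).2.2 (j := l - 2) (by omega) (by omega) len_α
  refine ((r2.mono fun D => mul_le_mul_of_nonneg_left D.hA' D.hU).neg.add
    (fun D => mul_nonneg D.hU (hA D).le) s2).congr fun D => ?_
  have w := ((r1 D).neg.add (s1 D)).congr
    (f' := dff (jt l1 l3 D.n D.dn) (jt l1 l3 D.m D.dm) a D.t) (by
      filter_upwards [ae_all_iff.2 (D.hm.eqn D.t D.ht), ae_all_iff.2 (D.hn.eqn D.t D.ht)] with x h1 h2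
      simp only [Pi.add_apply, Pi.neg_apply, dff, jt, crs, jj, h1, h2, lapc]
      ring) .rfl
  exact w.ae_eq.symm

end Dat

end

section

variable {N K l : ℕ} {l1 l3 : ℝ}

lemma energy_high_identity {σ : Type*} [Fintype σ] (W L U J k₁ k₂ m : Fin 3 → ℝ) (R θ θ' : σ → ℝ)
    (WP LP UP WW LL UU Y : σ → Fin 3 → ℝ) (hL : ∀ a, L a = ∑ j, UU j a) :
    ∑ a, ((-(∑ j, (LL j a + Y j a)) + J a) * W a + (∑ j, WW j a) * L a +
        k₁ a * ∑ j, WP j a * UP j a + k₂ a * (W a * U a)) +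
      ((∑ a, ((∑ j, ((WP j a * LP j a + W a * LL j a) + -1 * (WW j a * L a + WP j a * LP j a))) +
        -k₁ a * ∑ j, (WP j a * UP j a + W a * UU j a))) +
        ∑ j, (R j * θ j + (∑ a, W a * m a) * θ' j)) =
      ∑ a, ((∑ j, -(Y j a - m a * θ' j) * W a) + J a * W a + k₁ a * (-L a * W a) +
        k₂ a * (W a * U a)) + ∑ j, R j * θ j := by
  have e : ∑ j, (∑ a, W a * m a) * θ' j = ∑ a, W a * m a * ∑ j, θ' j := by
    rw [← mul_sum, sum_mul]
  rw [sum_add_distrib (s := (univ : Finset σ)), e,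
    add_comm (∑ j, R j * θ j), ← add_assoc, ← add_assoc, ← sum_add_distrib,
    ← sum_add_distrib]
  congr 1
  refine sum_congr rfl fun a _ => ?_
  simp only [← sum_mul, sum_add_distrib, ← mul_sum, sum_neg_distrib,
    sum_sub_distrib, hL a]
  ring

/-- Families of functions with integrals bounded by a multiple of `c`. -/
def QB {ι : Type*} (c : ι → ℝ) (f : ι → X N → ℝ) : Prop := ∃ C : ℝ, 0 ≤ C ∧ ∀ i, IB (f i) (C * c i)

namespace QB

variable {ι : Type*} {c c' e : ι → ℝ} {f g : ι → X N → ℝ}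

lemma add (hf : QB c f) (hg : QB c g) : QB c (fun i x => f i x + g i x) := by
  obtain ⟨C₁, h1, hf⟩ := hf
  obtain ⟨C₂, h2, hg⟩ := hg
  exact ⟨C₁ + C₂, by positivity, fun i => by rw [add_mul]; exact (hf i).add (hg i)⟩

lemma zero : QB c (fun _ (_ : X N) => (0 : ℝ)) := ⟨0, le_rfl, fun i => ⟨integrable_zero _ _ _, by simp⟩⟩

lemma const_mul (hf : QB c f) {r : ℝ} (hr : 0 ≤ r) : QB c (fun i x => r * f i x) := by
  obtain ⟨C, h1, hf⟩ := hf
  exact ⟨r * C, by positivity, fun i => by rw [mul_assoc]; exact (hf i).const_mul hr⟩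

lemma sum {σ : Type*} (t : Finset σ) {f : σ → ι → X N → ℝ} (h : ∀ a ∈ t, QB c (f a)) :
    QB c (fun i x => ∑ a ∈ t, f a i x) := by
  classical
  induction t using cons_induction with
  | empty => simpa using zero
  | cons a t ha ih =>
    simp only [sum_cons]
    exact (h a (by simp)).add (ih fun b hb => h b (by simp [hb]))

lemma _root_.LandauLifshitz.LB.mul (hc : ∀ i, 0 ≤ c i) (hc' : ∀ i, 0 ≤ c' i) (hf : LB c f)
    (hg : LB c' g) (h : ∀ i, c i * c' i ≤ e i) : QB e (fun i x => f i x * g i x) := by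
  obtain ⟨C₁, h1, hf⟩ := hf
  obtain ⟨C₂, h2, hg⟩ := hg
  refine ⟨C₁ * C₂, by positivity, fun i => ?_⟩
  obtain ⟨k1, k2⟩ := (hf i).ib (hg i) (mul_nonneg h1 (hc i)) (mul_nonneg h2 (hc' i))
  exact ⟨k1, k2.trans (by
    calc _ = C₁ * C₂ * (c i * c' i) := by ring
      _ ≤ _ := mul_le_mul_of_nonneg_left (h i) (by positivity))⟩

end QB

namespace Dat

lemma lb_du (a : Fin 3) : LB Dat.U (fun D : Dat N K l l1 l3 => wd D.α D.dn D.dm a D.t) :=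
  ⟨1, zero_le_one, fun D => (D.du a).mono (by simp)⟩

lemma lb_u (hl : 2 ≤ l) {a : Fin 3} (ha : a ≠ 1) :
    LB Dat.U (fun D : Dat N K l l1 l3 => wd D.α D.n D.m a D.t) := by
  refine ⟨1, zero_le_one, fun D => ?_⟩
  rw [one_mul]
  change Bd 1 (wd D.α D.n D.m a D.t) D.U
  rcases eq_zero_or_pos (len D.α) with h0 | h0
  · rw [eq_zero_of_len h0]
    exact (D.u2 a ha).congr ((CT.dff D.hn.ct D.hm.ct a).zero_ae (Nat.zero_le _) D.ht).symm
  · exact D.u1 a D.α h0 (by rw [D.len_α]; omega)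

variable [Nonempty (Fin N)]

lemma lb_lapc (hl : 2 ≤ l) (hK : l + 2 ≤ K) (a : Fin 3) :
    LB Dat.U (fun D : Dat N K l l1 l3 => wd D.α (lapc D.n) (lapc D.m) a D.t) :=
  (uu_lapc (l1 := l1) (l3 := l3) (by omega) hK a).bd_one (by omega) len_α

lemma lb_rho (hl : 2 ≤ l) (hK : l + 2 ≤ K) (j : Fin N) :
    LB (fun D : Dat N K l l1 l3 => D.U * D.A) (fun D x => ∑ a,
      (pd (wd D.α D.dn D.dm) j a D.t x * D.m a D.t x +
        wd D.α D.dn D.dm a D.t x * pd D.m j a D.t x)) := by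
  have hc : ∀ D : Dat N K l l1 l3, 0 ≤ D.U * D.A := fun D => mul_nonneg D.hU D.A_pos.le
  have q1 := fun b c => uu_mul (by omega) le_rfl (by norm_num)
    (uu (N := N) (l1 := l1) (l3 := l3) (by omega) hK b) (um_lapc (by omega) hK (.inr rfl) c)
  have p0 := pp (l1 := l1) (l3 := l3) (N := N) (fun D => le_rfl) hK
  have Q := fun a => lb_um (((q1 (a + 1) (a + 2)).sub A_pos Dat.hU (q1 (a + 2) (a + 1))).neg) le_rfl
    (show 0 + 2 + (l - 1) = l + 1 by omega) (len_β hl j)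
  have Y := fun a => lb_ut (pp_crs (f' := fun D => jj l1 l3 D.m) (g' := fun D => jj l1 l3 D.n)
    (fun D => le_rfl) p0 (fun a => (p0 a).const_mul (lam l1 l3 a)) a).2.2 (j := l - 1) (by omega)
    (by omega) (len_β hl j)
  have cm := fun b c => lb_comm_lapc (N := N) (l1 := l1) (l3 := l3) hl hK j b c
  simp only [pow_one] at Q
  have S := LB.sum hc univ fun a _ => ((((((cm (a + 2) (a + 1)).add hc
    (cm (a + 1) (a + 2)).neg).neg.add hc (Q a).2).add hc (Y a).2).mul_right hc
      fun D => D.hm.bd_zero D.ht a).mono fun D => (mul_one _).le).add hc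
        ((lb_du a).mul_right Dat.hU fun D => D.cm.b0 a j)
  refine S.congr fun D => ?_
  have w := fun a => ((((((CT.dff D.hn.lapc_ct D.hm.lapc_ct (a + 2)).mul (D.hm.ct (a + 1))).isWeak
    (γ := D.α + single j 1) (by rw [len_β hl]; omega) D.ht).sub
      (((CT.dff D.hn.lapc_ct D.hm.lapc_ct (a + 1)).mul (D.hm.ct (a + 2))).isWeak
        (γ := D.α + single j 1) (by rw [len_β hl]; omega) D.ht)).neg.add ((Q a).1 D)).add
        ((Y a).1 D)).congr (f' := dff D.dn D.dm a D.t) (by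
      filter_upwards [D.hm.eqn D.t D.ht a, D.hn.eqn D.t D.ht a] with x h1 h2
      simp only [Pi.add_apply, Pi.neg_apply, Pi.sub_apply, dff, crs, jj, h1, h2, lapc]
      ring) .rfl
  filter_upwards [ae_all_iff.2 fun a => (w a).ae_eq, ae_all_iff.2 fun a =>
    (CT.dff D.hn.dct D.hm.dct a).add_weakDeriv (α := D.α) (β := single j 1)
      (by rw [len_β hl]; omega) D.ht] with x h1 h2
  have h2 : ∀ a, pd (wd D.α D.dn D.dm) j a D.t x = _ := h2
  simp only [h2, h1, Pi.add_apply, Pi.neg_apply, Pi.sub_apply, sum_add_distrib]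
  congr 1
  rw [sum_fin_three 0, sum_fin_three 0]
  simp only [add_one_one, add_one_two, add_two_one, add_two_two]
  ring

lemma high_le (h1 : 0 ≤ l1) (h3 : 0 ≤ l3) (hl : 2 ≤ l) (hK : l + 2 ≤ K) : ∃ C : ℝ, 0 ≤ C ∧
    ∀ D : Dat N K l l1 l3, dHigh l1 l3 D.m D.dm D.n D.dn D.α D.t ≤
      C * (D.U ^ 2 * (D.A ^ 2 + D.A')) := by
  have hU := @Dat.hU N K l l1 l3
  have hA := @Dat.hA N K l l1 l3
  have hA' : ∀ D : Dat N K l l1 l3, 1 ≤ D.A' := fun D => D.hA.trans D.hA'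
  have hA2 : ∀ D : Dat N K l l1 l3, 0 ≤ D.U * D.A ^ 2 := fun D => mul_nonneg D.hU (sq_nonneg _)
  have hUA : ∀ D : Dat N K l l1 l3, 0 ≤ D.U * D.A := fun D => mul_nonneg D.hU D.A_pos.le
  have hUA' : ∀ D : Dat N K l l1 l3, 0 ≤ D.U * D.A' := fun D =>
    mul_nonneg D.hU (zero_le_one.trans (hA' D))
  have k1 : ∀ D : Dat N K l l1 l3, D.U * D.A ^ 2 * D.U ≤ D.U ^ 2 * (D.A ^ 2 + D.A') := fun D => by
    nlinarith [mul_nonneg (sq_nonneg D.U) (zero_le_one.trans (hA' D))]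
  have k2 : ∀ D : Dat N K l l1 l3, D.U * D.A' * D.U ≤ D.U ^ 2 * (D.A ^ 2 + D.A') := fun D => by
    nlinarith [mul_nonneg (sq_nonneg D.U) (sq_nonneg D.A)]
  have k3 : ∀ D : Dat N K l l1 l3, D.U * D.U ≤ D.U ^ 2 * (D.A ^ 2 + D.A') := fun D => by
    nlinarith [mul_nonneg (sq_nonneg D.U) (sq_nonneg D.A),
      mul_le_mul_of_nonneg_left (hA' D) (sq_nonneg D.U)]
  have k4 : ∀ D : Dat N K l l1 l3, D.U * D.A * (D.U * D.A) ≤ D.U ^ 2 * (D.A ^ 2 + D.A') := fun D => by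
    nlinarith [k1 D]
  have c1n : ∀ a, 0 ≤ c1 l1 l3 a := fun a => by rw [c1]; split <;> positivity
  have c2n : ∀ a, 0 ≤ c2 l1 l3 a := fun a => by rw [c2]; split <;> positivity
  obtain ⟨C, hC, hB⟩ := (QB.sum univ fun a _ => (((QB.sum univ fun j _ =>
    (lb_yy (l1 := l1) (l3 := l3) hl hK j a).neg.mul hA2 hU (lb_du a) k1).add
      ((lb_jt (l1 := l1) (l3 := l3) hl hK a).mul hUA' hU (lb_du a) k2)).add
      (((lb_lapc (l1 := l1) (l3 := l3) hl hK a).neg.mul hU hU (lb_du a) k3).const_mul (c1n a))).add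
      (show QB _ (fun (D : Dat N K l l1 l3) x => c2 l1 l3 a * (wd D.α D.dn D.dm a D.t x *
        wd D.α D.n D.m a D.t x)) by
        by_cases ha : a = 1
        · simpa [c2, ha] using QB.zero
        · exact ((lb_du a).mul hU hU (lb_u hl ha) k3).const_mul (c2n a))).add
    (QB.sum univ fun j _ => (lb_rho (l1 := l1) (l3 := l3) hl hK j).mul hUA hUA (lb_dq hl hK j) k4)
  refine ⟨C, hC, fun D => ?_⟩
  have hα := D.hα
  have cU := wd_ct D.hn.ct D.hm.ct D.α
  have cW := wd_ct D.hn.dct D.hm.dct D.α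
  have cL := wd_ct D.hn.lapc_ct D.hm.lapc_ct D.α
  have cW' := wd_ct D.hn.mtt_ct D.hm.mtt_ct D.α
  have cL' := wd_ct D.hn.ldm_ct D.hm.ldm_ct D.α
  have cq := fun j => ((D.hn.qq_ct j).sub (D.hm.qq_ct j)).deriv D.α
  have mW := fun a => (cW a).cLp_inf (by omega) (by omega) D.t D.ht
  have mP := fun j a => (CT.pd cW j a).cLp_inf (by omega) (by omega) D.t D.ht
  have cρ := CT.sum (T := D.T) univ fun a _ => (cW a).mul (D.hm.ct a)
  have i1 := fun a => ((cW' a).cLp_inf (by omega) (by omega) D.t D.ht).integrable_mul (mW a)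
  have i2 := fun a => ((cL' a).cLp_inf (by omega) (by omega) D.t D.ht).integrable_mul
    ((cL a).cLp_inf (by omega) (by omega) D.t D.ht)
  have i3 := fun a => (integrable_finsetSum univ fun j _ => (mP j a).integrable_mul
    ((CT.pd cU j a).cLp_inf (by omega) (by omega) D.t D.ht)).const_mul (c1 l1 l3 a)
  have i4 : ∀ a, Integrable (fun x => c2 l1 l3 a * (wd D.α D.dn D.dm a D.t x *
      wd D.α D.n D.m a D.t x)) := fun a => by
    by_cases ha : a = 1
    · simp [c2, ha]
    · have := (D.hm.wd_memLp D.hn (α := D.α) (by omega) ha D.t D.ht).1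
      rw [ex_one] at this
      exact ((mW a).integrable_mul this).const_mul _
  have hF := fun a => (((i1 a).add (i2 a)).add (i3 a)).add (i4 a)
  have Z1 := NI.sum univ fun a _ => (NI.sum univ fun j _ =>
    ((cW a).ni (CT.pd cL j a) (by omega) (by omega) (by omega) (by omega) D.ht j).add
      (((CT.pd cW j a).ni (cL a) (by omega) (by omega) (by omega) (by omega) D.ht j).const_mul
        (-1))).add ((NI.sum univ fun j _ => (cW a).ni (CT.pd cU j a) (by omega) (by omega)
          (by omega) (by omega) D.ht j).const_mul (-c1 l1 l3 a))
  have Z2 := NI.sum univ fun j _ => cρ.ni (cq j) (by omega) (by omega) (by omega) (by omega)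
    D.ht j
  refine le_trans (le_of_eq ?_) ((hB D).integral_le (integrable_finsetSum univ fun a _ => hF a)
    (Z1.add Z2) ?_)
  · refine Eq.trans ?_ (integral_finsetSum _ fun a _ => hF a).symm
    refine sum_congr rfl fun a _ => ?_
    rw [integral_add' (((i1 a).add (i2 a)).add (i3 a)) (i4 a), integral_add' ((i1 a).add (i2 a)) (i3 a),
      integral_add' (i1 a) (i2 a), integral_const_mul, integral_const_mul,
      integral_finsetSum _ fun j _ => (mP j a).integrable_mul
        ((CT.pd cU j a).cLp_inf (by omega) (by omega) D.t D.ht)]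
    rfl
  · have eρ := fun j => (IsWeakDeriv.sum univ fun a _ =>
      (cW a).isWeakDeriv_mul (D.hm.ct a) (by omega) D.ht j).ae_eq
    filter_upwards [ae_all_iff.2 fun a => D.hm.wd_mtt D.hn (α := D.α) (by omega) D.ht a,
      ae_all_iff.2 fun a => wd_lapc D.hn.dct D.hm.dct (α := D.α) (by omega) D.ht a,
      ae_all_iff.2 fun a => wd_lapc D.hn.ct D.hm.ct (α := D.α) (by omega) D.ht a,
      ae_all_iff.2 eρ, ae_all_iff.2 fun j => ((D.hn.qq_ct j).sub (D.hm.qq_ct j)).add_weakDeriv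
        (α := D.α) (β := single j 1) (by simp; omega) D.ht] with x e1 e2 e3 e4 e5
    have e4 : ∀ j, weakDeriv (single j 1)
        (fun x => ∑ a, wd D.α D.dn D.dm a D.t x * D.m a D.t x) x = ∑ a,
          (pd (wd D.α D.dn D.dm) j a D.t x * D.m a D.t x +
            wd D.α D.dn D.dm a D.t x * pd D.m j a D.t x) := fun j => by
      rw [show (fun x => ∑ a, wd D.α D.dn D.dm a D.t x * D.m a D.t x) = ∑ a, fun x =>
        wd D.α D.dn D.dm a D.t x * D.m a D.t x by ext y; simp]
      exact (e4 j).trans (by simp only [Finset.sum_apply]; rfl)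
    have e3 : ∀ a, wd D.α (lapc D.n) (lapc D.m) a D.t x =
      ∑ j, weakDeriv (single j 1) (pd (wd D.α D.n D.m) j a D.t) x := e3
    have := energy_high_identity (fun a => wd D.α D.dn D.dm a D.t x)
      (fun a => wd D.α (lapc D.n) (lapc D.m) a D.t x) (fun a => wd D.α D.n D.m a D.t x)
      (fun a => wd D.α (jt l1 l3 D.n D.dn) (jt l1 l3 D.m D.dm) a D.t x) (c1 l1 l3) (c2 l1 l3)
      (fun a => D.m a D.t x) (fun j => ∑ a, (pd (wd D.α D.dn D.dm) j a D.t x * D.m a D.t x +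
        wd D.α D.dn D.dm a D.t x * pd D.m j a D.t x))
      (fun j => weakDeriv D.α (D.dq j) x) (fun j => weakDeriv (D.α + single j 1) (D.dq j) x)
      (fun j a => pd (wd D.α D.dn D.dm) j a D.t x)
      (fun j a => pd (wd D.α (lapc D.n) (lapc D.m)) j a D.t x)
      (fun j a => pd (wd D.α D.n D.m) j a D.t x)
      (fun j a => pd (pd (wd D.α D.dn D.dm) j) j a D.t x)
      (fun j a => pd (pd (wd D.α (lapc D.n) (lapc D.m)) j) j a D.t x)
      (fun j a => pd (pd (wd D.α D.n D.m) j) j a D.t x)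
      (fun j a => wd (D.α + single j 1) (yy l1 l3 D.n j) (yy l1 l3 D.m j) a D.t x) e3
    simp only [Pi.add_apply, Pi.mul_apply, e1, e2]
    refine le_of_eq (Eq.trans ?_ this)
    simp only [e4]
    refine congrArg₂ (· + ·) rfl (congrArg₂ (· + ·) rfl (sum_congr rfl fun j _ => ?_))
    exact congrArg₂ (· + ·) rfl (congrArg₂ (· * ·) rfl (e5 j))

end Dat

end

section

variable {N K d : ℕ} {T t : ℝ}

lemma bd_norm {E : Type*} [NormedAddCommGroup E] {F : X N → E} (hF : MemLp F 2)
    {g : X N → ℝ} (h : ∀ᵐ x, ‖F x‖ = g x) : Bd 1 g (l2norm F) := by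
  have := bd_one_of_memLp hF.norm
  rw [eLpNorm_norm] at this
  exact this.congr h

lemma ae_norm_le_linfnorm {E : Type*} [NormedAddCommGroup E] {F : X N → E}
    (hF : MemLp F ⊤) : ∀ᵐ x, ‖F x‖ ≤ linfnorm F := by
  have h := hF.2.ne
  rw [eLpNorm_exponent_top] at h
  filter_upwards [ae_le_eLpNormEssSup (f := F) (μ := volume)] with x hx
  have := toReal_mono h hx
  rwa [toReal_enorm, ← eLpNorm_exponent_top] at this

lemma bd_of_integral_sq_le {g : X N → ℝ} (hg : MemLp g 2) {B : ℝ} (hB : 0 ≤ B)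
    (h : ∫ x, g x ^ 2 ≤ B ^ 2) : Bd 1 g B := by
  refine (bd_nr (s := 1) (by rwa [ex_one])).mono (abs_le_of_sq_le_sq' ?_ hB).2
  rw [← integral_sq_eq_nr hg]
  simpa only [sq] using h

lemma Bd.integral_sq_le {g : X N → ℝ} {B : ℝ} (h : Bd 1 g B) (hB : 0 ≤ B) :
    ∫ x, g x ^ 2 ≤ B ^ 2 := by
  simp only [sq]
  exact (h.ib h hB hB).2

lemma integral_norm_sq {E : Type*} [NormedAddCommGroup E] {F : X N → E} (hF : MemLp F 2) :
    ∫ x, ‖F x‖ ^ 2 = l2norm F ^ 2 := by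
  simpa only [sq, nr_one_eq, l2norm, eLpNorm_norm] using integral_sq_eq_nr hF.norm

lemma memLp_ve {f : Flow N} {p : ℝ≥0∞} (h : ∀ a, MemLp (f a t) p) :
    MemLp (fun x => ve f t x) p := MemLp.of_eval_piLp h

lemma weakDeriv_vec {F : ℝ → X N → V} {α : Fin N → ℕ} (hF : ∀ a, CT K d T (cmp F a))
    (hK : d + len α ≤ K) (ht : t ∈ Icc 0 T) :
    weakDeriv α (F t) =ᵐ[volume] ve (fun a t => weakDeriv α (cmp F a t)) t :=
  (isWeakDeriv_toLp fun a => (hF a).isWeak hK ht).ae_eq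

lemma grad_ae {F : ℝ → X N → V} (hF : ∀ a, CT K d T (cmp F a)) (hK : d + 1 ≤ K)
    (ht : t ∈ Icc 0 T) : ∀ᵐ x, grad (F t) x = toLp 2 fun i => ve (pd (cmp F) i) t x := by
  filter_upwards [ae_all_iff.2 fun i => weakDeriv_vec (α := single i 1) hF (by simpa using hK) ht]
    with x hx
  simp only [grad, wpartial, hx]
  rfl

lemma memLp_grad {F : ℝ → X N → V} (hF : ∀ a, CT K d T (cmp F a)) (hK : d + 1 ≤ K)
    (ht : t ∈ Icc 0 T) {p : ℝ≥0∞} (h : ∀ i a, MemLp (pd (cmp F) i a t) p) : MemLp (grad (F t)) p :=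
  (MemLp.of_eval_piLp fun i => memLp_ve (h i)).ae_eq
    (EventuallyEq.symm (by filter_upwards [grad_ae hF hK ht] with x hx using hx))

lemma norm_toLp_pn {σ : Type*} [Fintype σ] (g : σ → V) :
    ‖(toLp 2 g : PiLp 2 fun _ : σ => V)‖ = pn g := by rw [PiLp.norm_eq_of_L2, pn]

lemma norm_grad {F : ℝ → X N → V} (hF : ∀ a, CT K d T (cmp F a)) (hK : d + 1 ≤ K)
    (ht : t ∈ Icc 0 T) : ∀ᵐ x, ‖grad (F t) x‖ = pn fun i => ve (pd (cmp F) i) t x := by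
  filter_upwards [grad_ae hF hK ht] with x hx
  rw [hx, norm_toLp_pn]

lemma bd_grad {F : ℝ → X N → V} (hF : ∀ a, CT K d T (cmp F a)) (hK : d + 1 ≤ K)
    (ht : t ∈ Icc 0 T) : Bd 1 (fun x => pn fun i => ve (pd (cmp F) i) t x) (l2norm (grad (F t))) :=
  bd_norm (memLp_grad hF hK ht fun i a => (CT.pd hF i a).cLp_inf (by omega) hK t ht)
    (norm_grad hF hK ht)

lemma integral_hess {f : Flow N} (hf : ∀ a, CT K d T (f a)) (hK : d + 3 ≤ K)
    (ht : t ∈ Icc 0 T) (a : Fin 3) : ∫ x, (∑ i, pd (pd f i) i a t x) ^ 2 =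
      ∑ i, ∑ j, ∫ x, pd (pd f i) j a t x ^ 2 := by
  have h1 := fun i => CT.pd hf i
  have h2 := fun i j => CT.pd (h1 i) j
  have m2 := fun i j => (h2 i j a).cLp_inf (by omega) (by omega) t ht
  obtain ⟨z1, z2⟩ := NI.sum univ fun i _ => NI.sum univ fun j _ =>
    ((h1 i a).ni (h2 j j a) (by omega) (by omega) (by omega) (by omega) ht i).add
      (((h1 i a).ni (h2 i j a) (by omega) (by omega) (by omega) (by omega) ht j).const_mul (-1))
  have e3 : ∀ i j, weakDeriv (single i 1) (pd (pd f j) j a t)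
      =ᵐ[volume] weakDeriv (single j 1) (pd (pd f i) j a t) :=
    fun i j => ((h1 j a).swap (α := single j 1) (β := single i 1) (by simp; omega) ht).trans
      (weakDeriv_congr ((hf a).swap (by simp; omega) ht))
  have : ∫ x, ((∑ i, pd (pd f i) i a t x) ^ 2 - ∑ i, ∑ j, pd (pd f i) j a t x ^ 2) = 0 := by
    refine (integral_congr_ae ?_).trans z2
    filter_upwards [ae_all_iff.2 fun i => ae_all_iff.2 fun j => e3 i j] with x hx
    rw [sq, Finset.sum_mul_sum, ← sum_sub_distrib]
    refine sum_congr rfl fun i _ => ?_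
    rw [← sum_sub_distrib]
    refine sum_congr rfl fun j _ => ?_
    rw [hx i j]
    change _ = pd (pd f i) i a t x * _ + _ + -1 * (pd (pd f i) j a t x * _ + _)
    ring
  have i1 := fun i => integrable_finsetSum univ fun j _ => (m2 i j).integrable_sq
  rw [integral_sub (memLp_finsetSum _ fun i _ => m2 i i).integrable_sq
    (integrable_finsetSum _ fun i _ => i1 i), sub_eq_zero] at this
  rw [this, integral_finsetSum _ fun i _ => i1 i]
  exact sum_congr rfl fun i _ => integral_finsetSum _ fun j _ => (m2 i j).integrable_sq

end

section

variable {N K d : ℕ} {T t l1 l3 : ℝ} {m m' du v : ℝ → X N → V} {dm dn : Flow N}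

lemma cmp_sub (m' m : ℝ → X N → V) : cmp (m' - m) = dff (cmp m') (cmp m) := rfl

lemma ct_sub (hm : Sol l1 l3 K T (cmp m) dm) (hn : Sol l1 l3 K T (cmp m') dn) (a : Fin 3) :
    CT K 0 T (cmp (m' - m) a) := CT.dff hn.ct hm.ct a

namespace Sol

lemma memLp_top_vec (hm : Sol l1 l3 K T (cmp m) dm) (ht : t ∈ Icc 0 T) : MemLp (m t) ⊤ :=
  memLp_ve (f := cmp m) fun a => (hm.w a t ht).bdd

lemma norm_sub_le (hm : Sol l1 l3 K T (cmp m) dm) (hn : Sol l1 l3 K T (cmp m') dn)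
    (ht : t ∈ Icc 0 T) : ∀ᵐ x, ‖ve (dff (cmp m') (cmp m)) t x‖ ≤ linfnorm ((m' - m) t) :=
  ae_norm_le_linfnorm ((hn.memLp_top_vec ht).sub (hm.memLp_top_vec ht))

lemma bd_grad_sub (hm : Sol l1 l3 K T (cmp m) dm) (hn : Sol l1 l3 K T (cmp m') dn) (hK : 1 ≤ K)
    (ht : t ∈ Icc 0 T) : Bd 1 (fun x => pn fun i => ve (pd (cmp m') i) t x - ve (pd (cmp m) i) t x)
      (l2norm (grad ((m' - m) t))) := by
  refine (bd_grad (ct_sub hm hn) (by omega) ht).congr ?_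
  filter_upwards [ae_all_iff.2 fun i => pd_dff hn.ct hm.ct (by omega) ht i] with x hx
  simp only [cmp_sub, hx]

lemma grad_le (hm : Sol l1 l3 K T (cmp m) dm) (hK : 1 ≤ K) (ht : t ∈ Icc 0 T) :
    ∀ᵐ x, (pn fun i => ve (pd (cmp m) i) t x) ≤ linfnorm (grad (m t)) := by
  filter_upwards [ae_norm_le_linfnorm (memLp_grad hm.ct (by omega) ht fun i a => by
    have := (hm.gradInf a i t ht).1
    rwa [ex_zero] at this), norm_grad hm.ct (by omega) ht] with x h1 h2
  rwa [← h2]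

lemma bd_comp (hm : Sol l1 l3 K T (cmp m) dm) (ht : t ∈ Icc 0 T) {a : Fin 3} (ha : a ≠ 1) :
    Bd 1 (cmp m a t) (l2norm (comp a (m t))) := by
  have := (hm.l2 a ha t ht).1
  rw [ex_one] at this
  exact bd_one_of_memLp this

lemma dens0_eq (m m' : ℝ → X N → V) (t : ℝ) (x : X N) :
    ve (sh (cmp m) (cmp m')) t x = shifted (m' - m) t x := by
  ext a
  by_cases ha : a = 1
  · subst ha; simp [ve, sh, shifted, dff, cmp, comp]
  · simp [ve, sh, shifted, dff, cmp, comp, ha]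

lemma bd_shifted (hm : Sol l1 l3 K T (cmp m) dm) (hn : Sol l1 l3 K T (cmp m') dn) (hT : 0 < T)
    (hK : 2 ≤ K) (ht : t ∈ Icc 0 T) : Bd 1 (fun x => ‖ve (sh (cmp m) (cmp m')) t x‖)
      (l2norm (shifted (m' - m) t)) := by
  have h := memLp_ve fun a => (hm.sd_sh hn hT hK a).2.2 t ht
  simp only [dens0_eq] at h ⊢
  exact bd_norm h (.of_forall fun _ => rfl)

lemma level_zero (hm : Sol l1 l3 K T (cmp m) dm) (hn : Sol l1 l3 K T (cmp m') dn) (h1 : 0 ≤ l1)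
    (h3 : 0 ≤ l3) (hT : 0 < T) (hK : 3 ≤ K) :
    (∀ t ∈ Icc 0 T, Integrable (dens0 (m' - m) t)) ∧
      ContDiffOn ℝ 1 (gE l1 l3 (m' - m) v du 0) (Icc 0 T) ∧
      ∀ t ∈ Icc 0 T, derivWithin (gE l1 l3 (m' - m) v du 0) (Icc 0 T) t ≤
        2 * (1 + (l1 + l3)) * (1 + l2norm (grad (m' t)) + l2norm (grad (m t)) +
          l2norm (comp 0 (m' t)) + l2norm (comp 0 (m t)) + l2norm (comp 2 (m' t)) +
          l2norm (comp 2 (m t))) * (l2norm (shifted (m' - m) t) ^ 2 + linfnorm ((m' - m) t) ^ 2 +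
          l2norm (grad ((m' - m) t)) ^ 2 + l2norm (grad (comp 1 ((m' - m) 0))) ^ 2) := by
  have e : gE l1 l3 (m' - m) v du 0 = fun t => 1 / 2 * ∫ x, ‖ve (sh (cmp m) (cmp m')) t x‖ ^ 2 := by
    simp only [dens0_eq]; rfl
  obtain ⟨k1, k2⟩ := hm.energy_zero_deriv hn hT (by omega)
  obtain ⟨k3, k4⟩ := contDiffOn_one_of_hasDerivWithinAt hT k1 k2
  refine ⟨fun t ht => ?_, e ▸ k3, fun t ht => ?_⟩
  · have h := memLp_ve fun a => (hm.sd_sh hn hT (by omega) a).2.2 t ht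
    simp only [dens0_eq] at h
    exact h.norm.integrable_sq
  · rw [e, k4 t ht]
    have h0 : (0 : ℝ) ∈ Icc 0 T := ⟨le_rfl, hT.le⟩
    have p : ∀ {E : Type} [NormedAddCommGroup E] (f : X N → E), 0 ≤ l2norm f :=
      fun _ => toReal_nonneg
    have b := fun {m : ℝ → X N → V} {dm} (hm : Sol l1 l3 K T (cmp m) dm) {a : Fin 3} (ha : a ≠ 1) =>
      (hm.bd_comp ht ha).abs
    refine (hm.energy_zero_le (U := linfnorm ((m' - m) t)) hn h1 h3 hT hK ht toReal_nonneg
      (p _) (p _) (p _) (p _) (add_nonneg (add_nonneg (p _) (p _)) (add_nonneg (p _) (p _))) (p _) (hm.norm_sub_le hn ht)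
      (hm.bd_shifted hn hT (by omega) ht) (hm.bd_grad_sub hn (by omega) ht)
      (bd_norm (F := grad (comp 1 ((m' - m) 0))) (MemLp.of_eval_piLp fun i =>
        (CT.pd (ct_sub hm hn) i 1).cLp_inf le_rfl (by omega) 0 h0) (.of_forall fun x => ?_))
      (bd_grad hm.ct (by omega) ht) (bd_grad hn.ct (by omega) ht)
      (((b hn (a := 0) (by decide)).add (b hm (a := 0) (by decide)) one_le_two (p _) (p _)).add
        ((b hn (a := 2) (by decide)).add (b hm (a := 2) (by decide)) one_le_two (p _) (p _))
        one_le_two (add_nonneg (p _) (p _)) (add_nonneg (p _) (p _)))).trans (le_of_eq (by ring))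
    rw [PiLp.norm_eq_of_L2, pn]
    refine congrArg _ (sum_congr rfl fun i _ => ?_)
    rw [PiLp.norm_single]
    rfl

lemma hnorm_one (hm : Sol l1 l3 K T (cmp m) dm) (hK : 3 ≤ K) (ht : t ∈ Icc 0 T) :
    l2norm (grad (m t)) ≤ hnorm 1 (grad (m t)) ∧
    Bd 1 (fun x => pn fun p : Fin N × Fin N => ve (pd (pd (cmp m) p.1) p.2) t x)
      (hnorm 1 (grad (m t))) ∧
    Bd 1 (fun x => ‖ve (lapc (cmp m)) t x‖) (hnorm 1 (grad (m t))) := by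
  have c1 := hm.pd_ct
  have c2 := fun i j => CT.pd (c1 i) j
  have mg := memLp_grad hm.ct (by omega) ht fun i a => (c1 i a).cLp_inf le_rfl (by omega) t ht
  have m2 := fun i j => memLp_ve fun a => (c2 i j a).cLp_inf (by omega) (by omega) t ht
  have m3 := MemLp.of_eval_piLp (f := fun x => toLp 2 fun p : Fin N × Fin N =>
    ve (pd (pd (cmp m) p.1) p.2) t x) fun p => m2 p.1 p.2
  have eH : ∫ x, (pn fun p : Fin N × Fin N => ve (pd (pd (cmp m) p.1) p.2) t x) ^ 2 =
      ∑ j, ∑ i, ∫ x, ‖ve (pd (pd (cmp m) i) j) t x‖ ^ 2 := by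
    have i2 := fun i j => (m2 i j).norm.integrable_sq
    simp only [pn_sq, Fintype.sum_prod_type_right]
    rw [integral_finsetSum _ fun j _ => integrable_finsetSum _ fun i _ => i2 i j]
    exact sum_congr rfl fun j _ => integral_finsetSum _ fun i _ => i2 i j
  have w : ∀ j, weakDeriv (single j 1) (grad (m t)) =ᵐ[volume]
      fun x => toLp 2 fun i => ve (pd (pd (cmp m) i) j) t x := fun j =>
    ((isWeakDeriv_toLp fun i => isWeakDeriv_toLp fun a => (c1 i a).isWeak (γ := single j 1)
      (by simp; omega) ht).congr (by filter_upwards [grad_ae hm.ct (by omega) ht] with x hx using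
        hx.symm) .rfl).ae_eq
  have b1 : ∀ j, ∑ i, ∫ x, ‖ve (pd (pd (cmp m) i) j) t x‖ ^ 2 ≤
      l2norm (weakDeriv (single j 1) (grad (m t))) ^ 2 := fun j => by
    have := (bd_norm ((MemLp.of_eval_piLp fun i => m2 i j).ae_eq (w j).symm)
      (g := fun x => pn fun i => ve (pd (pd (cmp m) i) j) t x) (by
        filter_upwards [w j] with x hx
        rw [hx, norm_toLp_pn])).integral_sq_le toReal_nonneg
    simp only [pn_sq] at this
    rwa [integral_finsetSum _ fun i _ => (m2 i j).norm.integrable_sq] at this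
  have b2 : ∑ j : Fin N, l2norm (weakDeriv (single j 1) (grad (m t))) ^ 2 ≤
      hnorm 1 (grad (m t)) ^ 2 := by
    rw [hnorm, sq_sqrt (sum_nonneg fun _ _ => sum_nonneg fun _ _ => sq_nonneg _)]
    refine le_trans ?_ (single_le_sum (f := fun r => ∑ α ∈ multiIdx N r,
      l2norm (weakDeriv α (grad (m t))) ^ 2) (fun r _ => sum_nonneg fun _ _ => sq_nonneg _)
      (Finset.mem_range.2 one_lt_two))
    rw [← Finset.sum_image (s := univ) (g := fun j : Fin N => (single j 1 : Fin N → ℕ))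
      (f := fun α => l2norm (weakDeriv α (grad (m t))) ^ 2) fun i _ j _ h => by
        by_contra hij
        simpa [hij] using congrFun h i]
    refine Finset.sum_le_sum_of_subset_of_nonneg (fun α hα => ?_) fun _ _ _ => sq_nonneg _
    obtain ⟨j, -, rfl⟩ := Finset.mem_image.1 hα
    exact mem_multiIdx.2 (len_single _ _)
  have hle := (sum_le_sum fun j (_ : j ∈ Finset.univ) => b1 j).trans b2
  refine ⟨?_, bd_of_integral_sq_le (by simpa only [norm_toLp_pn] using m3.norm) (hnorm_nonneg _ _)
    (eH.trans_le hle), bd_of_integral_sq_le (memLp_ve fun a => (hm.lapc_ct a).cLp_inf (by norm_num)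
      (by omega) t ht).norm (hnorm_nonneg _ _) ?_⟩
  · have := l2norm_le_hnorm (s := 1) (grad (m t)) (α := 0) (by simp)
    rwa [l2norm, eLpNorm_congr_ae (isWeakDeriv_zero (mg.locInt one_le_two)).ae_eq] at this
  · refine le_trans (le_of_eq ?_) hle
    simp only [norm_sq_eq_sum]
    refine Eq.trans (integral_finsetSum (f := fun a x => lapc (cmp m) a t x ^ 2) _ fun a _ =>
      ((hm.lapc_ct a).cLp_inf (by norm_num) (by omega) t ht).integrable_sq) ?_
    have e1 : ∀ a, ∫ x, lapc (cmp m) a t x ^ 2 =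
        ∑ i, ∑ j, ∫ x, pd (pd (cmp m) i) j a t x ^ 2 := fun a => by
      rw [← integral_hess hm.ct (by omega) ht a]
      refine integral_congr_ae ?_
      filter_upwards [ae_all_iff.2 fun i => hm.pd_pd (by omega) ht i a] with x hx
      exact congrArg (· ^ 2) (sum_congr rfl fun i _ => (hx i).symm)
    have e2 : ∀ i j, ∫ x, ∑ a, ve (pd (pd (cmp m) i) j) t x a ^ 2 =
        ∑ a, ∫ x, pd (pd (cmp m) i) j a t x ^ 2 := fun i j =>
      integral_finsetSum _ fun a _ => ((c2 i j a).cLp_inf (by omega) (by omega) t ht).integrable_sq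
    simp only [e1, e2]
    refine sum_comm.trans (Eq.trans (sum_congr rfl fun i _ => ?_) sum_comm)
    exact sum_comm

lemma wpartial_avg (hm : Sol l1 l3 K T (cmp m) dm) (hn : Sol l1 l3 K T (cmp m') dn)
    (hK : 1 ≤ K) (ht : t ∈ Icc 0 T) (i : Fin N) :
    ∀ᵐ x, wpartial i (((1 / 2 : ℝ) • (m' + m)) t) x =
      (1 / 2 : ℝ) • (ve (pd (cmp m') i) t x + ve (pd (cmp m) i) t x) := by
  have e : cmp ((1 / 2 : ℝ) • (m' + m)) = avg (cmp m') (cmp m) := rfl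
  filter_upwards [weakDeriv_vec (F := (1 / 2 : ℝ) • (m' + m)) (α := single i 1) (d := 0)
    (K := K) (e ▸ CT.avg hn.ct hm.ct) (by simpa using hK) ht,
    pd_avg hn.ct hm.ct (by omega) ht i] with x h1 h2
  rw [wpartial, h1, ← h2, e]
  rfl

lemma dens1_ae (hm : Sol l1 l3 K T (cmp m) dm) (hn : Sol l1 l3 K T (cmp m') dn)
    (hK : 1 ≤ K) (ht : t ∈ Icc 0 T) : dens1 (m' - m) ((1 / 2 : ℝ) • (m' + m)) t =ᵐ[volume] fun x =>
      ∑ i, (‖ve (dff (pd (cmp m') i) (pd (cmp m) i)) t x‖ ^ 2 +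
        ‖ve (dff (bb (cmp m') i) (bb (cmp m) i)) t x‖ ^ 2) := by
  filter_upwards [norm_grad (ct_sub hm hn) (by omega) ht,
    ae_all_iff.2 fun i => weakDeriv_vec (α := single i 1) (ct_sub hm hn) (by simpa using hK) ht,
    ae_all_iff.2 fun i => pd_dff hn.ct hm.ct (by omega) ht i,
    ae_all_iff.2 fun i => hm.wpartial_avg hn hK ht i] with x h1 h2 h3 h4
  rw [dens1, h1, pn_sq, ← sum_add_distrib]
  refine sum_congr rfl fun i _ => ?_
  have h5 : wpartial i ((m' - m) t) x = ve (pd (cmp m') i) t x - ve (pd (cmp m) i) t x :=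
    (h2 i).trans (h3 i)
  rw [bb_dff, h4 i, h5, cmp_sub, h3 i]
  rfl

set_option maxHeartbeats 1000000 in
lemma level_one (hm : Sol l1 l3 K T (cmp m) dm) (hn : Sol l1 l3 K T (cmp m') dn) (h1 : 0 ≤ l1)
    (h3 : 0 ≤ l3) (hT : 0 < T) (hK : 3 ≤ K) :
    (∀ t ∈ Icc 0 T, Integrable (dens1 (m' - m) ((1 / 2 : ℝ) • (m' + m)) t)) ∧
      (∀ t ∈ Icc 0 T, l2norm (grad ((m' - m) t)) ^ 2 ≤
        2 * gE l1 l3 (m' - m) ((1 / 2 : ℝ) • (m' + m)) du 1 t) ∧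
      ContDiffOn ℝ 1 (gE l1 l3 (m' - m) ((1 / 2 : ℝ) • (m' + m)) du 1) (Icc 0 T) ∧
      ∀ t ∈ Icc 0 T,
        derivWithin (gE l1 l3 (m' - m) ((1 / 2 : ℝ) • (m' + m)) du 1) (Icc 0 T) t ≤
        6 * (14 + 6 * (l1 + l3)) * (1 + linfnorm (grad (m t)) ^ 2 + linfnorm (grad (m' t)) ^ 2) *
        (linfnorm ((m' - m) t) ^ 2 + l2norm (grad ((m' - m) t)) ^ 2) *
        (1 + linfnorm (grad (m t)) + linfnorm (grad (m' t)) + hnorm 1 (grad (m t)) +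
          hnorm 1 (grad (m' t))) := by
  have c1 := fun i => CT.dff (hn.pd_ct i) (hm.pd_ct i)
  have c2 := fun i => CT.dff (hn.bb_ct i) (hm.bb_ct i)
  have s1 := fun i t ht => (memLp_ve fun a => memLp_inf (c1 i) le_rfl (by omega) a t ht).norm.integrable_sq
  have s2 := fun i t ht => (memLp_ve fun a => memLp_inf (c2 i) le_rfl (by omega) a t ht).norm.integrable_sq
  have hi : ∀ t ∈ Icc 0 T, Integrable (dens1 (m' - m) ((1 / 2 : ℝ) • (m' + m)) t) := fun t ht =>
    (integrable_finsetSum univ fun i _ => (s1 i t ht).add (s2 i t ht)).congr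
      (hm.dens1_ae hn (by omega) ht).symm
  have e : ∀ t ∈ Icc 0 T, gE l1 l3 (m' - m) ((1 / 2 : ℝ) • (m' + m)) du 1 t =
      ∑ i, (1 / 2 * (∫ x, ‖ve (dff (pd (cmp m') i) (pd (cmp m) i)) t x‖ ^ 2)
      + 1 / 2 * ∫ x, ‖ve (dff (bb (cmp m') i) (bb (cmp m) i)) t x‖ ^ 2) := fun t ht => by
    change 1 / 2 * ∫ x, _ = _
    rw [integral_congr_ae (hm.dens1_ae hn (by omega) ht)]
    refine (congrArg _ (integral_finsetSum _ fun i _ => (s1 i t ht).add (s2 i t ht))).trans ?_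
    rw [mul_sum]
    refine sum_congr rfl fun i _ => ?_
    rw [integral_add' (s1 i t ht) (s2 i t ht), mul_add]
  obtain ⟨k1, k2⟩ := hm.energy_one_deriv hn hK
  obtain ⟨k3, k4⟩ := contDiffOn_one_of_hasDerivWithinAt hT
    (fun t ht => (k1 t ht).congr e (e t ht)) k2
  refine ⟨hi, fun t ht => ?_, k3, fun t ht => ?_⟩
  · have hg := memLp_grad (ct_sub hm hn) (by omega) ht fun i a =>
      (CT.pd (ct_sub hm hn) i a).cLp_inf (by omega) (by omega) t ht
    rw [← integral_norm_sq hg]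
    refine (integral_mono hg.norm.integrable_sq (hi t ht) fun x =>
      le_add_of_nonneg_right (sum_nonneg fun _ _ => sq_nonneg _)).trans (le_of_eq ?_)
    change _ = 2 * (1 / 2 * _)
    ring
  · rw [k4 t ht]
    have p : ∀ {E : Type} [NormedAddCommGroup E] (f : X N → E), 0 ≤ l2norm f :=
      fun _ => toReal_nonneg
    have q : ∀ {E : Type} [NormedAddCommGroup E] (f : X N → E), 0 ≤ linfnorm f :=
      fun _ => toReal_nonneg
    obtain ⟨a1, a2, a3⟩ := hm.hnorm_one hK ht
    obtain ⟨b1, b2, b3⟩ := hn.hnorm_one hK ht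
    have h0 := hnorm_nonneg 1 (grad (m t))
    have h0' := hnorm_nonneg 1 (grad (m' t))
    have hM : ∀ A B : ℝ, A ≤ √(A ^ 2 + B ^ 2) := fun A B =>
      le_sqrt_of_sq_le (le_add_of_nonneg_right (sq_nonneg B))
    refine (hm.energy_one_le (U := linfnorm ((m' - m) t)) (G := l2norm (grad ((m' - m) t))) (H := 3 * (hnorm 1 (grad (m' t)) +
      hnorm 1 (grad (m t)))) (M := √(linfnorm (grad (m t)) ^ 2 + linfnorm (grad (m' t)) ^ 2)) hn h1 h3
      hK ht (q _) (p _) (mul_nonneg zero_le_three (add_nonneg h0' h0)) (hm.norm_sub_le hn ht) (hm.bd_grad_sub hn (by omega) ht)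
      ?_ ?_ ?_).trans ?_
    · filter_upwards [hn.grad_le (by omega) ht] with x hx
      rw [add_comm]
      exact hx.trans (hM _ _)
    · filter_upwards [hm.grad_le (by omega) ht] with x hx using hx.trans (hM _ _)
    · have p1 := add_nonneg (p (grad (m' t))) (p (grad (m t)))
      have p2 := add_nonneg p1 h0'
      have p3 := add_nonneg p2 h0
      refine ((((((bd_grad hn.ct (by omega) ht).add (bd_grad hm.ct (by omega) ht) one_le_two
        (p _) (p _)).add b3 one_le_two p1 h0').add a3 one_le_two p2 h0).add b2 one_le_two p3 h0').add
        a2 one_le_two (add_nonneg p3 h0') h0).mono ?_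
      linarith only [a1, b1]
    · rw [sq_sqrt (by positivity)]
      have hU := q ((m' - m) t)
      have hG := p (grad ((m' - m) t))
      have hA := q (grad (m t))
      have hB := q (grad (m' t))
      generalize linfnorm ((m' - m) t) = U at *
      generalize l2norm (grad ((m' - m) t)) = G at *
      generalize linfnorm (grad (m t)) = A at *
      generalize linfnorm (grad (m' t)) = B at *
      generalize hnorm 1 (grad (m t)) = x at *
      generalize hnorm 1 (grad (m' t)) = y at *
      have hUG : U * G ≤ U ^ 2 + G ^ 2 := by nlinarith only [sq_nonneg (U - G), sq_nonneg U, sq_nonneg G]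
      have hP : G * G + U * (G * (3 * (y + x))) ≤ 6 * ((U ^ 2 + G ^ 2) * (1 + A + B + x + y)) := by
        have h1 := mul_le_mul_of_nonneg_right hUG (add_nonneg h0' h0)
        have h2 : 0 ≤ (U ^ 2 + G ^ 2) * (A + B + x + y) := by positivity
        have h3 : 0 ≤ (U ^ 2 + G ^ 2) * (A + B) := by positivity
        nlinarith only [h1, h2, h3, sq_nonneg U, sq_nonneg G]
      rw [← add_assoc 1 (A ^ 2)]
      calc _ ≤ (14 + 6 * (l1 + l3)) * (1 + A ^ 2 + B ^ 2) *
            (6 * ((U ^ 2 + G ^ 2) * (1 + A + B + x + y))) :=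
            mul_le_mul_of_nonneg_left hP (by positivity)
        _ = _ := by ring

end Sol

end

section

variable {N K d : ℕ} {T t l1 l3 : ℝ} {m m' dm dm' v : ℝ → X N → V} {α : Fin N → ℕ}

lemma lap_wd {f g : Flow N} (hf : ∀ a, CT K d T (f a)) (hg : ∀ a, CT K d T (g a))
    (hK : d + len α + 2 ≤ K) (ht : t ∈ Icc 0 T) :
    ∀ᵐ x, lap (ve (wd α f g) t) x = ve (wd α (lapc f) (lapc g)) t x := by
  have c := wd_ct hf hg α
  filter_upwards [ae_all_iff.2 fun i => weakDeriv_vec (F := fun t => ve (wd α f g) t)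
    (α := single i 2) c (by simpa using hK) ht, ae_all_iff.2 fun a => wd_lapc hf hg hK ht a,
    ae_all_iff.2 fun i : Fin N => ae_all_iff.2 fun a => (c a).add_weakDeriv (α := single i 1)
      (β := single i 1) (by simp; omega) ht] with x h1 h2 h3
  rw [lap, sum_congr rfl fun i _ => h1 i]
  ext a
  rw [WithLp.ofLp_sum, Finset.sum_apply]
  refine Eq.trans (sum_congr rfl fun i _ => ?_) (h2 a).symm
  refine Eq.trans ?_ (h3 i a).symm
  rw [← Pi.single_add]
  rfl

/-- The integrand of the functional at the `H^l` level, in terms of the components. -/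
noncomputable def dns (l1 l3 : ℝ) (m dm n dn : Flow N) (α : Fin N → ℕ) (t : ℝ)
    (a : Fin 3) : X N → ℝ := fun x => wd α dn dm a t x ^ 2 + wd α (lapc n) (lapc m) a t x ^ 2 +
  c1 l1 l3 a * ∑ i, pd (wd α n m) i a t x ^ 2 + c2 l1 l3 a * wd α n m a t x ^ 2

namespace Sol

lemma densHigh_ae (hm : Sol l1 l3 K T (cmp m) (cmp dm)) (hn : Sol l1 l3 K T (cmp m') (cmp dm'))
    (hα : len α + 4 ≤ K) (ht : t ∈ Icc 0 T) : densHigh l1 l3 (m' - m) (dm' - dm) α t =ᵐ[volume]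
      fun x => ∑ a, dns l1 l3 (cmp m) (cmp dm) (cmp m') (cmp dm') α t a x := by
  have hd := fun a => CT.dff hn.dct hm.dct a
  have e : weakDeriv α ((m' - m) t) =ᵐ[volume] ve (wd α (cmp m') (cmp m)) t :=
    weakDeriv_vec (ct_sub hm hn) (by omega) ht
  filter_upwards [weakDeriv_vec (F := dm' - dm) (α := α) hd (by omega) ht,
    lap_wd hn.ct hm.ct (α := α) (by omega) ht] with x h1 h2
  have h3 : lap (weakDeriv α ((m' - m) t)) x = lap (ve (wd α (cmp m') (cmp m)) t) x :=
    sum_congr rfl fun i _ => by rw [weakDeriv_eq e]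
  have h4 : ∀ f : X N → ℝ, ‖grad f x‖ ^ 2 = ∑ i, wpartial i f x ^ 2 := fun f => by
    rw [EuclideanSpace.norm_sq_eq]
    simp [grad]
  rw [densHigh, h1, h3, h2, h4, h4, norm_sq_eq_sum, norm_sq_eq_sum]
  simp only [Fin.sum_univ_three, dns, c1, c2, if_true, if_neg (show (0 : Fin 3) ≠ 1 by decide),
    if_neg (show (2 : Fin 3) ≠ 1 by decide)]
  change wd α (cmp dm') (cmp dm) 0 t x ^ 2 + wd α (cmp dm') (cmp dm) 1 t x ^ 2 +
    wd α (cmp dm') (cmp dm) 2 t x ^ 2 + (wd α (lapc (cmp m')) (lapc (cmp m)) 0 t x ^ 2 +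
    wd α (lapc (cmp m')) (lapc (cmp m)) 1 t x ^ 2 + wd α (lapc (cmp m')) (lapc (cmp m)) 2 t x ^ 2) +
    (l1 + l3) * (∑ i, pd (wd α (cmp m') (cmp m)) i 0 t x ^ 2 +
      ∑ i, pd (wd α (cmp m') (cmp m)) i 2 t x ^ 2) + l1 * l3 *
    (wd α (cmp m') (cmp m) 0 t x ^ 2 + wd α (cmp m') (cmp m) 2 t x ^ 2) = _
  ring

variable {f df g dg : Flow N}

lemma integral_dns (hm : Sol l1 l3 K T f df) (hn : Sol l1 l3 K T g dg) (hα : len α + 4 ≤ K)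
    (ht : t ∈ Icc 0 T) (a : Fin 3) : Integrable (dns l1 l3 f df g dg α t a) ∧
      1 / 2 * ∫ x, dns l1 l3 f df g dg α t a x = 1 / 2 * (∫ x, wd α dg df a t x ^ 2) +
        1 / 2 * (∫ x, wd α (lapc g) (lapc f) a t x ^ 2) +
        c1 l1 l3 a * ∑ i, 1 / 2 * (∫ x, pd (wd α g f) i a t x ^ 2) +
        c2 l1 l3 a * (1 / 2 * ∫ x, wd α g f a t x ^ 2) := by
  have cU := wd_ct hn.ct hm.ct α
  have i1 := ((wd_ct hn.dct hm.dct α a).cLp_inf (by omega) (by omega) t ht).integrable_sq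
  have i2 := ((wd_ct hn.lapc_ct hm.lapc_ct α a).cLp_inf (by omega) (by omega) t ht).integrable_sq
  have i3 := fun i => ((CT.pd cU i a).cLp_inf (by omega) (by omega) t ht).integrable_sq
  have i4 : Integrable fun x => c2 l1 l3 a * wd α g f a t x ^ 2 := by
    by_cases ha : a = 1
    · simp [c2, ha]
    · have := ((hm.wd_memLp hn (α := α) (by omega) ha) t ht).1
      rw [ex_one] at this
      exact this.integrable_sq.const_mul _
  have i5 := (integrable_finsetSum univ fun i _ => i3 i).const_mul (c1 l1 l3 a)
  refine ⟨((i1.add i2).add i5).add i4, ?_⟩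
  have e : ∫ x, dns l1 l3 f df g dg α t a x = (∫ x, wd α dg df a t x ^ 2) +
      (∫ x, wd α (lapc g) (lapc f) a t x ^ 2) + c1 l1 l3 a * ∑ i, (∫ x, pd (wd α g f) i a t x ^ 2) +
      c2 l1 l3 a * ∫ x, wd α g f a t x ^ 2 := by
    refine (integral_add' ((i1.add i2).add i5) i4).trans ?_
    rw [integral_add' (i1.add i2) i5, integral_add' i1 i2, integral_const_mul, integral_const_mul,
      integral_finsetSum _ fun i _ => i3 i]
  rw [e, ← mul_sum]
  ring

lemma gE_high (hm : Sol l1 l3 K T (cmp m) (cmp dm)) (hn : Sol l1 l3 K T (cmp m') (cmp dm')) {j : ℕ}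
    (hj : j + 4 ≤ K) (ht : t ∈ Icc 0 T) : (∀ α ∈ multiIdx N j,
      Integrable (densHigh l1 l3 (m' - m) (dm' - dm) α t)) ∧
      gE l1 l3 (m' - m) v (dm' - dm) (j + 2) t =
      ∑ α ∈ multiIdx N j, eHigh l1 l3 (cmp m) (cmp dm) (cmp m') (cmp dm') α t := by
  have hi := fun (α : Fin N → ℕ) (hα : len α + 4 ≤ K) (a : Fin 3) => hm.integral_dns hn hα ht a
  have hl : ∀ α ∈ multiIdx N j, len α + 4 ≤ K := fun α h => by rwa [mem_multiIdx.1 h]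
  refine ⟨fun α h => (integrable_finsetSum univ fun a _ => (hi α (hl α h) a).1).congr
    (hm.densHigh_ae hn (hl α h) ht).symm, ?_⟩
  change 1 / 2 * ∑ α ∈ multiIdx N j, _ = _
  rw [mul_sum]
  refine sum_congr rfl fun α h => ?_
  rw [integral_congr_ae (hm.densHigh_ae hn (hl α h) ht),
    integral_finsetSum _ fun a _ => (hi α (hl α h) a).1, mul_sum]
  exact sum_congr rfl fun a _ => (hi α (hl α h) a).2

lemma le_eHigh (h1 : 0 ≤ l1) (h3 : 0 ≤ l3) (a : Fin 3) : 0 ≤ eHigh l1 l3 f df g dg α t ∧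
    ∫ x, wd α dg df a t x ^ 2 ≤ 2 * eHigh l1 l3 f df g dg α t ∧
    ∫ x, wd α (lapc g) (lapc f) a t x ^ 2 ≤ 2 * eHigh l1 l3 f df g dg α t := by
  have p : ∀ f : X N → ℝ, 0 ≤ ∫ x, f x ^ 2 := fun f => integral_nonneg fun x => sq_nonneg (f x)
  have hc1 : ∀ a, 0 ≤ c1 l1 l3 a := fun a => by unfold c1; split_ifs <;> positivity
  have hc2 : ∀ a, 0 ≤ c2 l1 l3 a := fun a => by unfold c2; split_ifs <;> positivity
  have q3 := fun a => mul_nonneg (hc1 a) (sum_nonneg fun i (_ : i ∈ Finset.univ) =>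
    mul_nonneg one_half_pos.le (p (pd (wd α g f) i a t)))
  have q4 := fun a => mul_nonneg (hc2 a) (mul_nonneg one_half_pos.le (p (wd α g f a t)))
  have hle := single_le_sum (f := fun a => 1 / 2 * (∫ x, wd α dg df a t x ^ 2) +
    1 / 2 * (∫ x, wd α (lapc g) (lapc f) a t x ^ 2) +
    c1 l1 l3 a * ∑ i, 1 / 2 * (∫ x, pd (wd α g f) i a t x ^ 2) +
    c2 l1 l3 a * (1 / 2 * ∫ x, wd α g f a t x ^ 2)) (fun a _ => by
      have := q3 a
      have := q4 a
      have := p (wd α dg df a t)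
      have := p (wd α (lapc g) (lapc f) a t)
      positivity) (Finset.mem_univ a)
  change _ ≤ eHigh l1 l3 f df g dg α t at hle
  have := q3 a
  have := q4 a
  have := p (wd α dg df a t)
  have := p (wd α (lapc g) (lapc f) a t)
  refine ⟨?_, ?_, ?_⟩ <;> linarith

end Sol

end

section

variable {N K l : ℕ} {T t l1 l3 : ℝ} {m m' dm dm' u v du : ℝ → X N → V} {α : Fin N → ℕ}

lemma Bd.of_ae_le {s B : ℝ} {f g : X N → ℝ} (hg : Bd s g B) (hf : AEStronglyMeasurable f)
    (h : ∀ᵐ x, |f x| ≤ g x) : Bd s f B :=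
  ⟨hf, (eLpNorm_mono_ae (h.mono fun _ hx => hx.trans (le_abs_self _))).trans hg.2⟩

lemma abs_ve_le (f : Flow N) (a : Fin 3) (t : ℝ) (x : X N) :
    |f a t x| ≤ ‖ve f t x‖ := PiLp.norm_apply_le (ve f t x) a

lemma bd_zero_of_le {f : X N → ℝ} {A : ℝ} (hf : MemLp f ⊤) (h : ∀ᵐ x, |f x| ≤ A) :
    Bd 0 f A := bd_zero_of_bounded hf.1 h

lemma MemE.bd_weakDeriv {k : ℕ} {w : X N → V} (h : MemE (k + 1) w) (a : Fin 3) (hl : l ≤ k)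
    (h1 : 1 ≤ len α) (h2 : len α ≤ l + 1) : Bd 1 (weakDeriv α (comp a w)) (hnorm l (grad w)) := by
  obtain ⟨β, i, rfl, hβ⟩ := exists_eq_add_single (show len α = (len α - 1) + 1 by omega)
  have hβ' : len β ≤ l := by simp only [len_add, len_single] at h2; omega
  obtain ⟨k1, k2⟩ := memH_grad_weak h.1.hasWeakGrad h.1.grad_mem (β := β) (by omega) i a
  rw [add_comm]
  exact (bd_of_l2norm_le (MemLp.proj (MemLp.proj k2 i) a) ((l2norm_proj_le (MemLp.proj k2 i) a).trans
    ((l2norm_proj_le k2 i).trans (l2norm_le_hnorm _ hβ')))).congr k1.ae_eq.symm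

lemma gE_nonneg (h1 : 0 ≤ l1) (h3 : 0 ≤ l3) (j : ℕ) : 0 ≤ gE l1 l3 u v du j t := by
  match j with
  | 0 => exact mul_nonneg one_half_pos.le (integral_nonneg fun x => sq_nonneg _)
  | 1 => exact mul_nonneg one_half_pos.le (integral_nonneg fun x => add_nonneg (sq_nonneg _)
      (sum_nonneg fun _ _ => sq_nonneg _))
  | j + 2 => exact mul_nonneg one_half_pos.le (sum_nonneg fun α _ => integral_nonneg fun x => by
      simp only [densHigh, Pi.zero_apply]; positivity)

lemma gE_le_gS (h1 : 0 ≤ l1) (h3 : 0 ≤ l3) {j : ℕ} (hj : j ≤ l) :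
    gE l1 l3 u v du j t ≤ gS l1 l3 u v du l t :=
  single_le_sum (f := fun j => gE l1 l3 u v du j t) (fun j _ => gE_nonneg h1 h3 j)
    (Finset.mem_range.2 (Nat.lt_succ_of_le hj))

namespace Sol

lemma ctl {k : ℕ} {A A' : ℝ} (hE : MemE (k + 1) (m t)) (hm : Sol l1 l3 K T (cmp m) (cmp dm))
    (hK : 1 ≤ K) (ht : t ∈ Icc 0 T) (hl : l ≤ k) (hA1 : linfnorm (grad (m t)) ≤ A)
    (hA2 : hnorm l (grad (m t)) ≤ A)
    (hA' : l = 2 → ∀ a ≠ 1, l2norm (comp a (m t)) ≤ A') : Ctl l t A A' (cmp m) where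
  b0 a i := bd_zero_of_le (by have := (hm.gradInf a i t ht).1; rwa [ex_zero] at this) (by
    filter_upwards [hm.grad_le hK ht] with x hx
    exact (abs_ve_le (pd (cmp m) i) a t x).trans
      (((norm_le_pn (fun i => ve (pd (cmp m) i) t x) i).trans hx).trans hA1))
  b1 a α h1 h2 := (hE.bd_weakDeriv a hl h1 h2).mono hA2
  b2 h a ha := (hm.bd_comp ht ha).mono (hA' h a ha)

lemma bd_wd (hm : Sol l1 l3 K T (cmp m) (cmp dm)) (hn : Sol l1 l3 K T (cmp m') (cmp dm'))
    (h1 : 0 ≤ l1) (h3 : 0 ≤ l3) (hα : len α + 2 ≤ l) (hl : l + 2 ≤ K) (ht : t ∈ Icc 0 T) {U : ℝ}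
    (hU0 : 0 ≤ U) (hU : 2 * gS l1 l3 (m' - m) v (dm' - dm) l t ≤ U ^ 2) (a : Fin 3) :
    Bd 1 (wd α (cmp dm') (cmp dm) a t) U ∧ ∀ i k : Fin N,
      Bd 1 (weakDeriv (α + single i 1 + single k 1) (dff (cmp m') (cmp m) a t)) U := by
  have e := (hm.gE_high hn (j := len α) (v := v) (by omega) ht).2
  have e1 : 2 * eHigh l1 l3 (cmp m) (cmp dm) (cmp m') (cmp dm') α t ≤ U ^ 2 := by
    have g1 := single_le_sum (f := fun α => eHigh l1 l3 (cmp m) (cmp dm) (cmp m') (cmp dm') α t)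
      (fun α _ => (le_eHigh h1 h3 0).1) (mem_multiIdx.2 (rfl : len α = len α))
    have g2 := gE_le_gS (u := m' - m) (v := v) (du := dm' - dm) (t := t) h1 h3 hα
    linarith
  obtain ⟨-, b1, b2⟩ := le_eHigh (f := cmp m) (df := cmp dm) (g := cmp m') (dg := cmp dm') (α := α)
    (t := t) h1 h3 a
  have cU := wd_ct hn.ct hm.ct α
  have c2 := fun i j => CT.pd (CT.pd cU i) j
  have m2 := fun i j => (c2 i j a).cLp_inf (by omega) (by omega) t ht
  refine ⟨bd_of_integral_sq_le ((wd_ct hn.dct hm.dct α a).cLp_inf (by omega) (by omega) t ht) hU0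
    (b1.trans e1), fun i k => ?_⟩
  have e2 : ∫ x, wd α (lapc (cmp m')) (lapc (cmp m)) a t x ^ 2 =
      ∑ i, ∑ j, ∫ x, pd (pd (wd α (cmp m') (cmp m)) i) j a t x ^ 2 := by
    rw [← integral_hess cU (by omega) ht a]
    refine integral_congr_ae ?_
    filter_upwards [wd_lapc hn.ct hm.ct (α := α) (by omega) ht a] with x hx
    simp only [hx]
  have p : ∀ f : X N → ℝ, 0 ≤ ∫ x, f x ^ 2 := fun f => integral_nonneg fun x => sq_nonneg (f x)
  have b3 : ∫ x, pd (pd (wd α (cmp m') (cmp m)) i) k a t x ^ 2 ≤ U ^ 2 :=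
    (single_le_sum (f := fun k => ∫ x, pd (pd (wd α (cmp m') (cmp m)) i) k a t x ^ 2)
      (fun _ _ => p _) (Finset.mem_univ k)).trans ((single_le_sum (f := fun i => ∑ k,
        ∫ x, pd (pd (wd α (cmp m') (cmp m)) i) k a t x ^ 2)
      (fun _ _ => sum_nonneg fun _ _ => p _) (Finset.mem_univ i)).trans
      (e2.symm.trans_le (b2.trans e1)))
  refine (bd_of_integral_sq_le (m2 i k) hU0 b3).congr ?_
  have hu := CT.dff hn.ct hm.ct a
  exact (weakDeriv_congr (hu.add_weakDeriv (by simp; omega) ht)).trans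
    (hu.add_weakDeriv (by simp; omega) ht)

end Sol

end

noncomputable section

variable {N K k l : ℕ} {T t l1 l3 : ℝ} {m m' dm dm' v : ℝ → X N → V} {α : Fin N → ℕ}

variable (l) in
/-- The term of the estimate which is present at the level `l = 2` only. -/
def lowNorm (f g : X N → V) : ℝ :=
  if l = 2 then l2norm (comp 0 g) + l2norm (comp 0 f) + l2norm (comp 2 g) + l2norm (comp 2 f) else 0

lemma l2norm_nonneg {E : Type*} [NormedAddCommGroup E] (f : X N → E) : 0 ≤ l2norm f :=
  toReal_nonneg

lemma linfnorm_nonneg {E : Type*} [NormedAddCommGroup E] (f : X N → E) : 0 ≤ linfnorm f :=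
  toReal_nonneg

lemma lowNorm_nonneg (f g : X N → V) : 0 ≤ lowNorm l f g := by
  have p := fun (a : Fin 3) (f : X N → V) => l2norm_nonneg (comp a f)
  unfold lowNorm
  split_ifs
  exacts [add_nonneg (add_nonneg (add_nonneg (p _ _) (p _ _)) (p _ _)) (p _ _), le_rfl]

/-- The estimate at the level `H^l`, with the constant `C`. -/
def LevelHigh (l1 l3 : ℝ) (N k l : ℕ) (C : ℝ) : Prop :=
  ∀ (T : ℝ), 0 < T → ∀ (m m' dm dm' : ℝ → X N → V), ContInE (k + 1) T m →
    ContInE (k + 1) T m' → Sol l1 l3 (k + 1) T (cmp m) (cmp dm) →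
    Sol l1 l3 (k + 1) T (cmp m') (cmp dm') →
    ContDiffOn ℝ 1 (gE l1 l3 (m' - m) ((1 / 2 : ℝ) • (m' + m)) (dm' - dm) l) (Icc 0 T) ∧
    ∀ t ∈ Icc 0 T,
      derivWithin (gE l1 l3 (m' - m) ((1 / 2 : ℝ) • (m' + m)) (dm' - dm) l) (Icc 0 T) t ≤
      C * (1 + hnorm l (grad (m t)) ^ 2 + hnorm l (grad (m' t)) ^ 2 + linfnorm (grad (m t)) ^ 2 +
        linfnorm (grad (m' t)) ^ 2 + lowNorm l (m t) (m' t)) *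
      (gS l1 l3 (m' - m) ((1 / 2 : ℝ) • (m' + m)) (dm' - dm) l t + linfnorm ((m' - m) t) ^ 2)

namespace Sol

lemma exists_dat (hm : Sol l1 l3 K T (cmp m) (cmp dm)) (hn : Sol l1 l3 K T (cmp m') (cmp dm'))
    (h1 : 0 ≤ l1) (h3 : 0 ≤ l3) (hT : 0 < T) (hE : MemE (k + 1) (m t)) (hE' : MemE (k + 1) (m' t))
    (hl : l ≤ k) (hα : len α + 2 = l) (hK : l + 2 ≤ K) (ht : t ∈ Icc 0 T) {A S U : ℝ}
    (hA : A = 1 + hnorm l (grad (m t)) + hnorm l (grad (m' t)) + linfnorm (grad (m t)) +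
      linfnorm (grad (m' t)))
    (hS : S = lowNorm l (m t) (m' t))
    (hU : U = √(2 * (gS l1 l3 (m' - m) ((1 / 2 : ℝ) • (m' + m)) (dm' - dm) l t +
      linfnorm ((m' - m) t) ^ 2))) :
    ∃ D : Dat N K l l1 l3, D.m = cmp m ∧ D.dm = cmp dm ∧ D.n = cmp m' ∧ D.dn = cmp dm' ∧ D.α = α ∧
      D.t = t ∧ D.A = A ∧ D.A' = A + S ∧ D.U = U := by
  have q1 := linfnorm_nonneg (grad (m t))
  have q2 := linfnorm_nonneg (grad (m' t))
  have q3 := hnorm_nonneg l (grad (m t))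
  have q4 := hnorm_nonneg l (grad (m' t))
  have s0 := l2norm_nonneg (comp 0 (m t))
  have s1 := l2norm_nonneg (comp 0 (m' t))
  have s2 := l2norm_nonneg (comp 2 (m t))
  have s3 := l2norm_nonneg (comp 2 (m' t))
  have hS0 : 0 ≤ S := hS ▸ lowNorm_nonneg _ _
  have hU0 : 0 ≤ U := hU ▸ Real.sqrt_nonneg _
  have g0 := fun j => gE_nonneg (u := m' - m) (v := (1 / 2 : ℝ) • (m' + m)) (du := dm' - dm) (t := t)
    h1 h3 j
  have g1 := fun j hj => gE_le_gS (u := m' - m) (v := (1 / 2 : ℝ) • (m' + m)) (du := dm' - dm)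
    (t := t) (l := l) (j := j) h1 h3 hj
  have hS1 := sum_nonneg fun j (_ : j ∈ Finset.range (l + 1)) => g0 j
  change 0 ≤ gS l1 l3 (m' - m) ((1 / 2 : ℝ) • (m' + m)) (dm' - dm) l t at hS1
  have hU2 : U ^ 2 = 2 * (gS l1 l3 (m' - m) ((1 / 2 : ℝ) • (m' + m)) (dm' - dm) l t +
      linfnorm ((m' - m) t) ^ 2) := by rw [hU]; exact sq_sqrt (by positivity)
  have sqi := sq_nonneg (linfnorm ((m' - m) t))
  have hg : 2 * gS l1 l3 (m' - m) ((1 / 2 : ℝ) • (m' + m)) (dm' - dm) l t ≤ U ^ 2 := by linarith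
  have c := hm.ctl hE (A := A) (A' := A + S) (by omega) ht hl (by linarith) (by linarith)
    fun h2 a ha => by
      rw [lowNorm, if_pos h2] at hS
      fin_cases a
      · change l2norm (comp 0 (m t)) ≤ _; linarith
      · exact absurd rfl ha
      · change l2norm (comp 2 (m t)) ≤ _; linarith
  have c' := hn.ctl hE' (A := A) (A' := A + S) (by omega) ht hl (by linarith) (by linarith)
    fun h2 a ha => by
      rw [lowNorm, if_pos h2] at hS
      fin_cases a
      · change l2norm (comp 0 (m' t)) ≤ _; linarith
      · exact absurd rfl ha
      · change l2norm (comp 2 (m' t)) ≤ _; linarith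
  have hu := CT.dff hn.ct hm.ct
  refine ⟨⟨T, t, A, A + S, U, α, cmp m, cmp dm, cmp m', cmp dm', hm, hn, ht, hα, by linarith,
    by linarith, hU0, c, c', fun a => ?_, fun a γ γ1 γ2 => ?_, fun a ha => ?_, fun a =>
      (hm.bd_wd hn h1 h3 hα.le hK ht hU0 hg a).1⟩, rfl, rfl, rfl, rfl, rfl, rfl, rfl, rfl, rfl⟩
  · refine bd_zero_of_le ((hn.w a t ht).bdd.sub (hm.w a t ht).bdd) ?_
    filter_upwards [hm.norm_sub_le hn ht] with x hx
    refine ((abs_ve_le (dff (cmp m') (cmp m)) a t x).trans hx).trans (abs_le_of_sq_le_sq' ?_ hU0).2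
    linarith
  · rcases γ1.eq_or_lt with h | h
    · obtain ⟨β, i, rfl, hβ⟩ := exists_eq_add_single h.symm
      obtain rfl := eq_zero_of_len hβ
      rw [zero_add]
      refine ((hm.bd_grad_sub hn (by omega) ht).mono (abs_le_of_sq_le_sq' ?_ hU0).2).of_ae_le
        ((CT.pd hu i a).cLp_inf (by omega) (by omega) t ht).1 ?_
      · have e1 := (hm.level_one hn (du := dm' - dm) h1 h3 hT (by omega)).2.1 t ht
        have e2 := g1 1 (by omega)
        linarith
      · filter_upwards [pd_dff hn.ct hm.ct (by omega) ht i] with x hx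
        refine (abs_ve_le (pd (dff (cmp m') (cmp m)) i) a t x).trans ?_
        rw [hx]
        exact norm_le_pn (fun i => ve (pd (cmp m') i) t x - ve (pd (cmp m) i) t x) i
    · obtain ⟨β, k, rfl, hβ⟩ := exists_eq_add_single (show len γ = (len γ - 1) + 1 by omega)
      rw [len_add, len_single] at *
      obtain ⟨β, i, rfl, hβ'⟩ := exists_eq_add_single (show len β = (len β - 1) + 1 by omega)
      rw [len_add, len_single] at *
      exact (hm.bd_wd hn h1 h3 (by omega) hK ht hU0 hg a).2 i k
  · have e0 : sh (cmp m) (cmp m') a t = dff (cmp m') (cmp m) a t := by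
      funext x; simp [sh, ha]
    rw [← e0]
    refine ((hm.bd_shifted hn hT (by omega) ht).mono (abs_le_of_sq_le_sq' ?_ hU0).2).of_ae_le
      ((hm.sd_sh hn hT (by omega) a).2.2 t ht).1 (.of_forall fun x => abs_ve_le _ a t x)
    have hs := memLp_ve fun a => (hm.sd_sh hn hT (by omega) a).2.2 t ht
    simp only [dens0_eq] at hs
    have e2 := g1 0 (by omega)
    rw [← integral_norm_sq hs]
    have e3 : gE l1 l3 (m' - m) ((1 / 2 : ℝ) • (m' + m)) (dm' - dm) 0 t =
      1 / 2 * ∫ x, ‖shifted (m' - m) t x‖ ^ 2 := rfl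
    linarith

end Sol

lemma level_high [Nonempty (Fin N)] (h1 : 0 ≤ l1) (h3 : 0 ≤ l3) (hl : 2 ≤ l) (hlk : l + 1 ≤ k) :
    ∃ C, 0 ≤ C ∧ LevelHigh l1 l3 N k l C := by
  obtain ⟨j, rfl⟩ : ∃ j, l = j + 2 := ⟨l - 2, by omega⟩
  obtain ⟨C, hC, hD⟩ := Dat.high_le (N := N) (K := k + 1) h1 h3 hl (by omega)
  refine ⟨20 * ((multiIdx N j).card * C), by positivity, fun T hT m m' dm dm' hE hE' hm hn => ?_⟩
  have hd := fun (α : Fin N → ℕ) (hα : α ∈ multiIdx N j) =>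
    hm.high_deriv hn (α := α) (by rw [mem_multiIdx.1 hα]; omega)
  have e := fun t (ht : t ∈ Icc 0 T) =>
    (hm.gE_high hn (j := j) (v := (1 / 2 : ℝ) • (m' + m)) (by omega) ht).2
  obtain ⟨k1, k2⟩ := contDiffOn_one_of_hasDerivWithinAt hT
    (fun t ht => (HasDerivWithinAt.fun_sum fun α hα => (hd α hα).1 t ht).congr e (e t ht))
    (continuousOn_finsetSum _ fun α hα => (hd α hα).2)
  refine ⟨k1, fun t ht => ?_⟩
  rw [k2 t ht]
  set S := lowNorm (j + 2) (m t) (m' t) with hS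
  set G := gS l1 l3 (m' - m) ((1 / 2 : ℝ) • (m' + m)) (dm' - dm) (j + 2) t +
      linfnorm ((m' - m) t) ^ 2 with hG
  have hG0 : 0 ≤ G := add_nonneg (sum_nonneg fun j _ => gE_nonneg h1 h3 j) (sq_nonneg _)
  have hS0 : 0 ≤ S := lowNorm_nonneg _ _
  have q1 := linfnorm_nonneg (grad (m t))
  have q2 := linfnorm_nonneg (grad (m' t))
  have q3 := hnorm_nonneg (j + 2) (grad (m t))
  have q4 := hnorm_nonneg (j + 2) (grad (m' t))
  have key : ∀ α ∈ multiIdx N j, dHigh l1 l3 (cmp m) (cmp dm) (cmp m') (cmp dm') α t ≤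
      C * (2 * G * ((1 + hnorm (j + 2) (grad (m t)) + hnorm (j + 2) (grad (m' t)) +
        linfnorm (grad (m t)) + linfnorm (grad (m' t))) ^ 2 + ((1 + hnorm (j + 2) (grad (m t)) +
        hnorm (j + 2) (grad (m' t)) + linfnorm (grad (m t)) + linfnorm (grad (m' t))) + S))) := by
    intro α hα
    obtain ⟨D, d1, d2, d3, d4, d5, d6, d7, d8, d9⟩ := hm.exists_dat hn h1 h3 hT (hE t ht).1
      (hE' t ht).1 (l := j + 2) (α := α) (by omega) (by rw [mem_multiIdx.1 hα]) (by omega) ht rfl hS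
      rfl
    have := hD D
    rwa [d1, d2, d3, d4, d5, d6, d7, d8, d9, sq_sqrt (by positivity)] at this
  refine (Finset.sum_le_card_nsmul _ _ _ key).trans ?_
  rw [nsmul_eq_mul]
  generalize linfnorm (grad (m t)) = a at *
  generalize linfnorm (grad (m' t)) = b at *
  generalize hnorm (j + 2) (grad (m t)) = x at *
  generalize hnorm (j + 2) (grad (m' t)) = y at *
  have h5 : (1 + x + y + a + b) ^ 2 ≤ 5 * (1 + x ^ 2 + y ^ 2 + a ^ 2 + b ^ 2) := by
    nlinarith only [sq_nonneg (1 - x), sq_nonneg (1 - y), sq_nonneg (1 - a), sq_nonneg (1 - b),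
      sq_nonneg (x - y), sq_nonneg (x - a), sq_nonneg (x - b), sq_nonneg (y - a), sq_nonneg (y - b),
      sq_nonneg (a - b)]
  have h6 : (1 + x + y + a + b) ^ 2 + ((1 + x + y + a + b) + S) ≤
      10 * (1 + x ^ 2 + y ^ 2 + a ^ 2 + b ^ 2 + S) := by
    have : 1 + x + y + a + b ≤ (1 + x + y + a + b) ^ 2 := by
      rw [sq]
      exact le_mul_of_one_le_left (by positivity) (by linarith)
    linarith
  calc _ ≤ ((multiIdx N j).card : ℝ) * (C * (2 * G *
        (10 * (1 + x ^ 2 + y ^ 2 + a ^ 2 + b ^ 2 + S)))) := by gcongr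
    _ = _ := by ring

end

lemma exists_level_high_const {l1 l3 : ℝ} (h1 : 0 ≤ l1) (h3 : 0 ≤ l3) (k : ℕ) :
    ∃ C : ℝ, 0 < C ∧ ∀ N l : ℕ, 1 ≤ N → N < 2 * (k - 1) → 2 ≤ l → l + 1 ≤ k →
      LevelHigh l1 l3 N k l C := by
  have key : ∀ p : ℕ × ℕ, ∃ C : ℝ, 0 ≤ C ∧ (1 ≤ p.1 → 2 ≤ p.2 → p.2 + 1 ≤ k → LevelHigh l1 l3 p.1 k p.2 C) := fun p => by
    by_cases hp : 1 ≤ p.1 ∧ 2 ≤ p.2 ∧ p.2 + 1 ≤ k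
    · have : Nonempty (Fin p.1) := ⟨⟨0, hp.1⟩⟩
      obtain ⟨C, hC, h⟩ := level_high (N := p.1) (k := k) h1 h3 hp.2.1 hp.2.2
      exact ⟨C, hC, fun _ _ _ => h⟩
    · exact ⟨0, le_rfl, fun a b c => absurd ⟨a, b, c⟩ hp⟩
  choose c hc hcl using key
  refine ⟨1 + ∑ p ∈ Finset.range (2 * k) ×ˢ Finset.range k, c p,
    add_pos_of_pos_of_nonneg one_pos (sum_nonneg fun p _ => hc p),
    fun N l hN hNk hl hlk T hT m m' dm dm' hE hE' hm hn => ?_⟩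
  obtain ⟨k1, k2⟩ := hcl (N, l) hN hl hlk T hT m m' dm dm' hE hE' hm hn
  refine ⟨k1, fun t ht => (k2 t ht).trans ?_⟩
  have hle : c (N, l) ≤ 1 + ∑ p ∈ Finset.range (2 * k) ×ˢ Finset.range k, c p :=
    (single_le_sum (s := Finset.range (2 * k) ×ˢ Finset.range k) (fun p _ => hc p)
      (Finset.mem_product.2 ⟨Finset.mem_range.2 (by omega), Finset.mem_range.2 (by omega)⟩)).trans
      (le_add_of_nonneg_left zero_le_one)
  exact mul_le_mul_of_nonneg_right (mul_le_mul_of_nonneg_right hle (add_nonneg (by positivity)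
    (lowNorm_nonneg _ _)))
    (add_nonneg (sum_nonneg fun j _ => gE_nonneg h1 h3 j) (sq_nonneg _))

end LandauLifshitz

theorem mainTheorem8 (l₁ l₃ : ℝ) (hl₁ : 0 ≤ l₁) (hl₃ : 0 ≤ l₃) :
    ∃ (C₀ C₁ : ℝ) (C : ℕ → ℝ), 0 < C₀ ∧ 0 < C₁ ∧ (∀ k, 0 < C k) ∧
      ∀ (N k : ℕ), 1 ≤ N → (N : ℝ) / 2 + 1 < (k : ℝ) →
      ∀ (T : ℝ), 0 < T →
      ∀ (m m' dm dm' : ℝ → LandauLifshitz.X N → LandauLifshitz.V),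
        LandauLifshitz.IsLLSolution l₁ l₃ k T m dm →
        LandauLifshitz.IsLLSolution l₁ l₃ k T m' dm' →
      ∀ (u v du : ℝ → LandauLifshitz.X N → LandauLifshitz.V),
        u = m' - m → v = (1 / 2 : ℝ) • (m' + m) → du = dm' - dm →
        -- the `L²` level
        ((∀ t ∈ Set.Icc 0 T, MeasureTheory.Integrable (LandauLifshitz.dens0 u t)) ∧
          ContDiffOn ℝ 1 (LandauLifshitz.gE l₁ l₃ u v du 0) (Set.Icc 0 T) ∧
          ∀ t ∈ Set.Icc 0 T,
            derivWithin (LandauLifshitz.gE l₁ l₃ u v du 0) (Set.Icc 0 T) t ≤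
              C₀ * (1 + LandauLifshitz.l2norm (LandauLifshitz.grad (m' t))
                    + LandauLifshitz.l2norm (LandauLifshitz.grad (m t))
                    + LandauLifshitz.l2norm (LandauLifshitz.comp 0 (m' t))
                    + LandauLifshitz.l2norm (LandauLifshitz.comp 0 (m t))
                    + LandauLifshitz.l2norm (LandauLifshitz.comp 2 (m' t))
                    + LandauLifshitz.l2norm (LandauLifshitz.comp 2 (m t)))
                * (LandauLifshitz.l2norm (LandauLifshitz.shifted u t) ^ 2
                    + LandauLifshitz.linfnorm (u t) ^ 2
                    + LandauLifshitz.l2norm (LandauLifshitz.grad (u t)) ^ 2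
                    + LandauLifshitz.l2norm
                        (LandauLifshitz.grad (LandauLifshitz.comp 1 (u 0))) ^ 2)) ∧
        -- the `H¹` level
        ((∀ t ∈ Set.Icc 0 T, MeasureTheory.Integrable (LandauLifshitz.dens1 u v t)) ∧
          ContDiffOn ℝ 1 (LandauLifshitz.gE l₁ l₃ u v du 1) (Set.Icc 0 T) ∧
          ∀ t ∈ Set.Icc 0 T,
            derivWithin (LandauLifshitz.gE l₁ l₃ u v du 1) (Set.Icc 0 T) t ≤
              C₁ * (1 + LandauLifshitz.linfnorm (LandauLifshitz.grad (m t)) ^ 2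
                    + LandauLifshitz.linfnorm (LandauLifshitz.grad (m' t)) ^ 2)
                * (LandauLifshitz.linfnorm (u t) ^ 2
                    + LandauLifshitz.l2norm (LandauLifshitz.grad (u t)) ^ 2)
                * (1 + LandauLifshitz.linfnorm (LandauLifshitz.grad (m t))
                    + LandauLifshitz.linfnorm (LandauLifshitz.grad (m' t))
                    + LandauLifshitz.hnorm 1 (LandauLifshitz.grad (m t))
                    + LandauLifshitz.hnorm 1 (LandauLifshitz.grad (m' t)))) ∧
        -- the `H^l` level
        (∀ l : ℕ, 2 ≤ l → l + 1 ≤ k →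
          (∀ t ∈ Set.Icc 0 T, ∀ α ∈ LandauLifshitz.multiIdx N (l - 2),
            MeasureTheory.Integrable (LandauLifshitz.densHigh l₁ l₃ u du α t)) ∧
          ContDiffOn ℝ 1 (LandauLifshitz.gE l₁ l₃ u v du l) (Set.Icc 0 T) ∧
          ∀ t ∈ Set.Icc 0 T,
            derivWithin (LandauLifshitz.gE l₁ l₃ u v du l) (Set.Icc 0 T) t ≤
              C k * (1 + LandauLifshitz.hnorm l (LandauLifshitz.grad (m t)) ^ 2
                    + LandauLifshitz.hnorm l (LandauLifshitz.grad (m' t)) ^ 2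
                    + LandauLifshitz.linfnorm (LandauLifshitz.grad (m t)) ^ 2
                    + LandauLifshitz.linfnorm (LandauLifshitz.grad (m' t)) ^ 2
                    + (if l = 2 then
                        LandauLifshitz.l2norm (LandauLifshitz.comp 0 (m' t))
                          + LandauLifshitz.l2norm (LandauLifshitz.comp 0 (m t))
                          + LandauLifshitz.l2norm (LandauLifshitz.comp 2 (m' t))
                          + LandauLifshitz.l2norm (LandauLifshitz.comp 2 (m t))
                        else 0))
                * (LandauLifshitz.gS l₁ l₃ u v du l t
                    + LandauLifshitz.linfnorm (u t) ^ 2)) := by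
  choose C hC hCl using LandauLifshitz.exists_level_high_const hl₁ hl₃
  refine ⟨2 * (1 + (l₁ + l₃)), 6 * (14 + 6 * (l₁ + l₃)), C, by positivity, by positivity, hC, ?_⟩
  intro N k hN hk T hT m m' dm dm' hm hm' u v du hu hv hdu
  subst hu hv hdu
  have hNk : N + 2 < 2 * k := by
    have : (N : ℝ) + 2 < 2 * k := by linarith
    exact_mod_cast this
  have s := hm.sol (by omega) (by omega)
  have s' := hm'.sol (by omega) (by omega)
  obtain ⟨a1, -, a2, a3⟩ := s.level_one s' (du := dm' - dm) hl₁ hl₃ hT (by omega)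
  refine ⟨s.level_zero s' hl₁ hl₃ hT (by omega), ⟨a1, a2, a3⟩, fun l hl hlk => ⟨fun t ht => ?_,
    hCl k N l hN (by omega) hl hlk T hT m m' dm dm' hm.cont hm'.cont s s'⟩⟩
  exact (s.gE_high s' (v := 0) (by omega) ht).1
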